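/- Let $\rho,\sigma\subseteq\mathbb N$ each be finite or cofinite. A $[\rho,\sigma]$-dominating set of a graph $G=(V,E)$ is a set $D\subseteq V$ such that $|N(v)\cap D|\in\rho$ for every $v\in V\setminus D$ and $|N(v)\cap D|\in\sigma$ for every $v\in D$. Let $p=\max\rho$ if $\rho$ is finite and $p=1+\max(\mathbb N\setminus\rho)$ if $\rho$ is cofinite (with $p=0$ if $\rho=\emptyset$ or $\rho=\mathbb N$), define $q$ from $\sigma$ in the same way, and let $s=p+q+2$. The computational model is a random access machine with $w$-bit words, for any $w\ge 1$ (in particular $w=\Theta(k)$), whose registers and memory cells hold natural numbers. Reading, writing, adding, subtracting or comparing numbers, and using them as addresses, takes time equal to the number of words that they occupy (a $b$-bit number occupies $\lfloor b/w\rfloor+1$ words). Multiplying two numbers the longer of which has $b$ bits takes time $\lfloor b/w\rfloor+1+\mu(b)$ for an arbitrary function $\mu:\mathbb N\to\mathbb N$; and $i_\times(n)$ denotes the maximal time of multiplying two numbers of at most $n$ bits. Graphs and tree decompositions are given by the adjacency matrices of the graph and of the tree and the incidence matrix of the bags. Then there is an algorithm, depending only on $\rho$ and $\sigma$, that, given a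 graph $G$ with $n\ge 1$ vertices and a tree decomposition of $G$ with $O(n)$ nodes and of width at most $k$, where $k\ge 1$, computes the number of $[\rho,\sigma]$-dominating sets of $G$ of each size $\kappa$, $0\le\kappa\le n$, in time $$O\!\left(n^3\,(sk)^{2(s-2)}\,s^{k+1}\,i_\times(n)\right).$$ The constant in this bound depends only on the constant in the bound $O(n)$ on the number of nodes; it does not depend on $\rho,\sigma,n,k,w,\mu$ or the input. -/

import Mathlib

/-! ### `[ρ, σ]`-dominating sets -/

/-- `D` is a `[ρ, σ]`-dominating set of `G`: every vertex outside `D` has a number of neighbours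
in `D` that belongs to `ρ`, every vertex of `D` has a number of neighbours in `D` that belongs
to `σ`. -/
def IsRhoSigmaDominating {V : Type*} (ρ σ : Set ℕ) (G : SimpleGraph V) (D : Set V) : Prop :=
  (∀ v ∉ D, (G.neighborSet v ∩ D).ncard ∈ ρ) ∧ (∀ v ∈ D, (G.neighborSet v ∩ D).ncard ∈ σ)

/-- The number of `[ρ, σ]`-dominating sets of `G` of size `κ`. -/
noncomputable def rhoSigmaCount {V : Type*} [Fintype V] (ρ σ : Set ℕ) (G : SimpleGraph V)
    (κ : ℕ) : ℕ :=
  {D : Set V | IsRhoSigmaDominating ρ σ G D ∧ D.ncard = κ}.ncard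

open Classical in
/-- The value `p` associated with a finite or cofinite `ρ ⊆ ℕ` (and `q` with `σ`): `max ρ` if `ρ`
is finite, and `1 + max (ℕ \ ρ)` if `ρ` is cofinite. It is `0` for `ρ = ∅` and for `ρ = ℕ`. -/
noncomputable def lastIndex (ρ : Set ℕ) : ℕ :=
  if ρ.Finite then sSup ρ else sSup ((fun j => j + 1) '' ρᶜ)

/-- The number `s = p + q + 2` of vertex states of the `[ρ, σ]`-domination problem. -/
noncomputable def numStates (ρ σ : Set ℕ) : ℕ := lastIndex ρ + lastIndex σ + 2

/-! ### Tree decompositions -/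

/-- A tree decomposition of the graph `G` whose tree has node set `I`. -/
structure TreeDecomposition {V : Type*} (G : SimpleGraph V) (I : Type*) where
  tree : SimpleGraph I
  isTree : tree.IsTree
  bag : I → Finset V
  exists_mem_bag : ∀ v : V, ∃ x, v ∈ bag x
  exists_edge_subset_bag : ∀ u v : V, G.Adj u v → ∃ x, u ∈ bag x ∧ v ∈ bag x
  mem_bag_of_mem_path : ∀ (v : V) (x y : I) (P : tree.Walk x y), P.IsPath →
    v ∈ bag x → v ∈ bag y → ∀ z ∈ P.support, v ∈ bag z

/-- The width of a tree decomposition: the size of its largest bag minus one. -/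
def TreeDecomposition.width {V : Type*} {G : SimpleGraph V} {I : Type*} [Fintype I]
    (T : TreeDecomposition G I) : ℕ :=
  (Finset.univ.sup fun x => (T.bag x).card) - 1

/-! ### Random access machines

A machine has registers and finitely many random access memory banks (only finitely many registers
and banks occur in a program). Registers and memory cells hold natural numbers, and a number of `b`
bits occupies `b / w + 1` machine words of `w` bits: moving, adding, subtracting or comparing
numbers, and using a number as an address, takes time equal to the number of words involved. Hence
these operations take constant time on numbers and addresses of `O(w)` bits.
Multiplying two numbers of at most `b` bits takes the time for reading `b` bits plus an arbitrary
additional time `mulExtra b`. -/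

/-- The machine constants: the word length and the cost of multiplication. -/
structure Machine where
  wordLength : ℕ
  wordLength_pos : 0 < wordLength
  mulExtra : ℕ → ℕ

namespace Machine

/-- The number of words occupied by the number `x`. -/
def words (M : Machine) (x : ℕ) : ℕ := Nat.size x / M.wordLength + 1

/-- The time of a multiplication instruction whose longer operand has `b` bits. -/
def mulTime (M : Machine) (b : ℕ) : ℕ := b / M.wordLength + 1 + M.mulExtra b

/-- `i_×(n)`: the time required, in the worst case, to multiply two numbers of at most `n` bits. -/
def iMul (M : Machine) (n : ℕ) : ℕ := (Finset.range (n + 1)).sup M.mulTime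

end Machine

/-- A memory configuration: the contents `reg x` of each register, and the contents `mem a i` of
the cell with address `i` in bank `a`. -/
structure Config where
  reg : ℕ → ℕ
  mem : ℕ → ℕ → ℕ

namespace Config

def setReg (S : Config) (x v : ℕ) : Config :=
  { S with reg := Function.update S.reg x v }

def setMem (S : Config) (a i v : ℕ) : Config :=
  { S with mem := Function.update S.mem a (Function.update (S.mem a) i v) }

end Config

/-- Arithmetic expressions. Registers and banks are fixed in the program, while addresses within a
bank are computed. Subtraction is truncated at `0`, and comparisons return `0` or `1`. -/
inductive Expr where
  | const (c : ℕ)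
  | reg (x : ℕ)
  | load (a : ℕ) (i : Expr)
  | add (e f : Expr)
  | sub (e f : Expr)
  | mul (e f : Expr)
  | lt (e f : Expr)
  | eq (e f : Expr)

namespace Expr

def eval (S : Config) : Expr → ℕ
  | const c => c
  | reg x => S.reg x
  | load a i => S.mem a (i.eval S)
  | add e f => e.eval S + f.eval S
  | sub e f => e.eval S - f.eval S
  | mul e f => e.eval S * f.eval S
  | lt e f => if e.eval S < f.eval S then 1 else 0
  | eq e f => if e.eval S = f.eval S then 1 else 0

/-- The time for evaluating an expression. -/
def cost (M : Machine) (S : Config) : Expr → ℕ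
  | const c => M.words c
  | reg x => M.words (S.reg x)
  | load a i => i.cost M S + M.words (i.eval S) + M.words (S.mem a (i.eval S))
  | add e f => e.cost M S + f.cost M S + M.words (e.eval S) + M.words (f.eval S)
  | sub e f => e.cost M S + f.cost M S + M.words (e.eval S) + M.words (f.eval S)
  | mul e f => e.cost M S + f.cost M S +
      M.mulTime (max (Nat.size (e.eval S)) (Nat.size (f.eval S)))
  | lt e f => e.cost M S + f.cost M S + M.words (e.eval S) + M.words (f.eval S)
  | eq e f => e.cost M S + f.cost M S + M.words (e.eval S) + M.words (f.eval S)

end Expr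

/-- Programs: assignment to a register, writing the value of `e` into the cell of bank `a` with
address `i`, composition, branching and loops (a guard is true if its value is not `0`). -/
inductive Prog where
  | skip
  | assign (x : ℕ) (e : Expr)
  | store (a : ℕ) (i e : Expr)
  | seq (P Q : Prog)
  | branch (g : Expr) (P Q : Prog)
  | loop (g : Expr) (P : Prog)

/-- `Runs M P S S' t`: on the machine `M`, the program `P` started in the configuration `S` halts
in the configuration `S'` after time `t`. -/
inductive Runs (M : Machine) : Prog → Config → Config → ℕ → Prop where
  | skip (S : Config) : Runs M Prog.skip S S 1
  | assign (x : ℕ) (e : Expr) (S : Config) :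
      Runs M (Prog.assign x e) S (S.setReg x (e.eval S)) (e.cost M S + M.words (e.eval S))
  | store (a : ℕ) (i e : Expr) (S : Config) :
      Runs M (Prog.store a i e) S (S.setMem a (i.eval S) (e.eval S))
        (i.cost M S + e.cost M S + M.words (i.eval S) + M.words (e.eval S))
  | seq {P Q : Prog} {S S' S'' : Config} {t t' : ℕ} :
      Runs M P S S' t → Runs M Q S' S'' t' → Runs M (Prog.seq P Q) S S'' (t + t')
  | branch_true {g : Expr} {P Q : Prog} {S S' : Config} {t : ℕ} :
      g.eval S ≠ 0 → Runs M P S S' t → Runs M (Prog.branch g P Q) S S' (g.cost M S + 1 + t)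
  | branch_false {g : Expr} {P Q : Prog} {S S' : Config} {t : ℕ} :
      g.eval S = 0 → Runs M Q S S' t → Runs M (Prog.branch g P Q) S S' (g.cost M S + 1 + t)
  | loop_true {g : Expr} {P : Prog} {S S' S'' : Config} {t t' : ℕ} :
      g.eval S ≠ 0 → Runs M P S S' t → Runs M (Prog.loop g P) S' S'' t' →
        Runs M (Prog.loop g P) S S'' (g.cost M S + 1 + t + t')
  | loop_false {g : Expr} {P : Prog} {S : Config} :
      g.eval S = 0 → Runs M (Prog.loop g P) S S (g.cost M S + 1)

/-- Programs are deterministic: there is at most one halting run from a given configuration. -/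
theorem Runs.unique {M : Machine} {P : Prog} {S S₁ S₂ : Config} {t₁ t₂ : ℕ}
    (h₁ : Runs M P S S₁ t₁) (h₂ : Runs M P S S₂ t₂) : S₁ = S₂ ∧ t₁ = t₂ := by
  induction h₁ generalizing S₂ t₂ with
  | skip => cases h₂; exact ⟨rfl, rfl⟩
  | assign => cases h₂; exact ⟨rfl, rfl⟩
  | store => cases h₂; exact ⟨rfl, rfl⟩
  | seq _ _ ih ih' =>
    cases h₂ with
    | seq k k' =>
      obtain ⟨rfl, rfl⟩ := ih k
      obtain ⟨rfl, rfl⟩ := ih' k'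
      exact ⟨rfl, rfl⟩
  | branch_true hg _ ih =>
    cases h₂ with
    | branch_true _ k => obtain ⟨rfl, rfl⟩ := ih k; exact ⟨rfl, rfl⟩
    | branch_false hg' _ => exact absurd hg' hg
  | branch_false hg _ ih =>
    cases h₂ with
    | branch_true hg' _ => exact absurd hg hg'
    | branch_false _ k => obtain ⟨rfl, rfl⟩ := ih k; exact ⟨rfl, rfl⟩
  | loop_true hg _ _ ih ih' =>
    cases h₂ with
    | loop_true _ k k' =>
      obtain ⟨rfl, rfl⟩ := ih k
      obtain ⟨rfl, rfl⟩ := ih' k'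
      exact ⟨rfl, rfl⟩
    | loop_false hg' => exact absurd hg' hg
  | loop_false hg =>
    cases h₂ with
    | loop_true hg' _ _ => exact absurd hg hg'
    | loop_false _ => exact ⟨rfl, rfl⟩

/-! ### The input of the algorithm -/

open Classical in
/-- A relation as a 0/1-matrix with `a` rows and `b` columns, stored row by row. -/
noncomputable def matrixCells {a b : ℕ} (R : Fin a → Fin b → Prop) (i : ℕ) : ℕ :=
  if ∃ (u : Fin a) (v : Fin b), i = u * b + v ∧ R u v then 1 else 0

/-- The initial configuration for a graph `G` on `n` vertices and a tree decomposition `T` of `G`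
with `N` nodes. Registers 0 and 1 contain `n` and `N`, bank 0 contains the adjacency matrix of `G`,
bank 1 the adjacency matrix of the tree, and bank 2 the incidence matrix between the nodes of the
tree and the vertices in their bags. Everything else is `0`. -/
noncomputable def inputConfig {n N : ℕ} (G : SimpleGraph (Fin n))
    (T : TreeDecomposition G (Fin N)) : Config where
  reg x := if x = 0 then n else if x = 1 then N else 0
  mem a := if a = 0 then matrixCells G.Adj else if a = 1 then matrixCells T.tree.Adj
    else if a = 2 then matrixCells (fun x v => v ∈ T.bag x) else fun _ => 0

/-! The proof is dynamic programming over the tree decomposition with a fast join. A vertex in a bag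
carries one of `s` states: it is outside or inside the set, and its number of chosen neighbours is
either prescribed or arbitrary. Membership of a number in `ρ` or `σ` is a combination of these
conditions with coefficients `0`, `1` and `-1` (`sum_stateWeight`): a finite set is the sum of its
points, a cofinite set is everything minus the missing points. The table entry `sem F E f κ` counts,
with these signs, the choices of `κ` of the completed vertices `F` that satisfy the conditions on
`F` and give the states `f` to all other vertices, where only the edges `E` count.

Three identities govern the tables. Completing a vertex is a linear combination over its states
(`sem_insert`); vertices without edges can be added (`sem_restrict`); and two parts with disjoint
edges and disjoint completed vertices are joined by adding sizes, and adding neighbour counts at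
every vertex (`sem_union`). Carried out literally, the join ranges over pairs of state functions. To
reach `s ^ (k + 1)`, neighbour counts are treated as exponents: in each class of states (same
membership, same kind of condition) a table is a polynomial, which is evaluated at as many points as
the class has states, multiplied pointwise and interpolated (`evalMatrix`, `invMatrix`). The product
may have too large a degree, and interpolation then folds it back, but never to a count above the
true sum (`cv_le_of_coef_ne_zero`). So the tables are split by rank, the total count over all
vertices, and only products whose ranks add up to the rank of `f` are kept: then equality holds at
every single vertex, and no folded term survives (`mix_extract`). The price is a factor `r ^ 2` for
`r = (k + 1) * (s - 2) + 1` ranks.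

Every edge is assigned to one node whose bag contains both ends. While more than one node is left,
an end `x` of the remaining tree with neighbour `y` is chosen. A vertex of the bag of `x` that is
not in the bag of `y` lies in no other remaining bag (`IsEnd.inter_subset`), so it can be completed;
then the table of `x` is merged into that of `y`. At the last node all vertices are completed, and
`sem_univ` identifies the table with the required numbers. Convolving two tables costs the product
of their lengths; this is paid by the growth of the sum of the squared lengths
(`does_contractStep`). As the lengths add up to at most `N + n`, all merges together handle only
`O(n ^ 2)` pairs of sizes.

Numbers are kept modulo `m = scale * 2 ^ n + 1`, where `scale` is the absolute value of the
determinant of the evaluation matrix. This modulus exceeds every number to be computed, and `-2 ^ n`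
is the inverse of `scale`, so that interpolation is possible. Products are formed by doubling and
adding, and the program contains no multiplication instruction. Its time is therefore the number of
simple instructions times the number of words of a `B`-bit number, where `B` is linear in `n` for
fixed `s`; multiplying numbers of `n` bits includes reading them, so this number of words is bounded
by a multiple of `i_×(n)` (`Machine.unit_le`). The `n ^ 2` pairs of sizes and the `O(n)` doubling
steps give `n ^ 3`, and the remaining powers of `s` are absorbed by `pow_seven_mul_le`.

The correctness of the program is proved with timed Hoare triples, `Does`, whose rules also ensure
that no stored number has more than `B` bits. -/

/-! ### Bounded runs of programs -/

/-- Running time units: the cost of a primitive instruction on numbers of at most `B` bits. -/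
def Machine.unit (M : Machine) (B : ℕ) : ℕ := 500 * (B / M.wordLength + 1)

/-- All registers and memory cells hold numbers of at most `B` bits. -/
structure Config.Bounded (B : ℕ) (S : Config) : Prop where
  reg : ∀ x, S.reg x < 2 ^ B
  mem : ∀ a i, S.mem a i < 2 ^ B

namespace Config

@[simp] theorem setReg_reg (S : Config) (x v y : ℕ) :
    (S.setReg x v).reg y = if y = x then v else S.reg y := by
  simp [setReg, Function.update_apply]

@[simp] theorem setReg_mem (S : Config) (x v : ℕ) : (S.setReg x v).mem = S.mem := rfl

@[simp] theorem setMem_reg (S : Config) (a i v : ℕ) : (S.setMem a i v).reg = S.reg := rfl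

@[simp] theorem setMem_mem_ne (S : Config) (a i v b : ℕ) (h : b ≠ a) :
    (S.setMem a i v).mem b = S.mem b := by
  simp [setMem, h]

theorem setMem_mem_self (S : Config) (a i v j : ℕ) :
    (S.setMem a i v).mem a j = if j = i then v else S.mem a j := by
  simp [setMem, Function.update_apply]

theorem setReg_eq_self (S : Config) (x : ℕ) : S.setReg x (S.reg x) = S := by
  simp [setReg]

theorem Bounded.setReg {B : ℕ} {S : Config} (h : S.Bounded B) {x v : ℕ} (hv : v < 2 ^ B) :
    (S.setReg x v).Bounded B := by
  refine ⟨fun y => ?_, h.mem⟩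
  rw [setReg_reg]
  split_ifs
  exacts [hv, h.reg y]

theorem Bounded.setMem {B : ℕ} {S : Config} (h : S.Bounded B) {a i v : ℕ} (hv : v < 2 ^ B) :
    (S.setMem a i v).Bounded B := by
  refine ⟨h.reg, fun b j => ?_⟩
  by_cases hb : b = a
  · subst hb
    rw [setMem_mem_self]
    split_ifs
    exacts [hv, h.mem b j]
  · rw [setMem_mem_ne _ _ _ _ _ hb]
    exact h.mem b j

end Config

namespace Expr

/-- The number of nodes of an expression. -/
def weight : Expr → ℕ
  | const _ => 1
  | reg _ => 1
  | load _ i => i.weight + 1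
  | add e f => e.weight + f.weight + 1
  | sub e f => e.weight + f.weight + 1
  | mul e f => e.weight + f.weight + 1
  | lt e f => e.weight + f.weight + 1
  | eq e f => e.weight + f.weight + 1

/-- Expressions without multiplications and with constants of at most `4` bits. -/
def plain : Expr → Bool
  | const c => c < 16
  | reg _ => true
  | load _ i => i.plain
  | add e f => e.plain && f.plain
  | sub e f => e.plain && f.plain
  | mul _ _ => false
  | lt e f => e.plain && f.plain
  | eq e f => e.plain && f.plain

/-- Short expressions without multiplications. -/
def small (e : Expr) : Bool := e.plain && e.weight < 40

theorem weight_pos (e : Expr) : 0 < e.weight := by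
  cases e <;> simp [weight]

/-- Without multiplications every node of the expression adds at most one bit: a sum is at most
twice the larger summand, and the leaves, including the constants below 16, start with at most `B`
bits. -/
theorem eval_lt {B : ℕ} (hB : 64 ≤ B) {S : Config} (hS : S.Bounded B) {e : Expr}
    (he : e.plain = true) : e.eval S < 2 ^ (B + e.weight) := by
  have key : ∀ a b x y : ℕ, x < 2 ^ (B + a) → y < 2 ^ (B + b) → x + y < 2 ^ (B + (a + b + 1)) := by
    intro a b x y hx hy
    have h1 : 2 ^ (B + a) ≤ 2 ^ (B + (a + b)) := Nat.pow_le_pow_right (by norm_num) (by omega)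
    have h2 : 2 ^ (B + b) ≤ 2 ^ (B + (a + b)) := Nat.pow_le_pow_right (by norm_num) (by omega)
    have h3 : 2 ^ (B + (a + b + 1)) = 2 ^ (B + (a + b)) * 2 := by
      rw [← pow_succ]; rfl
    omega
  have one : ∀ a, 1 < 2 ^ (B + a) := fun a => Nat.one_lt_two_pow (by omega)
  induction e with
  | const c =>
    simp only [plain, decide_eq_true_eq] at he
    have h1 : 2 ^ 4 ≤ 2 ^ (B + weight (const c)) :=
      Nat.pow_le_pow_right (by norm_num) (by omega)
    simp only [eval]
    omega
  | reg x => exact (hS.reg x).trans_le (Nat.pow_le_pow_right (by norm_num) (by omega))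
  | load a i _ => exact (hS.mem a _).trans_le (Nat.pow_le_pow_right (by norm_num) (by omega))
  | add e f ihe ihf =>
    simp only [plain, Bool.and_eq_true] at he
    exact key _ _ _ _ (ihe he.1) (ihf he.2)
  | sub e f ihe ihf =>
    simp only [plain, Bool.and_eq_true] at he
    exact lt_of_le_of_lt (by simp only [eval]; omega) (key _ _ _ _ (ihe he.1) (ihf he.2))
  | mul e f _ _ => simp [plain] at he
  | lt e f _ _ =>
    simp only [eval]
    split_ifs
    exacts [one _, (one _).trans' one_pos]
  | eq e f _ _ =>
    simp only [eval]
    split_ifs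
    exacts [one _, (one _).trans' one_pos]

end Expr

theorem Machine.words_le (M : Machine) {x b : ℕ} (h : x < 2 ^ b) :
    M.words x ≤ b / M.wordLength + 1 :=
  Nat.add_le_add_right (Nat.div_le_div_right (Nat.size_le.2 h)) 1

namespace Expr

theorem cost_le {B : ℕ} (hB : 64 ≤ B) (M : Machine) {S : Config} (hS : S.Bounded B) {b : ℕ}
    {e : Expr} (he : e.plain = true) (hb : B + e.weight ≤ b) :
    e.cost M S ≤ 3 * e.weight * (b / M.wordLength + 1) := by
  have hw : ∀ x a, x < 2 ^ (B + a) → B + a ≤ b → M.words x ≤ b / M.wordLength + 1 :=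
    fun x a hx ha => M.words_le (hx.trans_le (Nat.pow_le_pow_right (by norm_num) ha))
  set U := b / M.wordLength + 1 with hU
  induction e with
  | const c =>
    have := hw _ _ (eval_lt hB hS he) hb
    simp only [eval] at this
    simp only [cost, weight]
    omega
  | reg x =>
    have := hw _ _ (eval_lt hB hS he) hb
    simp only [eval] at this
    simp only [cost, weight]
    omega
  | load a i ih =>
    simp only [plain] at he
    simp only [weight] at hb ⊢
    have h1 := ih he (by omega)
    have h2 := hw _ _ (eval_lt hB hS he) (by omega)
    have h3 := hw _ _ (eval_lt (e := load a i) hB hS he) hb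
    simp only [eval] at h3
    simp only [cost]
    nlinarith
  | add e f ihe ihf =>
    simp only [plain, Bool.and_eq_true] at he
    simp only [weight] at hb ⊢
    have h1 := ihe he.1 (by omega)
    have h2 := ihf he.2 (by omega)
    have h3 := hw _ _ (eval_lt hB hS he.1) (by omega)
    have h4 := hw _ _ (eval_lt hB hS he.2) (by omega)
    simp only [cost]
    nlinarith
  | sub e f ihe ihf =>
    simp only [plain, Bool.and_eq_true] at he
    simp only [weight] at hb ⊢
    have h1 := ihe he.1 (by omega)
    have h2 := ihf he.2 (by omega)
    have h3 := hw _ _ (eval_lt hB hS he.1) (by omega)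
    have h4 := hw _ _ (eval_lt hB hS he.2) (by omega)
    simp only [cost]
    nlinarith
  | mul e f _ _ => simp [plain] at he
  | lt e f ihe ihf =>
    simp only [plain, Bool.and_eq_true] at he
    simp only [weight] at hb ⊢
    have h1 := ihe he.1 (by omega)
    have h2 := ihf he.2 (by omega)
    have h3 := hw _ _ (eval_lt hB hS he.1) (by omega)
    have h4 := hw _ _ (eval_lt hB hS he.2) (by omega)
    simp only [cost]
    nlinarith
  | eq e f ihe ihf =>
    simp only [plain, Bool.and_eq_true] at he
    simp only [weight] at hb ⊢
    have h1 := ihe he.1 (by omega)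
    have h2 := ihf he.2 (by omega)
    have h3 := hw _ _ (eval_lt hB hS he.1) (by omega)
    have h4 := hw _ _ (eval_lt hB hS he.2) (by omega)
    simp only [cost]
    nlinarith

/-- Since `B ≥ 64`, the 40 additional bits of intermediate results at most double the number of
words. With three words per node and weight below 40 this gives the factor 3 · 40 · 2 = 240. -/
theorem cost_le_of_small {B : ℕ} (hB : 64 ≤ B) (M : Machine) {S : Config} (hS : S.Bounded B)
    {e : Expr} (he : e.small = true) :
    e.cost M S ≤ 240 * (B / M.wordLength + 1) ∧
      M.words (e.eval S) ≤ 2 * (B / M.wordLength + 1) := by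
  simp only [small, Bool.and_eq_true, decide_eq_true_eq] at he
  have hdiv : (B + 40) / M.wordLength + 1 ≤ 2 * (B / M.wordLength + 1) := by
    have h1 : (B + 40) / M.wordLength ≤ (2 * B) / M.wordLength :=
      Nat.div_le_div_right (by omega)
    have hw := M.wordLength_pos
    have h2 : (2 * B) / M.wordLength ≤ 2 * (B / M.wordLength) + 1 := by
      rw [← Nat.lt_succ_iff, Nat.div_lt_iff_lt_mul hw]
      have h3 := Nat.div_add_mod B M.wordLength
      have h4 := Nat.mod_lt B hw
      nlinarith
    omega
  constructor
  · have := cost_le hB M hS he.1 (b := B + 40) (by omega)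
    have h2 := e.weight_pos
    nlinarith
  · have h1 := eval_lt hB hS he.1
    have h2 := M.words_le (h1.trans_le (Nat.pow_le_pow_right (by norm_num)
      (show B + e.weight ≤ B + 40 by omega)))
    omega

end Expr

namespace Prog

/-- Does the program assign to register `y`? -/
def writesReg : Prog → ℕ → Bool
  | skip, _ => false
  | assign x _, y => x == y
  | store _ _ _, _ => false
  | seq P Q, y => P.writesReg y || Q.writesReg y
  | branch _ P Q, y => P.writesReg y || Q.writesReg y
  | loop _ P, y => P.writesReg y

/-- Does the program write into bank `b`? -/
def writesMem : Prog → ℕ → Bool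
  | skip, _ => false
  | assign _ _, _ => false
  | store a _ _, b => a == b
  | seq P Q, b => P.writesMem b || Q.writesMem b
  | branch _ P Q, b => P.writesMem b || Q.writesMem b
  | loop _ P, b => P.writesMem b

/-- The configurations agree on everything that `P` does not write. -/
structure Frame (P : Prog) (S S' : Config) : Prop where
  reg : ∀ y, P.writesReg y = false → S'.reg y = S.reg y
  mem : ∀ b, P.writesMem b = false → S'.mem b = S.mem b

theorem Frame.refl (P : Prog) (S : Config) : P.Frame S S := ⟨fun _ _ => rfl, fun _ _ => rfl⟩

theorem Frame.trans {P : Prog} {S S' S'' : Config} (h : P.Frame S S') (h' : P.Frame S' S'') :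
    P.Frame S S'' :=
  ⟨fun y hy => (h'.reg y hy).trans (h.reg y hy), fun y hy => (h'.mem y hy).trans (h.mem y hy)⟩

theorem Frame.mono {P Q : Prog} {S S' : Config} (h : P.Frame S S')
    (hr : ∀ y, Q.writesReg y = false → P.writesReg y = false)
    (hm : ∀ y, Q.writesMem y = false → P.writesMem y = false) : Q.Frame S S' :=
  ⟨fun y hy => h.reg y (hr y hy), fun y hy => h.mem y (hm y hy)⟩

end Prog

/-- What a program may write is computed from its text alone. In the proofs below, the invariance of
all other registers and banks is thereby reduced to an evaluation of `writesReg` or `writesMem`,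
mostly by `rfl`. -/
theorem Runs.frame {M : Machine} {P : Prog} {S S' : Config} {t : ℕ} (h : Runs M P S S' t) :
    P.Frame S S' := by
  induction h with
  | skip => exact .refl _ _
  | assign x e S =>
    refine ⟨fun y hy => ?_, fun _ _ => rfl⟩
    simp only [Prog.writesReg, beq_eq_false_iff_ne] at hy
    simp [hy.symm]
  | store a i e S =>
    refine ⟨fun _ _ => rfl, fun b hb => ?_⟩
    simp only [Prog.writesMem, beq_eq_false_iff_ne] at hb
    exact Config.setMem_mem_ne _ _ _ _ _ hb.symm
  | seq _ _ ih ih' =>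
    refine (ih.mono ?_ ?_).trans (ih'.mono ?_ ?_) <;>
      · intro y hy
        simp only [Prog.writesReg, Prog.writesMem, Bool.or_eq_false_iff] at hy
        first | exact hy.1 | exact hy.2
  | branch_true _ _ ih =>
    refine ih.mono ?_ ?_ <;>
      · intro y hy
        simp only [Prog.writesReg, Prog.writesMem, Bool.or_eq_false_iff] at hy
        exact hy.1
  | branch_false _ _ ih =>
    refine ih.mono ?_ ?_ <;>
      · intro y hy
        simp only [Prog.writesReg, Prog.writesMem, Bool.or_eq_false_iff] at hy
        exact hy.2
  | loop_true _ _ _ ih ih' =>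
    exact Prog.Frame.trans (ih.mono (fun _ hy => hy) (fun _ hy => hy)) ih'
  | loop_false => exact .refl _ _

/-- Started in `S`, the program halts after at most `τ` time units in a configuration that
satisfies `post`, and no number of more than `B` bits is stored. -/
def Does (M : Machine) (B : ℕ) (P : Prog) (S : Config) (τ : ℕ) (post : Config → Prop) : Prop :=
  S.Bounded B → ∃ S' t, Runs M P S S' t ∧ t ≤ τ * M.unit B ∧ S'.Bounded B ∧ post S'

infixr:60 " ;; " => Prog.seq

/-- The loop that runs `P` for `x = 0, 1, …` as long as `x` is less than register `y`. -/
def Prog.forLoop (x y : ℕ) (P : Prog) : Prog :=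
  .assign x (.const 0) ;; .loop (.lt (.reg x) (.reg y)) (P ;; .assign x (.add (.reg x) (.const 1)))

namespace Does

variable {M : Machine} {B : ℕ} {P Q : Prog} {S : Config} {τ τ' : ℕ} {post post' : Config → Prop}

theorem mono (h : Does M B P S τ post) (hτ : τ ≤ τ') : Does M B P S τ' post := fun hS => by
  obtain ⟨S', t, hr, ht, hb, hp⟩ := h hS
  exact ⟨S', t, hr, ht.trans (Nat.mul_le_mul_right _ hτ), hb, hp⟩

theorem conseq (h : Does M B P S τ post)
    (hp : ∀ S', P.Frame S S' → S'.Bounded B → post S' → post' S') : Does M B P S τ post' :=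
  fun hS => by
  obtain ⟨S', t, hr, ht, hb, hq⟩ := h hS
  exact ⟨S', t, hr, ht, hb, hp S' hr.frame hb hq⟩

theorem of_bounded (h : S.Bounded B → Does M B P S τ post) : Does M B P S τ post :=
  fun hS => h hS hS

theorem skip (h : post S) : Does M B .skip S 1 post := fun hS =>
  ⟨S, 1, .skip S, by
    unfold Machine.unit
    have := Nat.zero_le (B / M.wordLength)
    omega, hS, h⟩

theorem assign (hB : 64 ≤ B) {x : ℕ} {e : Expr} (he : e.small = true)
    (hv : S.Bounded B → e.eval S < 2 ^ B) (h : post (S.setReg x (e.eval S))) :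
    Does M B (.assign x e) S 1 post := fun hS => by
  refine ⟨_, _, .assign x e S, ?_, hS.setReg (hv hS), h⟩
  have := e.cost_le_of_small hB M hS he
  unfold Machine.unit
  have := Nat.zero_le (B / M.wordLength)
  omega

theorem assign_const {x c : ℕ} (hc : c < 2 ^ B) (h : post (S.setReg x c)) :
    Does M B (.assign x (.const c)) S 1 post := fun hS => by
  refine ⟨_, _, .assign x (.const c) S, ?_, hS.setReg hc, h⟩
  have := M.words_le hc
  simp only [Expr.cost, Expr.eval, Machine.unit]
  have := Nat.zero_le (B / M.wordLength)
  omega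

/-- The most expensive primitive: two expressions and two values cost at most 2 · 240 + 2 · 2 = 484
times the number of words, which explains the factor 500 in `Machine.unit`. -/
theorem store (hB : 64 ≤ B) {a : ℕ} {i e : Expr} (hi : i.small = true) (he : e.small = true)
    (hv : S.Bounded B → e.eval S < 2 ^ B) (h : post (S.setMem a (i.eval S) (e.eval S))) :
    Does M B (.store a i e) S 1 post := fun hS => by
  refine ⟨_, _, .store a i e S, ?_, hS.setMem (hv hS), h⟩
  have h1 := e.cost_le_of_small hB M hS he
  have h2 := i.cost_le_of_small hB M hS hi
  unfold Machine.unit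
  have := Nat.zero_le (B / M.wordLength)
  omega

theorem store_const {a i c : ℕ} (hi : i < 2 ^ B) (hc : c < 2 ^ B) (h : post (S.setMem a i c)) :
    Does M B (.store a (.const i) (.const c)) S 1 post := fun hS => by
  refine ⟨_, _, .store a (.const i) (.const c) S, ?_, hS.setMem hc, h⟩
  have h1 := M.words_le hc
  have h2 := M.words_le hi
  simp only [Expr.cost, Expr.eval, Machine.unit]
  have := Nat.zero_le (B / M.wordLength)
  omega

theorem seq (h : Does M B P S τ fun S' => Does M B Q S' τ' post) :
    Does M B (P ;; Q) S (τ + τ') post := fun hS => by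
  obtain ⟨S', t, hr, ht, hb, hq⟩ := h hS
  obtain ⟨S'', t', hr', ht', hb', hp⟩ := hq hb
  exact ⟨S'', t + t', .seq hr hr', by rw [add_mul]; omega, hb', hp⟩

/-- The times of both branches are added, rather than their maximum taken; the bounds stay free of
case distinctions, and a branch that cannot occur may be charged with time 0. -/
theorem branch (hB : 64 ≤ B) {g : Expr} (hg : g.small = true)
    (h₁ : g.eval S ≠ 0 → Does M B P S τ post) (h₂ : g.eval S = 0 → Does M B Q S τ' post) :
    Does M B (.branch g P Q) S (1 + τ + τ') post := fun hS => by
  have h3 := g.cost_le_of_small hB M hS hg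
  have h4 : g.cost M S + 1 ≤ M.unit B := by
    unfold Machine.unit
    have := Nat.zero_le (B / M.wordLength)
    omega
  by_cases h0 : g.eval S = 0
  · obtain ⟨S', t, hr, ht, hb, hq⟩ := h₂ h0 hS
    exact ⟨S', _, .branch_false h0 hr, by nlinarith, hb, hq⟩
  · obtain ⟨S', t, hr, ht, hb, hq⟩ := h₁ h0 hS
    exact ⟨S', _, .branch_true h0 hr, by nlinarith, hb, hq⟩

/-- The loop rule, with an invariant that may account for the time spent. -/
theorem forLoop_amortized (hB : 64 ≤ B) {x y : ℕ} (Inv : ℕ → ℕ → Config → Prop) {n : ℕ}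
    (hy : S.reg y = n) (hx : P.writesReg x = false) (hyP : P.writesReg y = false) (hxy : x ≠ y)
    (h0 : Inv 0 0 (S.setReg x 0))
    (hstep : ∀ i t S', i < n → (Prog.forLoop x y P).Frame S S' → S'.reg x = i → Inv i t S' →
      ∃ τ, Does M B P S' τ fun S'' => Inv (i + 1) (t + τ) (S''.setReg x (i + 1)))
    (hpost : ∀ t S', (Prog.forLoop x y P).Frame S S' → S'.reg x = n → Inv n t S' →
      post S' ∧ t ≤ τ) :
    Does M B (Prog.forLoop x y P) S (n * 2 + 2 + τ) post := by
  intro hS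
  have hU : 0 < M.unit B := by
    unfold Machine.unit
    have := Nat.zero_le (B / M.wordLength)
    omega
  have hg : ∀ S' : Config, S'.Bounded B →
      (Expr.lt (.reg x) (.reg y)).cost M S' + 1 ≤ M.unit B := fun S' hS' => by
    have := Expr.cost_le_of_small hB M hS' (e := .lt (.reg x) (.reg y)) rfl
    unfold Machine.unit
    have := Nat.zero_le (B / M.wordLength)
    omega
  have hframe : ∀ {S₁ S₂ t}, Runs M (.assign x (.const 0)) S₁ S₂ t →
      (Prog.forLoop x y P).Frame S₁ S₂ := fun h => h.frame.mono
    (fun z hz => by simp only [Prog.forLoop, Prog.writesReg, Bool.or_eq_false_iff] at hz ⊢; tauto)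
    (fun z hz => rfl)
  -- Induction on the number `k` of iterations left. Besides its body, each iteration takes two
  -- units, for the guard and the increment; the last guard and the initial assignment make up the
  -- additional 2.
  have main : ∀ k i t S', i + k = n → (Prog.forLoop x y P).Frame S S' → S'.reg x = i →
      S'.Bounded B → Inv i t S' → ∃ S'' t', Runs M
        (.loop (.lt (.reg x) (.reg y)) (P ;; .assign x (.add (.reg x) (.const 1)))) S' S'' t' ∧
        t * M.unit B + t' ≤ (k * 2 + 1 + τ) * M.unit B ∧ S''.Bounded B ∧ post S'' := by
    intro k
    induction k with
    | zero =>
      intro i t S' hi hf hxi hb hinv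
      have hy' : S'.reg y = n := by
        rw [hf.reg y (by simp [Prog.forLoop, Prog.writesReg, hyP, hxy]), hy]
      obtain rfl : i = n := by omega
      obtain ⟨hp, ht⟩ := hpost _ _ hf hxi hinv
      refine ⟨S', _, .loop_false ?_, ?_, hb, hp⟩
      · simp [Expr.eval, hxi, hy']
      · have := hg S' hb
        nlinarith
    | succ k ih =>
      intro i t S' hi hf hxi hb hinv
      have hy' : S'.reg y = n := by
        rw [hf.reg y (by simp [Prog.forLoop, Prog.writesReg, hyP, hxy]), hy]
      obtain ⟨τ₁, hd⟩ := hstep i t S' (by omega) hf hxi hinv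
      obtain ⟨S₁, t₁, hr₁, ht₁, hb₁, hI₁⟩ := hd hb
      have hx₁ : S₁.reg x = i := by rw [hr₁.frame.reg x hx, hxi]
      have hy₁ : S₁.reg y = n := by rw [hr₁.frame.reg y hyP, hy']
      -- The counter cannot overflow because it never exceeds the content of register `y`, which is
      -- already bounded.
      have hlt : i + 1 < 2 ^ B := by
        have := hb₁.reg y
        omega
      have hr₂ := Runs.assign (M := M) x (.add (.reg x) (.const 1)) S₁
      have hc := Expr.cost_le_of_small hB M hb₁ (e := .add (.reg x) (.const 1)) rfl
      simp only [Expr.eval, hx₁] at hr₂ hc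
      have hf₂ : (Prog.forLoop x y P).Frame S (S₁.setReg x (i + 1)) := by
        refine hf.trans ⟨fun z hz => ?_, fun z hz => ?_⟩
        · simp only [Prog.forLoop, Prog.writesReg, Bool.or_eq_false_iff,
            beq_eq_false_iff_ne] at hz
          rw [Config.setReg_reg, if_neg hz.1.symm, hr₁.frame.reg z hz.2.1]
        · simp only [Prog.forLoop, Prog.writesMem, Bool.or_eq_false_iff] at hz
          rw [Config.setReg_mem, hr₁.frame.mem z hz.2.1]
      obtain ⟨S₂, t₂, hr₃, ht₃, hb₃, hp₃⟩ := ih (i + 1) (t + τ₁) (S₁.setReg x (i + 1))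
        (by omega) hf₂ (by simp) (hb₁.setReg hlt) hI₁
      refine ⟨S₂, _, .loop_true ?_ (.seq hr₁ hr₂) hr₃, ?_, hb₃, hp₃⟩
      · simp [Expr.eval, hxi, hy']
        omega
      · have h1 := hg S' hb
        have h2 : (Expr.add (.reg x) (.const 1)).cost M S₁ + M.words (i + 1) ≤ M.unit B := by
          unfold Machine.unit
          have := Nat.zero_le (B / M.wordLength)
          omega
        rw [add_mul] at ht₃
        nlinarith
  have hr₀ := Runs.assign (M := M) x (.const 0) S
  have hc := Expr.cost_le_of_small hB M hS (e := .const 0) rfl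
  obtain ⟨S₂, t₂, hr₂, ht₂, hb₂, hp₂⟩ := main n 0 0 (S.setReg x 0) (by omega) (hframe hr₀)
    (by simp) (hS.setReg (by positivity)) h0
  refine ⟨S₂, _, .seq hr₀ hr₂, ?_, hb₂, hp₂⟩
  have h2 : (Expr.const 0).cost M S + M.words ((Expr.const 0).eval S) ≤ M.unit B := by
    unfold Machine.unit
    have := Nat.zero_le (B / M.wordLength)
    omega
  nlinarith

/-- The loop rule for bodies with a uniform time bound. -/
theorem forLoop (hB : 64 ≤ B) {x y : ℕ} (Inv : ℕ → Config → Prop) {n : ℕ}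
    (hy : S.reg y = n) (hx : P.writesReg x = false) (hyP : P.writesReg y = false) (hxy : x ≠ y)
    (h0 : Inv 0 (S.setReg x 0))
    (hstep : ∀ i S', i < n → (Prog.forLoop x y P).Frame S S' → S'.reg x = i → Inv i S' →
      Does M B P S' τ fun S'' => Inv (i + 1) (S''.setReg x (i + 1)))
    (hpost : ∀ S', (Prog.forLoop x y P).Frame S S' → S'.reg x = n → Inv n S' → post S') :
    Does M B (Prog.forLoop x y P) S (n * (τ + 2) + 2) post := by
  have := forLoop_amortized (M := M) (S := S) (P := P) (τ := n * τ) (post := post) hB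
    (fun i t S' => Inv i S' ∧ t = i * τ) hy hx hyP hxy ⟨h0, by simp⟩
    (fun i t S' hi hf hxi hI => ⟨τ, (hstep i S' hi hf hxi hI.1).conseq
      fun S'' _ _ h => ⟨h, by rw [hI.2]; ring⟩⟩)
    (fun t S' hf hxi hI => ⟨hpost S' hf hxi hI.1, hI.2.le⟩)
  exact this.mono (by ring_nf; omega)

end Does

/-! ### Vertex states -/

/-- The states of a vertex in a partial solution: `inn d` tells whether the vertex belongs to the
dominating set, and its number of neighbours in the set has to be `cv d`, unless `star d` holds and
that number is arbitrary. The weights `w` express the two conditions by states. -/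
structure StateSystem (ρ σ : Set ℕ) (s : ℕ) where
  inn : Fin s → Bool
  star : Fin s → Bool
  cv : Fin s → ℕ
  w : Fin s → ℤ
  zero : Fin s
  zero_val : (zero : ℕ) = 0
  inn_zero : inn zero = false
  cv_zero : cv zero = 0
  cv_of_star : ∀ d, star d = true → cv d = 0
  ext : ∀ d e, inn d = inn e → star d = star e → cv d = cv e → d = e
  exists_cv : ∀ d c, c ≤ cv d → ∃ e, inn e = inn d ∧ star e = star d ∧ cv e = c
  cv_le : ∀ d, cv d ≤ s - 2
  natAbs_w_le : ∀ d, (w d).natAbs ≤ 1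
  sum_w : ∀ (β : Bool) (c : ℕ) [Decidable (c ∈ if β then σ else ρ)],
    (∑ d, if inn d = β ∧ (star d = true ∨ cv d = c) then w d else 0) =
      if c ∈ (if β then σ else ρ) then 1 else 0

namespace StateSystem

variable {ρ σ : Set ℕ} {s : ℕ} (A : StateSystem ρ σ s)

/-- The number `c` of neighbours is allowed in state `d`. -/
def Fits (d : Fin s) (c : ℕ) : Prop := A.star d = true ∨ A.cv d = c

instance (d : Fin s) (c : ℕ) : Decidable (A.Fits d c) := inferInstanceAs (Decidable (_ ∨ _))

/-- States that differ at most in the number of neighbours. -/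
def SameClass (d e : Fin s) : Prop := A.inn d = A.inn e ∧ A.star d = A.star e

instance (d e : Fin s) : Decidable (A.SameClass d e) := inferInstanceAs (Decidable (_ ∧ _))

/-- The states `d` and `e` in two parts of the graph give the state `f` in their union. -/
def Sums (d e f : Fin s) : Prop :=
  A.SameClass d f ∧ A.SameClass e f ∧ A.cv d + A.cv e = A.cv f

instance (d e f : Fin s) : Decidable (A.Sums d e f) := inferInstanceAs (Decidable (_ ∧ _ ∧ _))

variable {A}

theorem SameClass.symm {d e : Fin s} (h : A.SameClass d e) : A.SameClass e d :=
  ⟨h.1.symm, h.2.symm⟩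

theorem SameClass.trans {d e f : Fin s} (h : A.SameClass d e) (h' : A.SameClass e f) :
    A.SameClass d f :=
  ⟨h.1.trans h'.1, h.2.trans h'.2⟩

theorem SameClass.eq {d e : Fin s} (h : A.SameClass d e) (hc : A.cv d = A.cv e) : d = e :=
  A.ext d e h.1 h.2 hc

theorem fits_zero : A.Fits A.zero 0 := Or.inr A.cv_zero

/-- Completed vertices and vertices outside the bag carry the state `zero`. This equivalence makes
them neutral when tables are joined. -/
theorem sums_zero {d e : Fin s} : A.Sums d e A.zero ↔ d = A.zero ∧ e = A.zero := by
  constructor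
  · rintro ⟨h1, h2, h3⟩
    rw [A.cv_zero] at h3
    exact ⟨h1.eq (by rw [A.cv_zero]; omega), h2.eq (by rw [A.cv_zero]; omega)⟩
  · rintro ⟨rfl, rfl⟩
    exact ⟨⟨rfl, rfl⟩, ⟨rfl, rfl⟩, by simp [A.cv_zero]⟩

/-- At most one pair of states contributes. If `f` allows any number, its class is a single state
and the pair is `(f, f)`. Otherwise the counts of the pair must be `c` and `c'`, and such states
exist in the class of `f`, with sum `f`, exactly if `f` has count `c + c'`. -/
theorem fits_add (f : Fin s) (c c' : ℕ) :
    (∑ d, ∑ e, if A.Sums d e f then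
      (if A.Fits d c then (1 : ℤ) else 0) * (if A.Fits e c' then 1 else 0) else 0) =
      if A.Fits f (c + c') then 1 else 0 := by
  have key : ∀ d₀ e₀ : Fin s, (∀ d e, A.Sums d e f ∧ A.Fits d c ∧ A.Fits e c' ↔
      A.Fits f (c + c') ∧ d = d₀ ∧ e = e₀) →
      (∑ d, ∑ e, if A.Sums d e f then
      (if A.Fits d c then (1 : ℤ) else 0) * (if A.Fits e c' then 1 else 0) else 0) =
      if A.Fits f (c + c') then 1 else 0 := by
    intro d₀ e₀ h
    have : ∀ d e, (if A.Sums d e f then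
      (if A.Fits d c then (1 : ℤ) else 0) * (if A.Fits e c' then 1 else 0) else 0) =
      if d = d₀ then (if e = e₀ then (if A.Fits f (c + c') then 1 else 0) else 0) else 0 := by
      intro d e
      replace h := h d e
      by_cases h1 : A.Sums d e f <;> by_cases h2 : A.Fits d c <;> by_cases h3 : A.Fits e c' <;>
        by_cases h4 : A.Fits f (c + c') <;> by_cases h5 : d = d₀ <;> by_cases h6 : e = e₀ <;>
        simp_all
    simp only [this]
    simp
  by_cases hs : A.star f = true
  · refine key f f fun d e => ⟨?_, ?_⟩
    · rintro ⟨⟨h1, h2, h3⟩, -, -⟩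
      have hf := A.cv_of_star f hs
      exact ⟨Or.inl hs, h1.eq (by omega), h2.eq (by omega)⟩
    · rintro ⟨-, rfl, rfl⟩
      have hf := A.cv_of_star _ hs
      exact ⟨⟨⟨rfl, rfl⟩, ⟨rfl, rfl⟩, by omega⟩, Or.inl hs, Or.inl hs⟩
  · by_cases hc : A.cv f = c + c'
    · obtain ⟨d₀, h1, h2, h3⟩ := A.exists_cv f c (by omega)
      obtain ⟨e₀, h4, h5, h6⟩ := A.exists_cv f c' (by omega)
      refine key d₀ e₀ fun d e => ⟨?_, ?_⟩
      · rintro ⟨⟨g1, g2, g3⟩, g4, g5⟩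
        have g4' : A.cv d = c := g4.resolve_left (by rw [g1.2]; exact hs)
        have g5' : A.cv e = c' := g5.resolve_left (by rw [g2.2]; exact hs)
        exact ⟨Or.inr hc, (g1.trans ⟨h1.symm, h2.symm⟩).eq (by omega),
          (g2.trans ⟨h4.symm, h5.symm⟩).eq (by omega)⟩
      · rintro ⟨-, rfl, rfl⟩
        exact ⟨⟨⟨h1, h2⟩, ⟨h4, h5⟩, by omega⟩, Or.inr h3, Or.inr h6⟩
    · refine key f f fun d e => ⟨?_, ?_⟩
      · rintro ⟨⟨g1, g2, g3⟩, g4, g5⟩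
        have g4' : A.cv d = c := g4.resolve_left (by rw [g1.2]; exact hs)
        have g5' : A.cv e = c' := g5.resolve_left (by rw [g2.2]; exact hs)
        omega
      · rintro ⟨h | h, -, -⟩
        exacts [absurd h hs, absurd h hc]

variable (A)

/-! #### The transformation matrices -/

/-- The matrix that evaluates, for every class of states, the polynomial with the given
coefficients. -/
def evalMatrix : Matrix (Fin s) (Fin s) ℤ :=
  fun l d => if A.SameClass l d then (A.cv l : ℤ) ^ A.cv d else 0

-- By `exists_cv` a class is closed under lowering the count, so it has states with the counts `0,
-- …, cv d`. This bounds the degrees of the polynomials by the number of evaluation points.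
open Finset in
theorem cv_lt_card (d : Fin s) : A.cv d < #{e | A.SameClass e d} := by
  have : (range (A.cv d + 1)) ⊆ image A.cv {e | A.SameClass e d} := by
    intro c hc
    obtain ⟨e, h1, h2, h3⟩ := A.exists_cv d c (by simpa [Nat.lt_succ_iff] using hc)
    exact mem_image.2 ⟨e, by simpa using ⟨h1, h2⟩, h3⟩
  have := (card_le_card this).trans card_image_le
  simpa using this

-- The values of `x` on the class of `d` are the coefficients of a polynomial of degree less than
-- the size of the class. The hypothesis says that it vanishes at the counts of all states of the
-- class, which are distinct, so it is zero. Only one class is involved, because the matrix is block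
-- diagonal with respect to the classes.
open Polynomial in
theorem eq_zero_of_evalMatrix_mulVec {x : Fin s → ℤ}
    {d : Fin s} (h : ∀ l, A.SameClass l d → A.evalMatrix.mulVec x l = 0) : x d = 0 := by
  classical
  set K : Finset (Fin s) := Finset.univ.filter (A.SameClass · d) with hK
  set p : ℤ[X] := ∑ e ∈ K, C (x e) * X ^ A.cv e with hp
  have hcl : ∀ l ∈ K, ∀ e, A.SameClass l e ↔ e ∈ K := by
    intro l hl e
    simp only [hK, Finset.mem_filter, Finset.mem_univ, true_and] at hl ⊢
    exact ⟨fun h => h.symm.trans hl, fun h => hl.trans h.symm⟩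
  have hroot : ∀ l ∈ K, p.eval (A.cv l : ℤ) = 0 := by
    intro l hl
    rw [← h l (by simpa [hK] using hl), hp, eval_finsetSum, Matrix.mulVec, dotProduct,
      ← Finset.sum_filter_add_sum_filter_not Finset.univ (· ∈ K)]
    rw [Finset.sum_eq_zero (s := Finset.univ.filter (· ∉ K)), add_zero]
    · rw [Finset.filter_mem_eq_inter, Finset.univ_inter]
      refine Finset.sum_congr rfl fun e he => ?_
      simp [evalMatrix, (hcl l hl e).2 he, mul_comm]
    · intro e he
      have : ¬ A.SameClass l e := fun h' => by
        simp only [Finset.mem_filter] at he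
        exact he.2 ((hcl l hl e).1 h')
      simp [evalMatrix, this]
  have hinj : Set.InjOn (fun l => (A.cv l : ℤ)) K := by
    intro l hl l' hl' he
    exact ((hcl l hl l').2 hl').eq (Int.ofNat_injective he)
  have hdeg : p.degree < K.card := by
    refine (degree_sum_le _ _).trans_lt ?_
    rw [Finset.sup_lt_iff (by exact WithBot.bot_lt_coe _)]
    intro e he
    have h1 := A.cv_lt_card d
    have h2 := A.cv_lt_card e
    have h3 : (Finset.univ.filter (A.SameClass · e)) = K := by
      ext l
      simp only [hK, Finset.mem_filter, Finset.mem_univ, true_and] at he ⊢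
      exact ⟨fun h => h.trans he, fun h => h.trans he.symm⟩
    rw [h3] at h2
    exact (degree_C_mul_X_pow_le _ _).trans_lt (by exact_mod_cast h2)
  have hp0 : p = 0 := by
    have := Polynomial.eq_zero_of_degree_lt_of_eval_finset_eq_zero
      (f := p) (K.image fun l => (A.cv l : ℤ))
      (by rwa [Finset.card_image_of_injOn hinj]) (by
        intro y hy
        obtain ⟨l, hl, rfl⟩ := Finset.mem_image.1 hy
        exact hroot l hl)
    exact this
  have hd : d ∈ K := by simpa [hK] using ⟨rfl, rfl⟩
  have hc : p.coeff (A.cv d) = x d := by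
    rw [hp, finsetSum_coeff, Finset.sum_eq_single d]
    · simp
    · intro e he hne
      rw [coeff_C_mul_X_pow, if_neg]
      exact fun h' => hne (((hcl e he d).2 hd).eq h'.symm)
    · exact fun h' => absurd hd h'
  rw [← hc, hp0, coeff_zero]

theorem det_evalMatrix_ne_zero : A.evalMatrix.det ≠ 0 := by
  intro h
  obtain ⟨x, hx, h0⟩ := Matrix.exists_mulVec_eq_zero_iff.2 h
  exact hx (funext fun d => A.eq_zero_of_evalMatrix_mulVec fun l _ => congrFun h0 l)

/-- The absolute value of the determinant of the evaluation matrix. -/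
def scale : ℕ := A.evalMatrix.det.natAbs

/-- The inverse of the evaluation matrix, multiplied by `scale`. -/
def invMatrix : Matrix (Fin s) (Fin s) ℤ := A.evalMatrix.det.sign • A.evalMatrix.adjugate

theorem scale_pos : 0 < A.scale := Int.natAbs_pos.2 A.det_evalMatrix_ne_zero

theorem invMatrix_mul : A.invMatrix * A.evalMatrix = (A.scale : ℤ) • 1 := by
  rw [invMatrix, Matrix.smul_mul, Matrix.adjugate_mul, smul_smul, Int.sign_mul_self_eq_natAbs]
  rfl

theorem mul_invMatrix : A.evalMatrix * A.invMatrix = (A.scale : ℤ) • 1 := by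
  rw [invMatrix, Matrix.mul_smul, Matrix.mul_adjugate, smul_smul, Int.sign_mul_self_eq_natAbs]
  rfl

/-- The structure constants of the multiplication by evaluation and interpolation. -/
def coef (d e f : Fin s) : ℤ :=
  ∑ l, A.invMatrix f l * (A.evalMatrix l d * A.evalMatrix l e)

theorem evalMatrix_mul_eq (l d e : Fin s) : A.evalMatrix l d * A.evalMatrix l e =
    if A.SameClass d e ∧ A.SameClass l d then (A.cv l : ℤ) ^ (A.cv d + A.cv e) else 0 := by
  unfold evalMatrix
  by_cases h1 : A.SameClass l d
  · by_cases h2 : A.SameClass l e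
    · rw [if_pos h1, if_pos h2, if_pos ⟨h1.symm.trans h2, h1⟩, pow_add]
    · have : ¬ (A.SameClass d e ∧ A.SameClass l d) := fun h => h2 (h1.trans h.1)
      rw [if_neg h2, if_neg this, mul_zero]
  · have : ¬ (A.SameClass d e ∧ A.SameClass l d) := fun h => h1 h.2
    rw [if_neg h1, if_neg this, zero_mul]

/-- If the class contains the state `g` of the added counts, then the product of the columns `d` and
`e` of the evaluation matrix is its column `g`, which interpolation recovers up to the factor
`scale`. -/
theorem coef_of_sums {d e g : Fin s} (h : A.Sums d e g) (f : Fin s) :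
    A.coef d e f = if f = g then (A.scale : ℤ) else 0 := by
  have h1 : ∀ l, A.evalMatrix l d * A.evalMatrix l e = A.evalMatrix l g := by
    intro l
    rw [evalMatrix_mul_eq, evalMatrix, h.2.2]
    refine if_congr ?_ rfl rfl
    exact ⟨fun h' => h'.2.trans h.1, fun h' => ⟨h.1.trans h.2.1.symm, h'.trans h.1.symm⟩⟩
  have h2 := congrFun (congrFun A.invMatrix_mul f) g
  rw [Matrix.mul_apply] at h2
  simp only [coef, h1, h2, Matrix.smul_apply, Matrix.one_apply, smul_eq_mul, mul_ite, mul_one,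
    mul_zero]

/-- Columns of different classes have disjoint supports, so their product vanishes. For `d` and `e`
in one class, evaluating the vector `coef d e` gives back `scale` times the product of the columns,
which is zero outside the class; evaluation is injective on each class separately. -/
theorem sameClass_of_coef_ne_zero {d e f : Fin s} (h : A.coef d e f ≠ 0) :
    A.SameClass d e ∧ A.SameClass f d := by
  have hde : A.SameClass d e := by
    by_contra hc
    apply h
    simp only [coef, evalMatrix_mul_eq, hc, false_and, if_false, mul_zero, Finset.sum_const_zero]
  refine ⟨hde, ?_⟩
  by_contra hc
  apply h
  refine A.eq_zero_of_evalMatrix_mulVec (x := fun f => A.coef d e f) (d := f) fun l hl => ?_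
  have h1 : (fun f => A.coef d e f) = A.invMatrix.mulVec
      (fun l => A.evalMatrix l d * A.evalMatrix l e) := rfl
  rw [h1, Matrix.mulVec_mulVec, mul_invMatrix, Matrix.smul_mulVec, Matrix.one_mulVec]
  simp only [Pi.smul_apply, evalMatrix_mul_eq]
  rw [if_neg, smul_zero]
  exact fun h' => hc (hl.symm.trans h'.2)

/-- If `cv f` exceeded the sum of the counts, the class would contain a state with that sum as its
count; then interpolation would be exact and the coefficient would be concentrated at that smaller
count. So whenever the product has too large a degree, it is folded to counts that do not exceed the
true sum. -/
theorem cv_le_of_coef_ne_zero {d e f : Fin s} (h : A.coef d e f ≠ 0) :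
    A.cv f ≤ A.cv d + A.cv e := by
  obtain ⟨h1, h2⟩ := A.sameClass_of_coef_ne_zero h
  by_contra! hlt
  obtain ⟨g, g1, g2, g3⟩ := A.exists_cv f (A.cv d + A.cv e) hlt.le
  have hg : A.SameClass g f := ⟨g1, g2⟩
  have hs : A.Sums d e g :=
    ⟨h2.symm.trans hg.symm, h1.symm.trans (h2.symm.trans hg.symm), g3.symm⟩
  rw [A.coef_of_sums hs, ne_eq, ite_eq_right_iff, Classical.not_imp] at h
  rw [h.1] at hlt
  omega

/-- Where no count is lost, interpolation gives the structure constants that the join requires,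
multiplied by `scale`. The comparison of ranks in `mix_extract` reduces everything to this case. -/
theorem coef_eq_of_cv_eq {d e f : Fin s} (h : A.cv f = A.cv d + A.cv e) :
    A.coef d e f = if A.Sums d e f then (A.scale : ℤ) else 0 := by
  by_cases hs : A.Sums d e f
  · rw [A.coef_of_sums hs, if_pos rfl, if_pos hs]
  · rw [if_neg hs]
    by_contra hc
    obtain ⟨h1, h2⟩ := A.sameClass_of_coef_ne_zero hc
    exact hs ⟨h2.symm, h1.symm.trans h2.symm, h.symm⟩

end StateSystem

/-! ### Weighted numbers of partial solutions -/

section PartialSolutions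

open Finset
open scoped Classical

variable {ρ σ : Set ℕ} {s n : ℕ}

/-- The number of vertices of `D` that are related to `u`. -/
noncomputable def degIn (E : Fin n → Fin n → Prop) (D : Finset (Fin n)) (u : Fin n) : ℕ :=
  #{v ∈ D | E u v}

/-- The indicator of the condition on a vertex with `c` neighbours in the dominating set. -/
noncomputable def domWeight (ρ σ : Set ℕ) (β : Bool) (c : ℕ) : ℤ :=
  if c ∈ (if β then σ else ρ) then 1 else 0

namespace StateSystem

variable (A : StateSystem ρ σ s)

/-- The vertices whose state lies in the dominating set. -/
def ins (f : Fin n → Fin s) : Finset (Fin n) := {u | A.inn (f u) = true}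

/-- The indicator of `Fits`. -/
def fitWeight (d : Fin s) (c : ℕ) : ℤ := if A.Fits d c then 1 else 0

/-- The contribution of the set `D` of chosen vertices among the completed vertices `F`, if the
other vertices have the states `f`, and only the edges `E` count. -/
noncomputable def term (F : Finset (Fin n)) (E : Fin n → Fin n → Prop) (f : Fin n → Fin s)
    (D : Finset (Fin n)) : ℤ :=
  ∏ v, if v ∈ F then domWeight ρ σ (decide (v ∈ D)) (degIn E (D ∪ A.ins f) v)
    else A.fitWeight (f v) (degIn E (D ∪ A.ins f) v)

/-- The number of choices of `κ` of the completed vertices `F` that fulfil the conditions on `F`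
and give the states `f` of the other vertices, if only the edges `E` count. -/
noncomputable def sem (F : Finset (Fin n)) (E : Fin n → Fin n → Prop) (f : Fin n → Fin s)
    (κ : ℕ) : ℤ :=
  ∑ D ∈ F.powerset, if #D = κ then A.term F E f D else 0

variable {A}

theorem mem_ins {f : Fin n → Fin s} {u : Fin n} : u ∈ A.ins f ↔ A.inn (f u) = true := by
  simp [ins]

theorem sem_empty (E : Fin n → Fin n → Prop) (f : Fin n → Fin s) (κ : ℕ) :
    A.sem ∅ E f κ =
      if κ = 0 ∧ ∀ u, A.Fits (f u) (degIn E (A.ins f) u) then 1 else 0 := by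
  simp only [sem, powerset_empty, sum_singleton, card_empty, term, notMem_empty, if_false,
    empty_union, fitWeight, prod_boole, mem_univ, true_imp_iff]
  by_cases h : κ = 0
  · simp [h]
  · simp [h, Ne.symm h]

/-- A table is only convolved up to its length, which exceeds the number of completed vertices; this
shows that the omitted sizes contribute nothing. -/
theorem sem_eq_zero {F : Finset (Fin n)} {κ : ℕ} (h : #F < κ) (E : Fin n → Fin n → Prop)
    (f : Fin n → Fin s) : A.sem F E f κ = 0 := by
  refine sum_eq_zero fun D hD => if_neg ?_
  have := card_le_card (mem_powerset.1 hD)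
  omega

/-- This is how the condition given by `ρ` or `σ` becomes linear in the states: a completed vertex
is a signed sum of vertices with states. -/
theorem sum_w_mul_fitWeight (β : Bool) (c : ℕ) :
    (∑ d, if A.inn d = β then A.w d * A.fitWeight d c else 0) = domWeight ρ σ β c := by
  rw [domWeight, ← A.sum_w β c]
  refine sum_congr rfl fun d _ => ?_
  simp only [fitWeight, Fits]
  split_ifs <;> simp_all

/-- Completing a vertex. -/
theorem sem_insert {F : Finset (Fin n)} {v : Fin n} (hv : v ∉ F) (E : Fin n → Fin n → Prop)
    {f : Fin n → Fin s} (hf : f v = A.zero) (κ : ℕ) :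
    A.sem (insert v F) E f κ = ∑ d, A.w d *
      (if A.inn d = true then (if κ = 0 then 0 else A.sem F E (Function.update f v d) (κ - 1))
        else A.sem F E (Function.update f v d) κ) := by
  have hins : ∀ d, A.ins (Function.update f v d) =
      if A.inn d = true then insert v (A.ins f) else A.ins f := by
    intro d
    ext u
    by_cases hu : u = v
    · subst hu
      by_cases hd : A.inn d = true <;> simp [mem_ins, hd, hf, A.inn_zero]
    · by_cases hd : A.inn d = true <;> simp [mem_ins, hd, hu]
  have hterm : ∀ d, ∀ D ⊆ F, A.term F E (Function.update f v d) D =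
      A.fitWeight d (degIn E (D ∪ A.ins (Function.update f v d)) v) *
      ∏ u ∈ univ.erase v, if u ∈ F then
        domWeight ρ σ (decide (u ∈ D)) (degIn E (D ∪ A.ins (Function.update f v d)) u)
        else A.fitWeight (f u) (degIn E (D ∪ A.ins (Function.update f v d)) u) := by
    intro d D _
    rw [term, ← mul_prod_erase _ _ (mem_univ v)]
    simp only [hv, if_false, Function.update_self]
    congr 1
    refine prod_congr rfl fun u hu => ?_
    rw [Function.update_of_ne (ne_of_mem_erase hu)]
  -- A subset of `insert v F` omits or contains `v`. In both cases the factor at `v` is an indicator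
  -- that `sum_w_mul_fitWeight` spreads over the states with the same membership; since the old
  -- state `zero` lies outside the set, the new state changes `ins` in the way described by `hins`.
  have hout : ∀ D ⊆ F, A.term (insert v F) E f D =
      ∑ d, if A.inn d = false then A.w d * A.term F E (Function.update f v d) D else 0 := by
    intro D hD
    have hvD : v ∉ D := fun h => hv (hD h)
    rw [term, ← mul_prod_erase _ _ (mem_univ v), if_pos (mem_insert_self _ _),
      ← sum_w_mul_fitWeight (A := A), sum_mul]
    refine sum_congr rfl fun d _ => ?_
    simp only [hvD, decide_false]
    by_cases hd : A.inn d = false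
    · rw [if_pos hd, if_pos hd, hterm d D hD, hins, if_neg (by simp [hd]), mul_assoc]
      congr 2
      refine prod_congr rfl fun u hu => ?_
      simp [ne_of_mem_erase hu]
    · rw [if_neg hd, if_neg hd, zero_mul]
  have hin : ∀ D ⊆ F, A.term (insert v F) E f (insert v D) =
      ∑ d, if A.inn d = true then A.w d * A.term F E (Function.update f v d) D else 0 := by
    intro D hD
    rw [term, ← mul_prod_erase _ _ (mem_univ v), if_pos (mem_insert_self _ _),
      ← sum_w_mul_fitWeight (A := A), sum_mul]
    refine sum_congr rfl fun d _ => ?_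
    simp only [mem_insert_self, decide_true]
    by_cases hd : A.inn d = true
    · rw [if_pos hd, if_pos hd, hterm d D hD, hins, if_pos hd, mul_assoc, insert_union,
        union_insert]
      congr 2
      refine prod_congr rfl fun u hu => ?_
      simp [ne_of_mem_erase hu]
    · rw [if_neg hd, if_neg hd, zero_mul]
  rw [sem, sum_powerset_insert hv]
  -- States outside the set match the subsets without `v`, states inside match the subsets with `v`.
  -- In the latter case the size grows by one, because only now `v` is counted.
  have h1 : ∀ d, A.w d *
      (if A.inn d = true then (if κ = 0 then 0 else A.sem F E (Function.update f v d) (κ - 1))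
        else A.sem F E (Function.update f v d) κ) =
      (∑ D ∈ F.powerset, if #D = κ then
        (if A.inn d = false then A.w d * A.term F E (Function.update f v d) D else 0) else 0) +
      ∑ D ∈ F.powerset, if #(insert v D) = κ then
        (if A.inn d = true then A.w d * A.term F E (Function.update f v d) D else 0) else 0 := by
    intro d
    by_cases hd : A.inn d = true
    · simp only [hd, if_true, Bool.true_eq_false, if_false, ite_self, sum_const_zero, zero_add]
      rcases κ with - | κ
      · simp
      · simp only [Nat.add_eq_zero_iff, one_ne_zero, and_false, if_false, Nat.add_sub_cancel, sem,
          mul_sum]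
        refine sum_congr rfl fun D hD => ?_
        rw [card_insert_of_notMem fun h => hv (mem_powerset.1 hD h)]
        simp
    · simp [hd, sem, mul_sum]
  simp only [h1, sum_add_distrib]
  congr 1
  · rw [sum_comm]
    refine sum_congr rfl fun D hD => ?_
    rw [hout D (mem_powerset.1 hD)]
    split_ifs <;> simp
  · rw [sum_comm]
    refine sum_congr rfl fun D hD => ?_
    rw [hin D (mem_powerset.1 hD)]
    split_ifs <;> simp

/-- Vertices without edges in `E` may be introduced. -/
theorem sem_restrict {F X : Finset (Fin n)} {E : Fin n → Fin n → Prop}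
    (hE : ∀ u v, E u v → (u ∈ F ∨ u ∈ X) ∧ (v ∈ F ∨ v ∈ X)) (f : Fin n → Fin s)
    (hf : ∀ v ∈ F, f v = A.zero) (κ : ℕ) :
    A.sem F E f κ = if ∀ v, v ∉ F → v ∉ X → A.Fits (f v) 0 then
      A.sem F E (fun v => if v ∈ X then f v else A.zero) κ else 0 := by
  set g : Fin n → Fin s := fun v => if v ∈ X then f v else A.zero with hg
  -- All neighbours along `E` lie in `F` or `X`. On `X` the state functions agree, and on `F` both
  -- of them put the vertex outside the set.
  have hdeg : ∀ D u, degIn E (D ∪ A.ins f) u = degIn E (D ∪ A.ins g) u := by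
    intro D u
    unfold degIn
    congr 1
    ext v
    simp only [mem_filter, mem_union, mem_ins, hg]
    constructor
    · rintro ⟨h1 | h1, h2⟩
      · exact ⟨Or.inl h1, h2⟩
      · have hvX : v ∈ X := (hE u v h2).2.resolve_left fun h => by
          rw [hf v h, A.inn_zero] at h1
          exact absurd h1 (by simp)
        exact ⟨Or.inr (by rwa [if_pos hvX]), h2⟩
    · rintro ⟨h1 | h1, h2⟩
      · exact ⟨Or.inl h1, h2⟩
      · refine ⟨Or.inr ?_, h2⟩
        by_contra hc
        split_ifs at h1
        · exact hc h1
        · rw [A.inn_zero] at h1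
          exact absurd h1 (by simp)
  -- A vertex outside `F` and `X` has no edges, so its factor only records whether its state allows
  -- the count 0.
  have hdeg0 : ∀ D u, u ∉ F → u ∉ X → degIn E D u = 0 := by
    intro D u h1 h2
    refine card_eq_zero.2 (filter_eq_empty_iff.2 fun v _ h => ?_)
    exact (hE u v h).1.elim h1 h2
  have hterm : ∀ D, A.term F E f D = if ∀ v, v ∉ F → v ∉ X → A.Fits (f v) 0 then
      A.term F E g D else 0 := by
    intro D
    split_ifs with h
    · refine prod_congr rfl fun v _ => ?_
      by_cases hvF : v ∈ F
      · simp only [hvF, if_true, hdeg]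
      · simp only [hvF, if_false, hdeg]
        by_cases hvX : v ∈ X
        · simp [hg, hvX]
        · have h2 : A.Fits (g v) 0 := by
            simp only [hg, hvX, if_false]
            exact fits_zero
          simp only [fitWeight, hdeg0 _ v hvF hvX, h v hvF hvX, h2]
    · push Not at h
      obtain ⟨v, h1, h2, h3⟩ := h
      refine prod_eq_zero (mem_univ v) ?_
      simp only [h1, if_false, fitWeight, hdeg0 _ v h1 h2, h3]
  simp only [sem, hterm]
  split_ifs <;> simp

/-- Two parts of the graph are put together. -/
theorem sem_union {F₁ F₂ : Finset (Fin n)} {E₁ E₂ : Fin n → Fin n → Prop} (hF : Disjoint F₁ F₂)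
    (hE₁ : ∀ u v, E₁ u v → u ∉ F₂ ∧ v ∉ F₂) (hE₂ : ∀ u v, E₂ u v → u ∉ F₁ ∧ v ∉ F₁)
    (hE : ∀ u v, E₁ u v → ¬ E₂ u v) {f : Fin n → Fin s} (hf : ∀ v, v ∈ F₁ ∪ F₂ → f v = A.zero)
    (κ : ℕ) :
    A.sem (F₁ ∪ F₂) (fun u v => E₁ u v ∨ E₂ u v) f κ =
      ∑ p ∈ antidiagonal κ, ∑ a, ∑ b, if ∀ v, A.Sums (a v) (b v) (f v) then
        A.sem F₁ E₁ a p.1 * A.sem F₂ E₂ b p.2 else 0 := by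
  -- A choice in the union corresponds to the pair of its intersections with `F₁` and `F₂`.
  have hbij : A.sem (F₁ ∪ F₂) (fun u v => E₁ u v ∨ E₂ u v) f κ =
      ∑ D₁ ∈ F₁.powerset, ∑ D₂ ∈ F₂.powerset, if #D₁ + #D₂ = κ then
        A.term (F₁ ∪ F₂) (fun u v => E₁ u v ∨ E₂ u v) f (D₁ ∪ D₂) else 0 := by
    rw [sem, ← sum_product']
    refine (sum_nbij' (fun p => p.1 ∪ p.2) (fun D => (D ∩ F₁, D ∩ F₂)) ?_ ?_ ?_ ?_ ?_).symm
    · rintro ⟨D₁, D₂⟩ h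
      simp only [mem_product, mem_powerset] at h ⊢
      exact union_subset_union h.1 h.2
    · intro D _
      simp only [mem_product, mem_powerset]
      exact ⟨inter_subset_right, inter_subset_right⟩
    · rintro ⟨D₁, D₂⟩ h
      simp only [mem_product, mem_powerset] at h
      have h1 : D₁ ∩ F₂ = ∅ := disjoint_iff_inter_eq_empty.1 (hF.mono_left h.1)
      have h2 : D₂ ∩ F₁ = ∅ := disjoint_iff_inter_eq_empty.1 (hF.symm.mono_left h.2)
      ext1
      · simp only [union_inter_distrib_right, h2, union_empty]
        exact inter_eq_left.2 h.1
      · simp only [union_inter_distrib_right, h1, empty_union]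
        exact inter_eq_left.2 h.2
    · intro D h
      simp only [mem_powerset] at h
      simp only [← inter_union_distrib_left]
      exact inter_eq_left.2 h
    · rintro ⟨D₁, D₂⟩ h
      simp only [mem_product, mem_powerset] at h
      rw [card_union_of_disjoint (hF.mono h.1 h.2)]
  have hterm : ∀ D₁ ⊆ F₁, ∀ D₂ ⊆ F₂,
      A.term (F₁ ∪ F₂) (fun u v => E₁ u v ∨ E₂ u v) f (D₁ ∪ D₂) =
      ∑ a, ∑ b, if ∀ v, A.Sums (a v) (b v) (f v) then
        A.term F₁ E₁ a D₁ * A.term F₂ E₂ b D₂ else 0 := by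
    intro D₁ h₁ D₂ h₂
    -- Degrees add up: no edge belongs to both parts, and the edges of each part avoid the completed
    -- vertices of the other one.
    have hdeg : ∀ u, degIn (fun u v => E₁ u v ∨ E₂ u v) (D₁ ∪ D₂ ∪ A.ins f) u =
        degIn E₁ (D₁ ∪ A.ins f) u + degIn E₂ (D₂ ∪ A.ins f) u := by
      intro u
      unfold degIn
      rw [← card_union_of_disjoint]
      · congr 1
        ext v
        simp only [mem_filter, mem_union]
        constructor
        · rintro ⟨(h | h) | h, h' | h'⟩
          · exact Or.inl ⟨Or.inl h, h'⟩
          · exact absurd (h₁ h) (hE₂ u v h').2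
          · exact absurd (h₂ h) (hE₁ u v h').2
          · exact Or.inr ⟨Or.inl h, h'⟩
          · exact Or.inl ⟨Or.inr h, h'⟩
          · exact Or.inr ⟨Or.inr h, h'⟩
        · tauto
      · rw [disjoint_left]
        intro v hv hv'
        exact hE u v (mem_filter.1 hv).2 (mem_filter.1 hv').2
    set φ₁ : Fin n → Fin s → ℤ := fun v x => if v ∈ F₁ then
      domWeight ρ σ (decide (v ∈ D₁)) (degIn E₁ (D₁ ∪ A.ins f) v)
      else A.fitWeight x (degIn E₁ (D₁ ∪ A.ins f) v) with hφ₁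
    set φ₂ : Fin n → Fin s → ℤ := fun v x => if v ∈ F₂ then
      domWeight ρ σ (decide (v ∈ D₂)) (degIn E₂ (D₂ ∪ A.ins f) v)
      else A.fitWeight x (degIn E₂ (D₂ ∪ A.ins f) v) with hφ₂
    have hsum : ∀ a b : Fin n → Fin s, (if ∀ v, A.Sums (a v) (b v) (f v) then
        A.term F₁ E₁ a D₁ * A.term F₂ E₂ b D₂ else 0) =
        ∏ v, if A.Sums (a v) (b v) (f v) then φ₁ v (a v) * φ₂ v (b v) else 0 := by
      intro a b
      split_ifs with h
      · have ha : A.ins a = A.ins f := by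
          ext v
          rw [mem_ins, mem_ins, (h v).1.1]
        have hb : A.ins b = A.ins f := by
          ext v
          rw [mem_ins, mem_ins, (h v).2.1.1]
        rw [term, term, ha, hb, ← prod_mul_distrib]
        exact prod_congr rfl fun v _ => by rw [if_pos (h v)]
      · push Not at h
        obtain ⟨v, hv⟩ := h
        exact (prod_eq_zero (mem_univ v) (if_neg hv)).symm
    simp only [hsum]
    -- By distributivity, the sum over all pairs of state functions of a product over the vertices
    -- is the product of the local sums, so the identity may be checked at each vertex.
    have hswap : (∑ a : Fin n → Fin s, ∑ b : Fin n → Fin s,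
        ∏ v, if A.Sums (a v) (b v) (f v) then φ₁ v (a v) * φ₂ v (b v) else 0) =
        ∏ v, ∑ x, ∑ y, if A.Sums x y (f v) then φ₁ v x * φ₂ v y else 0 := by
      rw [prod_univ_sum]
      refine sum_congr (by simp [Fintype.piFinset_univ]) fun a _ => ?_
      rw [prod_univ_sum]
      exact sum_congr (by simp [Fintype.piFinset_univ]) fun b _ => rfl
    rw [hswap, term]
    refine prod_congr rfl fun v _ => ?_
    rw [hdeg]
    -- At a completed vertex only `zero` with `zero` is possible, and the degree in the other part
    -- is 0. At every other vertex the claim is `fits_add`.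
    by_cases hv₁ : v ∈ F₁
    · have hv₂ : v ∉ F₂ := disjoint_left.1 hF hv₁
      have hvD : v ∉ D₂ := fun h => hv₂ (h₂ h)
      have hd0 : degIn E₂ (D₂ ∪ A.ins f) v = 0 :=
        card_eq_zero.2 (filter_eq_empty_iff.2 fun u _ h => (hE₂ v u h).1 hv₁)
      have hz := hf v (mem_union_left _ hv₁)
      simp only [hz, sums_zero, ite_and, if_true, hφ₁, hφ₂, hv₁, hv₂, if_false, mem_union, hvD,
        or_false, hd0, add_zero]
      simp [fitWeight, fits_zero]
    · by_cases hv₂ : v ∈ F₂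
      · have hvD : v ∉ D₁ := fun h => hv₁ (h₁ h)
        have hd0 : degIn E₁ (D₁ ∪ A.ins f) v = 0 :=
          card_eq_zero.2 (filter_eq_empty_iff.2 fun u _ h => (hE₁ v u h).1 hv₂)
        have hz := hf v (mem_union_right _ hv₂)
        simp only [hz, sums_zero, ite_and, if_true, hφ₁, hφ₂, hv₁, hv₂, if_false, mem_union, hvD,
          false_or, hd0, zero_add]
        simp [fitWeight, fits_zero]
      · simp only [hφ₁, hφ₂, hv₁, hv₂, mem_union, or_self, if_false]
        exact (fits_add (A := A) (f v) _ _).symm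
  rw [hbij]
  have hR : ∀ p : ℕ × ℕ, (∑ a, ∑ b, if ∀ v, A.Sums (a v) (b v) (f v) then
        A.sem F₁ E₁ a p.1 * A.sem F₂ E₂ b p.2 else 0) =
      ∑ D₁ ∈ F₁.powerset, ∑ D₂ ∈ F₂.powerset, if #D₁ = p.1 ∧ #D₂ = p.2 then
        ∑ a, ∑ b, (if ∀ v, A.Sums (a v) (b v) (f v) then
          A.term F₁ E₁ a D₁ * A.term F₂ E₂ b D₂ else 0) else 0 := by
    intro p
    have h1 : ∀ a b : Fin n → Fin s, (if ∀ v, A.Sums (a v) (b v) (f v) then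
        A.sem F₁ E₁ a p.1 * A.sem F₂ E₂ b p.2 else 0) =
        ∑ D₁ ∈ F₁.powerset, ∑ D₂ ∈ F₂.powerset, if #D₁ = p.1 ∧ #D₂ = p.2 then
        (if ∀ v, A.Sums (a v) (b v) (f v) then
          A.term F₁ E₁ a D₁ * A.term F₂ E₂ b D₂ else 0) else 0 := by
      intro a b
      split_ifs with h
      · rw [sem, sem, sum_mul_sum]
        refine sum_congr rfl fun D₁ _ => sum_congr rfl fun D₂ _ => ?_
        by_cases h1 : #D₁ = p.1 <;> by_cases h2 : #D₂ = p.2 <;> simp [h1, h2]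
      · simp
    simp only [h1]
    calc _ = ∑ a, ∑ D₁ ∈ F₁.powerset, ∑ D₂ ∈ F₂.powerset, ∑ b, if #D₁ = p.1 ∧ #D₂ = p.2 then
        (if ∀ v, A.Sums (a v) (b v) (f v) then
          A.term F₁ E₁ a D₁ * A.term F₂ E₂ b D₂ else 0) else 0 := by
          refine sum_congr rfl fun a _ => ?_
          rw [sum_comm]
          exact sum_congr rfl fun D₁ _ => sum_comm
      _ = _ := by
          rw [sum_comm]
          refine sum_congr rfl fun D₁ _ => ?_
          rw [sum_comm]
          refine sum_congr rfl fun D₂ _ => ?_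
          split_ifs <;> simp
  simp only [hR]
  conv_rhs => rw [sum_comm]
  refine sum_congr rfl fun D₁ hD₁ => ?_
  conv_rhs => rw [sum_comm]
  refine sum_congr rfl fun D₂ hD₂ => ?_
  rw [hterm D₁ (mem_powerset.1 hD₁) D₂ (mem_powerset.1 hD₂)]
  by_cases h : #D₁ + #D₂ = κ
  · rw [if_pos h, sum_eq_single (#D₁, #D₂)]
    · simp
    · rintro ⟨i, j⟩ - hne
      refine if_neg fun h' => hne ?_
      rw [h'.1, h'.2]
    · intro h'
      simp [h] at h'
  · rw [if_neg h]
    refine (sum_eq_zero fun p hp => if_neg fun h' => h ?_).symm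
    rw [h'.1, h'.2]
    exact mem_antidiagonal.1 hp

/-- If all vertices are completed, then the dominating sets are counted. -/
theorem sem_univ (G : SimpleGraph (Fin n)) (κ : ℕ) :
    A.sem univ G.Adj (fun _ => A.zero) κ = rhoSigmaCount ρ σ G κ := by
  have hins : A.ins (fun _ : Fin n => A.zero) = ∅ := by
    ext v
    simp [mem_ins, A.inn_zero]
  have hterm : ∀ D : Finset (Fin n), A.term univ G.Adj (fun _ => A.zero) D =
      if IsRhoSigmaDominating ρ σ G (D : Set (Fin n)) then 1 else 0 := by
    intro D
    have hdeg : ∀ v, (G.neighborSet v ∩ (D : Set (Fin n))).ncard = degIn G.Adj D v := by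
      intro v
      rw [degIn, ← Set.ncard_coe_finset]
      congr 1
      ext u
      simp [and_comm]
    simp only [term, mem_univ, if_true, hins, union_empty, domWeight, prod_boole, true_imp_iff]
    refine if_congr ?_ rfl rfl
    simp only [IsRhoSigmaDominating, hdeg, mem_coe]
    constructor
    · intro h
      exact ⟨fun v hv => by simpa [hv] using h v, fun v hv => by simpa [hv] using h v⟩
    · rintro ⟨h1, h2⟩ v
      by_cases hv : v ∈ D
      · simpa [hv] using h2 v hv
      · simpa [hv] using h1 v hv
  rw [sem, powerset_univ]
  simp only [hterm, ← ite_and]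
  rw [sum_boole, rhoSigmaCount, ← Set.ncard_coe_finset]
  congr 1
  refine Set.ncard_congr (fun D _ => (D : Set (Fin n))) ?_ ?_ ?_
  · intro D hD
    simp only [coe_filter, Set.mem_ofPred_eq] at hD
    exact ⟨hD.2.2, by rw [Set.ncard_coe_finset]; exact hD.2.1⟩
  · intro D D' _ _ h
    exact coe_injective h
  · intro D hD
    refine ⟨D.toFinset, ?_, by simp⟩
    simp only [coe_filter, Set.mem_ofPred_eq, mem_univ, true_and, Set.coe_toFinset]
    exact ⟨by rw [← Set.ncard_eq_toFinset_card']; exact hD.2, hD.1⟩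

end StateSystem

/-! ### Linear changes of the states -/

section Mix

variable {R : Type*} [CommRing R]

/-- Apply the matrix `K` to the states of the vertices in `Y`. -/
def mix (Y : Finset (Fin n)) (K : Matrix (Fin s) (Fin s) R) (Z : (Fin n → Fin s) → R)
    (f : Fin n → Fin s) : R :=
  ∑ a, (∏ v, if v ∈ Y then K (f v) (a v) else if a v = f v then 1 else 0) * Z a

theorem mix_empty (K : Matrix (Fin s) (Fin s) R) (Z : (Fin n → Fin s) → R) (f : Fin n → Fin s) :
    mix ∅ K Z f = Z f := by
  unfold mix
  rw [sum_eq_single f]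
  · simp
  · intro a _ ha
    obtain ⟨v, hv⟩ := Function.ne_iff.1 ha
    rw [prod_eq_zero (mem_univ v) (by simp [hv]), zero_mul]
  · simp

/-- The transformation is a tensor power of `K`, so it can be applied to one vertex after the other,
with `s` terms for each entry and vertex instead of `s ^ #Y` terms for each entry. -/
theorem mix_insert {Y : Finset (Fin n)} {v : Fin n} (hv : v ∉ Y) (K : Matrix (Fin s) (Fin s) R)
    (Z : (Fin n → Fin s) → R) (f : Fin n → Fin s) :
    mix (insert v Y) K Z f = ∑ d, K (f v) d * mix Y K Z (Function.update f v d) := by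
  simp only [mix, mul_sum]
  rw [sum_comm]
  refine sum_congr rfl fun a _ => ?_
  rw [sum_eq_single (a v)]
  · rw [← mul_assoc, ← mul_prod_erase _ _ (mem_univ v), ← mul_prod_erase _ _ (mem_univ v)]
    simp only [mem_insert_self, if_true, hv, if_false, Function.update_self, one_mul]
    congr 2
    refine prod_congr rfl fun u hu => ?_
    have := ne_of_mem_erase hu
    simp [this]
  · intro d _ hd
    rw [prod_eq_zero (mem_univ v) (by simp [hv, hd.symm]), zero_mul, mul_zero]
  · simp

/-- After expansion, the sum over the intermediate state functions is a product over the vertices by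
distributivity. The bilinear operation thus has structure constants that are products of local ones,
which for evaluation and interpolation are the numbers `coef`. -/
theorem mix_mul_mix (Y : Finset (Fin n)) (K K' : Matrix (Fin s) (Fin s) R)
    (Z₁ Z₂ : (Fin n → Fin s) → R) (f : Fin n → Fin s) :
    mix Y K' (fun g => mix Y K Z₁ g * mix Y K Z₂ g) f = ∑ a, ∑ b, Z₁ a * Z₂ b *
      ∏ v, if v ∈ Y then ∑ l, K' (f v) l * (K l (a v) * K l (b v))
        else if a v = f v ∧ b v = f v then 1 else 0 := by
  simp only [mix, sum_mul_sum]
  simp only [mul_sum]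
  rw [sum_comm]
  refine sum_congr rfl fun a _ => ?_
  rw [sum_comm]
  refine sum_congr rfl fun b _ => ?_
  have : ∀ v, (if v ∈ Y then ∑ l, K' (f v) l * (K l (a v) * K l (b v))
        else if a v = f v ∧ b v = f v then 1 else 0) =
      ∑ l, (if v ∈ Y then K' (f v) l else if l = f v then 1 else 0) *
        ((if v ∈ Y then K l (a v) else if a v = l then 1 else 0) *
        (if v ∈ Y then K l (b v) else if b v = l then 1 else 0)) := by
    intro v
    split_ifs with h1 h2
    · rfl
    · rw [sum_eq_single (f v)]
      · simp [h2]
      · intro l _ hl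
        simp [hl]
      · simp
    · rw [sum_eq_single (f v)]
      · by_cases h3 : a v = f v
        · have : b v ≠ f v := fun h => h2 ⟨h3, h⟩
          simp [this]
        · simp [h3]
      · intro l _ hl
        simp [hl]
      · simp
  simp only [this]
  rw [prod_univ_sum, mul_sum]
  refine sum_congr (by simp [Fintype.piFinset_univ]) fun g _ => ?_
  rw [prod_mul_distrib, prod_mul_distrib]
  ring

theorem mix_sum {ι : Type*} (I : Finset ι) (Y : Finset (Fin n)) (K : Matrix (Fin s) (Fin s) R)
    (Z : ι → (Fin n → Fin s) → R) (f : Fin n → Fin s) :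
    mix Y K (fun g => ∑ i ∈ I, Z i g) f = ∑ i ∈ I, mix Y K (Z i) f := by
  simp only [mix, mul_sum]
  exact sum_comm

namespace StateSystem

variable (A : StateSystem ρ σ s)

/-- The total number of neighbours in the states of all vertices. -/
def rank (f : Fin n → Fin s) : ℕ := ∑ v, A.cv (f v)

/-- The product of tables by evaluation and interpolation. -/
theorem mix_extract {q : R} (hq : q * A.scale = 1) (Y : Finset (Fin n))
    (Z₁ Z₂ : (Fin n → Fin s) → R) {f : Fin n → Fin s} (hf : ∀ v, v ∉ Y → f v = A.zero) :
    q ^ #Y * mix Y (A.invMatrix.map (Int.castRingHom R)) (fun g =>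
      ∑ p ∈ antidiagonal (A.rank f),
        mix Y (A.evalMatrix.map (Int.castRingHom R)) (fun a => if A.rank a = p.1 then Z₁ a else 0) g *
        mix Y (A.evalMatrix.map (Int.castRingHom R)) (fun a => if A.rank a = p.2 then Z₂ a else 0) g)
      f = ∑ a, ∑ b, if ∀ v, A.Sums (a v) (b v) (f v) then Z₁ a * Z₂ b else 0 := by
  rw [mix_sum]
  simp only [mix_mul_mix]
  rw [sum_comm, mul_sum]
  refine sum_congr rfl fun a _ => ?_
  rw [sum_comm, mul_sum]
  refine sum_congr rfl fun b _ => ?_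
  set H : Fin n → R := fun v => if v ∈ Y then ∑ l, (A.invMatrix.map (Int.castRingHom R)) (f v) l *
    ((A.evalMatrix.map (Int.castRingHom R)) l (a v) *
      (A.evalMatrix.map (Int.castRingHom R)) l (b v))
    else if a v = f v ∧ b v = f v then 1 else 0 with hH
  have hHY : ∀ v ∈ Y, H v = (A.coef (a v) (b v) (f v) : ℤ) := by
    intro v hv
    simp only [hH, hv, if_true, coef, Matrix.map_apply]
    push_cast
    rfl
  -- The indicators of the ranks of `a` and `b` select at most one pair of the antidiagonal.
  have hrank : (∑ p ∈ antidiagonal (A.rank f), (if A.rank a = p.1 then Z₁ a else 0) *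
      (if A.rank b = p.2 then Z₂ b else 0) * ∏ v, H v) =
      if A.rank a + A.rank b = A.rank f then Z₁ a * Z₂ b * ∏ v, H v else 0 := by
    split_ifs with h
    · rw [sum_eq_single (A.rank a, A.rank b)]
      · simp
      · rintro ⟨i, j⟩ - hne
        by_cases h1 : A.rank a = i
        · have : A.rank b ≠ j := fun h2 => hne (by rw [h1, h2])
          simp [this]
        · simp [h1]
      · simp [h]
    · refine sum_eq_zero fun p hp => ?_
      have hp := mem_antidiagonal.1 hp
      by_cases h1 : A.rank a = p.1
      · have : A.rank b ≠ p.2 := fun h2 => h (by rw [h1, h2, hp])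
        simp [this]
      · simp [h1]
  rw [hrank]
  by_cases hS : ∀ v, A.Sums (a v) (b v) (f v)
  · have h1 : A.rank a + A.rank b = A.rank f := by
      unfold rank
      rw [← sum_add_distrib]
      exact sum_congr rfl fun v _ => (hS v).2.2
    -- Every vertex of `Y` contributes the factor `scale`, which one factor `q` cancels; every other
    -- vertex contributes 1.
    have h2 : ∏ v, H v = (A.scale : R) ^ #Y := by
      rw [← prod_const, ← prod_subset (subset_univ Y)]
      · refine prod_congr rfl fun v hv => ?_
        rw [hHY v hv, A.coef_eq_of_cv_eq (hS v).2.2.symm, if_pos (hS v)]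
        simp
      · intro v _ hv
        have h3 := hS v
        rw [hf v hv, sums_zero] at h3
        simp [hH, hv, h3, hf v hv]
    rw [if_pos h1, if_pos hS, h2, mul_comm, mul_assoc, ← mul_pow, mul_comm _ q, hq, one_pow,
      mul_one]
  · rw [if_neg hS]
    by_cases h1 : A.rank a + A.rank b = A.rank f
    · rw [if_pos h1]
      suffices h : ∏ v, H v = 0 by rw [h, mul_zero, mul_zero]
      by_contra hne
      have hne' : ∀ v, H v ≠ 0 := fun v h => hne (prod_eq_zero (mem_univ v) h)
      -- The key step: if the product of the local constants is not zero, no vertex has a count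
      -- above the sum of the two counts. Equality of the total ranks then forces equality at every
      -- vertex, where `coef_eq_of_cv_eq` leaves only the desired terms, contrary to the assumption.
      have hle : ∀ v ∈ univ, A.cv (f v) ≤ A.cv (a v) + A.cv (b v) := by
        intro v _
        by_cases hv : v ∈ Y
        · refine A.cv_le_of_coef_ne_zero fun h => hne' v ?_
          rw [hHY v hv, h, Int.cast_zero]
        · simp [hf v hv, A.cv_zero]
      have heq : ∀ v ∈ univ, A.cv (f v) = A.cv (a v) + A.cv (b v) := by
        refine (sum_eq_sum_iff_of_le hle).1 ?_
        rw [sum_add_distrib]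
        exact h1.symm
      refine hS fun v => ?_
      by_cases hv : v ∈ Y
      · by_contra hc
        refine hne' v ?_
        rw [hHY v hv, A.coef_eq_of_cv_eq (heq v (mem_univ v)), if_neg hc, Int.cast_zero]
      · have := hne' v
        simp only [hH, hv, if_false] at this
        have h3 : a v = f v ∧ b v = f v := by
          by_contra hc
          rw [if_neg hc] at this
          exact this rfl
        rw [h3.1, h3.2, hf v hv, sums_zero]
        exact ⟨rfl, rfl⟩
    · rw [if_neg h1, mul_zero]

end StateSystem

end Mix

end PartialSolutions

/-! ### The state system of `[ρ, σ]`-domination and the size of its matrices -/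

section StateSystemOf

open Finset

open scoped Classical in
/-- The state `c` of a vertex whose number of neighbours has to belong to `τ` allows any number. -/
noncomputable def isStar (τ : Set ℕ) (c : ℕ) : Bool := decide (¬ τ.Finite ∧ c = lastIndex τ)

/-- The number of neighbours in state `c`. -/
noncomputable def stateCount (τ : Set ℕ) (c : ℕ) : ℕ := if isStar τ c then 0 else c

open scoped Classical in
/-- The weights with which the states express the membership in `τ`. -/
noncomputable def stateWeight (τ : Set ℕ) (c : ℕ) : ℤ :=
  if isStar τ c then 1 else if τ.Finite then if c ∈ τ then 1 else 0 else if c ∈ τ then 0 else -1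

theorem le_lastIndex {τ : Set ℕ} (h : τ.Finite) {c : ℕ} (hc : c ∈ τ) : c ≤ lastIndex τ := by
  rw [lastIndex, if_pos h]
  exact le_csSup h.bddAbove hc

theorem lt_lastIndex {τ : Set ℕ} (h : ¬ τ.Finite) (h' : τᶜ.Finite) {c : ℕ} (hc : c ∉ τ) :
    c < lastIndex τ := by
  rw [lastIndex, if_neg h]
  have : c + 1 ≤ sSup ((fun j => j + 1) '' τᶜ) := le_csSup (h'.image _).bddAbove ⟨c, hc, rfl⟩
  omega

/-- A finite set is the sum of the indicators of its elements, which are at most `lastIndex τ`. For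
a cofinite set, the last state allows every number and has weight 1, and each missing number, being
smaller than `lastIndex τ`, has a state of weight -1. -/
theorem sum_stateWeight {τ : Set ℕ} (h : τ.Finite ∨ τᶜ.Finite) (k : ℕ) [Decidable (k ∈ τ)] :
    (∑ c ∈ range (lastIndex τ + 1),
      if isStar τ c = true ∨ stateCount τ c = k then stateWeight τ c else 0) =
      if k ∈ τ then 1 else 0 := by
  classical
  by_cases hf : τ.Finite
  · have h1 : ∀ c, isStar τ c = false := fun c => by simp [isStar, hf]
    simp only [stateCount, stateWeight, h1, hf, Bool.false_eq_true, if_false, if_true, false_or]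
    rw [sum_ite_eq' (range (lastIndex τ + 1)) k]
    by_cases hk : k ∈ τ
    · have := le_lastIndex hf hk
      rw [if_pos (mem_range.2 (by omega))]
      simp [hk]
    · simp [hk]
  · have hc := h.resolve_left hf
    have h1 : ∀ c < lastIndex τ, isStar τ c = false := fun c hc => by simp [isStar, hc.ne]
    have h2 : isStar τ (lastIndex τ) = true := by simp [isStar, hf]
    rw [sum_range_succ, sum_congr rfl (g := fun c => if c = k then if k ∈ τ then 0 else -1 else 0)
      fun c hc => ?_, sum_ite_eq' (range (lastIndex τ)) k]
    · by_cases hk : k ∈ τ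
      · simp [h2, stateWeight, hk]
      · have := lt_lastIndex hf hc hk
        simp [h2, stateWeight, hk, this]
    · have := h1 c (mem_range.1 hc)
      simp only [stateCount, stateWeight, this, hf, Bool.false_eq_true, if_false, false_or]
      split_ifs <;> simp_all

variable {ρ σ : Set ℕ}

/-- The value of `f` at a state of the `[ρ, σ]`-domination problem. -/
noncomputable def stateValue {α : Type*} (ρ σ : Set ℕ) (f : Set ℕ → ℕ → α) (d : ℕ) : α :=
  if d ≤ lastIndex ρ then f ρ d else f σ (d - (lastIndex ρ + 1))

theorem stateCount_le (τ : Set ℕ) (c : ℕ) : stateCount τ c ≤ c := by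
  unfold stateCount
  split_ifs <;> omega

theorem stateCount_exists {τ : Set ℕ} {c k : ℕ} (hc : c ≤ lastIndex τ) (hk : k ≤ stateCount τ c) :
    ∃ e ≤ c, isStar τ e = isStar τ c ∧ stateCount τ e = k := by
  by_cases h : k = stateCount τ c
  · exact ⟨c, le_rfl, rfl, h.symm⟩
  · have hs : isStar τ c = false := by
      by_contra hs
      simp only [stateCount, Bool.not_eq_false] at hs hk h
      simp only [hs, if_true] at hk h
      omega
    simp only [stateCount, hs, Bool.false_eq_true, if_false] at hk h
    have hs' : isStar τ k = false := by
      have : k ≠ lastIndex τ := by omega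
      simp [isStar, this]
    exact ⟨k, hk, by rw [hs, hs'], by simp [stateCount, hs']⟩

theorem stateCount_inj {τ : Set ℕ} {c e : ℕ} (hs : isStar τ c = isStar τ e)
    (h : stateCount τ c = stateCount τ e) : c = e := by
  by_cases hc : isStar τ c = true
  · have he := hs ▸ hc
    simp only [isStar, decide_eq_true_eq] at hc he
    rw [hc.2, he.2]
  · have he := hs ▸ hc
    simpa [stateCount, hc, he] using h

/-- The states of the `[ρ, σ]`-domination problem. -/
noncomputable def StateSystem.of (hρ : ρ.Finite ∨ ρᶜ.Finite) (hσ : σ.Finite ∨ σᶜ.Finite) :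
    StateSystem ρ σ (numStates ρ σ) where
  inn d := decide (lastIndex ρ < d)
  star d := stateValue ρ σ isStar d
  cv d := stateValue ρ σ stateCount d
  w d := stateValue ρ σ stateWeight d
  zero := ⟨0, by unfold numStates; omega⟩
  zero_val := rfl
  inn_zero := by simp
  cv_zero := by simp [stateValue, stateCount]
  cv_of_star d h := by
    unfold stateValue at *
    split_ifs at * with hd <;> simp [stateCount, h]
  ext d e h1 h2 h3 := by
    rw [decide_eq_decide] at h1
    unfold stateValue at *
    ext
    by_cases hd : (d : ℕ) ≤ lastIndex ρ
    · have he : (e : ℕ) ≤ lastIndex ρ := by omega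
      rw [if_pos hd, if_pos he] at h2 h3
      exact stateCount_inj h2 h3
    · have he : ¬ (e : ℕ) ≤ lastIndex ρ := by omega
      rw [if_neg hd, if_neg he] at h2 h3
      have := stateCount_inj h2 h3
      omega
  exists_cv d c hc := by
    have hd' := d.2
    unfold numStates at hd'
    unfold stateValue at *
    by_cases hd : (d : ℕ) ≤ lastIndex ρ
    · rw [if_pos hd] at hc
      obtain ⟨e, he, h1, h2⟩ := stateCount_exists hd hc
      refine ⟨⟨e, he.trans_lt d.2⟩, ?_, ?_, ?_⟩
      · rw [decide_eq_decide]
        constructor <;> intro <;> simp only at * <;> omega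
      · simp [hd, he.trans hd, h1]
      · simp [he.trans hd, h2]
    · rw [if_neg hd] at hc
      obtain ⟨e, he, h1, h2⟩ := stateCount_exists (by omega) hc
      refine ⟨⟨lastIndex ρ + 1 + e, by unfold numStates; omega⟩, ?_, ?_, ?_⟩
      · rw [decide_eq_decide]
        constructor <;> intro <;> simp only at * <;> omega
      · simp only
        rw [if_neg (by omega), if_neg hd, Nat.add_sub_cancel_left, h1]
      · simp only
        rw [if_neg (by omega), Nat.add_sub_cancel_left, h2]
  cv_le d := by
    have hd' := d.2
    unfold numStates at *
    unfold stateValue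
    split_ifs with hd
    · have := stateCount_le ρ d
      omega
    · have := stateCount_le σ (d - (lastIndex ρ + 1))
      omega
  natAbs_w_le d := by
    unfold stateValue stateWeight
    split_ifs <;> simp
  sum_w β c _ := by
    classical
    rw [Fin.sum_univ_eq_sum_range (fun d => if decide (lastIndex ρ < d) = β ∧
      (stateValue ρ σ isStar d = true ∨ stateValue ρ σ stateCount d = c) then
        stateValue ρ σ stateWeight d else 0) (numStates ρ σ)]
    -- The first `lastIndex ρ + 1` states are those outside the set, the other `lastIndex σ + 1` are
    -- those inside, so the sum splits and only the part selected by `β` remains.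
    have hs : numStates ρ σ = (lastIndex ρ + 1) + (lastIndex σ + 1) := by unfold numStates; omega
    have h1 : ∀ d ∈ range (lastIndex ρ + 1), (if decide (lastIndex ρ < d) = β ∧
        (stateValue ρ σ isStar d = true ∨ stateValue ρ σ stateCount d = c) then
        stateValue ρ σ stateWeight d else 0) = if β = false then
        (if isStar ρ d = true ∨ stateCount ρ d = c then stateWeight ρ d else 0) else 0 := by
      intro d hd
      have h1 : d ≤ lastIndex ρ := by rw [mem_range] at hd; omega
      have h2 : ¬ lastIndex ρ < d := by omega
      cases β <;> simp [stateValue, h1, h2]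
    have h2 : ∀ d ∈ range (lastIndex σ + 1), (if decide (lastIndex ρ < lastIndex ρ + 1 + d) = β ∧
        (stateValue ρ σ isStar (lastIndex ρ + 1 + d) = true ∨
          stateValue ρ σ stateCount (lastIndex ρ + 1 + d) = c) then
        stateValue ρ σ stateWeight (lastIndex ρ + 1 + d) else 0) = if β = true then
        (if isStar σ d = true ∨ stateCount σ d = c then stateWeight σ d else 0) else 0 := by
      intro d hd
      have h1 : ¬ lastIndex ρ + 1 + d ≤ lastIndex ρ := by omega
      have h2 : lastIndex ρ < lastIndex ρ + 1 + d := by omega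
      simp only [stateValue, h1, if_false, Nat.add_sub_cancel_left]
      cases β <;> simp [h2]
    rw [hs, sum_range_add, sum_congr rfl h1, sum_congr rfl h2]
    cases β
    · simpa using sum_stateWeight hρ c
    · simpa using sum_stateWeight hσ c

variable {s : ℕ} (A : StateSystem ρ σ s)

/-- The number of bits of the matrix entries for `s` states. -/
def entryBits (s : ℕ) : ℕ := s * (s * s) + s * s + s + 1

/-- Entries of the evaluation matrix are at most `s ^ s`, hence at most `2 ^ (s * s)`. The Leibniz
formula then bounds determinants by `s ! * 2 ^ (s * s * s)`, and this covers the inverse as well,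
since a cofactor is the determinant of the matrix with one row replaced by a unit vector. -/
theorem StateSystem.entries_lt (hs : 2 ≤ s) (l d : Fin s) :
    (A.evalMatrix l d).natAbs < 2 ^ entryBits s ∧ (A.invMatrix l d).natAbs < 2 ^ entryBits s ∧
      A.scale < 2 ^ entryBits s := by
  have h2 : s < 2 ^ s := Nat.lt_two_pow_self
  have hent : ∀ l d, |A.evalMatrix l d| ≤ ((2 ^ (s * s) : ℕ) : ℤ) := by
    intro l d
    rw [StateSystem.evalMatrix]
    split_ifs
    · rw [abs_of_nonneg (by positivity)]
      have h3 := A.cv_le l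
      have h4 := A.cv_le d
      have : A.cv l ^ A.cv d ≤ 2 ^ (s * s) := by
        calc A.cv l ^ A.cv d ≤ (2 ^ s) ^ A.cv d := Nat.pow_le_pow_left (by omega) _
          _ ≤ (2 ^ s) ^ s := Nat.pow_le_pow_right (by positivity) (by omega)
          _ = 2 ^ (s * s) := by rw [← pow_mul]
      exact_mod_cast this
    · simp
  have hdet : ∀ Q : Matrix (Fin s) (Fin s) ℤ, (∀ l d, |Q l d| ≤ ((2 ^ (s * s) : ℕ) : ℤ)) →
      Q.det.natAbs < 2 ^ entryBits s := by
    intro Q hQ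
    have h3 := Matrix.det_le (abv := AbsoluteValue.abs) hQ
    simp only [AbsoluteValue.abs_apply, Fintype.card_fin, nsmul_eq_mul] at h3
    have h4 : Q.det.natAbs ≤ s.factorial * (2 ^ (s * s)) ^ s := by
      have : (Q.det.natAbs : ℤ) ≤ ((s.factorial * (2 ^ (s * s)) ^ s : ℕ) : ℤ) := by
        rw [Int.natCast_natAbs]
        exact_mod_cast h3
      exact_mod_cast this
    have h5 : s.factorial ≤ 2 ^ (s * s) :=
      (Nat.factorial_le_pow s).trans (by rw [pow_mul]; exact Nat.pow_le_pow_left h2.le s)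
    calc Q.det.natAbs ≤ 2 ^ (s * s) * (2 ^ (s * s)) ^ s := h4.trans (Nat.mul_le_mul_right _ h5)
      _ = 2 ^ (s * s + s * s * s) := by rw [← pow_mul, ← pow_add]
      _ < 2 ^ entryBits s := Nat.pow_lt_pow_right (by norm_num) (by unfold entryBits; ring_nf; omega)
  refine ⟨?_, ?_, hdet _ hent⟩
  · have h3 := hent l d
    rw [Int.abs_eq_natAbs] at h3
    have h4 : (A.evalMatrix l d).natAbs ≤ 2 ^ (s * s) := by exact_mod_cast h3
    exact h4.trans_lt (Nat.pow_lt_pow_right (by norm_num) (by unfold entryBits; omega))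
  · rw [StateSystem.invMatrix, Matrix.smul_apply, smul_eq_mul, Int.natAbs_mul,
      Int.natAbs_sign_of_ne_zero A.det_evalMatrix_ne_zero, one_mul, Matrix.adjugate_apply]
    refine hdet _ fun i j => ?_
    rw [Matrix.updateRow_apply]
    split_ifs
    · rw [Pi.single_apply]
      split_ifs
      · rw [abs_one]
        exact_mod_cast Nat.one_le_two_pow
      · simp
    · exact hent i j

end StateSystemOf

/-! ### Registers and memory banks of the program -/

namespace R
abbrev n : ℕ := 0
abbrev N : ℕ := 1
abbrev s : ℕ := 2
abbrev m : ℕ := 3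
abbrev W : ℕ := 4
abbrev L : ℕ := 5
abbrev LW : ℕ := 6
abbrev bits : ℕ := 7
abbrev sbits : ℕ := 8
abbrev top : ℕ := 9
abbrev u : ℕ := 10
abbrev mx : ℕ := 20
abbrev my : ℕ := 21
abbrev ml : ℕ := 22
abbrev macc : ℕ := 23
abbrev mi : ℕ := 24
abbrev ew : ℕ := 25
abbrev eq : ℕ := 26
abbrev ed : ℕ := 27
abbrev ei : ℕ := 28
abbrev pos : ℕ := 29
abbrev dw : ℕ := 30
abbrev lc : ℕ := 31
abbrev bz : ℕ := 32
abbrev bskip : ℕ := 33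
abbrev bq : ℕ := 34
abbrev br : ℕ := 35
abbrev bv : ℕ := 36
abbrev df : ℕ := 37
abbrev rem : ℕ := 38
abbrev di : ℕ := 39
abbrev dd : ℕ := 40
abbrev dj : ℕ := 41
abbrev tw : ℕ := 42
abbrev tq : ℕ := 43
abbrev ti : ℕ := 44
abbrev tacc : ℕ := 45
abbrev x : ℕ := 46
abbrev i : ℕ := 47
abbrev flag : ℕ := 48
abbrev a : ℕ := 49
abbrev b : ℕ := 50
abbrev cnt : ℕ := 51
abbrev y : ℕ := 52
abbrev last : ℕ := 53
abbrev px : ℕ := 54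
abbrev py : ℕ := 55
abbrev fx : ℕ := 56
abbrev fv : ℕ := 57
abbrev k : ℕ := 58
abbrev d : ℕ := 59
abbrev acc : ℕ := 60
abbrev sg : ℕ := 61
abbrev lz : ℕ := 62
abbrev ly : ℕ := 63
abbrev g : ℕ := 64
abbrev rk : ℕ := 65
abbrev gd : ℕ := 66
abbrev gi : ℕ := 67
abbrev l : ℕ := 68
abbrev xv : ℕ := 69
abbrev xq : ℕ := 70
abbrev xr : ℕ := 71
abbrev rr : ℕ := 72
abbrev lca : ℕ := 73
abbrev lcb : ℕ := 74
abbrev j : ℕ := 75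
abbrev pw : ℕ := 76
abbrev it : ℕ := 77
abbrev its : ℕ := 78
abbrev h : ℕ := 79
abbrev row : ℕ := 80
abbrev lenz : ℕ := 81
end R

namespace K
abbrev adjG : ℕ := 0
abbrev adjT : ℕ := 1
abbrev inc : ℕ := 2
abbrev out : ℕ := 3
abbrev pow2 : ℕ := 4
abbrev powS : ℕ := 5
abbrev mulN : ℕ := 6
abbrev mulNN : ℕ := 7
abbrev mulW : ℕ := 8
abbrev mulLW : ℕ := 9
abbrev mulS : ℕ := 10
abbrev fwdAbs : ℕ := 11
abbrev fwdSgn : ℕ := 12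
abbrev invAbs : ℕ := 13
abbrev invSgn : ℕ := 14
abbrev inn : ℕ := 15
abbrev cv : ℕ := 16
abbrev star : ℕ := 17
abbrev wAbs : ℕ := 18
abbrev wSgn : ℕ := 19
abbrev own : ℕ := 20
abbrev alive : ℕ := 21
abbrev len : ℕ := 22
abbrev tab : ℕ := 23
abbrev list : ℕ := 24
abbrev listA : ℕ := 25
abbrev listB : ℕ := 26
abbrev wA : ℕ := 27
abbrev wB : ℕ := 28
abbrev wC : ℕ := 29
abbrev tmp : ℕ := 30
abbrev dv : ℕ := 31
abbrev dig : ℕ := 32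
abbrev keep : ℕ := 33
end K

/-! ### Arithmetic modulo the number in register `R.m` -/

open Expr Prog in
/-- Reduce the number in register `r`. -/
def reduce (r : ℕ) : Prog := branch (lt (reg r) (reg R.m)) skip (assign r (sub (reg r) (reg R.m)))

open Expr Prog in
/-- Multiply the number in register `R.mx` by the number of `R.ml` bits in register `R.my`. -/
def mulMod : Prog :=
  assign R.macc (const 0) ;;
  forLoop R.mi R.ml
    (assign R.macc (add (reg R.macc) (reg R.macc)) ;;
    reduce R.macc ;;
    branch (lt (reg R.my) (load K.pow2 (sub (sub (reg R.ml) (const 1)) (reg R.mi)))) skip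
      (assign R.my (sub (reg R.my) (load K.pow2 (sub (sub (reg R.ml) (const 1)) (reg R.mi)))) ;;
      assign R.macc (add (reg R.macc) (reg R.mx)) ;;
      reduce R.macc))

section Arithmetic

variable {M : Machine} {B : ℕ} {S : Config} {m : ℕ}

theorem does_reduce (hB : 64 ≤ B) {r : ℕ} (hm : S.reg R.m = m)
    (hlt : S.reg r < 2 * m) {post : Config → Prop}
    (h : ∀ x, x < m → (x : ZMod m) = S.reg r → post (S.setReg r x)) :
    Does M B (reduce r) S 3 post := by
  refine (Does.branch hB rfl (fun hg => .skip ?_) (fun hg => .assign hB rfl ?_ ?_)).mono le_rfl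
  · have hlt' : S.reg r < m := by
      by_contra hc
      simp [Expr.eval, hm, hc] at hg
    simpa only [Config.setReg_eq_self] using h _ hlt' rfl
  · intro hS
    exact lt_of_le_of_lt (Nat.sub_le _ _) (hS.reg r)
  · have hlt' : m ≤ S.reg r := by
      by_contra hc
      simp [Expr.eval, hm, not_le.1 hc] at hg
    simp only [Expr.eval, hm]
    refine h _ (by omega) ?_
    rw [Nat.cast_sub hlt']
    simp

/-- Doubling and adding, starting from the leading bit: after `i` steps the accumulator is the
residue of `R.mx` times the number formed by the first `i` of the `l` bits, and `R.my` holds the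
remaining bits. Doubling a residue or adding `R.mx ≤ m` to it stays below `2 * m`, so one
subtraction suffices for the reduction. -/
theorem does_mulMod (hB : 64 ≤ B) (hm : S.reg R.m = m) (hm2 : 2 * m < 2 ^ B) {l : ℕ}
    (hl : S.reg R.ml = l) (hx : S.reg R.mx ≤ m) (hy : S.reg R.my < 2 ^ l)
    (hm0 : 0 < m) (hpow : ∀ j < l, S.mem K.pow2 j = 2 ^ j) :
    Does M B mulMod S (l * 20 + 3) fun S' =>
      S'.reg R.macc < m ∧ (S'.reg R.macc : ZMod m) = (S.reg R.mx : ZMod m) * S.reg R.my := by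
  refine (Does.seq (.assign hB rfl (fun _ => by simp [Expr.eval]) ?_)).mono (τ := 1 + (l * (18 + 2) + 2)) (by omega)
  refine Does.forLoop hB (fun i S' => S'.reg R.macc < m ∧ S'.reg R.my = S.reg R.my % 2 ^ (l - i) ∧
    (S'.reg R.macc : ZMod m) = (S.reg R.mx : ZMod m) * (S.reg R.my / 2 ^ (l - i) : ℕ))
    (by simpa using hl) rfl rfl (by decide) ?_ ?_ ?_
  · simp [hm0, Nat.mod_eq_of_lt hy, Nat.div_eq_of_lt hy, Expr.eval]
  · rintro i S' hi hf hxi ⟨h1, h2, h3⟩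
    have e1 : S'.reg R.m = m := by rw [hf.reg R.m rfl]; simpa using hm
    have e2 : S'.reg R.ml = l := by rw [hf.reg R.ml rfl]; simpa using hl
    have e3 : S'.reg R.mx = S.reg R.mx := by rw [hf.reg R.mx rfl]; simp
    have e4 : S'.mem K.pow2 (l - 1 - i) = 2 ^ (l - (i + 1)) := by
      rw [hf.mem K.pow2 rfl, Config.setReg_mem, hpow _ (by omega)]
      congr 1
      omega
    have hp : 2 ^ (l - i) = 2 ^ (l - (i + 1)) * 2 := by
      rw [← pow_succ]
      congr 1
      omega
    rw [hp] at h2 h3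
    have hpos : 0 < 2 ^ (l - (i + 1)) := by positivity
    set p := 2 ^ (l - (i + 1)) with hpdef
    set Y := S.reg R.my with hY
    -- The quotient `S'.reg R.my / p` is the next bit of the multiplier; it is 0 or 1 and is found
    -- by a comparison with `p`.
    have hdiv : Y / p = 2 * (Y / (p * 2)) + (S'.reg R.my) / p := by
      rw [h2, ← Nat.div_div_eq_div_mul, Nat.mod_mul_right_div_self]
      omega
    have hmod : S'.reg R.my % p = Y % p := by
      rw [h2]
      exact Nat.mod_mod_of_dvd _ (Dvd.intro _ rfl)
    have hlt : S'.reg R.my < p * 2 := by rw [h2]; exact Nat.mod_lt _ (by omega)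
    refine (Does.seq (.assign hB rfl ?_ ?_)).mono (τ := 1 + (3 + (1 + 1 + (1 + (1 + 3))))) (by norm_num)
    · simp only [Expr.eval]
      omega
    refine .seq (does_reduce (m := m) hB (by simpa using e1)
      (by simp [Expr.eval]; omega) ?_)
    intro x hx1 hx2
    refine .branch hB rfl (fun hg => .skip ?_) (fun hg => .seq (.assign hB rfl ?_ ?_))
    · have hlt' : S'.reg R.my < p := by
        by_contra hc
        simp [Expr.eval, e2, hxi, e4, hc] at hg
      simp only [Config.setReg_reg, OfNat.ofNat_eq_ofNat, Nat.reduceEqDiff, reduceIte, Expr.eval]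
        at hx2 ⊢
      rw [hx2, hdiv, ← hmod, Nat.mod_eq_of_lt hlt', Nat.div_eq_of_lt hlt']
      refine ⟨hx1, rfl, ?_⟩
      push_cast
      rw [h3]
      ring
    · intro hS
      exact lt_of_le_of_lt (Nat.sub_le _ _) (hS.reg _)
    · have hge : p ≤ S'.reg R.my := by
        by_contra hc
        simp [Expr.eval, e2, hxi, e4, not_le.1 hc] at hg
      have h1' : S'.reg R.my / p = 1 := Nat.div_eq_of_lt_le (by omega) (by omega)
      refine .seq (.assign hB rfl ?_ ?_)
      · simp [Expr.eval, e3]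
        omega
      · refine does_reduce (m := m) hB (by simpa using e1)
          (by simp [Expr.eval, e3]; omega) ?_
        intro z hz1 hz2
        simp only [Config.setReg_reg, Config.setReg_mem, OfNat.ofNat_eq_ofNat, Nat.reduceEqDiff,
          reduceIte, Expr.eval, e2, e3, hxi, e4] at hz2 hx2 ⊢
        rw [hz2, hdiv, ← hmod, h1']
        refine ⟨hz1, ?_, ?_⟩
        · rw [Nat.mod_eq_sub_mod hge, Nat.mod_eq_of_lt (by omega)]
        · push_cast
          rw [hx2]
          push_cast
          rw [h3]
          ring
  · rintro S' - - ⟨h1, -, h3⟩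
    simp only [Nat.sub_self, pow_zero, Nat.div_one] at h3
    exact ⟨h1, h3⟩

end Arithmetic

/-! ### Addresses -/

section Addresses

open Finset

variable {n s : ℕ}

/-- The number with the digits `f` in base `s`. -/
def code (f : Fin n → Fin s) : ℕ := ∑ v, (f v : ℕ) * s ^ (v : ℕ)

theorem code_lt (f : Fin n → Fin s) : code f < s ^ n := by
  rw [code, ← finFunctionFinEquiv_apply]
  exact Fin.is_lt _

theorem code_injective : Function.Injective (code : (Fin n → Fin s) → ℕ) := by
  intro f g h
  rw [code, code, ← finFunctionFinEquiv_apply, ← finFunctionFinEquiv_apply] at h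
  exact finFunctionFinEquiv.injective (Fin.ext h)

theorem code_div_mod (f : Fin n → Fin s) (v : Fin n) : code f / s ^ (v : ℕ) % s = f v := by
  have h := congrFun (finFunctionFinEquiv.symm_apply_apply f) v
  rw [← h]
  simp only [finFunctionFinEquiv, Equiv.ofRightInverseOfCardLE_symm_apply, code]
  rfl

theorem code_update (f : Fin n → Fin s) (v : Fin n) (d z : Fin s) (hz : (z : ℕ) = 0) :
    code (Function.update f v d) = code (Function.update f v z) + d * s ^ (v : ℕ) := by
  have h : ∀ e, code (Function.update f v e) =
      (e : ℕ) * s ^ (v : ℕ) + ∑ u ∈ univ.erase v, (f u : ℕ) * s ^ (u : ℕ) := by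
    intro e
    rw [code, ← add_sum_erase _ _ (mem_univ v), Function.update_self]
    congr 1
    refine sum_congr rfl fun u hu => ?_
    rw [Function.update_of_ne (ne_of_mem_erase hu)]
  rw [h, h z, hz]
  ring

/-- The address belonging to the states `f`, the size `κ` and the row `j`. -/
def addr (L : ℕ) (f : Fin n → Fin s) (κ j : ℕ) : ℕ := code f + κ * s ^ n + j * (L * s ^ n)

/-- An address is a number in mixed radix: the code is its remainder modulo `s ^ n`, and the size is
the next digit, in base `L`. The row is the leading part and needs no bound. -/
theorem addr_inj {L : ℕ} {f g : Fin n → Fin s} {κ κ' j j' : ℕ} (hκ : κ < L) (hκ' : κ' < L) :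
    addr L f κ j = addr L g κ' j' ↔ f = g ∧ κ = κ' ∧ j = j' := by
  refine ⟨fun h => ?_, by rintro ⟨rfl, rfl, rfl⟩; rfl⟩
  unfold addr at h
  have hf := code_lt f
  have hg := code_lt g
  have e : ∀ c κ j : ℕ, c + κ * s ^ n + j * (L * s ^ n) = c + s ^ n * (κ + L * j) :=
    fun c κ j => by ring
  rw [e, e] at h
  have h1 := congrArg (· % s ^ n) h
  simp only [Nat.add_mul_mod_self_left, Nat.mod_eq_of_lt hf, Nat.mod_eq_of_lt hg] at h1
  rw [h1, Nat.add_left_cancel_iff] at h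
  have h2 := Nat.eq_of_mul_eq_mul_left (by omega) h
  have h3 := congrArg (· % L) h2
  simp only [Nat.add_mul_mod_self_left, Nat.mod_eq_of_lt hκ, Nat.mod_eq_of_lt hκ'] at h3
  rw [h3, Nat.add_left_cancel_iff] at h2
  exact ⟨code_injective h1, h3, Nat.eq_of_mul_eq_mul_left (by omega) h2⟩

theorem addr_lt {L J : ℕ} {f : Fin n → Fin s} {κ j : ℕ} (hκ : κ < L) (hj : j < J) :
    addr L f κ j < s ^ n * (L * J) := by
  have hf := code_lt f
  have h1 : code f + κ * s ^ n < L * s ^ n := by nlinarith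
  calc addr L f κ j = (code f + κ * s ^ n) + j * (L * s ^ n) := rfl
    _ < (j + 1) * (L * s ^ n) := by rw [add_mul]; omega
    _ ≤ J * (L * s ^ n) := Nat.mul_le_mul_right _ hj
    _ = s ^ n * (L * J) := by ring

theorem addr_update {L : ℕ} (f : Fin n → Fin s) (v : Fin n) (d z : Fin s) (hz : (z : ℕ) = 0)
    (κ j : ℕ) : addr L (Function.update f v d) κ j =
      addr L (Function.update f v z) κ j + d * s ^ (v : ℕ) := by
  rw [addr, addr, code_update f v d z hz]
  ring

/-- All vertices outside `Y` have state `0`. -/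
def Off (Y : Finset (Fin n)) (f : Fin n → Fin s) : Prop := ∀ v ∉ Y, (f v : ℕ) = 0

instance (Y : Finset (Fin n)) (f : Fin n → Fin s) : Decidable (Off Y f) :=
  inferInstanceAs (Decidable (∀ _, _))

theorem Off.mono {Y Y' : Finset (Fin n)} {f : Fin n → Fin s} (h : Off Y f) (hY : Y ⊆ Y') :
    Off Y' f := fun v hv => h v fun h' => hv (hY h')

theorem Off.update {Y : Finset (Fin n)} {f : Fin n → Fin s} (h : Off Y f) {v : Fin n}
    (hv : v ∈ Y) (d : Fin s) : Off Y (Function.update f v d) := fun u hu => by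
  have : u ≠ v := fun h' => hu (h' ▸ hv)
  rw [Function.update_of_ne this]
  exact h u hu

theorem Off.update_erase {Y : Finset (Fin n)} {f : Fin n → Fin s} (h : Off Y f) (v : Fin n)
    {z : Fin s} (hz : (z : ℕ) = 0) : Off (Y.erase v) (Function.update f v z) := fun u hu => by
  by_cases huv : u = v
  · subst huv
    rwa [Function.update_self]
  · rw [Function.update_of_ne huv]
    exact h u fun h' => hu (mem_erase.2 ⟨huv, h'⟩)

/-- The addresses for states outside `Y` equal to `0`, sizes below `q` and rows below `r`. -/
def addrBox (s L : ℕ) (Y : Finset (Fin n)) (q r : ℕ) : Finset ℕ :=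
  image (fun p : (Fin n → Fin s) × ℕ × ℕ => addr L p.1 p.2.1 p.2.2)
    ((univ.filter fun f : Fin n → Fin s => Off Y f) ×ˢ range q ×ˢ range r)

theorem mem_addrBox {L : ℕ} {Y : Finset (Fin n)} {q r a : ℕ} :
    a ∈ addrBox s L Y q r ↔ ∃ f : Fin n → Fin s, Off Y f ∧ ∃ κ < q, ∃ j < r, addr L f κ j = a := by
  simp only [addrBox, mem_image, mem_product, mem_filter, mem_univ, true_and, mem_range, Prod.exists]
  constructor
  · rintro ⟨f, κ, j, ⟨h1, h2, h3⟩, h4⟩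
    exact ⟨f, h1, κ, h2, j, h3, h4⟩
  · rintro ⟨f, h1, κ, h2, j, h3, h4⟩
    exact ⟨f, κ, j, ⟨h1, h2, h3⟩, h4⟩

theorem card_off (hs : 0 < s) (Y : Finset (Fin n)) :
    #{f : Fin n → Fin s | Off Y f} = s ^ #Y := by
  have : ({f : Fin n → Fin s | Off Y f} : Finset _) =
      Fintype.piFinset fun v => if v ∈ Y then univ else {⟨0, hs⟩} := by
    ext f
    simp only [mem_filter, mem_univ, true_and, Fintype.mem_piFinset]
    unfold Off
    refine forall_congr' fun v => ?_
    by_cases hv : v ∈ Y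
    · simp [hv]
    · simp [hv, Fin.ext_iff]
  rw [this, Fintype.card_piFinset]
  have h : ∀ v : Fin n, #(if v ∈ Y then (univ : Finset (Fin s)) else {⟨0, hs⟩}) =
      if v ∈ Y then s else 1 := fun v => by split_ifs <;> simp
  simp only [h, prod_ite_mem, univ_inter, prod_const]

theorem card_addrBox (hs : 0 < s) {L : ℕ} (Y : Finset (Fin n)) {q : ℕ} (hq : q ≤ L) (r : ℕ) :
    #(addrBox s L Y q r) = s ^ #Y * q * r := by
  rw [addrBox, card_image_of_injOn, card_product, card_product, card_off hs, card_range, card_range,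
    mul_assoc]
  rintro ⟨f, κ, j⟩ h ⟨f', κ', j'⟩ h' e
  simp only [coe_product, Set.mem_prod, coe_range, Set.mem_Iio] at h h'
  obtain ⟨rfl, rfl, rfl⟩ := (addr_inj (h.2.1.trans_le hq) (h'.2.1.trans_le hq)).1 e
  rfl

theorem addrBox_lt {L J : ℕ} {Y : Finset (Fin n)} {q r a : ℕ} (hq : q ≤ L) (hr : r ≤ J)
    (h : a ∈ addrBox s L Y q r) : a < s ^ n * (L * J) := by
  obtain ⟨f, -, κ, hκ, j, hj, rfl⟩ := mem_addrBox.1 h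
  exact addr_lt (hκ.trans_le hq) (hj.trans_le hr)

/-- This lemma and the next two mirror the uses of `extend` in `build`: the box grows by a vertex,
by the sizes and by the rows, each time by adding the multiples of a fixed stride. -/
theorem addrBox_insert {L : ℕ} {Y : Finset (Fin n)} {v : Fin n} (hv : v ∉ Y) :
    addrBox s L (insert v Y) 1 1 =
      (addrBox s L Y 1 1 ×ˢ range s).image fun p => p.1 + p.2 * s ^ (v : ℕ) := by
  ext a
  simp only [mem_addrBox, mem_image, mem_product, mem_range, Prod.exists, Nat.lt_one_iff,
    exists_eq_left]
  constructor
  · rintro ⟨f, hf, rfl⟩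
    have hs : 0 < s := Fin.pos (f v)
    refine ⟨_, f v, ⟨⟨Function.update f v ⟨0, hs⟩, ?_, rfl⟩, (f v).2⟩, ?_⟩
    · have := hf.update_erase v (z := ⟨0, hs⟩) rfl
      rwa [erase_insert hv] at this
    · rw [← addr_update f v (f v) ⟨0, hs⟩ rfl, Function.update_eq_self]
  · rintro ⟨_, d, ⟨⟨f, hf, rfl⟩, hd⟩, rfl⟩
    have hs : 0 < s := by omega
    refine ⟨Function.update f v ⟨d, hd⟩,
      (hf.mono (subset_insert v Y)).update (mem_insert_self v Y) _, ?_⟩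
    rw [addr_update f v ⟨d, hd⟩ (f v) (hf v hv), Function.update_eq_self]

theorem addrBox_sizes {L : ℕ} {Y : Finset (Fin n)} (q : ℕ) :
    addrBox s L Y q 1 = (addrBox s L Y 1 1 ×ˢ range q).image fun p => p.1 + p.2 * s ^ n := by
  ext a
  simp only [mem_addrBox, mem_image, mem_product, mem_range, Prod.exists, Nat.lt_one_iff,
    exists_eq_left]
  constructor
  · rintro ⟨f, hf, κ, hκ, rfl⟩
    exact ⟨_, κ, ⟨⟨f, hf, rfl⟩, hκ⟩, by simp [addr]⟩
  · rintro ⟨_, κ, ⟨⟨f, hf, rfl⟩, hκ⟩, rfl⟩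
    exact ⟨f, hf, κ, hκ, by simp [addr]⟩

theorem addrBox_rows {L : ℕ} {Y : Finset (Fin n)} (q r : ℕ) :
    addrBox s L Y q r = (addrBox s L Y q 1 ×ˢ range r).image fun p => p.1 + p.2 * (L * s ^ n) := by
  ext a
  simp only [mem_addrBox, mem_image, mem_product, mem_range, Prod.exists, Nat.lt_one_iff,
    exists_eq_left]
  constructor
  · rintro ⟨f, hf, κ, hκ, j, hj, rfl⟩
    exact ⟨_, j, ⟨⟨f, hf, κ, hκ, rfl⟩, hj⟩, by simp [addr]⟩
  · rintro ⟨_, j, ⟨⟨f, hf, κ, hκ, rfl⟩, hj⟩, rfl⟩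
    exact ⟨f, hf, κ, hκ, j, hj, by simp [addr]⟩

theorem addrBox_empty {L : ℕ} (hs : 0 < s) : addrBox s L (∅ : Finset (Fin n)) 1 1 = {0} := by
  ext a
  simp only [mem_addrBox, Nat.lt_one_iff, exists_eq_left, mem_singleton]
  have h0 : ∀ f : Fin n → Fin s, Off ∅ f → addr L f 0 0 = 0 := by
    intro f hf
    simp [addr, code, hf _ (notMem_empty _)]
  constructor
  · rintro ⟨f, hf, rfl⟩
    exact h0 f hf
  · rintro rfl
    exact ⟨fun _ => ⟨0, hs⟩, fun _ _ => rfl, h0 _ fun _ _ => rfl⟩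

end Addresses

/-! ### The constant part of the memory -/

/-- Bounds on the numbers in the memory. -/
structure Limits (B n N s L J m lb ls : ℕ) : Prop where
  le_B : 64 ≤ B
  n_pos : 0 < n
  N_pos : 0 < N
  two_le : 2 ≤ s
  -- The lengths of all tables together never exceed `n + N`, so every size that occurs is below
  -- `L`.
  lt_L : n + N < L
  -- Rows are indexed by the nodes in `K.tab` and by the ranks in the work banks. A product of two
  -- tables may have twice as many ranks as its factors, hence the factor 2.
  le_J : N + 2 * (n * (s - 2) + 1) ≤ J
  two_m : 2 * m < 2 ^ B
  one_lt_m : 1 < m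
  cells : 4 * (s ^ n * (L * J)) < 2 ^ B
  m_lt : m < 2 ^ lb
  ls_pos : 0 < ls
  ls_le : ls ≤ lb

namespace Limits

variable {B n N s L J m lb ls : ℕ} (h : Limits B n N s L J m lb ls)

include h

theorem pow_pos : 0 < s ^ n := Nat.pow_pos (by have := h.two_le; omega)

theorem J_pos : 0 < J := by have := h.le_J; have := h.N_pos; omega

theorem L_pos : 0 < L := by have := h.lt_L; omega

theorem L_lt : 4 * L < 2 ^ B := by
  have h1 := h.cells
  have h2 := h.pow_pos
  have h3 := h.J_pos
  have : L ≤ s ^ n * (L * J) := by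
    calc L = 1 * (L * 1) := by ring
      _ ≤ s ^ n * (L * J) := Nat.mul_le_mul h2 (Nat.mul_le_mul le_rfl h3)
  omega

theorem J_lt : 4 * J < 2 ^ B := by
  have h1 := h.cells
  have h2 := h.pow_pos
  have h3 := h.L_pos
  have : J ≤ s ^ n * (L * J) := by
    calc J = 1 * (1 * J) := by ring
      _ ≤ s ^ n * (L * J) := Nat.mul_le_mul h2 (Nat.mul_le_mul h3 le_rfl)
  omega

theorem pow_lt : 4 * s ^ n < 2 ^ B := by
  have h1 := h.cells
  have h2 := h.L_pos
  have h3 := h.J_pos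
  have : s ^ n ≤ s ^ n * (L * J) := Nat.le_mul_of_pos_right _ (Nat.mul_pos h2 h3)
  omega

theorem s_le : s ≤ s ^ n := Nat.le_self_pow h.n_pos.ne' s

end Limits

section Memory

variable {ρ σ : Set ℕ} {s n N : ℕ}

/-- The constant registers and memory banks after the initialization; `home u v` is a node whose bag
contains the adjacent vertices `u` and `v`. -/
structure Env (A : StateSystem ρ σ s) (G : SimpleGraph (Fin n)) (T : TreeDecomposition G (Fin N))
    (home : Fin n → Fin n → Fin N) (L J m lb ls : ℕ) (S : Config) : Prop where
  n_eq : S.reg R.n = n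
  N_eq : S.reg R.N = N
  s_eq : S.reg R.s = s
  m_eq : S.reg R.m = m
  W_eq : S.reg R.W = s ^ n
  L_eq : S.reg R.L = L
  LW_eq : S.reg R.LW = L * s ^ n
  bits_eq : S.reg R.bits = lb
  sbits_eq : S.reg R.sbits = ls
  top_eq : S.reg R.top = s - 2
  u_lt : S.reg R.u < m
  u_mul : (S.reg R.u : ZMod m) * A.scale = 1
  adjG : ∀ u v : Fin n, (S.mem K.adjG (u * n + v) ≠ 0) ↔ G.Adj u v
  adjT : ∀ x y : Fin N, (S.mem K.adjT (x * N + y) ≠ 0) ↔ T.tree.Adj x y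
  pow2 : ∀ j < lb, S.mem K.pow2 j = 2 ^ j
  powS : ∀ v < n, S.mem K.powS v = s ^ v
  mulN : ∀ v < n + N, S.mem K.mulN v = v * n
  mulNN : ∀ x < N, S.mem K.mulNN x = x * N
  mulW : ∀ κ < L, S.mem K.mulW κ = κ * s ^ n
  mulLW : ∀ j < J, S.mem K.mulLW j = j * (L * s ^ n)
  mulS : ∀ d < s, S.mem K.mulS d = d * s
  fwdAbs : ∀ l d : Fin s, S.mem K.fwdAbs (l * s + d) = (A.evalMatrix l d).natAbs
  fwdSgn : ∀ l d : Fin s, (S.mem K.fwdSgn (l * s + d) ≠ 0) ↔ A.evalMatrix l d < 0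
  fwd_lt : ∀ l d : Fin s, (A.evalMatrix l d).natAbs < 2 ^ ls
  invAbs : ∀ l d : Fin s, S.mem K.invAbs (l * s + d) = (A.invMatrix l d).natAbs
  invSgn : ∀ l d : Fin s, (S.mem K.invSgn (l * s + d) ≠ 0) ↔ A.invMatrix l d < 0
  inv_lt : ∀ l d : Fin s, (A.invMatrix l d).natAbs < 2 ^ ls
  inn : ∀ d : Fin s, S.mem K.inn d = if A.inn d = true then 1 else 0
  cv : ∀ d : Fin s, S.mem K.cv d = A.cv d
  star : ∀ d : Fin s, (S.mem K.star d ≠ 0) ↔ A.star d = true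
  wAbs : ∀ d : Fin s, S.mem K.wAbs d = (A.w d).natAbs
  wSgn : ∀ d : Fin s, (S.mem K.wSgn d ≠ 0) ↔ A.w d < 0
  own : ∀ u v : Fin n, S.mem K.own (u * n + v) = home u v

/-- The program does not write into the constant part of the memory. -/
def Prog.keepsEnv (P : Prog) : Bool :=
  ((List.range 11).all fun y => !P.writesReg y) &&
    ([0, 1, 4, 5, 6, 7, 8, 9, 10, 11, 12, 13, 14, 15, 16, 17, 18, 19, 20].all
      fun b => !P.writesMem b)

variable {A : StateSystem ρ σ s} {G : SimpleGraph (Fin n)} {T : TreeDecomposition G (Fin N)}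
  {home : Fin n → Fin n → Fin N} {L J m lb ls : ℕ} {S S' : Config}

theorem Env.congr (h : Env A G T home L J m lb ls S) (hr : ∀ y < 11, S'.reg y = S.reg y)
    (hm : ∀ b ∈ [0, 1, 4, 5, 6, 7, 8, 9, 10, 11, 12, 13, 14, 15, 16, 17, 18, 19, 20],
      S'.mem b = S.mem b) : Env A G T home L J m lb ls S' := by
  constructor
  all_goals try first | rw [hr _ (by decide)] | rw [hm _ (by decide)]
  exacts [h.n_eq, h.N_eq, h.s_eq, h.m_eq, h.W_eq, h.L_eq, h.LW_eq, h.bits_eq, h.sbits_eq, h.top_eq,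
    h.u_lt, h.u_mul, h.adjG, h.adjT, h.pow2, h.powS, h.mulN, h.mulNN, h.mulW, h.mulLW, h.mulS,
    h.fwdAbs, h.fwdSgn, h.fwd_lt, h.invAbs, h.invSgn, h.inv_lt, h.inn, h.cv, h.star, h.wAbs, h.wSgn,
    h.own]

theorem Env.frame (h : Env A G T home L J m lb ls S) {P : Prog} (hf : P.Frame S S')
    (hP : P.keepsEnv = true) : Env A G T home L J m lb ls S' := by
  simp only [Prog.keepsEnv, Bool.and_eq_true, List.all_eq_true, List.mem_range,
    Bool.not_eq_true'] at hP
  exact h.congr (fun y hy => hf.reg y (hP.1 y hy)) (fun b hb => hf.mem b (hP.2 b hb))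

theorem Env.setReg (h : Env A G T home L J m lb ls S) {x : ℕ} (hx : 11 ≤ x) (v : ℕ) :
    Env A G T home L J m lb ls (S.setReg x v) :=
  h.congr (fun y hy => by rw [Config.setReg_reg, if_neg (by omega)]) fun _ _ => rfl

theorem Env.setMem (h : Env A G T home L J m lb ls S) {a : ℕ}
    (ha : a ∉ [0, 1, 4, 5, 6, 7, 8, 9, 10, 11, 12, 13, 14, 15, 16, 17, 18, 19, 20]) (i v : ℕ) :
    Env A G T home L J m lb ls (S.setMem a i v) :=
  h.congr (fun _ _ => rfl) fun _ hb => Config.setMem_mem_ne _ _ _ _ _ fun h' => ha (h' ▸ hb)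

/-- The incidence matrix of the bags. -/
def Bags (S : Config) (bag : Fin N → Finset (Fin n)) : Prop :=
  ∀ (x : Fin N) (v : Fin n), (S.mem K.inc (x * n + v) ≠ 0) ↔ v ∈ bag x

end Memory

/-! ### Enumerates of addresses -/

/-- The first `cnt` entries of the bank `b` run over the elements of `E`, without repetitions. -/
structure Enumerates (S : Config) (b cnt : ℕ) (E : Finset ℕ) : Prop where
  image : (Finset.range cnt).image (S.mem b) = E
  card : cnt = E.card

theorem Enumerates.mem {S : Config} {b cnt : ℕ} {E : Finset ℕ} (h : Enumerates S b cnt E) {i : ℕ}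
    (hi : i < cnt) : S.mem b i ∈ E := by
  rw [← h.image]
  exact Finset.mem_image_of_mem _ (Finset.mem_range.2 hi)

theorem Enumerates.inj {S : Config} {b cnt : ℕ} {E : Finset ℕ} (h : Enumerates S b cnt E) {i j : ℕ}
    (hi : i < cnt) (hj : j < cnt) (he : S.mem b i = S.mem b j) : i = j := by
  have : Set.InjOn (S.mem b) (Finset.range cnt : Finset ℕ) := by
    rw [← Finset.card_image_iff, h.image, ← h.card, Finset.card_range]
  exact this (by simpa using hi) (by simpa using hj) he

theorem Enumerates.congr {S S' : Config} {b cnt : ℕ} {E : Finset ℕ} (h : Enumerates S b cnt E)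
    (he : S'.mem b = S.mem b) : Enumerates S' b cnt E := ⟨by rw [he, h.image], h.card⟩

namespace Does

variable {M : Machine} {B : ℕ} {P : Prog} {S : Config} {τ : ℕ} {post : Config → Prop}

/-- The rule for loops over the entries of a list. -/
theorem forEach (hB : 64 ≤ B) {x y b cnt : ℕ} {E : Finset ℕ} (Inv : Finset ℕ → Config → Prop)
    (hy : S.reg y = cnt) (hE : Enumerates S b cnt E)
    (hx : P.writesReg x = false) (hyP : P.writesReg y = false) (hxy : x ≠ y)
    (hb : P.writesMem b = false)
    (hset : ∀ D S' v, Inv D S' → Inv D (S'.setReg x v))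
    (h0 : Inv ∅ S)
    (hstep : ∀ a ∈ E, ∀ D ⊆ E, a ∉ D → ∀ S', (Prog.forLoop x y P).Frame S S' →
      S'.mem b (S'.reg x) = a → Inv D S' → Does M B P S' τ (Inv (insert a D)))
    (hpost : ∀ S', (Prog.forLoop x y P).Frame S S' → Inv E S' → post S') :
    Does M B (Prog.forLoop x y P) S (cnt * (τ + 2) + 2) post := by
  have hb' : (Prog.forLoop x y P).writesMem b = false := by
    simp [Prog.forLoop, Prog.writesMem, hb]
  refine Does.forLoop hB (fun i S' => Inv ((Finset.range i).image (S.mem b)) S') hy hx hyP hxy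
    (by simpa using hset _ _ _ h0) (fun i S' hi hf hxi hI => ?_) (fun S' hf _ hI => ?_)
  · have hsub : (Finset.range i).image (S.mem b) ⊆ E := by
      rw [← hE.image]
      exact Finset.image_subset_image (Finset.range_subset_range.2 hi.le)
    refine (hstep (S.mem b i) (hE.mem hi) _ hsub ?_ S' hf ?_ hI).conseq fun S'' _ _ h => ?_
    · rw [Finset.mem_image]
      rintro ⟨j, hj, he⟩
      rw [Finset.mem_range] at hj
      exact hj.ne (hE.inj (hj.trans hi) hi he)
    · rw [hf.mem b hb', hxi]
    · rw [Finset.range_add_one, Finset.image_insert]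
      exact hset _ _ _ h
  · rw [hE.image] at hI
    exact hpost S' hf hI

end Does

open Expr Prog in
/-- Add `0, w, …, (q - 1) * w` to the entries of the list, for `w` and `q` in the registers `R.ew`
and `R.eq`. -/
def extend : Prog :=
  assign R.pos (const 0) ;;
  assign R.dw (const 0) ;;
  forLoop R.ed R.eq
    (forLoop R.ei R.lc
      (store K.list (reg R.pos) (add (load K.list (reg R.ei)) (reg R.dw)) ;;
      assign R.pos (add (reg R.pos) (const 1))) ;;
    assign R.dw (add (reg R.dw) (reg R.ew))) ;;
  assign R.lc (reg R.pos)

/-- The hypothesis `hcard` expresses that the new entries are pairwise distinct; it will come from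
the cardinality of the address boxes. -/
theorem does_extend {M : Machine} {B : ℕ} {S : Config} (hB : 64 ≤ B) {E : Finset ℕ} {cnt w q b : ℕ}
    (hE : Enumerates S K.list cnt E) (hcnt : S.reg R.lc = cnt) (hw : S.reg R.ew = w)
    (hq : S.reg R.eq = q) (hlt : ∀ a ∈ E, a < b) (hb : b + q * w < 2 ^ B)
    (hcard : ((E ×ˢ Finset.range q).image fun p => p.1 + p.2 * w).card = cnt * q)
    (hcq : cnt * q < 2 ^ B) :
    Does M B extend S (q * (cnt * 4 + 5) + 5) fun S' => S'.reg R.lc = cnt * q ∧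
      Enumerates S' K.list (cnt * q) ((E ×ˢ Finset.range q).image fun p => p.1 + p.2 * w) := by
  refine (Does.seq (.assign hB rfl (by simp [Expr.eval]) (.seq (.assign hB rfl
    (by simp [Expr.eval]) (.seq ?_))))).mono (τ := 1 + (1 + ((q * (((cnt * (1 + 1 + 2) + 2) + 1) + 2) + 2)
      + 1))) (by ring_nf; omega)
  refine Does.forLoop hB (fun d S' => S'.reg R.pos = d * cnt ∧ S'.reg R.dw = d * w ∧
    (∀ i < cnt, S'.mem K.list i = S.mem K.list i) ∧
    ∀ e < d, ∀ i < cnt, S'.mem K.list (e * cnt + i) = S.mem K.list i + e * w)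
    (by simpa using hq) rfl rfl (by decide) ?_ ?_ ?_
  · simp [Expr.eval]
  · rintro d S₁ hd hf₁ hxd ⟨h1, h2, h3, h4⟩
    have e1 : S₁.reg R.lc = cnt := by rw [hf₁.reg _ rfl]; simpa using hcnt
    have e2 : S₁.reg R.ew = w := by rw [hf₁.reg _ rfl]; simpa using hw
    have hdw : (d + 1) * w ≤ q * w := Nat.mul_le_mul_right _ hd
    have hdc : (d + 1) * cnt ≤ cnt * q := by
      rw [mul_comm]
      exact Nat.mul_le_mul_left _ hd
    have hdw' : d * w + w = (d + 1) * w := by ring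
    have hdc' : d * cnt + cnt = (d + 1) * cnt := by ring
    refine .seq (τ := cnt * (1 + 1 + 2) + 2) (τ' := 1) (Does.forLoop (τ := 1 + 1) hB (fun i S' => S'.reg R.pos = d * cnt + i ∧ S'.reg R.dw = d * w ∧
      (∀ i < cnt, S'.mem K.list i = S.mem K.list i) ∧
      (∀ e < d, ∀ i < cnt, S'.mem K.list (e * cnt + i) = S.mem K.list i + e * w) ∧
      ∀ j < i, S'.mem K.list (d * cnt + j) = S.mem K.list j + d * w) e1 rfl rfl (by decide) ?_ ?_ ?_)
    · simp only [Config.setReg_reg, Config.setReg_mem, OfNat.ofNat_eq_ofNat, Nat.reduceEqDiff,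
        reduceIte]
      exact ⟨by omega, h2, h3, h4, by simp⟩
    · rintro i S₂ hi hf₂ hxi ⟨g1, g2, g3, g4, g5⟩
      have hval : Expr.eval S₂ ((Expr.load K.list (.reg R.ei)).add (.reg R.dw)) =
          S.mem K.list i + d * w := by
        simp [Expr.eval, hxi, g2, g3 i hi]
      refine .seq (.store hB rfl rfl (fun _ => ?_) (.assign hB rfl ?_ ?_))
      · rw [hval]
        have := hlt _ (hE.mem hi)
        omega
      · simp only [Expr.eval, Config.setMem_reg, g1]
        omega
      · rw [hval]
        simp only [Config.setReg_reg, Config.setReg_mem, Config.setMem_reg, OfNat.ofNat_eq_ofNat,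
          Nat.reduceEqDiff, reduceIte, Expr.eval, g1, g2, Config.setMem_mem_self]
        refine ⟨by omega, trivial, fun j hj => ?_, fun e he j hj => ?_, fun j hj => ?_⟩
        -- The list is extended in place. In the first round the summand is 0 and each entry is
        -- replaced by itself; in later rounds all writes lie behind the first `cnt` entries, which
        -- are the ones being read.
        · rcases Nat.eq_zero_or_pos d with rfl | hd0
          · rcases eq_or_ne j i with rfl | hji
            · simp
            · rw [if_neg (by omega), g3 j hj]
          · have : 1 * cnt ≤ d * cnt := Nat.mul_le_mul_right _ hd0
            rw [if_neg (by omega), g3 j hj]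
        · have : (e + 1) * cnt ≤ d * cnt := Nat.mul_le_mul_right _ he
          have h' : e * cnt + cnt = (e + 1) * cnt := by ring
          rw [if_neg (by omega), g4 e he j hj]
        · rcases Nat.lt_succ_iff_lt_or_eq.1 hj with hj' | rfl
          · rw [if_neg (by omega), g5 j hj']
          · rw [if_pos rfl]
    · rintro S₂ hf₂ - ⟨g1, g2, g3, g4, g5⟩
      have e2' : S₂.reg R.ew = w := by rw [hf₂.reg _ rfl, e2]
      refine .assign hB rfl ?_ ?_
      · simp only [Expr.eval, g2, e2']
        omega
      · simp only [Config.setReg_reg, Config.setReg_mem, OfNat.ofNat_eq_ofNat, Nat.reduceEqDiff,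
          reduceIte, Expr.eval, g1, g2, e2']
        refine ⟨by omega, by omega, g3, fun e he i hi => ?_⟩
        rcases Nat.lt_succ_iff_lt_or_eq.1 he with he' | rfl
        · exact g4 e he' i hi
        · exact g5 i hi
  · rintro S₁ hf₁ - ⟨h1, -, -, h4⟩
    refine .assign hB rfl (fun hS => hS.reg _) ?_
    simp only [Expr.eval, Config.setReg_reg, reduceIte, h1]
    refine ⟨mul_comm _ _, ⟨?_, hcard.symm⟩⟩
    ext a
    simp only [Finset.mem_image, Finset.mem_range, Finset.mem_product, Prod.exists,
      Config.setReg_mem]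
    constructor
    · rintro ⟨k, hk, rfl⟩
      have hc : 0 < cnt := Nat.pos_of_ne_zero fun h => by simp [h] at hk
      have hkd : k / cnt < q := Nat.div_lt_of_lt_mul hk
      have hkm : k % cnt < cnt := Nat.mod_lt _ hc
      refine ⟨_, _, ⟨hE.mem hkm, hkd⟩, ?_⟩
      rw [← h4 _ hkd _ hkm, Nat.div_add_mod']
    · rintro ⟨a, d, ⟨ha, hd⟩, rfl⟩
      rw [← hE.image, Finset.mem_image] at ha
      obtain ⟨i, hi, rfl⟩ := ha
      rw [Finset.mem_range] at hi
      refine ⟨d * cnt + i, ?_, h4 d hd i hi⟩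
      calc d * cnt + i < (d + 1) * cnt := by rw [add_mul]; omega
        _ ≤ q * cnt := Nat.mul_le_mul_right _ hd
        _ = cnt * q := mul_comm _ _

section Algorithm

open Finset Expr Prog
open Function (update update_self update_of_ne update_eq_self update_idem update_comm)
open Config (setReg_reg setReg_mem setMem_reg setMem_mem_self setMem_mem_ne setReg_eq_self)

variable {M : Machine} {B : ℕ} {S : Config} {ρ σ : Set ℕ} {s n N L J m lb ls : ℕ}
  {A : StateSystem ρ σ s} {G : SimpleGraph (Fin n)} {T : TreeDecomposition G (Fin N)}
  {home : Fin n → Fin n → Fin N} {X : Finset (Fin N)} {bag F : Fin N → Finset (Fin n)}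
  {E : Fin N → Fin n → Fin n → Prop} {len : Fin N → ℕ}

/-- The parameters of the algorithm and the input are present in the memory. -/
local notation "Ready" => Env A G T home L J m lb ls

/-! ### Auxiliary routines -/

/-- Store `0, w, …, (q - 1) * w` in bank `b`, for `w` and `q` in the registers `R.tw` and `R.tq`. -/
def multiples (b : ℕ) : Prog :=
  assign R.tacc (const 0) ;;
  forLoop R.ti R.tq
    (store b (reg R.ti) (reg R.tacc) ;;
    assign R.tacc (add (reg R.tacc) (reg R.tw)))

theorem does_multiples (hB : 64 ≤ B) {b w q : ℕ} (hw : S.reg R.tw = w) (hq : S.reg R.tq = q)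
    (hlt : q * w < 2 ^ B) :
    Does M B (multiples b) S (q * 4 + 3) fun S' => ∀ d < q, S'.mem b d = d * w := by
  refine (Does.seq (τ := 1) (.assign hB rfl (by simp [eval])
    (.forLoop (τ := 1 + 1) (n := q) hB (fun d S' => S'.reg R.tacc = d * w ∧
      ∀ e < d, S'.mem b e = e * w) (by simpa using hq) rfl rfl (by decide) ?_ ?_ ?_))).mono
      (by omega)
  · simp [eval]
  · rintro d S₁ hd hf hx ⟨h1, h2⟩
    have e1 : S₁.reg R.tw = w := by rw [hf.reg _ rfl]; simpa using hw
    have : (d + 1) * w ≤ q * w := Nat.mul_le_mul_right _ hd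
    have h' : (d + 1) * w = d * w + w := by ring
    refine .seq (.store hB rfl rfl (fun hS => hS.reg _) (.assign hB rfl ?_ ?_))
    · simp only [eval, setMem_reg, h1, e1]
      omega
    · simp only [setReg_reg, setReg_mem, setMem_reg, OfNat.ofNat_eq_ofNat,
        Nat.reduceEqDiff, reduceIte, eval, h1, e1, hx, setMem_mem_self]
      refine ⟨h'.symm, fun e he => ?_⟩
      split_ifs with h
      · rw [h]
      · exact h2 e (by omega)
  · rintro S₁ - - ⟨-, h⟩
    exact h

/-- The cell with address `a` of bank `b` contains the least residue of `z`. -/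
def Cell (m : ℕ) (S : Config) (b a : ℕ) (z : ZMod m) : Prop :=
  S.mem b a < m ∧ (S.mem b a : ZMod m) = z

theorem Cell.congr {m : ℕ} {S S' : Config} {b a : ℕ} {z : ZMod m} (h : Cell m S b a z)
    (he : S'.mem b = S.mem b) : Cell m S' b a z := by
  unfold Cell
  rwa [he]

theorem Cell.setMem {m : ℕ} {S : Config} {b a i v : ℕ} {y z : ZMod m} (h : a ≠ i → Cell m S b a z)
    (hv : v < m) (hy : (v : ZMod m) = y) (hz : a = i → y = z) : Cell m (S.setMem b i v) b a z := by
  unfold Cell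
  rw [setMem_mem_self]
  split_ifs with ha
  · exact ⟨hv, hy.trans (hz ha)⟩
  · exact h ha

/-- Add the product of the numbers in the registers `R.mx` and `R.my` to the number in the register
`R.acc`, or subtract it if the register `R.sg` is not zero. -/
def mulAcc : Prog :=
  branch (reg R.sg) (assign R.mx (sub (reg R.m) (reg R.mx))) skip ;;
  mulMod ;;
  assign R.acc (add (reg R.acc) (reg R.macc)) ;;
  reduce R.acc

/-- Write the digits of the number in the register `R.df` into the bank `K.dig`. -/
def decode : Prog :=
  assign R.rem (reg R.df) ;;
  forLoop R.di R.n
    (assign R.dd (const 0) ;;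
    forLoop R.dj R.s
      (branch (lt (reg R.rem) (load K.powS (sub (sub (reg R.n) (const 1)) (reg R.di)))) skip
        (assign R.rem
          (sub (reg R.rem) (load K.powS (sub (sub (reg R.n) (const 1)) (reg R.di)))) ;;
        assign R.dd (add (reg R.dd) (const 1)))) ;;
    store K.dig (sub (sub (reg R.n) (const 1)) (reg R.di)) (reg R.dd))

/-- List the addresses for the states of the vertices in the bag of the node in the register `R.bz`
without the vertex in the register `R.bskip`, and for as many sizes and rows as the registers
`R.bq` and `R.br` say. -/
def build : Prog :=
  store K.list (const 0) (const 0) ;;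
  assign R.lc (const 1) ;;
  forLoop R.bv R.n
    (branch (load K.inc (add (load K.mulN (reg R.bz)) (reg R.bv)))
      (branch (eq (reg R.bv) (reg R.bskip)) skip
        (assign R.ew (load K.powS (reg R.bv)) ;; assign R.eq (reg R.s) ;; extend)) skip) ;;
  assign R.ew (reg R.W) ;; assign R.eq (reg R.bq) ;; extend ;;
  assign R.ew (reg R.LW) ;; assign R.eq (reg R.br) ;; extend

/-- Subtracting `x * y` means adding `(m - x) * y`. For `x = 0` the first factor is `m` itself,
which is why `does_mulMod` admits `R.mx ≤ m`. -/
theorem does_mulAcc (hl : Limits B n N s L J m lb ls) (he : Ready S) {l : ℕ}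
    (hml : S.reg R.ml = l) (hlb : l ≤ lb) (hx : S.reg R.mx < m) (hy : S.reg R.my < 2 ^ l)
    (ha : S.reg R.acc < m) :
    Does M B mulAcc S (l * 20 + 10) fun S' => S'.reg R.acc < m ∧
      (S'.reg R.acc : ZMod m) = S.reg R.acc +
        (if S.reg R.sg ≠ 0 then -1 else 1) * S.reg R.mx * S.reg R.my := by
  have hB := hl.le_B
  have hm1 := hl.one_lt_m
  refine (Does.seq (τ := 1 + 1 + 1) (τ' := (l * 20 + 3) + (1 + 3))
    (post := fun S' => S'.reg R.acc < m ∧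
      (S'.reg R.acc : ZMod m) = S.reg R.acc +
        (if S.reg R.sg ≠ 0 then -1 else 1) * S.reg R.mx * S.reg R.my) ?_).mono (by omega)
  have main : ∀ x : ℕ, x ≤ m → (x : ZMod m) = (if S.reg R.sg ≠ 0 then -1 else 1) * S.reg R.mx →
      Does M B (mulMod ;; .assign R.acc (.add (.reg R.acc) (.reg R.macc)) ;; reduce R.acc)
        (S.setReg R.mx x) ((l * 20 + 3) + (1 + 3)) fun S' => S'.reg R.acc < m ∧
      (S'.reg R.acc : ZMod m) = S.reg R.acc +
        (if S.reg R.sg ≠ 0 then -1 else 1) * S.reg R.mx * S.reg R.my := by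
    intro x hxm hx'
    refine .seq ((does_mulMod (S := S.setReg R.mx x) hB (m := m) (by simpa using he.m_eq) hl.two_m (l := l)
      (by simpa using hml) (by simpa using hxm) (by simpa using hy) (by omega)
      (fun j hj => he.pow2 j (by omega))).conseq fun S₁ hf _ ⟨h1, h2⟩ => ?_)
    have e1 : S₁.reg R.acc = S.reg R.acc := by rw [hf.reg _ rfl]; simp
    have e2 : S₁.reg R.m = m := by rw [hf.reg _ rfl]; simpa using he.m_eq
    have h2m := hl.two_m
    refine .seq (.assign hB rfl ?_ ?_)
    · simp only [eval, e1]
      omega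
    · refine does_reduce (m := m) hB (by simpa using e2) (by simp [eval, e1]; omega) ?_
      intro y hy1 hy2
      simp only [setReg_reg, OfNat.ofNat_eq_ofNat, Nat.reduceEqDiff, reduceIte, eval,
        e1] at hy2 h2 ⊢
      refine ⟨hy1, ?_⟩
      rw [hy2, Nat.cast_add, h2, hx']
  refine .branch hB rfl (fun hg => .assign hB rfl ?_ ?_) (fun hg => .skip ?_)
  · intro hS
    exact lt_of_le_of_lt (Nat.sub_le _ _) (hS.reg _)
  · simp only [eval, he.m_eq] at hg ⊢
    refine main _ (Nat.sub_le _ _) ?_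
    rw [if_pos hg, Nat.cast_sub hx.le]
    simp
  · simp only [eval] at hg
    have := main (S.reg R.mx) hx.le (by simp [hg])
    rwa [setReg_eq_self] at this

/-- Division by repeated subtraction, from the leading digit on. In the inner loop either the
remainder is already less than the power of `s`, or each of the `j` rounds so far has subtracted it;
since a digit is less than `s`, the former holds after `s` rounds. -/
theorem does_decode (hl : Limits B n N s L J m lb ls) (he : Ready S)
    {f : Fin n → Fin s} (hf : S.reg R.df = code f) :
    Does M B decode S (n * (s * 6 + 6) + 3) fun S' => ∀ v : Fin n, S'.mem K.dig v = f v := by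
  have hB := hl.le_B
  have h2 := hl.two_le
  refine (Does.seq (τ := 1) (.assign hB rfl (fun hS => hS.reg _)
    (.forLoop (τ := 1 + ((s * ((1 + 1 + (1 + 1)) + 2) + 2) + 1)) (n := n) hB
      (fun i S' => S'.reg R.rem = code f % s ^ (n - i) ∧
      ∀ v : Fin n, n - i ≤ v → S'.mem K.dig v = f v) (by simpa using he.n_eq) rfl rfl (by decide)
      ?_ ?_ ?_))).mono (by ring_nf; omega)
  · simp only [setReg_reg, setReg_mem, OfNat.ofNat_eq_ofNat, Nat.reduceEqDiff,
      reduceIte, eval, hf, Nat.sub_zero, Nat.mod_eq_of_lt (code_lt f), true_and]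
    intro v hv
    omega
  · rintro i S₁ hi hf₁ hxi ⟨h3, h4⟩
    have e1 : S₁.reg R.n = n := by rw [hf₁.reg _ rfl]; simpa using he.n_eq
    have e2 : S₁.reg R.s = s := by rw [hf₁.reg _ rfl]; simpa using he.s_eq
    have e3 : S₁.mem K.powS (n - 1 - i) = s ^ (n - 1 - i) := by
      rw [hf₁.mem _ rfl]; exact he.powS _ (by omega)
    set p := s ^ (n - 1 - i) with hp
    have hp0 : 0 < p := by positivity
    have hps : s ^ (n - i) = p * s := by
      rw [hp, ← pow_succ]
      congr 1
      omega
    set r := code f % s ^ (n - i) with hr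
    have hrlt : r < p * s := by
      rw [← hps]
      exact Nat.mod_lt _ (by positivity)
    have hrp : r / p = f ⟨n - 1 - i, by omega⟩ := by
      rw [← code_div_mod f ⟨n - 1 - i, by omega⟩, hr, hps, Nat.mod_mul_right_div_self]
    have hrm : r % p = code f % s ^ (n - (i + 1)) := by
      rw [hr, hps, Nat.mod_mul_right_mod, hp]
      congr 2
      omega
    refine .seq (.assign hB rfl (by simp [eval]) (.seq (.forLoop (τ := 1 + 1 + (1 + 1)) (n := s) hB (fun j S' =>
      S'.reg R.dd ≤ j ∧ S'.reg R.rem + S'.reg R.dd * p = r ∧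
      (S'.reg R.rem < p ∨ S'.reg R.dd = j) ∧ S'.mem K.dig = S₁.mem K.dig)
      (by simpa using e2) rfl rfl (by decide) ?_ ?_ ?_)))
    · simp [eval, h3]
    · rintro j S₂ hj hf₂ - ⟨g1, g2, g3, g4⟩
      have k1 : S₂.reg R.n = n := by rw [hf₂.reg _ rfl]; simpa using e1
      have k2 : S₂.reg R.di = i := by rw [hf₂.reg _ rfl]; simpa using hxi
      have k3 : S₂.mem K.powS (n - 1 - i) = p := by rw [hf₂.mem _ rfl]; simpa using e3
      refine .branch hB rfl (fun hg => .skip ?_) (fun hg => .seq (.assign hB rfl ?_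
        (.assign hB rfl ?_ ?_)))
      · have : S₂.reg R.rem < p := by
          by_contra hc
          simp [eval, k1, k2, k3, hc] at hg
        simp only [setReg_reg, setReg_mem, OfNat.ofNat_eq_ofNat, Nat.reduceEqDiff,
          reduceIte]
        exact ⟨by omega, g2, Or.inl this, g4⟩
      · intro hS
        exact lt_of_le_of_lt (Nat.sub_le _ _) (hS.reg _)
      · simp only [eval, setReg_reg, OfNat.ofNat_eq_ofNat, Nat.reduceEqDiff, reduceIte]
        have h1 := hl.s_le
        have h2 := hl.pow_lt
        omega
      · have hge : p ≤ S₂.reg R.rem := by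
          by_contra hc
          simp [eval, k1, k2, k3, not_le.1 hc] at hg
        simp only [setReg_reg, setReg_mem, OfNat.ofNat_eq_ofNat, Nat.reduceEqDiff,
          reduceIte, eval, k1, k2, k3]
        refine ⟨by omega, ?_, by omega, g4⟩
        rw [add_mul]
        omega
    · rintro S₂ hf₂ - ⟨g1, g2, g3, g4⟩
      have k1 : S₂.reg R.n = n := by rw [hf₂.reg _ rfl]; simpa using e1
      have k2 : S₂.reg R.di = i := by rw [hf₂.reg _ rfl]; simpa using hxi
      have hlt : S₂.reg R.rem < p := by
        rcases g3 with g3 | g3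
        · exact g3
        · rw [g3] at g2
          nlinarith
      have hdd : S₂.reg R.dd = r / p := by
        rw [← g2, Nat.add_mul_div_right _ _ hp0, Nat.div_eq_of_lt hlt, zero_add]
      have hrem : S₂.reg R.rem = r % p := by
        rw [← g2, Nat.add_mul_mod_self_right, Nat.mod_eq_of_lt hlt]
      refine .store hB rfl rfl (fun hS => hS.reg _) ?_
      simp only [setReg_reg, setReg_mem, setMem_reg, OfNat.ofNat_eq_ofNat,
        Nat.reduceEqDiff, reduceIte, eval, k1, k2, setMem_mem_self]
      refine ⟨by rw [hrem, hrm], fun v hv => ?_⟩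
      split_ifs with h
      · rw [hdd, hrp]
        congr 2
        exact Fin.ext h.symm
      · rw [g4]
        exact h4 v (by omega)
  · rintro S₁ - - ⟨-, h⟩ v
    exact h v (by omega)

/-- The vertices of a bag without the vertex with index `k`. -/
def bagWithout (Y : Finset (Fin n)) (k : ℕ) : Finset (Fin n) := Y.filter fun v => (v : ℕ) ≠ k

/-- With the value `n`, which is not the index of a vertex, nothing is skipped. -/
theorem bagWithout_of_le {Y : Finset (Fin n)} {k : ℕ} (hk : n ≤ k) : bagWithout Y k = Y :=
  filter_true_of_mem fun v _ => by omega

theorem bagWithout_eq_erase (Y : Finset (Fin n)) (v : Fin n) : bagWithout Y v = Y.erase v := by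
  ext u
  simp [bagWithout, Fin.ext_iff, and_comm]

/-- Each vertex of the bag multiplies the length of the list by `s ≥ 2`, so the time for all
extensions is a geometric sum, proportional to the final length. The invariant of the amortized loop
says so: at most 5 units for each vertex that was examined, plus 30 for each entry of the current
list. -/
theorem does_build (hl : Limits B n N s L J m lb ls) (he : Ready S)
    {bag : Fin N → Finset (Fin n)} (hbag : Bags S bag) {z : Fin N} (hz : S.reg R.bz = z) {k q r : ℕ}
    (hk : S.reg R.bskip = k) (hq : S.reg R.bq = q) (hr : S.reg R.br = r) (hq0 : 0 < q)
    (hqL : q ≤ L) (hr0 : 0 < r) (hrJ : r ≤ J) :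
    Does M B build S (n * 7 + 70 * (s ^ (bagWithout (bag z) k).card * q * r)) fun S' =>
      S'.reg R.lc = s ^ (bagWithout (bag z) k).card * q * r ∧
      Enumerates S' K.list (s ^ (bagWithout (bag z) k).card * q * r)
        (addrBox s L (bagWithout (bag z) k) q r) := by
  have hB := hl.le_B
  have hs2 := hl.two_le
  have hL := hl.L_pos
  have hJ := hl.J_pos
  have hs0 : 0 < s := by omega
  have hcells := hl.cells
  set Y := bagWithout (bag z) k with hY
  have hcard : ∀ Z : Finset (Fin n), s ^ Z.card ≤ s ^ n := fun Z =>
    Nat.pow_le_pow_right hs0 (by simpa using card_le_univ Z)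
  have hle : ∀ a b c : ℕ, a ≤ s ^ n → b ≤ L → c ≤ J → a * b * c ≤ s ^ n * (L * J) :=
    fun a b c h1 h2 h3 => by
      rw [mul_assoc]
      exact Nat.mul_le_mul h1 (Nat.mul_le_mul h2 h3)
  set c := s ^ Y.card with hc
  have hc0 : 0 < c := by positivity
  have hcq : 0 < c * q := by positivity
  have hcqr : c * q ≤ c * q * r := Nat.le_mul_of_pos_right _ hr0
  have hcq1 : c ≤ c * q := Nat.le_mul_of_pos_right _ hq0
  refine (Does.seq (τ := 1) (τ' := 1 + ((n * 2 + 2 + (n * 5 + 30 * c)) + (1 + (1 +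
    ((q * (c * 4 + 5) + 5) + (1 + (1 + (r * (c * q * 4 + 5) + 5)))))))) (.store hB rfl rfl
    (by simp [eval]) (.seq (.assign hB rfl (fun _ => Nat.one_lt_two_pow (by omega)) (.seq
    (.forLoop_amortized hB (fun i t S' => ∃ Z : Finset (Fin n), Z = Y.filter (fun v : Fin n => (v : ℕ) < i) ∧
      S'.reg R.lc = s ^ Z.card ∧ Enumerates S' K.list (s ^ Z.card) (addrBox s L Z 1 1) ∧
      t ≤ i * 5 + 30 * s ^ Z.card)
      (by simpa using he.n_eq) rfl rfl (by decide) ?_ ?_ ?_)))))).mono ?_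
  · refine ⟨∅, by simp, by simp [eval], ?_, by simp⟩
    rw [addrBox_empty hs0]
    constructor
    · simp [eval, setMem_mem_self]
    · simp
  · rintro i t S₁ hi hf hxi ⟨Z, hZ, h1, h2, h3⟩
    have e0 : Ready S₁ := by
      refine ((he.setMem (a := K.list) (by decide) 0 0).setReg (x := R.lc) (by decide) 1).frame hf ?_
      rfl
    have e1 : S₁.reg R.bz = z := by rw [hf.reg _ rfl]; simpa using hz
    have e2 : S₁.reg R.bskip = k := by rw [hf.reg _ rfl]; simpa using hk
    have e3 : S₁.mem K.inc = S.mem K.inc := by rw [hf.mem _ rfl]; simp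
    have e4 : S₁.mem K.mulN z = z * n := e0.mulN _ (by omega)
    have hgood : S₁.mem K.inc (z * n + i) ≠ 0 ↔ (⟨i, hi⟩ : Fin n) ∈ bag z := by
      rw [e3]; exact hbag z ⟨i, hi⟩
    have hval : eval S₁ (.load K.inc (.add (.load K.mulN (.reg R.bz)) (.reg R.bv))) =
        S₁.mem K.inc (z * n + i) := by
      simp [eval, e1, hxi, e4]
    have hfil : ∀ Z', Z' = Y.filter (fun v : Fin n => (v : ℕ) < i + 1) → (⟨i, hi⟩ : Fin n) ∉ Y → Z' = Z := by
      rintro Z' rfl h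
      rw [hZ]
      ext v
      simp only [mem_filter, and_congr_right_iff]
      intro hv
      have : v ≠ ⟨i, hi⟩ := fun h' => h (h' ▸ hv)
      have : (v : ℕ) ≠ i := fun h' => this (Fin.ext h')
      omega
    by_cases hiY : (⟨i, hi⟩ : Fin n) ∈ Y
    · have hiZ : (⟨i, hi⟩ : Fin n) ∉ Z := by simp [hZ]
      have hZ' : insert (⟨i, hi⟩ : Fin n) Z = Y.filter (fun v : Fin n => (v : ℕ) < i + 1) := by
        rw [hZ]
        ext v
        simp only [mem_insert, mem_filter, Fin.ext_iff]
        constructor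
        · rintro (h | h)
          · have : v = ⟨i, hi⟩ := Fin.ext h
            rw [this]
            exact ⟨hiY, by simp⟩
          · exact ⟨h.1, by omega⟩
        · rintro ⟨h, h'⟩
          by_cases hvi : (v : ℕ) = i
          · exact Or.inl hvi
          · exact Or.inr ⟨h, by omega⟩
      have hY' := hiY
      simp only [hY, bagWithout, mem_filter] at hY'
      have hcardZ : s ^ (insert (⟨i, hi⟩ : Fin n) Z).card = s ^ Z.card * s := by
        rw [card_insert_of_notMem hiZ, pow_succ]
      have hcZ := hcard (insert (⟨i, hi⟩ : Fin n) Z)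
      have hin : s ≤ s ^ n := hl.s_le
      have hpi : s * s ^ i ≤ s ^ n := by
        rw [mul_comm, ← pow_succ]
        exact Nat.pow_le_pow_right hs0 hi
      have hWc := hl.pow_lt
      have hbox := card_addrBox (L := L) hs0 (insert (⟨i, hi⟩ : Fin n) Z) (q := 1) (by omega) 1
      rw [addrBox_insert hiZ, hcardZ, mul_one, mul_one] at hbox
      refine ⟨1 + (1 + 1 + (1 + (1 + (s * (s ^ Z.card * 4 + 5) + 5)))) + 1, .branch hB rfl
        (fun _ => .branch hB rfl (fun hg => ?_) (fun _ => .seq (.assign hB rfl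
          (fun hS => hS.mem _ _) (.seq (.assign hB rfl (fun hS => hS.reg _) ?_))))) (fun hg => ?_)⟩
      · simp [eval, hxi, e2, hY'.2] at hg
      · refine (does_extend hB (E := addrBox s L Z 1 1) (cnt := s ^ Z.card) (w := s ^ i) (q := s)
          (b := s ^ n) (by exact h2.congr rfl) (by simpa using h1) ?_ ?_ ?_ ?_ hbox ?_).conseq ?_
        · simpa [eval, hxi] using e0.powS i hi
        · simpa [eval] using e0.s_eq
        · intro a ha
          obtain ⟨f, -, κ, hκ, j, hj, rfl⟩ := mem_addrBox.1 ha
          obtain rfl : κ = 0 := by omega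
          obtain rfl : j = 0 := by omega
          simpa [addr] using code_lt f
        · omega
        · rw [← hcardZ]
          omega
        · rintro S₂ hf₂ - ⟨g1, g2⟩
          refine ⟨_, hZ', ?_, ?_, ?_⟩
          · simpa [hcardZ] using g1
          · rw [hcardZ, addrBox_insert hiZ]
            exact g2.congr rfl
          · rw [hcardZ]
            have : 1 ≤ s ^ Z.card := Nat.pow_pos hs0
            have h1 : 2 * s ^ Z.card ≤ s ^ Z.card * s := by
              rw [mul_comm]
              exact Nat.mul_le_mul_left _ hs2
            have h2 : s ≤ s ^ Z.card * s := Nat.le_mul_of_pos_left _ this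
            have h3 : s * (s ^ Z.card * 4 + 5) = 4 * (s ^ Z.card * s) + 5 * s := by ring
            omega
      · rw [hval] at hg
        exact absurd hg (hgood.2 hY'.1)
    · have key2 : ∀ t', t' ≤ t + 5 → ∃ Z' : Finset (Fin n), Z' = Y.filter (fun v : Fin n => (v : ℕ) < i + 1) ∧
          (S₁.setReg R.bv (i + 1)).reg R.lc = s ^ Z'.card ∧
          Enumerates (S₁.setReg R.bv (i + 1)) K.list (s ^ Z'.card) (addrBox s L Z' 1 1) ∧
          t' ≤ (i + 1) * 5 + 30 * s ^ Z'.card := by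
        intro t' ht'
        refine ⟨_, rfl, ?_⟩
        rw [hfil _ rfl hiY]
        exact ⟨by simpa using h1, h2.congr rfl, by omega⟩
      by_cases hib : (⟨i, hi⟩ : Fin n) ∈ bag z
      · have hik : i = k := by
          by_contra hne
          exact hiY (by simp [hY, bagWithout, hib, hne])
        refine ⟨5, Does.mono (τ := 1 + (1 + 1 + 0) + 1) (.branch hB rfl
          (fun _ => .branch hB rfl (fun hg => .skip (key2 _ le_rfl)) (fun hg => ?_)) (fun hg => ?_))
          (by norm_num)⟩
        · simp [eval, hxi, e2, hik] at hg
        · rw [hval] at hg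
          exact absurd hg (hgood.2 hib)
      · refine ⟨5, Does.mono (τ := 1 + 0 + 1) (.branch hB rfl (fun hg => ?_)
          (fun hg => .skip (key2 _ le_rfl))) (by norm_num)⟩
        rw [hval] at hg
        exact absurd (hgood.1 hg) hib
  · rintro t S₁ hf - ⟨Z, hZ, h1, h2, h3⟩
    obtain rfl : Z = Y := by
      rw [hZ]
      exact filter_true_of_mem fun v _ => v.2
    refine ⟨?_, h3⟩
    have e0 : Ready S₁ := by
      refine ((he.setMem (a := K.list) (by decide) 0 0).setReg (x := R.lc) (by decide) 1).frame hf ?_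
      rfl
    have e1 : S₁.reg R.bq = q := by rw [hf.reg _ rfl]; simpa using hq
    have e2 : S₁.reg R.br = r := by rw [hf.reg _ rfl]; simpa using hr
    have hb1 := card_addrBox (L := L) hs0 Y hqL 1
    rw [addrBox_sizes, mul_one] at hb1
    have hb2 := card_addrBox (L := L) hs0 Y hqL r
    rw [addrBox_rows] at hb2
    have hLJ : L ≤ L * J := Nat.le_mul_of_pos_right _ hJ
    have i1 : q * s ^ n ≤ s ^ n * (L * J) := by
      rw [mul_comm]
      exact Nat.mul_le_mul_left _ (hqL.trans hLJ)
    have i2 : r * (L * s ^ n) ≤ s ^ n * (L * J) := by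
      calc r * (L * s ^ n) ≤ J * (L * s ^ n) := Nat.mul_le_mul_right _ hrJ
        _ = _ := by ring
    have i3 : c * q * 1 ≤ s ^ n * (L * J) := hle _ _ _ (hcard Y) hqL hJ
    have i4 : c * q * r ≤ s ^ n * (L * J) := hle _ _ _ (hcard Y) hqL hrJ
    refine .seq (.assign hB rfl (fun hS => hS.reg _) (.seq (.assign hB rfl (fun hS => hS.reg _)
      (.seq ((does_extend hB (E := addrBox s L Y 1 1) (cnt := c) (w := s ^ n) (q := q)
          (b := s ^ n * (L * J)) (by exact h2.congr rfl) (by simpa using h1) ?_ ?_ ?_ ?_ hb1 ?_).conseq ?_)))))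
    · simpa [eval] using e0.W_eq
    · simpa [eval] using e1
    · intro a ha
      exact addrBox_lt hL hJ ha
    · omega
    · omega
    · rintro S₂ hf₂ - ⟨g1, g2⟩
      rw [← addrBox_sizes] at g2
      refine .seq (.assign hB rfl (fun hS => hS.reg _) (.seq (.assign hB rfl (fun hS => hS.reg _)
        ((does_extend hB (E := addrBox s L Y q 1) (cnt := c * q) (w := L * s ^ n) (q := r)
          (b := s ^ n * (L * J)) (by exact g2.congr rfl) (by simpa using g1) ?_ ?_ ?_ ?_ hb2 ?_).conseq ?_))))
      · have : S₂.reg R.LW = L * s ^ n := by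
          rw [hf₂.reg _ rfl]; simpa [eval] using e0.LW_eq
        simpa [eval] using this
      · have : S₂.reg R.br = r := by
          rw [hf₂.reg _ rfl]; simpa [eval] using e2
        simpa [eval] using this
      · intro a ha
        exact addrBox_lt hqL hJ ha
      · omega
      · omega
      · rintro S₃ - - ⟨k1, k2⟩
        rw [← addrBox_rows] at k2
        exact ⟨k1, k2⟩
  · have h1 : q * (c * 4 + 5) = 4 * (c * q) + 5 * q := by ring
    have h2 : r * (c * q * 4 + 5) = 4 * (c * q * r) + 5 * r := by ring
    have h3 : q ≤ c * q := Nat.le_mul_of_pos_left _ hc0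
    have h4 : r ≤ c * q * r := Nat.le_mul_of_pos_left _ hcq
    omega

/-! ### The initial tables -/

/-- Test whether the states in the bank `K.dig` fit if no vertex is completed and the edges are those
of the node in the register `R.x`. -/
def checkFits : Prog :=
  assign R.flag (const 1) ;;
  forLoop R.a R.n
    (assign R.cnt (const 0) ;;
    forLoop R.b R.n
      (branch (load K.adjG (add (load K.mulN (reg R.a)) (reg R.b)))
        (branch (eq (load K.own (add (load K.mulN (reg R.a)) (reg R.b))) (reg R.x))
          (assign R.cnt (add (reg R.cnt) (load K.inn (load K.dig (reg R.b))))) skip) skip) ;;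
    branch (load K.star (load K.dig (reg R.a))) skip
      (branch (eq (load K.cv (load K.dig (reg R.a))) (reg R.cnt)) skip (assign R.flag (const 0))))

/-- Compute the tables for all nodes of the tree. -/
def initTables : Prog :=
  forLoop R.x R.N
    (assign R.bz (reg R.x) ;;
    assign R.bskip (reg R.n) ;;
    assign R.bq (const 1) ;;
    assign R.br (const 1) ;;
    build ;;
    forLoop R.i R.lc
      (assign R.df (load K.list (reg R.i)) ;;
      decode ;;
      checkFits ;;
      store K.tab (add (reg R.df) (load K.mulLW (reg R.x))) (reg R.flag)))

section InitTables

open scoped Classical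

theorem Fin.sum_lt_succ {n i : ℕ} {α : Type*} [AddCommMonoid α] (g : Fin n → α) (hi : i < n) :
    (∑ v : Fin n, if (v : ℕ) < i + 1 then g v else 0) =
      (∑ v : Fin n, if (v : ℕ) < i then g v else 0) + g ⟨i, hi⟩ := by
  have : ∀ v : Fin n, (if (v : ℕ) < i + 1 then g v else 0) =
      (if (v : ℕ) < i then g v else 0) + if v = ⟨i, hi⟩ then g v else 0 := by
    intro v
    rcases lt_trichotomy (v : ℕ) i with h | h | h
    · rw [if_pos (by omega), if_pos h, if_neg (by simp [Fin.ext_iff, h.ne]), add_zero]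
    · rw [if_pos (by omega), if_neg (by omega), if_pos (Fin.ext h), zero_add]
    · rw [if_neg (by omega), if_neg (by omega), if_neg (by simp [Fin.ext_iff, h.ne']), add_zero]
  simp only [this, sum_add_distrib, sum_ite_eq', mem_univ, if_true]

theorem Limits.n_lt (hl : Limits B n N s L J m lb ls) : n + N < 2 ^ B := by
  have := hl.lt_L
  have := hl.L_lt
  omega

theorem does_checkFits (hl : Limits B n N s L J m lb ls) (he : Ready S)
    {f : Fin n → Fin s} (hdig : ∀ v : Fin n, S.mem K.dig v = f v) {x : Fin N} (hx : S.reg R.x = x) :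
    Does M B checkFits S (n * (n * 7 + 11) + 3) fun S' => S'.reg R.flag =
      if ∀ u, A.Fits (f u) (degIn (fun u v => G.Adj u v ∧ home u v = x) (A.ins f) u)
        then 1 else 0 := by
  have hB := hl.le_B
  have hnB := hl.n_lt
  set E : Fin n → Fin n → Prop := fun u v => G.Adj u v ∧ home u v = x with hE
  have hdeg : ∀ u, degIn E (A.ins f) u = ∑ v : Fin n, if E u v ∧ A.inn (f v) = true then 1 else 0 := by
    intro u
    simp only [degIn, StateSystem.ins, filter_filter, card_filter]
    exact sum_congr rfl fun v _ => by simp only [and_comm]; congr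
  refine (Does.seq (τ := 1) (.assign hB rfl (by simp [eval]; omega)
    (.forLoop (τ := 1 + ((n * ((1 + (1 + 1 + 1) + 1) + 2) + 2) + (1 + 1 + (1 + 1 + 1)))) (n := n) hB
      (fun i S' => S'.reg R.flag = if ∀ u : Fin n, (u : ℕ) < i → A.Fits (f u) (degIn E (A.ins f) u)
        then 1 else 0)
      (by simpa using he.n_eq) rfl rfl (by decide) ?_ ?_ ?_))).mono (by ring_nf; omega)
  · simp [eval]
  · rintro i S₁ hi hf₁ hxi h1
    have e0 : Ready S₁ := by
      refine (he.setReg (x := R.flag) (by decide) 1).frame hf₁ ?_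
      rfl
    have e1 : S₁.mem K.dig = S.mem K.dig := by rw [hf₁.mem _ rfl]; rfl
    have e2 : S₁.reg R.x = x := by rw [hf₁.reg _ rfl]; simpa using hx
    refine .seq (.assign hB rfl (by simp [eval]) (.seq (.forLoop
      (τ := 1 + (1 + 1 + 1) + 1) (n := n) hB (fun j S' => S'.reg R.cnt =
        (∑ v : Fin n, if (v : ℕ) < j then (if E ⟨i, hi⟩ v ∧ A.inn (f v) = true then 1 else 0) else 0) ∧
        S'.reg R.cnt ≤ j)
      (by simpa using e0.n_eq) rfl rfl (by decide) ?_ ?_ ?_)))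
    · simp [eval]
    · rintro j S₂ hj hf₂ hxj ⟨g1, g1'⟩
      have k0 : Ready S₂ := by
        refine (e0.setReg (x := R.cnt) (by decide) _).frame hf₂ ?_
        rfl
      have k1 : S₂.mem K.dig j = f ⟨j, hj⟩ := by
        rw [hf₂.mem _ rfl, setReg_mem, e1]; exact hdig ⟨j, hj⟩
      have k2 : S₂.reg R.x = x := by rw [hf₂.reg _ rfl]; simpa using e2
      have k3 : S₂.reg R.a = i := by rw [hf₂.reg _ rfl]; simpa using hxi
      have k4 : S₂.mem K.mulN i = i * n := k0.mulN _ (by omega)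
      have k5 := k0.adjG ⟨i, hi⟩ ⟨j, hj⟩
      have k6 := k0.own ⟨i, hi⟩ ⟨j, hj⟩
      have k7 := k0.inn (f ⟨j, hj⟩)
      simp only at k5 k6
      rw [Fin.sum_lt_succ _ hj]
      refine .branch hB rfl (fun hg => .branch hB rfl (fun hg' => .assign hB rfl ?_ ?_)
        (fun hg' => .skip ?_)) (fun hg => .skip ?_)
      · simp only [eval, hxj, k1, k7]
        split_ifs <;> omega
      · have c1 : E ⟨i, hi⟩ ⟨j, hj⟩ := by
          simp only [eval, k3, hxj, k4] at hg
          simp only [eval, k3, hxj, k4, k6, k2] at hg'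
          refine ⟨k5.1 hg, ?_⟩
          by_contra hc
          simp [← Fin.ext_iff, hc] at hg'
        simp only [setReg_reg, OfNat.ofNat_eq_ofNat, Nat.reduceEqDiff, reduceIte, eval,
          hxj, k1, k7, c1, true_and]
        refine ⟨by rw [g1], ?_⟩
        split_ifs <;> omega
      · have c1 : ¬ E ⟨i, hi⟩ ⟨j, hj⟩ := by
          simp only [eval, k3, hxj, k4, k6, k2] at hg'
          rintro ⟨-, hc⟩
          simp [hc] at hg'
        simp only [setReg_reg, OfNat.ofNat_eq_ofNat, Nat.reduceEqDiff, reduceIte, g1, c1,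
          false_and, add_zero, true_and]
        omega
      · have c1 : ¬ E ⟨i, hi⟩ ⟨j, hj⟩ := by
          simp only [eval, k3, hxj, k4] at hg
          rintro ⟨hc, -⟩
          exact k5.2 hc hg
        simp only [setReg_reg, OfNat.ofNat_eq_ofNat, Nat.reduceEqDiff, reduceIte, g1, c1,
          false_and, add_zero, true_and]
        omega
    · rintro S₂ hf₂ - ⟨g1, -⟩
      have k0 : Ready S₂ := by
        refine (e0.setReg (x := R.cnt) (by decide) _).frame hf₂ ?_
        rfl
      have k1 : S₂.mem K.dig i = f ⟨i, hi⟩ := by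
        rw [hf₂.mem _ rfl, setReg_mem, e1]; exact hdig ⟨i, hi⟩
      have k3 : S₂.reg R.a = i := by rw [hf₂.reg _ rfl]; simpa using hxi
      have k4 : S₂.reg R.flag = S₁.reg R.flag := by rw [hf₂.reg _ rfl]; simp
      have k5 := k0.star (f ⟨i, hi⟩)
      have k6 := k0.cv (f ⟨i, hi⟩)
      have g2 : S₂.reg R.cnt = degIn E (A.ins f) ⟨i, hi⟩ := by
        rw [g1, hdeg]
        exact sum_congr rfl fun v _ => if_pos v.2
      have hiff : (∀ u : Fin n, (u : ℕ) < i + 1 → A.Fits (f u) (degIn E (A.ins f) u)) ↔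
          (∀ u : Fin n, (u : ℕ) < i → A.Fits (f u) (degIn E (A.ins f) u)) ∧
            A.Fits (f ⟨i, hi⟩) (degIn E (A.ins f) ⟨i, hi⟩) := by
        constructor
        · exact fun h => ⟨fun u hu => h u (by omega), h _ (by simp)⟩
        · rintro ⟨h, h'⟩ u hu
          rcases Nat.lt_succ_iff_lt_or_eq.1 hu with hu | hu
          · exact h u hu
          · rwa [show u = ⟨i, hi⟩ from Fin.ext hu]
      refine .branch hB rfl (fun hg => .skip ?_) (fun hg => .branch hB rfl (fun hg' => .skip ?_)
        (fun hg' => .assign hB rfl (by simp [eval]) ?_))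
      · simp only [eval, k3, k1] at hg
        have : A.Fits (f ⟨i, hi⟩) (degIn E (A.ins f) ⟨i, hi⟩) := Or.inl (k5.1 hg)
        simp only [setReg_reg, OfNat.ofNat_eq_ofNat, Nat.reduceEqDiff, reduceIte, k4, h1,
          hiff, this, and_true]
      · have : A.Fits (f ⟨i, hi⟩) (degIn E (A.ins f) ⟨i, hi⟩) := by
          simp only [eval, k3, k1, k6, g2] at hg'
          by_contra hc
          exact hg' (if_neg fun h => hc (Or.inr h))
        simp only [setReg_reg, OfNat.ofNat_eq_ofNat, Nat.reduceEqDiff, reduceIte, k4, h1,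
          hiff, this, and_true]
      · have : ¬ A.Fits (f ⟨i, hi⟩) (degIn E (A.ins f) ⟨i, hi⟩) := by
          simp only [eval, k3, k1, k6, g2] at hg hg'
          rintro (hc | hc)
          · exact k5.2 hc hg
          · simp [hc] at hg'
        simp only [setReg_reg, OfNat.ofNat_eq_ofNat, Nat.reduceEqDiff, reduceIte, eval,
          hiff, this, and_false]
  · rintro S₁ - - h
    rw [h]
    simp

/-- The bank `K.tab` contains the tables `Z x` of the nodes `x` in `X`. -/
def Tables (m L : ℕ) (S : Config) (X : Set (Fin N)) (bag : Fin N → Finset (Fin n))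
    (Z : Fin N → (Fin n → Fin s) → ℕ → ZMod m) : Prop :=
  ∀ x ∈ X, ∀ f, Off (bag x) f → ∀ κ < L, Cell m S K.tab (addr L f κ x) (Z x f κ)

/-- If no vertex is completed, only the size 0 can have a non-zero entry, and by `sem_empty` it is
an indicator. So one cell for each state function is computed; all others keep their initial value
0. -/
theorem does_initTables (hl : Limits B n N s L J m lb ls) (he : Ready S)
    {bag : Fin N → Finset (Fin n)} (hbag : Bags S bag) {w : ℕ} (hw : ∀ x, s ^ (bag x).card ≤ w)
    (h0 : ∀ a, S.mem K.tab a = 0) :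
    Does M B initTables S (N * (w * (40 * (n * (n + s)) + 100)) + 2) fun S' =>
      Tables m L S' Set.univ bag fun x f κ =>
        (A.sem ∅ (fun u v => G.Adj u v ∧ home u v = x) f κ : ℤ) := by
  have hB := hl.le_B
  have hnB := hl.n_lt
  have hL := hl.L_pos
  have hJ := hl.J_pos
  have hs2 := hl.two_le
  have hm1 := hl.one_lt_m
  have hcells := hl.cells
  have hn := hl.n_pos
  set E : Fin N → Fin n → Fin n → Prop := fun x u v => G.Adj u v ∧ home u v = x with hE
  have hz : ∀ (x : Fin N) (f : Fin n → Fin s) κ, κ ≠ 0 → ((A.sem ∅ (E x) f κ : ℤ) : ZMod m) = 0 := by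
    intro x f κ hκ
    rw [StateSystem.sem_empty]
    simp [hκ]
  have hNJ : N ≤ J := by have := hl.le_J; omega
  refine (Does.forLoop (n := N) (τ := 1 + (1 + (1 + (1 + ((n * 7 + 70 * (w * 1 * 1)) +
    (w * ((1 + ((n * (s * 6 + 6) + 3) + ((n * (n * 7 + 11) + 3) + 1))) + 2) + 2)))))) hB
    (fun i S' => ∀ (y : Fin N) f, Off (bag y) f → ∀ κ < L, Cell m S' K.tab (addr L f κ y)
      (if (y : ℕ) < i then (A.sem ∅ (E y) f κ : ℤ) else 0)) he.N_eq rfl rfl (by decide)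
      ?_ ?_ ?_).mono ?_
  · intro y f hf κ hκ
    simp only [Cell, setReg_mem, h0, Nat.cast_zero, Nat.not_lt_zero, if_false, and_true]
    omega
  · rintro i S₁ hi hf₁ hxi h1
    have e0 : Ready S₁ := he.frame hf₁ rfl
    have eb : Bags S₁ bag := by
      unfold Bags
      rw [hf₁.mem _ rfl]
      exact hbag
    refine .seq (.assign hB rfl (fun hS => hS.reg _) (.seq (.assign hB rfl (fun hS => hS.reg _)
      (.seq (.assign hB rfl (fun hS => Nat.one_lt_two_pow (by omega)) (.seq (.assign hB rfl
      (fun hS => Nat.one_lt_two_pow (by omega)) (.seq (Does.mono (Does.conseq (does_build hl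
        (z := ⟨i, hi⟩) (bag := bag) (k := n) (q := 1) (r := 1)
        ((((e0.setReg (by decide) _).setReg (by decide) _).setReg (by decide) _).setReg
          (by decide) _) (by exact eb) ?_ ?_ ?_ ?_ (by omega) (by omega) (by omega) (by omega)) ?_)
        ?_)))))))))
    · simp [eval, hxi]
    · simp [eval, e0.n_eq]
    · simp [eval]
    · simp [eval]
    · rintro S₂ hf₂ - ⟨g1, g2⟩
      rw [bagWithout_of_le le_rfl] at g1 g2
      simp only [mul_one] at g1 g2
      have k0 : Ready S₂ :=
        ((((e0.setReg (by decide) _).setReg (by decide) _).setReg (by decide) _).setReg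
          (by decide) _).frame hf₂ rfl
      have k1 : S₂.reg R.x = i := by rw [hf₂.reg _ rfl]; simpa using hxi
      have k2 : S₂.mem K.tab = S₁.mem K.tab := by rw [hf₂.mem _ rfl]; rfl
      refine Does.mono (Does.forEach (τ := (1 + ((n * (s * 6 + 6) + 3) + ((n * (n * 7 + 11) + 3) + 1))))
        hB (fun D S' => ∀ (y : Fin N) f, Off (bag y) f → ∀ κ < L,
        Cell m S' K.tab (addr L f κ y) (if (y : ℕ) < i ∨ (y : ℕ) = i ∧ (addr L f 0 0 ∈ D)
          then (A.sem ∅ (E y) f κ : ℤ) else 0)) g1 g2 rfl rfl (by decide) rfl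
          (fun D S' v h => h) ?_ ?_ ?_) ?_
      · intro y f hf κ hκ
        have := (h1 y f hf κ hκ).congr k2
        simpa using this
      · rintro a ha D hD haD S₃ hf₃ hxa h2
        obtain ⟨f, hf, κ₀, hκ₀, j₀, hj₀, rfl⟩ := mem_addrBox.1 ha
        obtain rfl : κ₀ = 0 := by omega
        obtain rfl : j₀ = 0 := by omega
        have q0 : Ready S₃ := k0.frame hf₃ rfl
        have q1 : S₃.reg R.x = i := by rw [hf₃.reg _ rfl, k1]
        refine .seq (.assign hB rfl (fun hS => hS.mem _ _) (.seq ((does_decode (f := f) hl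
          (q0.setReg (by decide) _) ?_).conseq fun S₄ hf₄ _ p1 => ?_)))
        · simp only [setReg_reg, reduceIte, eval, hxa]
          simp [addr]
        · have r0 : Ready S₄ := (q0.setReg (by decide) _).frame hf₄ rfl
          refine .seq ((does_checkFits (x := ⟨i, hi⟩) hl r0 p1 ?_).conseq fun S₅ hf₅ _ p2 => ?_)
          · rw [hf₄.reg _ rfl]
            simpa using q1
          · have t0 : Ready S₅ := r0.frame hf₅ rfl
            have t1 : S₅.reg R.x = i := by
              rw [hf₅.reg _ rfl, hf₄.reg _ rfl]
              simpa using q1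
            have t2 : S₅.reg R.df = addr L f 0 0 := by
              rw [hf₅.reg _ rfl, hf₄.reg _ rfl]
              simpa [eval] using hxa
            have t3 : S₅.mem K.tab = S₃.mem K.tab := by
              rw [hf₅.mem _ rfl, hf₄.mem _ rfl]; rfl
            have t4 : S₅.mem K.mulLW i = i * (L * s ^ n) := t0.mulLW _ (by omega)
            refine .store hB rfl rfl (fun hS => hS.reg _) ?_
            intro y g hg κ hκ
            have haddr : eval S₅ (.add (.reg R.df) (.load K.mulLW (.reg R.x))) =
                addr L f 0 i := by
              simp [eval, t1, t2, t4, addr]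
            rw [haddr]
            have hkey : A.sem ∅ (E ⟨i, hi⟩) f 0 = (S₅.reg R.flag : ℕ) := by
              rw [StateSystem.sem_empty, p2]
              simp [hE]
            refine Cell.setMem (y := ((A.sem ∅ (E ⟨i, hi⟩) f 0 : ℤ) : ZMod m)) (fun hne => ?_) ?_ ?_
              (fun heq => ?_)
            · have := (h2 y g hg κ hκ).congr t3
              by_cases hκ0 : κ = 0
              · convert this using 2
                rw [mem_insert, addr_inj hL hL]
                simp only [and_true]
                rw [Ne, addr_inj hκ hL] at hne
                have : (y : ℕ) = i → g ≠ f := fun h h' => hne ⟨h', hκ0, h⟩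
                tauto
              · rw [hz _ _ _ hκ0, ite_self] at this ⊢
                exact this
            · simp only [eval, p2]
              split_ifs <;> omega
            · rw [hkey]
              simp [eval]
            · rw [addr_inj hκ hL] at heq
              obtain ⟨rfl, rfl, hyi⟩ := heq
              obtain rfl : y = ⟨i, hi⟩ := Fin.ext hyi
              rw [if_pos (Or.inr ⟨rfl, mem_insert_self _ _⟩)]
      · rintro S₃ - h2 y g hg κ hκ
        have := (h2 y g hg κ hκ).congr (S' := S₃.setReg R.x (i + 1)) rfl
        convert this using 2
        have h3 : (y : ℕ) = i → addr L g 0 0 ∈ addrBox s L (bag ⟨i, hi⟩) 1 1 := by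
          intro hyi
          obtain rfl : y = ⟨i, hi⟩ := Fin.ext hyi
          exact mem_addrBox.2 ⟨g, hg, 0, by omega, 0, by omega, rfl⟩
        rw [Nat.lt_succ_iff_lt_or_eq]
        by_cases hyi : (y : ℕ) = i
        · simp [hyi, h3 hyi]
        · simp [hyi]
      · exact Nat.add_le_add_right (Nat.mul_le_mul_right _ (hw _)) _
    · rw [bagWithout_of_le le_rfl]
      have := hw ⟨i, hi⟩
      omega
  · rintro S₁ - - h x - f hf κ hκ
    have := h x f hf κ hκ
    rwa [if_pos x.2] at this
  · have hw1 : 1 ≤ w := (Nat.pow_pos (by omega)).trans_le (hw ⟨0, hl.N_pos⟩)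
    have h1 : n * n ≤ n * (n + s) := Nat.mul_le_mul_left _ (by omega)
    have h2 : n * 2 ≤ n * (n + s) := Nat.mul_le_mul_left _ (by omega)
    have h3 : n * s ≤ n * (n + s) := Nat.mul_le_mul_left _ (by omega)
    have h4 : 1 * n ≤ w * n := Nat.mul_le_mul_right _ hw1
    have h5 : n * (s * 6 + 6) + n * (n * 7 + 11) + n * 7 ≤ 40 * (n * (n + s)) := by
      nlinarith
    have h6 : w * (n * (s * 6 + 6) + n * (n * 7 + 11) + n * 7) ≤ w * (40 * (n * (n + s))) :=
      Nat.mul_le_mul_left _ h5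
    have h7 : w * (n * (s * 6 + 6) + n * (n * 7 + 11) + n * 7) =
      w * (n * (s * 6 + 6)) + w * (n * (n * 7 + 11)) + 7 * (w * n) := by ring
    refine Nat.add_le_add_right (Nat.mul_le_mul_left _ ?_) _
    ring_nf at h6 h7 h4 hw1 ⊢
    omega

end InitTables

/-! ### Completing a vertex -/

/-- Complete the vertex in the register `R.fv` in the table of the node in the register `R.fx`. -/
def forgetVertex : Prog :=
  store K.inc (add (load K.mulN (reg R.fx)) (reg R.fv)) (const 0) ;;
  store K.len (reg R.fx) (add (load K.len (reg R.fx)) (const 1)) ;;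
  assign R.bz (reg R.fx) ;;
  assign R.bskip (reg R.n) ;;
  assign R.bq (const 1) ;;
  assign R.br (const 1) ;;
  build ;;
  assign R.tw (load K.powS (reg R.fv)) ;;
  assign R.tq (reg R.s) ;;
  multiples K.dv ;;
  forLoop R.i R.lc
    (forLoop R.k R.L
      (assign R.acc (const 0) ;;
      forLoop R.d R.s
        (branch (load K.wAbs (reg R.d))
          (branch (lt (reg R.k) (load K.inn (reg R.d))) skip
            (assign R.mx (load K.tab (add (add (add (load K.list (reg R.i)) (load K.dv (reg R.d)))
              (load K.mulW (sub (reg R.k) (load K.inn (reg R.d))))) (load K.mulLW (reg R.fx)))) ;;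
            branch (load K.wSgn (reg R.d)) (assign R.mx (sub (reg R.m) (reg R.mx))) skip ;;
            assign R.acc (add (reg R.acc) (reg R.mx)) ;;
            reduce R.acc)) skip) ;;
      store K.tab (add (add (load K.list (reg R.i)) (load K.mulW (reg R.k)))
        (load K.mulLW (reg R.fx))) (reg R.acc)))

/-- The memory contains the tables of the nodes in `X`, where the node `x` has the bag `bag x`, the
completed vertices `F x`, the edges `E x`, and tables of length `len x`. -/
structure Holds (A : StateSystem ρ σ s) (m L : ℕ) (S : Config) (X : Finset (Fin N))
    (bag F : Fin N → Finset (Fin n)) (E : Fin N → Fin n → Fin n → Prop) (len : Fin N → ℕ) :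
    Prop where
  bags : Bags S bag
  lens : ∀ x : Fin N, S.mem K.len x = len x
  alive : ∀ x : Fin N, S.mem K.alive x ≠ 0 ↔ x ∈ X
  tabs : Tables m L S X bag fun x f κ => (A.sem (F x) (E x) f κ : ℤ)

theorem Bags.congr {S S' : Config} {bag : Fin N → Finset (Fin n)} (h : Bags S bag)
    (he : S'.mem K.inc = S.mem K.inc) : Bags S' bag := by
  unfold Bags
  rwa [he]

theorem Tables.congr {S S' : Config} {X : Set (Fin N)} {bag : Fin N → Finset (Fin n)}
    {Z : Fin N → (Fin n → Fin s) → ℕ → ZMod m} (h : Tables m L S X bag Z)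
    (he : S'.mem K.tab = S.mem K.tab) : Tables m L S' X bag Z :=
  fun x hx f hf κ hκ => (h x hx f hf κ hκ).congr he

theorem Holds.congr {S S' : Config} (h : Holds A m L S X bag F E len)
    (h1 : S'.mem K.inc = S.mem K.inc) (h2 : S'.mem K.len = S.mem K.len)
    (h3 : S'.mem K.alive = S.mem K.alive) (h4 : S'.mem K.tab = S.mem K.tab) :
    Holds A m L S' X bag F E len :=
  ⟨h.bags.congr h1, fun x => by rw [h2]; exact h.lens x, fun x => by rw [h3]; exact h.alive x,
    h.tabs.congr h4⟩

theorem mul_add_inj {n N : ℕ} {x y : Fin N} {u v : Fin n} :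
    (x : ℕ) * n + u = y * n + v ↔ x = y ∧ u = v := by
  constructor
  · intro h
    have h0 : 0 < n := Fin.pos u
    have h1 := congrArg (· % n) h
    simp only [Nat.mul_add_mod_self_right, Nat.mod_eq_of_lt u.2, Nat.mod_eq_of_lt v.2] at h1
    rw [h1, Nat.add_right_cancel_iff] at h
    exact ⟨Fin.ext (Nat.eq_of_mul_eq_mul_right h0 h), Fin.ext h1⟩
  · rintro ⟨rfl, rfl⟩
    rfl

-- The routine carries out `sem_insert` within the table itself. The list contains the state
-- functions `f` with `f v = zero`; their cells are overwritten by the signed sums over the states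
-- of `v`, while cells with another state at `v` become irrelevant as `v` leaves the bag. As the
-- weights are `0` and `±1`, no product is needed.
set_option maxHeartbeats 1000000 in
theorem does_forgetVertex (hl : Limits B n N s L J m lb ls) (he : Ready S)
    (hS : Holds A m L S X bag F E len) {x : Fin N} (hxX : x ∈ X)
    (hx : S.reg R.fx = x) {v : Fin n} (hv : v ∈ bag x) (hvF : v ∉ F x) (hfv : S.reg R.fv = v)
    (hlen : len x < L) {w : ℕ} (hw : s ^ (bag x).card ≤ w) :
    Does M B forgetVertex S (200 * (w * L)) fun S' =>
      Holds A m L S' X (update bag x ((bag x).erase v)) (update F x (insert v (F x))) E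
        (update len x (len x + 1)) := by
  have hB := hl.le_B
  have hnB := hl.n_lt
  have hL := hl.L_pos
  have hL4 := hl.L_lt
  have hJ := hl.J_pos
  have hs2 := hl.two_le
  have hm1 := hl.one_lt_m
  have hm2 := hl.two_m
  have hcells := hl.cells
  have hn := hl.n_pos
  have hsn := hl.s_le
  have hpow := hl.pow_lt
  have hNJ : N ≤ J := by have := hl.le_J; omega
  have hlt := hl.lt_L
  set Y := (bag x).erase v with hY
  have hcw : s ^ Y.card * s ≤ w := by
    rw [← pow_succ, hY, card_erase_add_one hv]
    exact hw
  have hc0 : 0 < s ^ Y.card := Nat.pow_pos (by omega)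
  set bag' := update bag x Y with hbag'
  have hbx : bag' x = Y := by simp [hbag']
  have haddr0 : eval S (.add (.load K.mulN (.reg R.fx)) (.reg R.fv)) = x * n + v := by
    simp [eval, hx, hfv, he.mulN x (by omega)]
  set S₁ := S.setMem K.inc (x * n + v) 0 with hS₁
  set S₂ := S₁.setMem K.len x (len x + 1) with hS₂
  have e2 : Ready S₂ := (he.setMem (by decide) _ _).setMem (by decide) _ _
  have hB2 : Bags S₂ bag' := by
    intro y u
    have : S₂.mem K.inc = S₁.mem K.inc := rfl
    rw [this, setMem_mem_self]
    by_cases hyx : y = x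
    · subst hyx
      by_cases huv : u = v
      · simp [huv, hbag', hY]
      · rw [if_neg (fun h => huv (mul_add_inj.1 h).2), hS.bags y u]
        simp [hbag', hY, huv]
    · rw [if_neg (fun h => hyx (mul_add_inj.1 h).1), hS.bags y u]
      simp [hbag', hyx]
  have hlen2 : ∀ y : Fin N, S₂.mem K.len y = update len x (len x + 1) y := by
    intro y
    rw [setMem_mem_self]
    by_cases hyx : y = x
    · simp [hyx]
    · rw [if_neg (fun h => hyx (Fin.ext h)), update_of_ne hyx]
      exact hS.lens y
  refine (Does.seq (τ := 1) (τ' := 1 + (1 + (1 + (1 + (1 + ((n * 7 + 70 * (s ^ Y.card * 1 * 1)) +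
    (1 + (1 + ((s * 4 + 3) + (s ^ Y.card * ((L * ((1 + ((s * ((1 + (1 + 1 + (1 + ((1 + 1 + 1) + (1 + 3)))) +
      1) + 2) + 2) + 1)) + 2) + 2) + 2) + 2)))))))))) (.store hB rfl rfl (by simp [eval]) ?_)).mono ?_
  · rw [haddr0]
    refine .seq (.store hB rfl rfl (fun _ => ?_) ?_)
    · simp only [eval, setMem_reg, hx]
      have : (S.setMem K.inc (x * n + v) 0).mem K.len = S.mem K.len := rfl
      rw [this, hS.lens]
      omega
    · have q1 : (Expr.reg R.fx).eval S₁ = x := by simp [eval, hS₁, hx]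
      have q2 : (Expr.add (.load K.len (.reg R.fx)) (.const 1)).eval S₁ = len x + 1 := by
        simp [eval, hS₁, hx, hS.lens]
      change Does M B _ (S₁.setMem K.len ((Expr.reg R.fx).eval S₁)
        ((Expr.add (.load K.len (.reg R.fx)) (.const 1)).eval S₁)) _ _
      rw [q1, q2]
      change Does M B _ S₂ _ _
      refine .seq (.assign hB rfl (fun hS => hS.reg _) (.seq (.assign hB rfl (fun hS => hS.reg _)
        (.seq (.assign hB rfl (fun hS => Nat.one_lt_two_pow (by omega)) (.seq (.assign hB rfl
        (fun hS => Nat.one_lt_two_pow (by omega)) (.seq (Does.mono (Does.conseq (does_build hl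
          (z := x) (bag := bag') (k := n) (q := 1) (r := 1)
          ((((e2.setReg (by decide) _).setReg (by decide) _).setReg (by decide) _).setReg
            (by decide) _) (by exact hB2) ?_ ?_ ?_ ?_ (by omega) (by omega) (by omega) (by omega)) ?_)
          ?_)))))))))
      · simp [eval, hx, hS₂, hS₁]
      · have := e2.n_eq
        simp [eval, this]
      · simp [eval]
      · simp [eval]
      · rintro S₃ hf₃ - ⟨g1, g2⟩
        rw [bagWithout_of_le le_rfl, hbx] at g1 g2
        simp only [mul_one] at g1 g2
        have k0 : Ready S₃ :=
          ((((e2.setReg (by decide) _).setReg (by decide) _).setReg (by decide) _).setReg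
            (by decide) _).frame hf₃ rfl
        have k1 : S₃.reg R.fx = x := by rw [hf₃.reg _ rfl]; simpa [hS₂, hS₁] using hx
        have k2 : S₃.reg R.fv = v := by rw [hf₃.reg _ rfl]; simpa [hS₂, hS₁] using hfv
        have k3 : S₃.mem K.tab = S.mem K.tab := by rw [hf₃.mem _ rfl]; rfl
        have k4 : S₃.mem K.inc = S₂.mem K.inc := by rw [hf₃.mem _ rfl]; rfl
        have k5 : S₃.mem K.len = S₂.mem K.len := by rw [hf₃.mem _ rfl]; rfl
        have k6 : S₃.mem K.alive = S.mem K.alive := by rw [hf₃.mem _ rfl]; rfl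
        clear_value S₂ S₁
        have hps : s * s ^ (v : ℕ) ≤ s ^ n := by
          rw [mul_comm, ← pow_succ]
          exact Nat.pow_le_pow_right (by omega) v.2
        refine .seq (.assign hB rfl (fun hS => hS.mem _ _) (.seq (.assign hB rfl (fun hS => hS.reg _)
          (.seq ((does_multiples hB (w := s ^ (v : ℕ)) (q := s) ?_ ?_ ?_).conseq ?_)))))
        · simpa [eval, k2] using k0.powS v v.2
        · simpa [eval] using k0.s_eq
        · omega
        · intro S₄ hf₄ _ hdv
          have p0 : Ready S₄ :=
            ((k0.setReg (by decide) _).setReg (by decide) _).frame hf₄ rfl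
          have p1 : S₄.reg R.fx = x := by rw [hf₄.reg _ rfl]; simpa using k1
          have p3 : S₄.mem K.tab = S.mem K.tab := by rw [hf₄.mem _ rfl]; exact k3
          have p4 : S₄.mem K.inc = S₂.mem K.inc := by rw [hf₄.mem _ rfl]; exact k4
          have p5 : S₄.mem K.len = S₂.mem K.len := by rw [hf₄.mem _ rfl]; exact k5
          have p6 : S₄.mem K.alive = S.mem K.alive := by rw [hf₄.mem _ rfl]; exact k6
          have p7 : S₄.reg R.lc = s ^ Y.card := by rw [hf₄.reg _ rfl]; simpa using g1
          have p8 : Enumerates S₄ K.list (s ^ Y.card) (addrBox s L Y 1 1) :=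
            g2.congr (by rw [hf₄.mem _ rfl]; rfl)
          refine Does.forEach (τ := L * ((1 + ((s * ((1 + (1 + 1 + (1 + ((1 + 1 + 1) + (1 + 3)))) + 1)
              + 2) + 2) + 1)) + 2) + 2)
            hB (fun D S' => ∀ y ∈ X, ∀ f, Off (bag y) f → ∀ κ < L,
            Cell m S' K.tab (addr L f κ y) (if y = x ∧ (addr L f 0 0 ∈ D)
            then (A.sem (insert v (F x)) (E x) f κ : ℤ) else (A.sem (F y) (E y) f κ : ℤ)))
            p7 p8 rfl rfl (by decide) rfl (fun D S' v h => h) ?_ ?_ ?_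
          · intro y hy f hf κ hκ
            have := (hS.tabs y hy f hf κ hκ).congr p3
            simpa using this
          · rintro a ha D hD haD S₅ hf₅ hxa h5
            obtain ⟨f, hf, κ₀, hκ₀, j₀, hj₀, rfl⟩ := mem_addrBox.1 ha
            obtain rfl : κ₀ = 0 := by omega
            obtain rfl : j₀ = 0 := by omega
            have hfv0 : f v = A.zero := Fin.ext (by
              rw [A.zero_val]
              exact hf v (by simp [hY]))
            have q0 : Ready S₅ := p0.frame hf₅ rfl
            have q1 : S₅.reg R.fx = x := by rw [hf₅.reg _ rfl, p1]
            have q2 : ∀ d < s, S₅.mem K.dv d = d * s ^ (v : ℕ) := by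
              rw [hf₅.mem _ rfl]; exact hdv
            refine Does.forLoop (n := L) (τ := (1 + ((s * ((1 + (1 + 1 + (1 + ((1 + 1 + 1) + (1 + 3)))) + 1)
              + 2) + 2) + 1)))
              hB (fun k S' => ∀ y ∈ X, ∀ g, Off (bag y) g → ∀ κ < L,
              Cell m S' K.tab (addr L g κ y) (if y = x ∧ (addr L g 0 0 ∈ D ∨ g = f ∧ κ < k)
              then (A.sem (insert v (F x)) (E x) g κ : ℤ) else (A.sem (F y) (E y) g κ : ℤ)))
              q0.L_eq rfl rfl (by decide) ?_ ?_ ?_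
            · intro y hy g hg κ hκ
              have := (h5 y hy g hg κ hκ).congr (S' := S₅.setReg R.k 0) rfl
              simpa only [Nat.not_lt_zero, and_false, or_false] using this
            · rintro k S₆ hk hf₆ hxk h6
              have r0 : Ready S₆ := q0.frame hf₆ rfl
              have r1 : S₆.reg R.fx = x := by rw [hf₆.reg _ rfl, q1]
              have r2 : ∀ d < s, S₆.mem K.dv d = d * s ^ (v : ℕ) := by
                rw [hf₆.mem _ rfl]; exact q2
              have r3 : S₆.mem K.list (S₆.reg R.i) = addr L f 0 0 := by
                rw [hf₆.mem _ rfl, hf₆.reg R.i rfl]; exact hxa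
              set h : Fin s → ℤ := fun d => A.w d *
                (if A.inn d = true then (if k = 0 then 0 else
                  A.sem (F x) (E x) (update f v d) (k - 1))
                  else A.sem (F x) (E x) (update f v d) k) with hh
              refine .seq (.assign hB rfl (by simp [eval]) (.seq (.forLoop
                (τ := 1 + (1 + 1 + (1 + ((1 + 1 + 1) + (1 + 3)))) + 1) (n := s) hB (fun j S' =>
                  S'.reg R.acc < m ∧
                  (S'.reg R.acc : ZMod m) = (∑ d : Fin s, if (d : ℕ) < j then (h d : ZMod m) else 0))
                (by simpa using r0.s_eq) rfl rfl (by decide) ?_ ?_ ?_)))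
              · simp only [setReg_reg, OfNat.ofNat_eq_ofNat, Nat.reduceEqDiff, reduceIte,
                  eval]
                exact ⟨by omega, by simp⟩
              · rintro j S₇ hj hf₇ hxj ⟨c1, c2⟩
                have t0 : Ready S₇ := (r0.setReg (by decide) _).frame hf₇ rfl
                have t1 : S₇.reg R.fx = x := by rw [hf₇.reg _ rfl]; simpa using r1
                have t2 : S₇.mem K.dv j = j * s ^ (v : ℕ) := by
                  rw [hf₇.mem _ rfl]; exact r2 j hj
                have t3 : S₇.mem K.list (S₇.reg R.i) = addr L f 0 0 := by
                  rw [hf₇.mem _ rfl, hf₇.reg R.i rfl]; exact r3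
                have t4 : S₇.reg R.k = k := by rw [hf₇.reg _ rfl]; simpa using hxk
                have t5 : S₇.mem K.tab = S₆.mem K.tab := by rw [hf₇.mem _ rfl]; rfl
                have t6 := t0.inn ⟨j, hj⟩
                have t7 := t0.wAbs ⟨j, hj⟩
                have t8 := t0.wSgn ⟨j, hj⟩
                have t9 : S₇.mem K.mulLW x = x * (L * s ^ n) := t0.mulLW _ (by omega)
                have w1 := A.natAbs_w_le ⟨j, hj⟩
                simp only at t6 t7 t8
                rw [Fin.sum_lt_succ _ hj]
                refine .branch hB rfl (fun hg => .branch hB rfl (fun hg' => .skip ?_)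
                  (fun hg' => .seq (.assign hB rfl (fun hS => hS.mem _ _) ?_)))
                  (fun hg => .skip ?_)
                · simp only [eval, hxj, t4, t6] at hg'
                  have hin : A.inn ⟨j, hj⟩ = true := by
                    by_contra hc
                    simp [hc] at hg'
                  have hk0 : k = 0 := by
                    by_contra hc
                    simp [hin, hc] at hg'
                  have : h ⟨j, hj⟩ = 0 := by simp [hh, hin, hk0]
                  simp only [setReg_reg, OfNat.ofNat_eq_ofNat, Nat.reduceEqDiff, reduceIte,
                    this, Int.cast_zero, add_zero]
                  exact ⟨c1, c2⟩
                · simp only [eval, hxj, t4, t6] at hg'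
                  simp only [eval, hxj, t7] at hg
                  set k' := k - (if A.inn ⟨j, hj⟩ = true then 1 else 0) with hk'
                  have hk'L : k' < L := by omega
                  have hval : h ⟨j, hj⟩ = A.w ⟨j, hj⟩ *
                      A.sem (F x) (E x) (update f v ⟨j, hj⟩) k' := by
                    simp only [hh, hk']
                    by_cases hin : A.inn ⟨j, hj⟩ = true
                    · have : k ≠ 0 := by
                        rintro rfl
                        simp [hin] at hg'
                      simp [hin, this]
                    · simp [hin]
                  have hmx : eval S₇ (.load K.tab (.add (.add (.add (.load K.list (.reg R.i))
                      (.load K.dv (.reg R.d))) (.load K.mulW (.sub (.reg R.k) (.load K.inn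
                      (.reg R.d))))) (.load K.mulLW (.reg R.fx)))) =
                      S₇.mem K.tab (addr L (update f v ⟨j, hj⟩) k' x) := by
                    simp only [eval, hxj, t3, t4, t6, t1, t2, t9, ← hk', t0.mulW k' hk'L]
                    rw [addr_update f v ⟨j, hj⟩ A.zero A.zero_val]
                    have hff : update f v A.zero = f := by rw [← hfv0, update_eq_self]
                    rw [hff]
                    congr 1
                    simp only [addr]
                    ring
                  -- The cell still has its old value. Only cells with state `zero` at `v` are
                  -- overwritten, so this is clear unless the state with index `j` is `zero`. That
                  -- state lies outside the set, hence the size read is `k` itself, whose cell is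
                  -- written only after the summation.
                  have hcell : Cell m S₇ K.tab (addr L (update f v ⟨j, hj⟩) k' x)
                      (A.sem (F x) (E x) (update f v ⟨j, hj⟩) k' : ℤ) := by
                    have := (h6 x hxX (update f v ⟨j, hj⟩)
                      ((hf.mono (erase_subset _ _)).update hv _) k' hk'L).congr t5
                    rwa [if_neg] at this
                    rintro ⟨-, hc | ⟨hc, hc'⟩⟩
                    · obtain ⟨f', hf', κ', hκ', j', hj', he'⟩ := mem_addrBox.1 (hD hc)
                      obtain ⟨rfl, -, -⟩ := (addr_inj (by omega) hL).1 he'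
                      have h1 := hf' v (by simp [hY])
                      rw [update_self] at h1
                      have : (⟨j, hj⟩ : Fin s) = f v := by
                        rw [hfv0]
                        exact Fin.ext (h1.trans A.zero_val.symm)
                      rw [this, update_eq_self] at hc
                      exact haD hc
                    · have h1 : (⟨j, hj⟩ : Fin s) = A.zero := by
                        rw [← hfv0, ← hc, update_self]
                      simp [hk', h1, A.inn_zero] at hc'
                  rw [hmx]
                  have key : ∀ z : ℕ, z ≤ m → (z : ZMod m) = h ⟨j, hj⟩ →
                      Does M B (.assign R.acc (.add (.reg R.acc) (.reg R.mx)) ;; reduce R.acc)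
                      (S₇.setReg R.mx z) (1 + 3) fun S' =>
                        (S'.setReg R.d (j + 1)).reg R.acc < m ∧
                        ((S'.setReg R.d (j + 1)).reg R.acc : ZMod m) =
                        (∑ d : Fin s, if (d : ℕ) < j then (h d : ZMod m) else 0) + h ⟨j, hj⟩ := by
                    intro z hz1 hz2
                    refine .seq (.assign hB rfl ?_ (does_reduce (m := m) hB ?_ ?_ ?_))
                    · simp only [eval, setReg_reg, OfNat.ofNat_eq_ofNat,
                        Nat.reduceEqDiff, reduceIte]
                      omega
                    · simpa using t0.m_eq
                    · simp only [eval, setReg_reg, OfNat.ofNat_eq_ofNat,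
                        Nat.reduceEqDiff, reduceIte]
                      omega
                    · intro y hy1 hy2
                      simp only [eval, setReg_reg, OfNat.ofNat_eq_ofNat,
                        Nat.reduceEqDiff, reduceIte] at hy2 ⊢
                      refine ⟨hy1, ?_⟩
                      rw [hy2, Nat.cast_add, c2, hz2]
                  have hsame : ∀ z z', (S₇.setReg R.mx z).setReg R.mx z' = S₇.setReg R.mx z' := by
                    intro z z'
                    simp [Config.setReg]
                  refine .seq (.branch hB rfl (fun hg₂ => .assign hB rfl
                    (fun hS => lt_of_le_of_lt (Nat.sub_le _ _) (hS.reg _)) ?_) (fun hg₂ => .skip ?_))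
                  · rw [hsame]
                    simp only [eval, setReg_reg, setReg_mem, OfNat.ofNat_eq_ofNat,
                      Nat.reduceEqDiff, reduceIte, hxj, t0.m_eq] at hg₂ ⊢
                    have hw1 : A.w ⟨j, hj⟩ = -1 := by
                      have := t8.1 hg₂
                      omega
                    refine key _ (Nat.sub_le _ _) ?_
                    rw [hval, hw1, Nat.cast_sub hcell.1.le, hcell.2]
                    simp
                  · simp only [eval, setReg_reg, setReg_mem, OfNat.ofNat_eq_ofNat,
                      Nat.reduceEqDiff, reduceIte, hxj] at hg₂
                    have hw1 : A.w ⟨j, hj⟩ = 1 := by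
                      have : ¬ A.w ⟨j, hj⟩ < 0 := fun h' => t8.2 h' hg₂
                      omega
                    refine key _ hcell.1.le ?_
                    rw [hval, hw1, hcell.2, one_mul]
                · simp only [eval, hxj, t7] at hg
                  have : h ⟨j, hj⟩ = 0 := by
                    simp only [hh]
                    rw [Int.natAbs_eq_zero.1 hg, zero_mul]
                  simp only [setReg_reg, OfNat.ofNat_eq_ofNat, Nat.reduceEqDiff, reduceIte,
                    this, Int.cast_zero, add_zero]
                  exact ⟨c1, c2⟩
              · rintro S₇ hf₇ - ⟨c1, c2⟩
                have t0 : Ready S₇ := (r0.setReg (by decide) _).frame hf₇ rfl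
                have t1 : S₇.reg R.fx = x := by rw [hf₇.reg _ rfl]; simpa using r1
                have t3 : S₇.mem K.list (S₇.reg R.i) = addr L f 0 0 := by
                  rw [hf₇.mem _ rfl, hf₇.reg R.i rfl]; exact r3
                have t4 : S₇.reg R.k = k := by rw [hf₇.reg _ rfl]; simpa using hxk
                have t5 : S₇.mem K.tab = S₆.mem K.tab := by rw [hf₇.mem _ rfl]; rfl
                have t9 : S₇.mem K.mulLW x = x * (L * s ^ n) := t0.mulLW _ (by omega)
                refine .store hB rfl rfl (fun hS => hS.reg _) ?_
                have haddr : eval S₇ (.add (.add (.load K.list (.reg R.i)) (.load K.mulW (.reg R.k)))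
                    (.load K.mulLW (.reg R.fx))) = addr L f k x := by
                  simp only [eval, t3, t4, t1, t9, t0.mulW k hk]
                  simp only [addr]
                  ring
                rw [haddr]
                have hsum : (S₇.reg R.acc : ZMod m) = (A.sem (insert v (F x)) (E x) f k : ℤ) := by
                  rw [c2, StateSystem.sem_insert hvF _ hfv0, Int.cast_sum]
                  exact sum_congr rfl fun d _ => if_pos d.2
                intro y hy g hg κ hκ
                change Cell m (S₇.setMem K.tab (addr L f k x) (S₇.reg R.acc)) K.tab _ _
                refine Cell.setMem (y := ((A.sem (insert v (F x)) (E x) f k : ℤ) : ZMod m))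
                  (fun hne => ?_) c1 hsum (fun heq => ?_)
                · have := (h6 y hy g hg κ hκ).congr t5
                  rw [Ne, addr_inj hκ hk] at hne
                  convert this using 2
                  have : y = x → g = f → κ ≠ k := fun h h' h'' => hne ⟨h', h'', congrArg _ h⟩
                  refine and_congr_right fun h => or_congr_right (and_congr_right fun h' => ?_)
                  have := this h h'
                  omega
                · rw [addr_inj hκ hk] at heq
                  obtain ⟨rfl, rfl, hyx⟩ := heq
                  obtain rfl : y = x := Fin.ext hyx
                  rw [if_pos ⟨rfl, Or.inr ⟨rfl, by omega⟩⟩]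
            · rintro S₆ - - h6 y hy g hg κ hκ
              have := h6 y hy g hg κ hκ
              convert this using 2
              rw [mem_insert, addr_inj hL hL]
              simp only [and_true, hκ]
              rw [or_comm]
          · rintro S₅ hf₅ h5
            refine ⟨hB2.congr ?_, fun y => ?_, fun y => ?_, fun y hy f hf κ hκ => ?_⟩
            · rw [hf₅.mem _ rfl, p4]
            · rw [hf₅.mem _ rfl, p5]
              exact hlen2 y
            · rw [hf₅.mem _ rfl, p6]
              exact hS.alive y
            · by_cases hyx : y = x
              · subst hyx
                have := h5 y hy f (hf.mono (by rw [hbx]; exact erase_subset _ _)) κ hκ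
                rw [hbx] at hf
                rw [if_pos ⟨rfl, mem_addrBox.2 ⟨f, hf, 0, by omega, 0, by omega, rfl⟩⟩] at this
                simpa using this
              · have := h5 y hy f (by simpa [hbag', hyx] using hf) κ hκ
                rw [if_neg (fun h => hyx h.1)] at this
                simpa [hyx] using this
      · rw [bagWithout_of_le le_rfl, hbx]
  · set c := s ^ Y.card with hc
    have h1 : c * 2 ≤ c * s := Nat.mul_le_mul_left _ hs2
    have h2 : s ≤ c * s := Nat.le_mul_of_pos_left _ hc0
    have h3 : n ≤ w * L := by nlinarith
    have h4 : w ≤ w * L := Nat.le_mul_of_pos_right _ hL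
    have h5 : c * L * 2 ≤ w * L := by nlinarith
    have h6 : c * L * s ≤ w * L := by nlinarith
    ring_nf at h1 h2 h3 h4 h5 h6 hcw ⊢
    omega

/-! ### Completing several vertices, and loading tables -/

/-- Complete all vertices in the bag of the node in the register `R.px` that are not marked in the
bank `K.keep`. -/
def forgetAll : Prog :=
  assign R.fx (reg R.px) ;;
  forLoop R.h R.n
    (branch (load K.inc (add (load K.mulN (reg R.px)) (reg R.h)))
      (branch (load K.keep (reg R.h)) skip (assign R.fv (reg R.h) ;; forgetVertex)) skip)

/-- Restrict the states with the code in the register `R.df` to the bag of the node in the register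
`R.lz`. -/
def project : Prog :=
  assign R.g (reg R.df) ;;
  assign R.rk (const 0) ;;
  assign R.flag (const 1) ;;
  forLoop R.a R.n
    (assign R.gd (load K.dig (reg R.a)) ;;
    assign R.rk (add (reg R.rk) (load K.cv (reg R.gd))) ;;
    branch (load K.inc (add (load K.mulN (reg R.lz)) (reg R.a))) skip
      (branch (load K.star (reg R.gd)) skip
        (branch (load K.cv (reg R.gd)) (assign R.flag (const 0)) skip) ;;
      forLoop R.gi R.gd (assign R.g (sub (reg R.g) (load K.powS (reg R.a))))))

/-- Write the table of the node in the register `R.lz` into the bank `dst`, for the bag of the node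
in the register `R.ly`, and with one row for each rank. -/
def loadRanked (dst : ℕ) : Prog :=
  assign R.bz (reg R.ly) ;;
  assign R.bskip (reg R.n) ;;
  assign R.bq (reg R.lenz) ;;
  assign R.br (reg R.rr) ;;
  build ;;
  forLoop R.i R.lc (store dst (load K.list (reg R.i)) (const 0)) ;;
  assign R.bq (const 1) ;;
  assign R.br (const 1) ;;
  build ;;
  forLoop R.i R.lc
    (assign R.df (load K.list (reg R.i)) ;;
    decode ;;
    project ;;
    forLoop R.k R.lenz
      (branch (reg R.flag)
        (store dst (add (add (reg R.df) (load K.mulW (reg R.k))) (load K.mulLW (reg R.rk)))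
          (load K.tab (add (add (reg R.g) (load K.mulW (reg R.k))) (load K.mulLW (reg R.lz))))) skip))

/-- Each call scans all `n` vertices, but the expensive term is charged only for the vertices that
are completed. Their number is kept in the bound, because it is amortized over the whole
computation. -/
theorem does_forgetAll (hl : Limits B n N s L J m lb ls) (he : Ready S)
    (hS : Holds A m L S X bag F E len) {x : Fin N} (hxX : x ∈ X)
    (hx : S.reg R.px = x) {Y : Finset (Fin n)} (hY : ∀ v : Fin n, S.mem K.keep v ≠ 0 ↔ v ∈ Y)
    (hF : Disjoint (F x) (bag x)) (hlen : len x + (bag x \ Y).card < L) {w : ℕ}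
    (hw : s ^ (bag x).card ≤ w) :
    Does M B forgetAll S (n * 7 + 3 + (bag x \ Y).card * (200 * (w * L))) fun S' =>
      Holds A m L S' X (update bag x (bag x ∩ Y)) (update F x (F x ∪ (bag x \ Y))) E
        (update len x (len x + (bag x \ Y).card)) := by
  have hB := hl.le_B
  refine (Does.seq (τ := 1) (.assign hB rfl (fun hS => hS.reg _) (.forLoop_amortized (n := n)
    (τ := n * 5 + (bag x \ Y).card * (200 * (w * L))) hB
    (fun i t S' => ∃ Z : Finset (Fin n), Z = (bag x \ Y).filter (fun v : Fin n => (v : ℕ) < i) ∧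
      Holds A m L S' X (update bag x (bag x \ Z)) (update F x (F x ∪ Z)) E
        (update len x (len x + Z.card)) ∧ t ≤ i * 5 + Z.card * (200 * (w * L)))
    (by simpa using he.n_eq) rfl rfl (by decide) ?_ ?_ ?_))).mono (by omega)
  · refine ⟨∅, by simp, ?_, by simp⟩
    simp only [sdiff_empty, union_empty, card_empty, add_zero, update_eq_self]
    exact hS.congr rfl rfl rfl rfl
  · rintro i t S₁ hi hf hxi ⟨Z, hZ, h1, h2⟩
    have e0 : Ready S₁ := (he.setReg (by decide) _).frame hf rfl
    have e1 : S₁.reg R.px = x := by rw [hf.reg _ rfl]; simpa using hx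
    have e2 : S₁.reg R.fx = x := by rw [hf.reg _ rfl]; simpa [eval] using hx
    have e3 : S₁.mem K.keep = S.mem K.keep := by rw [hf.mem _ rfl]; rfl
    have hZsub : Z ⊆ bag x \ Y := by rw [hZ]; exact filter_subset _ _
    have hgood : S₁.mem K.inc (x * n + i) ≠ 0 ↔ (⟨i, hi⟩ : Fin n) ∈ bag x := by
      rw [h1.bags x ⟨i, hi⟩, update_self, hZ]
      simp
    have hval : eval S₁ (.load K.inc (.add (.load K.mulN (.reg R.px)) (.reg R.h))) =
        S₁.mem K.inc (x * n + i) := by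
      simp [eval, e1, hxi, e0.mulN x (by omega)]
    have hskip : (⟨i, hi⟩ : Fin n) ∉ bag x \ Y →
        ∀ t' ≤ t + 5, ∃ Z : Finset (Fin n), Z = (bag x \ Y).filter (fun v : Fin n => (v : ℕ) < i + 1) ∧
        Holds A m L (S₁.setReg R.h (i + 1)) X (update bag x (bag x \ Z)) (update F x (F x ∪ Z)) E
        (update len x (len x + Z.card)) ∧ t' ≤ (i + 1) * 5 + Z.card * (200 * (w * L)) := by
      intro hv t' ht'
      refine ⟨Z, ?_, h1.congr rfl rfl rfl rfl, by omega⟩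
      rw [hZ]
      refine filter_congr fun v hv' => ?_
      have : v ≠ ⟨i, hi⟩ := fun h => hv (h ▸ hv')
      have : (v : ℕ) ≠ i := fun h => this (Fin.ext h)
      omega
    by_cases hib : (⟨i, hi⟩ : Fin n) ∈ bag x
    · by_cases hiY : (⟨i, hi⟩ : Fin n) ∈ Y
      · refine ⟨5, Does.mono (τ := 1 + (1 + 1 + 0) + 1) (.branch hB rfl (fun _ => .branch hB rfl
          (fun _ => .skip (hskip (by simp [hiY]) _ le_rfl)) (fun hg => ?_))
          (fun hg => ?_)) (by norm_num)⟩
        · simp only [eval, hxi, e3] at hg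
          exact absurd hg ((hY ⟨i, hi⟩).2 hiY)
        · rw [hval] at hg
          exact absurd hg (hgood.2 hib)
      · have hmem : (⟨i, hi⟩ : Fin n) ∈ bag x \ Y := by simp [hib, hiY]
        have hiZ : (⟨i, hi⟩ : Fin n) ∉ Z := by simp [hZ]
        have hZ' : insert ⟨i, hi⟩ Z = (bag x \ Y).filter (fun v : Fin n => (v : ℕ) < i + 1) := by
          rw [hZ]
          ext v
          simp only [mem_insert, mem_filter, Fin.ext_iff]
          constructor
          · rintro (h | h)
            · have : v = ⟨i, hi⟩ := Fin.ext h
              rw [this]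
              exact ⟨hmem, by simp⟩
            · exact ⟨h.1, by omega⟩
          · rintro ⟨h, h'⟩
            by_cases hvi : (v : ℕ) = i
            · exact Or.inl hvi
            · exact Or.inr ⟨h, by omega⟩
        have hcard : Z.card + 1 ≤ (bag x \ Y).card := by
          rw [← card_insert_of_notMem hiZ]
          exact card_le_card (insert_subset hmem hZsub)
        refine ⟨200 * (w * L) + 5, Does.mono (τ := 1 + (1 + 1 + (1 + 200 * (w * L))) + 1)
          (.branch hB rfl (fun _ => .branch hB rfl (fun hg => ?_) (fun _ => .seq (.assign hB rfl
          (fun hS => hS.reg _) ((does_forgetVertex (x := x) (v := ⟨i, hi⟩) hl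
          (e0.setReg (by decide) _) (h1.congr rfl rfl rfl rfl) hxX ?_ ?_ ?_ ?_ ?_ ?_).conseq ?_))))
          (fun hg => ?_)) (by omega)⟩
        · simp only [eval, hxi, e3] at hg
          exact absurd ((hY ⟨i, hi⟩).1 hg) hiY
        · simpa using e2
        · simp [hib, hiZ]
        · simp only [update_self, mem_union, hiZ, or_false]
          exact disjoint_right.1 hF hib
        · simp [eval, hxi]
        · simp only [update_self]
          omega
        · simp only [update_self]
          exact (Nat.pow_le_pow_right (by have := hl.two_le; omega)
            (card_le_card sdiff_subset)).trans hw
        · intro S₂ _ _ h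
          simp only [update_idem, update_self] at h
          refine ⟨_, hZ', ?_, ?_⟩
          · rw [sdiff_insert, union_insert, card_insert_of_notMem hiZ,
              ← add_assoc]
            exact h.congr rfl rfl rfl rfl
          · rw [card_insert_of_notMem hiZ, add_mul Z.card 1]
            omega
        · rw [hval] at hg
          exact absurd hg (hgood.2 hib)
    · refine ⟨5, Does.mono (τ := 1 + 0 + 1) (.branch hB rfl (fun hg => ?_)
        (fun hg => .skip (hskip (by simp [hib]) _ le_rfl))) (by norm_num)⟩
      rw [hval] at hg
      exact absurd (hgood.1 hg) hib
  · rintro t S₁ - - ⟨Z, hZ, h1, h2⟩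
    obtain rfl : Z = bag x \ Y := by
      rw [hZ]
      exact filter_true_of_mem fun v _ => v.2
    rw [sdiff_sdiff_self_left] at h1
    exact ⟨h1, h2⟩

/-- The code of the restricted states arises by removing the digits outside the bag; a digit is
removed by subtracting the power of `s` as many times as the digit says. The flag records the
condition of `sem_restrict` that the removed states allow the count 0. -/
theorem does_project (hl : Limits B n N s L J m lb ls) (he : Ready S)
    {bag : Fin N → Finset (Fin n)} (hbag : Bags S bag) {f : Fin n → Fin s}
    (hdig : ∀ v : Fin n, S.mem K.dig v = f v) (hdf : S.reg R.df = code f) {z : Fin N}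
    (hz : S.reg R.lz = z) (hrk : A.rank f < J) :
    Does M B project S (n * (s * 3 + 14) + 5) fun S' => S'.reg R.rk = A.rank f ∧
      S'.reg R.g = code (fun v => if v ∈ bag z then f v else A.zero) ∧
      (S'.reg R.flag ≠ 0 ↔ ∀ v ∉ bag z, A.Fits (f v) 0) := by
  have hB := hl.le_B
  have hs2 := hl.two_le
  have hJ4 := hl.J_lt
  have hfits : ∀ v, A.Fits (f v) 0 ↔ A.star (f v) = true ∨ A.cv (f v) = 0 := fun v => Iff.rfl
  refine (Does.seq (τ := 1) (.assign hB rfl (fun hS => hS.reg _) (.seq (τ := 1) (.assign hB rfl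
    (by simp [eval]) (.seq (τ := 1) (.assign hB rfl (fun _ => Nat.one_lt_two_pow (by omega))
    (.forLoop (n := n) (τ := 1 + (1 + (1 + 1 + (((1 + 1 + (1 + 1 + 1))) + (s * (1 + 2) + 2))))) hB
      (fun i S' => S'.reg R.rk = (∑ v : Fin n, if (v : ℕ) < i then A.cv (f v) else 0) ∧
        S'.reg R.g + (∑ v : Fin n, if (v : ℕ) < i then
          (if v ∈ bag z then 0 else (f v : ℕ) * s ^ (v : ℕ)) else 0) = code f ∧
        (S'.reg R.flag ≠ 0 ↔ ∀ v : Fin n, (v : ℕ) < i → v ∉ bag z → A.Fits (f v) 0))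
      (by simpa using he.n_eq) rfl rfl (by decide) ?_ ?_ ?_))))))).mono (by ring_nf; omega)
  · simp [eval, hdf]
  · rintro i S₁ hi hf hxi ⟨h1, h2, h3⟩
    have e0 : Ready S₁ :=
      (((he.setReg (by decide) _).setReg (by decide) _).setReg (by decide) _).frame hf rfl
    have e1 : S₁.reg R.lz = z := by rw [hf.reg _ rfl]; simpa using hz
    have e2 : S₁.mem K.dig i = f ⟨i, hi⟩ := by rw [hf.mem _ rfl]; exact hdig ⟨i, hi⟩
    have e3 : S₁.mem K.inc (z * n + i) ≠ 0 ↔ (⟨i, hi⟩ : Fin n) ∈ bag z := by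
      rw [hf.mem _ rfl]; exact hbag z ⟨i, hi⟩
    have e4 := e0.cv (f ⟨i, hi⟩)
    have e5 := e0.star (f ⟨i, hi⟩)
    have e6 : S₁.mem K.mulN z = z * n := e0.mulN _ (by omega)
    rw [Fin.sum_lt_succ _ hi, Fin.sum_lt_succ _ hi]
    have hall : (∀ v : Fin n, (v : ℕ) < i + 1 → v ∉ bag z → A.Fits (f v) 0) ↔
        (∀ v : Fin n, (v : ℕ) < i → v ∉ bag z → A.Fits (f v) 0) ∧
          ((⟨i, hi⟩ : Fin n) ∉ bag z → A.Fits (f ⟨i, hi⟩) 0) := by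
      constructor
      · exact fun h => ⟨fun u hu => h u (by omega), h _ (by simp)⟩
      · rintro ⟨h, h'⟩ u hu
        rcases Nat.lt_succ_iff_lt_or_eq.1 hu with hu | hu
        · exact h u hu
        · rwa [show u = ⟨i, hi⟩ from Fin.ext hu]
    have hle : (∑ v : Fin n, if (v : ℕ) < i then A.cv (f v) else 0) + A.cv (f ⟨i, hi⟩) ≤
        A.rank f := by
      rw [← Fin.sum_lt_succ (fun v => A.cv (f v)) hi]
      exact sum_le_sum fun v _ => by split_ifs <;> omega
    have hval : eval S₁ (.add (.reg R.rk) (.load K.cv (.load K.dig (.reg R.a)))) =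
        (∑ v : Fin n, if (v : ℕ) < i then A.cv (f v) else 0) + A.cv (f ⟨i, hi⟩) := by
      simp [eval, hxi, e2, e4, h1]
    set S₂ := (S₁.setReg R.gd (f ⟨i, hi⟩)).setReg R.rk
      ((∑ v : Fin n, if (v : ℕ) < i then A.cv (f v) else 0) + A.cv (f ⟨i, hi⟩)) with hS₂
    refine .seq (.assign hB rfl (fun hS => hS.mem _ _) (.seq (.assign hB rfl (fun _ => ?_) ?_)))
    · simp only [eval, setReg_reg, setReg_mem, OfNat.ofNat_eq_ofNat,
        Nat.reduceEqDiff, reduceIte, hxi, e2, e4, h1]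
      omega
    · have hS' : ((S₁.setReg R.gd ((Expr.load K.dig (.reg R.a)).eval S₁)).setReg R.rk
        ((Expr.add (.reg R.rk) (.load K.cv (.reg R.gd))).eval
          (S₁.setReg R.gd ((Expr.load K.dig (.reg R.a)).eval S₁)))) = S₂ := by
        simp only [eval, setReg_reg, setReg_mem, OfNat.ofNat_eq_ofNat,
          Nat.reduceEqDiff, reduceIte, hxi, e2, e4, h1, hS₂]
      rw [hS']
      have a1 : S₂.reg R.lz = z := by simpa [hS₂] using e1
      have a2 : S₂.reg R.a = i := by simpa [hS₂] using hxi
      have a3 : S₂.reg R.gd = f ⟨i, hi⟩ := by simp [hS₂]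
      have a4 : S₂.reg R.g = S₁.reg R.g := by simp [hS₂]
      have a5 : S₂.reg R.flag = S₁.reg R.flag := by simp [hS₂]
      have a6 : S₂.reg R.rk = (∑ v : Fin n, if (v : ℕ) < i then A.cv (f v) else 0) +
        A.cv (f ⟨i, hi⟩) := by simp [hS₂]
      have a7 : S₂.mem = S₁.mem := rfl
      clear_value S₂
      refine .branch hB rfl (fun hg => .skip ?_) (fun hg => .seq (Does.conseq (post := fun S' =>
        S'.reg R.gd = f ⟨i, hi⟩ ∧ S'.reg R.g = S₁.reg R.g ∧ S'.reg R.a = i ∧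
        S'.mem = S₁.mem ∧ S'.reg R.rk = S₂.reg R.rk ∧
        (S'.reg R.flag ≠ 0 ↔ S₁.reg R.flag ≠ 0 ∧ A.Fits (f ⟨i, hi⟩) 0)) ?_ ?_))
      · have hmem : (⟨i, hi⟩ : Fin n) ∈ bag z := by
          rw [← e3]
          simpa [eval, a1, a2, a7, e6] using hg
        simp only [setReg_reg, OfNat.ofNat_eq_ofNat, Nat.reduceEqDiff, reduceIte, a6, a4, a5,
          hmem, if_true, add_zero, hall, not_true, false_imp_iff, and_true]
        exact ⟨trivial, h2, h3⟩
      · refine .branch hB rfl (fun hg' => .skip ?_) (fun hg' => .branch hB rfl (fun hg'' =>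
          .assign hB rfl (by simp [eval]) ?_) (fun hg'' => .skip ?_))
        · simp only [eval, a3, a7] at hg'
          simp [a3, a4, a2, a7, a5, hfits, e5.1 hg']
        · simp only [eval, a3, a7, e4] at hg' hg''
          have : A.star (f ⟨i, hi⟩) = false := by
            by_contra hc
            exact e5.2 (by simpa using hc) hg'
          simp [eval, a3, a4, a2, a7, a6, hfits, this, hg'']
        · simp only [eval, a3, a7, e4] at hg''
          simp [a3, a4, a2, a7, a5, hfits, hg'']
      · rintro S₃ - - ⟨b1, b2, b3, b4, b5, b6⟩
        have hmem : (⟨i, hi⟩ : Fin n) ∉ bag z := by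
          rw [← e3]
          simpa [eval, a1, a2, a7, e6] using hg
        have hp : S₁.mem K.powS i = s ^ i := e0.powS i hi
        refine Does.mono (Does.forLoop (τ := 1) (n := f ⟨i, hi⟩) hB (fun j S' =>
          S'.reg R.g = S₁.reg R.g - j * s ^ i ∧ S'.reg R.rk = S₂.reg R.rk ∧
          S'.reg R.flag = S₃.reg R.flag) b1 rfl rfl (by decide) ?_ ?_ ?_) ?_
        · simp [b2, b5]
        · rintro j S₄ hj hf₄ - ⟨c1, c2, c3⟩
          have d1 : S₄.reg R.a = i := by rw [hf₄.reg _ rfl, b3]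
          have d2 : S₄.mem K.powS i = s ^ i := by rw [hf₄.mem _ rfl, b4, hp]
          refine .assign hB rfl (fun hS => lt_of_le_of_lt (Nat.sub_le _ _) (hS.reg _)) ?_
          simp only [setReg_reg, OfNat.ofNat_eq_ofNat, Nat.reduceEqDiff, reduceIte,
            eval, c1, c2, c3, d1, d2, and_true]
          rw [Nat.sub_sub]
          congr 1
          ring
        · rintro S₄ - - ⟨c1, c2, c3⟩
          simp only [setReg_reg, OfNat.ofNat_eq_ofNat, Nat.reduceEqDiff, c1, c2,
            c3, a6, hmem, if_false, hall, not_false_eq_true, true_imp_iff]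
          refine ⟨trivial, ?_, ?_⟩
          · have : (∑ v : Fin n, if (v : ℕ) < i then
                (if v ∈ bag z then 0 else (f v : ℕ) * s ^ (v : ℕ)) else 0) +
                (f ⟨i, hi⟩ : ℕ) * s ^ i ≤ code f := by
              have := Fin.sum_lt_succ (fun v : Fin n => if v ∈ bag z then 0 else
                (f v : ℕ) * s ^ (v : ℕ)) hi
              simp only [hmem, if_false] at this
              rw [← this]
              exact sum_le_sum fun v _ => by split_ifs <;> omega
            omega
          · rw [b6, h3]
        · have := (f ⟨i, hi⟩).2
          omega
  · rintro S₁ - - ⟨h1, h2, h3⟩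
    refine ⟨?_, ?_, ?_⟩
    · rw [h1]
      exact sum_congr rfl fun v _ => if_pos v.2
    · have hc : code (fun v => if v ∈ bag z then f v else A.zero) + (∑ v : Fin n, if (v : ℕ) < n then
          (if v ∈ bag z then 0 else (f v : ℕ) * s ^ (v : ℕ)) else 0) = code f := by
        rw [code, code, ← sum_add_distrib]
        refine sum_congr rfl fun v _ => ?_
        rw [if_pos v.2]
        split_ifs
        · simp
        · simp [A.zero_val]
      omega
    · rw [h3]
      exact ⟨fun h v hv => h v v.2 hv, fun h v _ hv => h v hv⟩

-- The bank is first cleared on all rows. Each state function is then written into the single row of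
-- its rank, so the rows are the homogeneous parts needed in `mix_extract`. The value for the bag of
-- `y` is read off the table of `z` by `sem_restrict`.
set_option maxHeartbeats 1000000 in
open scoped Classical in
theorem does_loadRanked (hl : Limits B n N s L J m lb ls) (he : Ready S)
    (hS : Holds A m L S X bag F E len) {dst : ℕ} (hd : dst = K.wA ∨ dst = K.wB)
    {z y : Fin N} (hzX : z ∈ X) (hz : S.reg R.lz = z) (hy : S.reg R.ly = y) {q r : ℕ}
    (hq : S.reg R.lenz = q) (hr : S.reg R.rr = r) (hq0 : 0 < q) (hqL : q ≤ L) (hr0 : 0 < r)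
    (hrJ : r ≤ J) (hrank : ∀ f, Off (bag y) f → A.rank f < r)
    (hE : ∀ u v, E z u v → (u ∈ F z ∨ u ∈ bag z) ∧ (v ∈ F z ∨ v ∈ bag z))
    (hF : Disjoint (F z) (bag y)) {w : ℕ}
    (hw : s ^ (bag y).card ≤ w) :
    Does M B (loadRanked dst) S (w * (200 * (q * r) + 30 * (n * s))) fun S' =>
      ∀ f, Off (bag y) f → ∀ κ < q, ∀ j < r, Cell m S' dst (addr L f κ j)
        (if A.rank f = j then (A.sem (F z) (E z) f κ : ℤ) else 0) := by
  have hB := hl.le_B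
  have hL := hl.L_pos
  have hJ := hl.J_pos
  have hs2 := hl.two_le
  have hm1 := hl.one_lt_m
  have hn := hl.n_pos
  have hNJ : N ≤ J := by have := hl.le_J; omega
  set c := s ^ (bag y).card with hc
  have hc0 : 0 < c := Nat.pow_pos (by omega)
  refine Does.mono (τ := 1 + (1 + (1 + (1 + ((n * 7 + 70 * (c * q * r)) + ((c * q * r * (1 + 2) + 2) +
    (1 + (1 + ((n * 7 + 70 * (c * 1 * 1)) + (c * ((1 + ((n * (s * 6 + 6) + 3) + ((n * (s * 3 + 14) + 5) +
    (q * ((1 + 1 + 1) + 2) + 2)))) + 2) + 2)))))))))) (.seq (.assign hB rfl (fun hS => hS.reg _) (.seq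
    (.assign hB rfl (fun hS => hS.reg _) (.seq (.assign hB rfl (fun hS => hS.reg _) (.seq
    (.assign hB rfl (fun hS => hS.reg _) (.seq (Does.mono (Does.conseq (does_build hl
      (z := y) (bag := bag) (k := n) (q := q) (r := r)
      ((((he.setReg (by decide) _).setReg (by decide) _).setReg (by decide) _).setReg
        (by decide) _) (by exact hS.bags) ?_ ?_ ?_ ?_ hq0 hqL hr0 hrJ) ?_) ?_)))))))))) ?_
  · simp [eval, hy]
  · simp [eval, he.n_eq]
  · simp [eval, hq]
  · simp [eval, hr]
  · rintro S₁ hf₁ - ⟨g1, g2⟩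
    rw [bagWithout_of_le le_rfl] at g1 g2
    have k0 : Ready S₁ :=
      ((((he.setReg (by decide) _).setReg (by decide) _).setReg (by decide) _).setReg
        (by decide) _).frame hf₁ rfl
    have k1 : S₁.reg R.lz = z := by rw [hf₁.reg _ rfl]; simpa using hz
    have k2 : S₁.reg R.ly = y := by rw [hf₁.reg _ rfl]; simpa using hy
    have k3 : S₁.reg R.bz = y := by rw [hf₁.reg _ rfl]; simpa [eval] using hy
    have k4 : S₁.reg R.bskip = n := by rw [hf₁.reg _ rfl]; simpa [eval] using he.n_eq
    have k5 : S₁.reg R.lenz = q := by rw [hf₁.reg _ rfl]; simpa using hq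
    have k6 : Holds A m L S₁ X bag F E len := by
      refine hS.congr ?_ ?_ ?_ ?_ <;> rw [hf₁.mem _ rfl] <;> rfl
    refine .seq ((Does.forEach hB (fun D S' => ∀ a ∈ D, S'.mem dst a = 0) g1 g2 rfl rfl (by decide)
      (by rcases hd with rfl | rfl <;> rfl) (fun D S' v h => h) (by simp) ?_
      (fun S' _ h => h)).conseq ?_)
    · rintro a ha D hD haD S₂ hf₂ hxa h2
      refine .store hB rfl rfl (by simp [eval]) ?_
      intro b hb
      rw [setMem_mem_self]
      split_ifs with hab
      · rfl
      · refine h2 b ?_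
        rcases mem_insert.1 hb with h | h
        · exact absurd (h.trans hxa.symm) hab
        · exact h
    · intro S₂ hf₂ _ hzero
      have p0 : Ready S₂ :=
        k0.frame hf₂ (by rcases hd with rfl | rfl <;> rfl)
      have p1 : S₂.reg R.lz = z := by rw [hf₂.reg _ rfl, k1]
      have p3 : S₂.reg R.bz = y := by rw [hf₂.reg _ rfl, k3]
      have p4 : S₂.reg R.bskip = n := by rw [hf₂.reg _ rfl, k4]
      have p5 : S₂.reg R.lenz = q := by rw [hf₂.reg _ rfl, k5]
      have p6 : Holds A m L S₂ X bag F E len := by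
        refine k6.congr ?_ ?_ ?_ ?_ <;> rw [hf₂.mem _ (by rcases hd with rfl | rfl <;> rfl)]
      refine .seq (.assign hB rfl (fun hS => Nat.one_lt_two_pow (by omega)) (.seq (.assign hB rfl
        (fun hS => Nat.one_lt_two_pow (by omega)) (.seq (Does.mono (Does.conseq (does_build hl
          (z := y) (bag := bag) (k := n) (q := 1) (r := 1)
          ((p0.setReg (by decide) _).setReg (by decide) _) (by exact p6.bags) ?_ ?_ ?_ ?_
          (by omega) (by omega) (by omega) (by omega)) ?_) ?_)))))
      · simpa using p3
      · simpa using p4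
      · simp [eval]
      · simp [eval]
      · rintro S₃ hf₃ - ⟨a1, a2⟩
        rw [bagWithout_of_le le_rfl] at a1 a2
        simp only [mul_one] at a1 a2
        have q0 : Ready S₃ :=
          ((p0.setReg (by decide) _).setReg (by decide) _).frame hf₃ rfl
        have q1 : S₃.reg R.lz = z := by rw [hf₃.reg _ rfl]; simpa using p1
        have q5 : S₃.reg R.lenz = q := by rw [hf₃.reg _ rfl]; simpa using p5
        have q6 : Holds A m L S₃ X bag F E len := by
          refine p6.congr ?_ ?_ ?_ ?_ <;> rw [hf₃.mem _ rfl] <;> rfl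
        have q7 : S₃.mem dst = S₂.mem dst := by
          rcases hd with rfl | rfl <;> (rw [hf₃.mem _ rfl]; rfl)
        refine Does.forEach (τ := (1 + ((n * (s * 6 + 6) + 3) + ((n * (s * 3 + 14) + 5) +
            (q * ((1 + 1 + 1) + 2) + 2))))) hB
          (fun D S' => ∀ f, Off (bag y) f → ∀ κ < q, ∀ j < r, Cell m S' dst (addr L f κ j)
            (if A.rank f = j ∧ addr L f 0 0 ∈ D then (A.sem (F z) (E z) f κ : ℤ) else 0))
          a1 a2 rfl rfl (by decide) (by rcases hd with rfl | rfl <;> rfl)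
          (fun D S' v h => h) ?_ ?_ ?_
        · intro f hf κ hκ j hj
          have h0 := hzero _ (mem_addrBox.2 ⟨f, hf, κ, hκ, j, hj, rfl⟩)
          rw [← q7] at h0
          simp only [notMem_empty, and_false, if_false]
          exact ⟨by omega, by rw [h0]; simp⟩
        · rintro a ha D hD haD S₄ hf₄ hxa h4
          obtain ⟨f, hf, κ₀, hκ₀, j₀, hj₀, rfl⟩ := mem_addrBox.1 ha
          obtain rfl : κ₀ = 0 := by omega
          obtain rfl : j₀ = 0 := by omega
          have r0 : Ready S₄ :=
            q0.frame hf₄ (by rcases hd with rfl | rfl <;> rfl)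
          have r1 : S₄.reg R.lz = z := by rw [hf₄.reg _ rfl, q1]
          have r5 : S₄.reg R.lenz = q := by rw [hf₄.reg _ rfl, q5]
          have r6 : Holds A m L S₄ X bag F E len := by
            refine q6.congr ?_ ?_ ?_ ?_ <;> rw [hf₄.mem _ (by rcases hd with rfl | rfl <;> rfl)]
          refine .seq (.assign hB rfl (fun hS => hS.mem _ _) (.seq ((does_decode (f := f) hl
            (r0.setReg (by decide) _) ?_).conseq fun S₅ hf₅ _ hdig => ?_)))
          · simp only [setReg_reg, reduceIte, eval, hxa]
            simp [addr]
          · have t0 : Ready S₅ := (r0.setReg (by decide) _).frame hf₅ rfl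
            have t1 : S₅.reg R.lz = z := by rw [hf₅.reg _ rfl]; simpa using r1
            have t2 : S₅.reg R.df = addr L f 0 0 := by
              rw [hf₅.reg _ rfl]; simpa [eval] using hxa
            have t5 : S₅.reg R.lenz = q := by rw [hf₅.reg _ rfl]; simpa using r5
            have t6 : Holds A m L S₅ X bag F E len := by
              refine r6.congr ?_ ?_ ?_ ?_ <;> rw [hf₅.mem _ rfl] <;> rfl
            have t7 : S₅.mem dst = S₄.mem dst := by
              rcases hd with rfl | rfl <;> (rw [hf₅.mem _ rfl]; rfl)
            refine .seq ((does_project (f := f) hl t0 t6.bags hdig (by rw [t2]; simp [addr]) t1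
              (by have := hrank f hf; omega)).conseq ?_)
            rintro S₆ hf₆ - ⟨b1, b2, b3⟩
            have u0 : Ready S₆ := t0.frame hf₆ rfl
            have u1 : S₆.reg R.lz = z := by rw [hf₆.reg _ rfl, t1]
            have u2 : S₆.reg R.df = addr L f 0 0 := by rw [hf₆.reg _ rfl, t2]
            have u5 : S₆.reg R.lenz = q := by rw [hf₆.reg _ rfl, t5]
            have u6 : Holds A m L S₆ X bag F E len := by
              refine t6.congr ?_ ?_ ?_ ?_ <;> rw [hf₆.mem _ rfl]
            have u7 : S₆.mem dst = S₄.mem dst := by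
              rw [← t7]
              rcases hd with rfl | rfl <;> rw [hf₆.mem _ rfl]
            set f' : Fin n → Fin s := fun v => if v ∈ bag z then f v else A.zero with hf'
            have hOff' : Off (bag z) f' := by
              intro v hv
              simp [hf', hv, A.zero_val]
            -- States at the completed vertices are `zero`, which allows the count 0, so the
            -- condition of `sem_restrict` may be tested at all vertices outside the bag, as the
            -- flag does.
            have hsem : ∀ κ, A.sem (F z) (E z) f κ =
                if S₆.reg R.flag ≠ 0 then A.sem (F z) (E z) f' κ else 0 := by
              intro κ
              have hfF : ∀ v ∈ F z, f v = A.zero := fun v hv => Fin.ext (by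
                rw [A.zero_val]
                exact hf v (disjoint_left.1 hF hv))
              rw [StateSystem.sem_restrict hE f hfF κ]
              refine if_congr ?_ rfl rfl
              rw [b3]
              constructor
              · intro h v hv
                by_cases hvF : v ∈ F z
                · rw [hfF v hvF]
                  exact StateSystem.fits_zero
                · exact h v hvF hv
              · exact fun h v _ hv => h v hv
            refine Does.forLoop (n := q) (τ := 1 + 1 + 1) hB (fun k S' =>
              ∀ g, Off (bag y) g → ∀ κ < q, ∀ j < r, Cell m S' dst (addr L g κ j)
              (if A.rank g = j ∧ (addr L g 0 0 ∈ D ∨ g = f ∧ κ < k) then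
                (A.sem (F z) (E z) g κ : ℤ) else 0))
              u5 rfl rfl (by decide) ?_ ?_ ?_
            · intro g hg κ hκ j hj
              have := (h4 g hg κ hκ j hj).congr (S' := S₆.setReg R.k 0) u7
              simpa only [Nat.not_lt_zero, and_false, or_false] using this
            · rintro k S₇ hk hf₇ hxk h7
              have v0 : Ready S₇ :=
                u0.frame hf₇ (by rcases hd with rfl | rfl <;> rfl)
              have v1 : S₇.reg R.lz = z := by rw [hf₇.reg _ rfl, u1]
              have v2 : S₇.reg R.df = addr L f 0 0 := by rw [hf₇.reg _ rfl, u2]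
              have v3 : S₇.reg R.rk = A.rank f := by rw [hf₇.reg _ rfl, b1]
              have v4 : S₇.reg R.g = code f' := by rw [hf₇.reg _ rfl, b2]
              have v5 : S₇.reg R.flag = S₆.reg R.flag := hf₇.reg _ rfl
              have v6 : S₇.mem K.tab = S₆.mem K.tab := 
                hf₇.mem _ (by rcases hd with rfl | rfl <;> rfl)
              have hkL : k < L := by omega
              have v7 := v0.mulW k hkL
              have v8 : S₇.mem K.mulLW z = z * (L * s ^ n) := v0.mulLW _ (by omega)
              have v9 : S₇.mem K.mulLW (A.rank f) = A.rank f * (L * s ^ n) :=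
                v0.mulLW _ (by have := hrank f hf; omega)
              refine .branch hB rfl (fun hg => .store hB rfl rfl (fun hS => hS.mem _ _) ?_)
                (fun hg => .skip ?_)
              · have haddr : eval S₇ (.add (.add (.reg R.df) (.load K.mulW (.reg R.k)))
                    (.load K.mulLW (.reg R.rk))) = addr L f k (A.rank f) := by
                  simp only [eval, v2, v3, hxk, v7, v9]
                  simp [addr]
                have hval : eval S₇ (.load K.tab (.add (.add (.reg R.g) (.load K.mulW (.reg R.k)))
                    (.load K.mulLW (.reg R.lz)))) = S₇.mem K.tab (addr L f' k z) := by
                  simp only [eval, v1, v4, hxk, v7, v8]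
                  simp [addr]
                simp only [eval, v5] at hg
                have hcell := (u6.tabs z hzX f' hOff' k hkL).congr v6
                have hcell2 : (S₇.mem K.tab (addr L f' k z) : ZMod m) =
                    (A.sem (F z) (E z) f k : ℤ) := by
                  rw [hcell.2, hsem k, if_pos hg]
                rw [haddr, hval]
                intro g hg κ hκ j hj
                change Cell m (S₇.setMem dst (addr L f k (A.rank f)) (S₇.mem K.tab (addr L f' k z)))
                  dst _ _
                refine Cell.setMem (fun hne => ?_) hcell.1 hcell2 (fun heq => ?_)
                · have := h7 g hg κ hκ j hj
                  rw [Ne, addr_inj (by omega) hkL] at hne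
                  convert this using 2
                  refine and_congr_right fun h => or_congr_right (and_congr_right fun h' => ?_)
                  have : κ ≠ k := fun h'' => hne ⟨h', h'', by rw [← h, h']⟩
                  omega
                · rw [addr_inj (by omega) hkL] at heq
                  obtain ⟨rfl, rfl, rfl⟩ := heq
                  rw [if_pos ⟨rfl, Or.inr ⟨rfl, by omega⟩⟩]
              · simp only [eval, v5] at hg
                intro g hg' κ hκ j hj
                have := (h7 g hg' κ hκ j hj).congr (S' := S₇.setReg R.k (k + 1)) rfl
                by_cases hgf : g = f
                · have hs0 : A.sem (F z) (E z) g κ = 0 := by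
                    rw [hgf, hsem κ, if_neg (not_not.2 hg)]
                  rw [hs0] at this ⊢
                  simpa only [Int.cast_zero, ite_self] using this
                · simpa only [hgf, false_and] using this
            · rintro S₇ - - h7 g hg κ hκ j hj
              have := h7 g hg κ hκ j hj
              convert this using 2
              rw [mem_insert, addr_inj hL hL]
              simp only [and_true, hκ]
              rw [or_comm]
        · intro S₄ _ h4 f hf κ hκ j hj
          have := h4 f hf κ hκ j hj
          simpa only [mem_addrBox.2 ⟨f, hf, 0, Nat.one_pos, 0, Nat.one_pos, rfl⟩, and_true] using this
      · rw [bagWithout_of_le le_rfl]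
  · rw [bagWithout_of_le le_rfl]
  · have h1 : c * q * r ≤ w * (q * r) := by
      rw [mul_assoc]
      exact Nat.mul_le_mul_right _ hw
    have h2 : 1 ≤ q * r := Nat.mul_pos hq0 hr0
    have h3 : w * 1 ≤ w * (q * r) := Nat.mul_le_mul_left _ h2
    have h4 : n * 2 ≤ n * s := Nat.mul_le_mul_left _ hs2
    have h5 : c * (n * s) ≤ w * (n * s) := Nat.mul_le_mul_right _ hw
    have h6 : c * q ≤ c * q * r := Nat.le_mul_of_pos_right _ hr0
    have h7 : c * (n * 2) ≤ c * (n * s) := Nat.mul_le_mul_left _ h4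
    have h8 : n ≤ c * n := Nat.le_mul_of_pos_left _ hc0
    ring_nf at h1 h2 h3 h4 h5 h6 h7 h8 ⊢
    omega

/-! ### Applying a matrix to the states -/

/-- Apply the matrix in the banks `ab` and `sg` to the state of one vertex. -/
def transform (work ab sg : ℕ) : Prog :=
  forLoop R.i R.lc
    (forLoop R.l R.s
      (assign R.acc (const 0) ;;
      forLoop R.d R.s
        (assign R.mx (load work (add (load K.list (reg R.i)) (load K.dv (reg R.d)))) ;;
        assign R.my (load ab (add (load K.mulS (reg R.l)) (reg R.d))) ;;
        assign R.sg (load sg (add (load K.mulS (reg R.l)) (reg R.d))) ;;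
        assign R.ml (reg R.sbits) ;;
        mulAcc) ;;
      store K.tmp (reg R.l) (reg R.acc)) ;;
    forLoop R.l R.s
      (store work (add (load K.list (reg R.i)) (load K.dv (reg R.l))) (load K.tmp (reg R.l))))

/-- Apply the matrix in the banks `ab` and `sg` to the states of all vertices in the bag of the node
in the register `R.ly`. -/
def mixAll (work ab sg : ℕ) : Prog :=
  forLoop R.xv R.n
    (branch (load K.inc (add (load K.mulN (reg R.ly)) (reg R.xv)))
      (assign R.tw (load K.powS (reg R.xv)) ;;
      assign R.tq (reg R.s) ;;
      multiples K.dv ;;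
      assign R.bz (reg R.ly) ;;
      assign R.bskip (reg R.xv) ;;
      assign R.bq (reg R.xq) ;;
      assign R.br (reg R.xr) ;;
      build ;;
      transform work ab sg) skip)

/-- The banks `ab` and `sg` hold the matrix to be applied to the bank `work`. -/
def MatrixBanks (A : StateSystem ρ σ s) (work ab sg : ℕ) (Q : Matrix (Fin s) (Fin s) ℤ) : Prop :=
  (work = K.wA ∧ ab = K.fwdAbs ∧ sg = K.fwdSgn ∧ Q = A.evalMatrix) ∨
  (work = K.wB ∧ ab = K.fwdAbs ∧ sg = K.fwdSgn ∧ Q = A.evalMatrix) ∨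
  (work = K.wC ∧ ab = K.invAbs ∧ sg = K.invSgn ∧ Q = A.invMatrix)

theorem MatrixBanks.entries {work ab sg : ℕ} {Q : Matrix (Fin s) (Fin s) ℤ}
    (hd : MatrixBanks A work ab sg Q) (he : Ready S) (l d : Fin s) :
    S.mem ab (l * s + d) = (Q l d).natAbs ∧ (S.mem sg (l * s + d) ≠ 0 ↔ Q l d < 0) ∧
      (Q l d).natAbs < 2 ^ ls := by
  rcases hd with ⟨rfl, rfl, rfl, rfl⟩ | ⟨rfl, rfl, rfl, rfl⟩ | ⟨rfl, rfl, rfl, rfl⟩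
  · exact ⟨he.fwdAbs l d, he.fwdSgn l d, he.fwd_lt l d⟩
  · exact ⟨he.fwdAbs l d, he.fwdSgn l d, he.fwd_lt l d⟩
  · exact ⟨he.invAbs l d, he.invSgn l d, he.inv_lt l d⟩

theorem sign_mul_natAbs {R : Type*} [Ring R] (z : ℤ) :
    (if z < 0 then (-1 : R) else 1) * (z.natAbs : R) = (z : R) := by
  rw [← Int.cast_natCast z.natAbs]
  split_ifs with h
  · rw [Int.ofNat_natAbs_of_nonpos h.le]
    simp
  · rw [Int.natAbs_of_nonneg (not_lt.1 h), one_mul]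

/-- For each state function that is 0 at `v`, the `s` cells that differ from it at most at `v` form
a vector, which is multiplied by the matrix. The new vector is first collected in `K.tmp`, because
every new entry needs all the old ones. -/
theorem does_transform (hl : Limits B n N s L J m lb ls) (he : Ready S)
    {work ab sg : ℕ} {Q : Matrix (Fin s) (Fin s) ℤ} (hd : MatrixBanks A work ab sg Q)
    {Y : Finset (Fin n)} {v : Fin n} (hv : v ∈ Y) {q r c : ℕ} (hqL : q ≤ L)
    (hlc : S.reg R.lc = c) (hlist : Enumerates S K.list c (addrBox s L (Y.erase v) q r))
    (hdv : ∀ d < s, S.mem K.dv d = d * s ^ (v : ℕ)) {Z : (Fin n → Fin s) → ℕ → ℕ → ZMod m}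
    (hZ : ∀ f, Off Y f → ∀ κ < q, ∀ j < r, Cell m S work (addr L f κ j) (Z f κ j)) :
    Does M B (transform work ab sg) S (c * (s * (s * (ls * 20 + 16) + 9) + 6) + 2) fun S' =>
      ∀ f, Off Y f → ∀ κ < q, ∀ j < r, Cell m S' work (addr L f κ j)
        (∑ d, (Q (f v) d : ZMod m) * Z (update f v d) κ j) := by
  have hB := hl.le_B
  have hL := hl.L_pos
  have hm1 := hl.one_lt_m
  have hs2 := hl.two_le
  set New : (Fin n → Fin s) → ℕ → ℕ → ZMod m :=
    fun f κ j => ∑ d, (Q (f v) d : ZMod m) * Z (update f v d) κ j with hNew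
  refine Does.mono (τ := c * ((s * ((1 + ((s * ((1 + (1 + (1 + (1 + (ls * 20 + 10))))) + 2) + 2) + 1)) + 2) + 2)
    + (s * (1 + 2) + 2) + 2) + 2) ?_ (by ring_nf; omega)
  refine Does.forEach hB (fun D S' => ∀ f, Off Y f → ∀ κ < q, ∀ j < r, Cell m S' work (addr L f κ j)
      (if addr L (update f v A.zero) κ j ∈ D then New f κ j else Z f κ j))
    hlc hlist rfl rfl (by decide) ?_ (fun D S' v h => h) ?_ ?_ ?_
  · rcases hd with ⟨rfl, rfl, rfl, rfl⟩ | ⟨rfl, rfl, rfl, rfl⟩ | ⟨rfl, rfl, rfl, rfl⟩ <;> rfl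
  · intro f hf κ hκ j hj
    simpa using hZ f hf κ hκ j hj
  · rintro a ha D hD haD S₁ hf₁ hxa h1
    obtain ⟨f, hf, κ, hκ, j, hj, rfl⟩ := mem_addrBox.1 ha
    have hfv0 : f v = A.zero := Fin.ext (by
      rw [A.zero_val]
      exact hf v (by simp))
    have hfY : Off Y f := hf.mono (erase_subset _ _)
    have haddr : ∀ d : Fin s, addr L f κ j + d * s ^ (v : ℕ) = addr L (update f v d) κ j := by
      intro d
      rw [addr_update f v d A.zero A.zero_val, ← hfv0, update_eq_self]
    have e0 : Ready S₁ := by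
      refine he.frame hf₁ ?_
      rcases hd with ⟨rfl, rfl, rfl, rfl⟩ | ⟨rfl, rfl, rfl, rfl⟩ | ⟨rfl, rfl, rfl, rfl⟩ <;> rfl
    have e1 : ∀ d < s, S₁.mem K.dv d = d * s ^ (v : ℕ) := by
      rw [hf₁.mem]
      · exact hdv
      rcases hd with ⟨rfl, rfl, rfl, rfl⟩ | ⟨rfl, rfl, rfl, rfl⟩ | ⟨rfl, rfl, rfl, rfl⟩ <;> rfl
    have hwt : work ≠ K.tmp := by
      rcases hd with ⟨rfl, rfl, rfl, rfl⟩ | ⟨rfl, rfl, rfl, rfl⟩ | ⟨rfl, rfl, rfl, rfl⟩ <;> decide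
    have hwl : work ≠ K.list := by
      rcases hd with ⟨rfl, rfl, rfl, rfl⟩ | ⟨rfl, rfl, rfl, rfl⟩ | ⟨rfl, rfl, rfl, rfl⟩ <;> decide
    have hwd : work ≠ K.dv := by
      rcases hd with ⟨rfl, rfl, rfl, rfl⟩ | ⟨rfl, rfl, rfl, rfl⟩ | ⟨rfl, rfl, rfl, rfl⟩ <;> decide
    refine .seq (.forLoop (n := s)
      (τ := 1 + ((s * ((1 + (1 + (1 + (1 + (ls * 20 + 10))))) + 2) + 2) + 1)) hB (fun l S' =>
      S'.mem work = S₁.mem work ∧ ∀ l' : Fin s, (l' : ℕ) < l → Cell m S' K.tmp l'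
        (New (update f v l') κ j)) e0.s_eq rfl rfl (by decide) ?_ ?_ ?_)
    · exact ⟨rfl, fun l' h => absurd h (Nat.not_lt_zero _)⟩
    · rintro l S₂ hl' hf₂ hxl ⟨h2, h3⟩
      have p0 : Ready S₂ := e0.frame hf₂ rfl
      have p1 : ∀ d < s, S₂.mem K.dv d = d * s ^ (v : ℕ) := by
        rw [hf₂.mem _ rfl]; exact e1
      have p2 : S₂.mem K.list (S₂.reg R.i) = addr L f κ j := by
        rw [hf₂.mem _ rfl, hf₂.reg R.i rfl]; exact hxa
      refine .seq (.assign hB rfl (by simp [eval]) (.seq (.forLoop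
        (τ := 1 + (1 + (1 + (1 + (ls * 20 + 10))))) (n := s) hB (fun d S' =>
          S'.reg R.acc < m ∧ (S'.reg R.acc : ZMod m) = (∑ d' : Fin s, if (d' : ℕ) < d then
            (Q ⟨l, hl'⟩ d' : ZMod m) * Z (update f v d') κ j else 0))
        (by simpa using p0.s_eq) rfl rfl (by decide) ?_ ?_ ?_)))
      · simp only [setReg_reg, OfNat.ofNat_eq_ofNat, Nat.reduceEqDiff, reduceIte, eval]
        exact ⟨by omega, by simp⟩
      · rintro d S₃ hdlt hf₃ hxd ⟨c1, c2⟩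
        have q0 : Ready S₃ := (p0.setReg (by decide) _).frame hf₃ rfl
        have q1 : S₃.mem K.dv d = d * s ^ (v : ℕ) := by rw [hf₃.mem _ rfl]; exact p1 d hdlt
        have q2 : S₃.mem K.list (S₃.reg R.i) = addr L f κ j := by
          rw [hf₃.mem _ rfl, hf₃.reg R.i rfl]; exact p2
        have q3 : S₃.reg R.l = l := by rw [hf₃.reg _ rfl]; simpa using hxl
        have q4 : S₃.mem work = S₁.mem work := by rw [hf₃.mem _ rfl]; exact h2
        have q5 : S₃.mem K.mulS l = l * s := q0.mulS l hl'
        obtain ⟨w1, w2, w3⟩ := hd.entries q0 ⟨l, hl'⟩ ⟨d, hdlt⟩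
        simp only at w1 w2
        have hval : eval S₃ (.load work (.add (.load K.list (.reg R.i))
            (.load K.dv (.reg R.d)))) = S₃.mem work (addr L (update f v ⟨d, hdlt⟩) κ j) := by
          simp only [eval, q2, hxd, q1]
          rw [← haddr]
        have hcell : Cell m S₃ work (addr L (update f v ⟨d, hdlt⟩) κ j)
            (Z (update f v ⟨d, hdlt⟩) κ j) := by
          have := (h1 _ (hfY.update hv ⟨d, hdlt⟩) κ hκ j hj).congr q4
          rwa [update_idem, ← hfv0, update_eq_self, if_neg haD] at this
        rw [Fin.sum_lt_succ _ hdlt]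
        refine .seq (.assign hB rfl (fun hS => hS.mem _ _) (.seq (.assign hB rfl
          (fun hS => hS.mem _ _) (.seq (.assign hB rfl (fun hS => hS.mem _ _) (.seq
          (.assign hB rfl (fun hS => hS.reg _) (Does.conseq (does_mulAcc (l := ls) hl
            ((((q0.setReg (by decide) _).setReg (by decide) _).setReg (by decide) _).setReg
              (by decide) _) ?_ hl.ls_le ?_ ?_ ?_) ?_))))))))
        · simp only [setReg_reg, OfNat.ofNat_eq_ofNat, Nat.reduceEqDiff, reduceIte,
            eval]
          exact q0.sbits_eq
        · rw [hval]
          simp only [setReg_reg, OfNat.ofNat_eq_ofNat, Nat.reduceEqDiff, reduceIte]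
          exact hcell.1
        · simp only [setReg_reg, setReg_mem, OfNat.ofNat_eq_ofNat, Nat.reduceEqDiff,
            reduceIte, eval, q3, q5, hxd, w1]
          exact w3
        · simp only [setReg_reg, OfNat.ofNat_eq_ofNat, Nat.reduceEqDiff, reduceIte]
          exact c1
        · rintro S₄ - - ⟨b1, b2⟩
          rw [hval] at b2
          simp only [setReg_reg, setReg_mem, OfNat.ofNat_eq_ofNat, Nat.reduceEqDiff,
            reduceIte, eval, q3, q5, hxd, w1] at b1 b2 ⊢
          refine ⟨b1, ?_⟩
          rw [b2, c2, hcell.2]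
          congr 1
          have : (if S₃.mem sg (l * s + d) ≠ 0 then (-1 : ZMod m) else 1) *
              ((Q ⟨l, hl'⟩ ⟨d, hdlt⟩).natAbs : ZMod m) = (Q ⟨l, hl'⟩ ⟨d, hdlt⟩ : ZMod m) := by
            rw [← sign_mul_natAbs (Q ⟨l, hl'⟩ ⟨d, hdlt⟩)]
            exact congrArg (· * _) (if_congr w2 rfl rfl)
          rw [mul_right_comm, this]
      · rintro S₃ hf₃ - ⟨c1, c2⟩
        have q3 : S₃.reg R.l = l := by rw [hf₃.reg _ rfl]; simpa using hxl
        have q4 : S₃.mem work = S₁.mem work := by rw [hf₃.mem _ rfl]; exact h2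
        have q6 : S₃.mem K.tmp = S₂.mem K.tmp := by rw [hf₃.mem _ rfl]; rfl
        refine .store hB rfl rfl (fun hS => hS.reg _) ⟨?_, fun l' hl₂ => ?_⟩
        · rw [setReg_mem, setMem_mem_ne _ _ _ _ _ hwt, q4]
        · change Cell m (S₃.setMem K.tmp (S₃.reg R.l) (S₃.reg R.acc)) K.tmp _ _
          refine Cell.setMem (fun hne => ?_) c1 c2 (fun heq => ?_)
          · exact (h3 l' (by omega)).congr q6
          · rw [q3] at heq
            obtain rfl : l' = ⟨l, hl'⟩ := Fin.ext heq
            simp only [hNew, update_self, update_idem]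
            exact sum_congr rfl fun d _ => if_pos d.2
    · rintro S₂ hf₂ - ⟨h2, h3⟩
      have p0 : Ready S₂ := e0.frame hf₂ rfl
      have p1 : ∀ d < s, S₂.mem K.dv d = d * s ^ (v : ℕ) := by
        rw [hf₂.mem _ rfl]; exact e1
      have p2 : S₂.mem K.list (S₂.reg R.i) = addr L f κ j := by
        rw [hf₂.mem _ rfl, hf₂.reg R.i rfl]; exact hxa
      refine .forLoop (n := s) (τ := 1) hB (fun l S' =>
        ∀ g, Off Y g → ∀ κ' < q, ∀ j' < r, Cell m S' work (addr L g κ' j')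
          (if addr L (update g v A.zero) κ' j' ∈ D ∨
            addr L (update g v A.zero) κ' j' = addr L f κ j ∧ (g v : ℕ) < l
            then New g κ' j' else Z g κ' j')) p0.s_eq rfl rfl (by decide) ?_ ?_ ?_
      · intro g hg κ' hκ' j' hj'
        have := (h1 g hg κ' hκ' j' hj').congr (S' := S₂.setReg R.l 0) h2
        simpa only [Nat.not_lt_zero, and_false, or_false] using this
      · intro l S₃ hl' hf₃ hxl h4
        have hP : ∀ b, work ≠ b → (Prog.forLoop R.l R.s (Prog.store work
            (.add (.load K.list (.reg R.i)) (.load K.dv (.reg R.l)))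
            (.load K.tmp (.reg R.l)))).writesMem b = false := by
          intro b hb
          simp [Prog.forLoop, Prog.writesMem, hb]
        have q1 : S₃.mem K.dv l = l * s ^ (v : ℕ) := by
          rw [hf₃.mem _ (hP _ hwd)]; exact p1 l hl'
        have q2 : S₃.mem K.list (S₃.reg R.i) = addr L f κ j := by
          rw [hf₃.mem _ (hP _ hwl), hf₃.reg R.i rfl]; exact p2
        have q3 : Cell m S₃ K.tmp l (New (update f v ⟨l, hl'⟩) κ j) :=
          (h3 ⟨l, hl'⟩ hl').congr (hf₃.mem _ (hP _ hwt))
        have haddr' : eval S₃ (.add (.load K.list (.reg R.i)) (.load K.dv (.reg R.l))) =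
            addr L (update f v ⟨l, hl'⟩) κ j := by
          simp only [eval, q2, hxl, q1]
          rw [← haddr]
        have hval : eval S₃ (.load K.tmp (.reg R.l)) = S₃.mem K.tmp l := by
          simp only [eval, hxl]
        refine .store hB rfl rfl (fun hS => hS.mem _ _) ?_
        rw [haddr', hval]
        intro g hg κ' hκ' j' hj'
        change Cell m (S₃.setMem work _ _) work _ _
        refine Cell.setMem (fun hne => ?_) q3.1 q3.2 (fun heq => ?_)
        · have := h4 g hg κ' hκ' j' hj'
          convert this using 2
          refine or_congr_right (and_congr_right fun h => ?_)
          have h' := (addr_inj (by omega) (by omega)).1 h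
          have : (g v : ℕ) ≠ l := by
            intro hgl
            refine hne ?_
            have : (⟨l, hl'⟩ : Fin s) = g v := Fin.ext hgl.symm
            rw [this, ← h'.1, update_idem, update_eq_self, h'.2.1, h'.2.2]
          omega
        · obtain ⟨rfl, rfl, rfl⟩ := (addr_inj (by omega) (by omega)).1 heq
          rw [if_pos]
          refine Or.inr ⟨?_, by simp⟩
          rw [update_idem, ← hfv0, update_eq_self]
      · rintro S₃ - - h4 g hg κ' hκ' j' hj'
        have := h4 g hg κ' hκ' j' hj'
        convert this using 2
        rw [mem_insert, or_comm]
        simp only [(g v).2, and_true]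
  · intro S₁ _ h1 f hf κ hκ j hj
    have := h1 f hf κ hκ j hj
    rwa [if_pos] at this
    exact mem_addrBox.2 ⟨_, hf.update_erase v A.zero_val, κ, hκ, j, hj, rfl⟩

/-- The vertices of the bag are treated one after the other, as in `mix_insert`; after `i` rounds
the matrix has been applied at the vertices of the bag with index below `i`. -/
theorem does_mixAll (hl : Limits B n N s L J m lb ls) (he : Ready S)
    {work ab sg : ℕ} {Q : Matrix (Fin s) (Fin s) ℤ} (hd : MatrixBanks A work ab sg Q)
    {bag : Fin N → Finset (Fin n)} (hbag : Bags S bag) {y : Fin N} (hy : S.reg R.ly = y) {q r : ℕ}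
    (hq : S.reg R.xq = q) (hr : S.reg R.xr = r) (hq0 : 0 < q) (hqL : q ≤ L) (hr0 : 0 < r)
    (hrJ : r ≤ J) {w : ℕ} (hw : s ^ (bag y).card ≤ w) {Z : (Fin n → Fin s) → ℕ → ℕ → ZMod m}
    (hZ : ∀ f, Off (bag y) f → ∀ κ < q, ∀ j < r, Cell m S work (addr L f κ j) (Z f κ j)) :
    Does M B (mixAll work ab sg) S (n * (200 * (w * (q * r) * (s * ls)) + 7 * n) + 2) fun S' =>
      ∀ f, Off (bag y) f → ∀ κ < q, ∀ j < r, Cell m S' work (addr L f κ j)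
        (mix (bag y) (Q.map (Int.castRingHom (ZMod m))) (fun g => Z g κ j) f) := by
  have hB := hl.le_B
  have hs2 := hl.two_le
  have hls := hl.ls_pos
  have hw1 : 1 ≤ w := (Nat.pow_pos (by omega)).trans_le hw
  have hpow := hl.pow_lt
  have hwD : ∀ b ∈ [K.list, K.dv, K.inc, K.tmp], work ≠ b := by
    rcases hd with ⟨rfl, rfl, rfl, rfl⟩ | ⟨rfl, rfl, rfl, rfl⟩ | ⟨rfl, rfl, rfl, rfl⟩ <;> decide
  refine Does.mono (τ := n * ((200 * (w * (q * r) * (s * ls)) + 7 * n - 2) + 2) + 2)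
    (Does.forLoop hB (fun i S' => ∀ f, Off (bag y) f → ∀ κ < q, ∀ j < r,
    Cell m S' work (addr L f κ j) (mix ((bag y).filter (fun v : Fin n => (v : ℕ) < i))
      (Q.map (Int.castRingHom (ZMod m))) (fun g => Z g κ j) f)) he.n_eq rfl rfl (by decide) ?_ ?_ ?_) ?_
  · intro f hf κ hκ j hj
    simpa [mix_empty] using (hZ f hf κ hκ j hj).congr (S' := S.setReg R.xv 0) rfl
  · rintro i S₁ hi hf₁ hxi h1
    have e0 : Ready S₁ := he.frame (P := mixAll work ab sg) hf₁ (by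
      rcases hd with ⟨rfl, rfl, rfl, rfl⟩ | ⟨rfl, rfl, rfl, rfl⟩ | ⟨rfl, rfl, rfl, rfl⟩ <;> rfl)
    have e1 : Bags S₁ bag := by
      refine hbag.congr (Prog.Frame.mem (P := mixAll work ab sg) hf₁ _ ?_)
      rcases hd with ⟨rfl, rfl, rfl, rfl⟩ | ⟨rfl, rfl, rfl, rfl⟩ | ⟨rfl, rfl, rfl, rfl⟩ <;> rfl
    have e2 : S₁.reg R.ly = y := by rw [hf₁.reg _ rfl, hy]
    have e3 : S₁.reg R.xq = q := by rw [hf₁.reg _ rfl, hq]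
    have e4 : S₁.reg R.xr = r := by rw [hf₁.reg _ rfl, hr]
    have hval : eval S₁ (.load K.inc (.add (.load K.mulN (.reg R.ly)) (.reg R.xv))) =
        S₁.mem K.inc (y * n + i) := by
      simp [eval, e2, hxi, e0.mulN y (by omega)]
    have hgood := e1 y ⟨i, hi⟩
    simp only at hgood
    have hqr : 1 ≤ q * r := Nat.mul_pos hq0 hr0
    have hsl : 2 * 1 ≤ s * ls := Nat.mul_le_mul hs2 hls
    have hwqr : 1 ≤ w * (q * r) := Nat.mul_pos hw1 hqr
    have hbig : s * ls ≤ w * (q * r) * (s * ls) := Nat.le_mul_of_pos_left _ hwqr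
    by_cases hib : (⟨i, hi⟩ : Fin n) ∈ bag y
    · set v : Fin n := ⟨i, hi⟩ with hv
      have hfil : insert v ((bag y).filter (fun v : Fin n => (v : ℕ) < i)) =
          (bag y).filter (fun v : Fin n => (v : ℕ) < i + 1) := by
        ext u
        simp only [mem_insert, mem_filter, Fin.ext_iff, hv]
        constructor
        · rintro (h | h)
          · have : u = ⟨i, hi⟩ := Fin.ext h
            rw [this]
            exact ⟨hib, by simp⟩
          · exact ⟨h.1, by omega⟩
        · rintro ⟨h, h'⟩
          by_cases hvi : (u : ℕ) = i
          · exact Or.inl hvi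
          · exact Or.inr ⟨h, by omega⟩
      have hvn : v ∉ (bag y).filter (fun v : Fin n => (v : ℕ) < i) := by simp [hv]
      set c := s ^ ((bag y).erase v).card with hc
      have hcs : c * s ≤ w := by
        rw [hc, ← pow_succ, card_erase_add_one hib]
        exact hw
      have hps : s * s ^ i ≤ s ^ n := by
        rw [mul_comm, ← pow_succ]
        exact Nat.pow_le_pow_right (by omega) hi
      refine Does.mono (τ := 1 + (1 + (1 + ((s * 4 + 3) + (1 + (1 + (1 + (1 + ((n * 7 + 70 * (c * q * r)) +
        (c * q * r * (s * (s * (ls * 20 + 16) + 9) + 6) + 2))))))))) + 0) (.branch hB rfl (fun _ =>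
        .seq (.assign hB rfl (fun hS => hS.mem _ _) (.seq (.assign hB rfl (fun hS => hS.reg _) (.seq
        (Does.conseq (does_multiples hB (w := s ^ i) (q := s) ?_ ?_ ?_) ?_))))))
        (fun hg => absurd (hval.symm.trans hg) (hgood.2 hib))) ?_
      · simpa [eval, hxi] using e0.powS i hi
      · simpa [eval] using e0.s_eq
      · omega
      · intro S₂ hf₂ _ hdv
        have p0 : Ready S₂ :=
          ((e0.setReg (by decide) _).setReg (by decide) _).frame hf₂ rfl
        have p1 : Bags S₂ bag := e1.congr (by rw [hf₂.mem _ rfl]; rfl)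
        have p2 : S₂.reg R.ly = y := by rw [hf₂.reg _ rfl]; simpa using e2
        have p3 : S₂.reg R.xq = q := by rw [hf₂.reg _ rfl]; simpa using e3
        have p4 : S₂.reg R.xr = r := by rw [hf₂.reg _ rfl]; simpa using e4
        have p5 : S₂.reg R.xv = i := by rw [hf₂.reg _ rfl]; simpa using hxi
        have p6 : S₂.mem work = S₁.mem work := by
          rcases hd with ⟨rfl, rfl, rfl, rfl⟩ | ⟨rfl, rfl, rfl, rfl⟩ | ⟨rfl, rfl, rfl, rfl⟩ <;>
            (rw [hf₂.mem _ rfl]; rfl)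
        have hbw : bagWithout (bag y) i = (bag y).erase v := bagWithout_eq_erase _ v
        refine .seq (.assign hB rfl (fun hS => hS.reg _) (.seq (.assign hB rfl (fun hS => hS.reg _)
          (.seq (.assign hB rfl (fun hS => hS.reg _) (.seq (.assign hB rfl (fun hS => hS.reg _)
          (.seq (Does.mono (Does.conseq (does_build hl (z := y) (bag := bag) (k := i) (q := q) (r := r)
            ((((p0.setReg (by decide) _).setReg (by decide) _).setReg (by decide) _).setReg
              (by decide) _) (by exact p1) ?_ ?_ ?_ ?_ hq0 hqL hr0 hrJ) ?_) ?_)))))))))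
        · simp [eval, p2]
        · simp [eval, p5]
        · simp [eval, p3]
        · simp [eval, p4]
        · rintro S₃ hf₃ - ⟨g1, g2⟩
          rw [hbw] at g1 g2
          have q0 : Ready S₃ :=
            ((((p0.setReg (by decide) _).setReg (by decide) _).setReg (by decide) _).setReg
              (by decide) _).frame hf₃ rfl
          have q1 : S₃.mem work = S₁.mem work := by
            rw [← p6]
            rcases hd with ⟨rfl, rfl, rfl, rfl⟩ | ⟨rfl, rfl, rfl, rfl⟩ | ⟨rfl, rfl, rfl, rfl⟩ <;>
              (rw [hf₃.mem _ rfl]; rfl)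
          refine (does_transform hl q0 hd hib hqL g1 g2 (by rw [hf₃.mem _ rfl]; exact hdv)
            (fun f hf κ hκ j hj => (h1 f hf κ hκ j hj).congr q1)).conseq ?_
          intro S₄ _ _ h4 f hf κ hκ j hj
          have := (h4 f hf κ hκ j hj).congr (S' := S₄.setReg R.xv (i + 1)) rfl
          rw [← hfil, mix_insert hvn]
          exact this
        · rw [hbw]
      -- The list omits the vertex, so it has at most `w / s` state functions. A round therefore
      -- needs about `s` multiplications by a matrix entry, of `ls` bits, for each of the `w * (q *
      -- r)` cells.
      · have a1 : c * q * r * s ≤ w * (q * r) := by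
          calc c * q * r * s = (c * s) * (q * r) := by ring
            _ ≤ _ := Nat.mul_le_mul_right _ hcs
        have a2 : c * q * r * 2 ≤ c * q * r * s := Nat.mul_le_mul_left _ hs2
        have a3 : c * q * r * (s * (s * (ls * 20 + 16) + 9) + 6) =
          20 * (c * q * r * s * (s * ls)) + 16 * (c * q * r * s * s) + 9 * (c * q * r * s) +
            6 * (c * q * r) := by ring
        have a4 : c * q * r * s * (s * ls) ≤ w * (q * r) * (s * ls) := Nat.mul_le_mul_right _ a1
        have a5 : w * (q * r) * s ≤ w * (q * r) * (s * ls) :=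
          Nat.mul_le_mul_left _ (Nat.le_mul_of_pos_right _ hls)
        have a6 : c * q * r * s * s ≤ w * (q * r) * s := Nat.mul_le_mul_right _ a1
        have a7 : w * (q * r) * 2 ≤ w * (q * r) * (s * ls) := Nat.mul_le_mul_left _ hsl
        have a8 : s ≤ s * ls := Nat.le_mul_of_pos_right _ hls
        rw [a3]
        omega
    · refine Does.mono (τ := 1 + 0 + 1) (.branch hB rfl
        (fun hg => absurd (hgood.1 (by rw [← hval]; exact hg)) hib) (fun _ => .skip ?_)) (by omega)
      have hfil : ((bag y).filter (fun v : Fin n => (v : ℕ) < i)) =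
          (bag y).filter (fun v : Fin n => (v : ℕ) < i + 1) := by
        refine filter_congr fun v hv' => ?_
        have : v ≠ ⟨i, hi⟩ := fun h => hib (h ▸ hv')
        have : (v : ℕ) ≠ i := fun h => this (Fin.ext h)
        omega
      rw [← hfil]
      exact h1
  · rintro S₁ - - h1 f hf κ hκ j hj
    have := h1 f hf κ hκ j hj
    rwa [filter_true_of_mem fun v _ => v.2] at this
  · have hqr : 1 ≤ q * r := Nat.mul_pos hq0 hr0
    have hsl : 2 * 1 ≤ s * ls := Nat.mul_le_mul hs2 hls
    have hwqr : 1 ≤ w * (q * r) := Nat.mul_pos hw1 hqr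
    have hbig : s * ls ≤ w * (q * r) * (s * ls) := Nat.le_mul_of_pos_left _ hwqr
    rw [Nat.sub_add_cancel (by omega)]

/-! ### Products of tables -/

/-- List the addresses for the sizes and rows in the bank `dst`, and their number in the register
`x`. -/
def offsets (dst x : ℕ) : Prog :=
  store K.list (const 0) (const 0) ;;
  assign R.lc (const 1) ;;
  assign R.ew (reg R.W) ;; assign R.eq (reg R.bq) ;; extend ;;
  assign R.ew (reg R.LW) ;; assign R.eq (reg R.br) ;; extend ;;
  forLoop R.i R.lc (store dst (reg R.i) (load K.list (reg R.i))) ;;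
  assign x (reg R.lc)

/-- Multiply the tables in the banks `K.wA` and `K.wB`. -/
def convolve : Prog :=
  forLoop R.i R.lc
    (forLoop R.j R.lca
      (forLoop R.k R.lcb
        (assign R.acc (load K.wC (add (add (load K.list (reg R.i)) (load K.listA (reg R.j)))
          (load K.listB (reg R.k)))) ;;
        assign R.mx (load K.wA (add (load K.list (reg R.i)) (load K.listA (reg R.j)))) ;;
        assign R.my (load K.wB (add (load K.list (reg R.i)) (load K.listB (reg R.k)))) ;;
        assign R.sg (const 0) ;;
        assign R.ml (reg R.bits) ;;
        mulAcc ;;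
        store K.wC (add (add (load K.list (reg R.i)) (load K.listA (reg R.j)))
          (load K.listB (reg R.k))) (reg R.acc))))

theorem sum_addrBox {α : Type*} [AddCommMonoid α] (Y : Finset (Fin n)) {q r : ℕ} (hq : q ≤ L)
    (g : ℕ → α) : ∑ a ∈ addrBox s L Y q r, g a =
      ∑ f : Fin n → Fin s with Off Y f, ∑ κ ∈ range q, ∑ j ∈ range r, g (addr L f κ j) := by
  rw [addrBox, sum_image]
  · simp only [sum_product]
  · rintro ⟨f, κ, j⟩ h ⟨f', κ', j'⟩ h' e
    simp only [coe_product, Set.mem_prod, coe_range, Set.mem_Iio] at h h'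
    obtain ⟨rfl, rfl, rfl⟩ := (addr_inj (h.2.1.trans_le hq) (h'.2.1.trans_le hq)).1 e
    rfl

theorem off_empty (hs : 0 < s) :
    (univ.filter fun f : Fin n → Fin s => Off ∅ f) = {fun _ => ⟨0, hs⟩} := by
  ext f
  simp only [mem_filter, mem_univ, true_and, mem_singleton]
  constructor
  · intro h
    funext v
    exact Fin.ext (h v (notMem_empty v))
  · rintro rfl v -
    rfl

theorem addr_zero (hs : 0 < s) (κ j : ℕ) :
    addr L (fun _ : Fin n => (⟨0, hs⟩ : Fin s)) κ j = κ * s ^ n + j * (L * s ^ n) := by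
  simp [addr, code]

/-- The box over the empty set of vertices consists of the pure offsets of sizes and rows. Adding
such an offset to the address of a state function gives the address of the corresponding cell. -/
theorem does_offsets (hl : Limits B n N s L J m lb ls) (he : Ready S)
    {dst x : ℕ} (hd : (dst = K.listA ∧ x = R.lca) ∨ (dst = K.listB ∧ x = R.lcb)) {q r : ℕ}
    (hq : S.reg R.bq = q) (hr : S.reg R.br = r) (hq0 : 0 < q) (hqL : q ≤ L) (hr0 : 0 < r)
    (hrJ : r ≤ J) :
    Does M B (offsets dst x) S (100 * (q * r)) fun S' =>
      S'.reg x = q * r ∧ Enumerates S' dst (q * r) (addrBox s L (∅ : Finset (Fin n)) q r) := by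
  have hB := hl.le_B
  have hL := hl.L_pos
  have hJ := hl.J_pos
  have hs2 := hl.two_le
  have hs0 : 0 < s := by omega
  have hcells := hl.cells
  have hpow := hl.pow_pos
  have hLJ : L ≤ L * J := Nat.le_mul_of_pos_right _ hJ
  have i1 : q * s ^ n ≤ s ^ n * (L * J) := by
    rw [mul_comm]
    exact Nat.mul_le_mul_left _ (hqL.trans hLJ)
  have i2 : r * (L * s ^ n) ≤ s ^ n * (L * J) := by
    calc r * (L * s ^ n) ≤ J * (L * s ^ n) := Nat.mul_le_mul_right _ hrJ
      _ = _ := by ring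
  have i5 : L * J ≤ s ^ n * (L * J) := Nat.le_mul_of_pos_left _ hpow
  have i4 : q * r ≤ L * J := Nat.mul_le_mul hqL hrJ
  have i3 : q * 1 ≤ q * r := Nat.mul_le_mul_left _ hr0
  have i6 : 1 * r ≤ q * r := Nat.mul_le_mul_right _ hq0
  have hb1 := card_addrBox (L := L) hs0 (∅ : Finset (Fin n)) hqL 1
  rw [addrBox_sizes, card_empty, pow_zero, mul_one] at hb1
  have hb2 := card_addrBox (L := L) hs0 (∅ : Finset (Fin n)) hqL r
  rw [addrBox_rows, card_empty, pow_zero] at hb2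
  refine Does.mono (τ := 1 + (1 + (1 + (1 + ((q * (1 * 4 + 5) + 5) + (1 + (1 + ((r * (1 * q * 4 + 5) + 5) +
    ((1 * q * r * (1 + 2) + 2) + 1)))))))))
    (.seq (.store hB rfl rfl (by simp [eval]) (.seq (.assign hB rfl
    (fun hS => Nat.one_lt_two_pow (by omega)) (.seq (.assign hB rfl (fun hS => hS.reg _) (.seq
    (.assign hB rfl (fun hS => hS.reg _) (.seq (Does.conseq (does_extend hB
      (E := addrBox s L (∅ : Finset (Fin n)) 1 1) (cnt := 1) (w := s ^ n) (q := q)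
      (b := s ^ n * (L * J)) ?_ ?_ ?_ ?_ ?_ ?_ hb1 ?_) ?_)))))))))) ?_
  · rw [addrBox_empty hs0]
    exact ⟨by simp [eval, setMem_mem_self], by simp⟩
  · simp [eval]
  · simpa [eval] using he.W_eq
  · simpa [eval] using hq
  · intro a ha
    exact addrBox_lt hL hJ ha
  · omega
  · omega
  · rintro S₁ hf₁ - ⟨g1, g2⟩
    rw [← addrBox_sizes] at g2
    refine .seq (.assign hB rfl (fun hS => hS.reg _) (.seq (.assign hB rfl (fun hS => hS.reg _)
      (.seq (Does.conseq (does_extend hB (E := addrBox s L (∅ : Finset (Fin n)) q 1)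
        (cnt := 1 * q) (w := L * s ^ n) (q := r)
        (b := s ^ n * (L * J)) (by exact g2.congr rfl) (by simpa using g1) ?_ ?_ ?_ ?_ hb2 ?_) ?_)))))
    · have : S₁.reg R.LW = L * s ^ n := by
        rw [hf₁.reg _ rfl]; simpa [eval] using he.LW_eq
      simpa [eval] using this
    · have : S₁.reg R.br = r := by
        rw [hf₁.reg _ rfl]; simpa [eval] using hr
      simpa [eval] using this
    · intro a ha
      exact addrBox_lt hqL hJ ha
    · omega
    · rw [one_mul]
      omega
    · rintro S₂ - - ⟨k1, k2⟩
      rw [← addrBox_rows] at k2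
      rw [one_mul] at k1 k2 ⊢
      refine .seq (Does.forLoop (n := q * r) hB (fun i S' => (∀ j < i, S'.mem dst j = S₂.mem K.list j))
        k1 rfl rfl (by decide) (by simp) ?_ ?_)
      · rintro i S₃ hi hf₃ hxi h3
        have e1 : S₃.mem K.list = S₂.mem K.list := by
          rcases hd with ⟨rfl, rfl⟩ | ⟨rfl, rfl⟩ <;> exact hf₃.mem _ rfl
        refine .store hB rfl rfl (fun hS => hS.mem _ _) ?_
        intro j hj
        simp only [setReg_mem, eval, hxi, setMem_mem_self, e1]
        split_ifs with h
        · rw [h]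
        · exact h3 j (by omega)
      · rintro S₃ hf₃ - h3
        refine .assign hB rfl (fun hS => hS.reg _) ⟨?_, ?_⟩
        · have e1 : S₃.reg R.lc = q * r := by rw [hf₃.reg _ rfl, k1]
          simpa [eval] using e1
        · refine ⟨?_, k2.card⟩
          rw [← k2.image]
          exact image_congr fun j hj => h3 j (by simpa using hj)
  · simp only [one_mul]
    have : q * (4 + 5) = 9 * q := by ring
    have : r * (q * 4 + 5) = 4 * (q * r) + 5 * r := by ring
    have : 1 ≤ q * r := Nat.mul_pos hq0 hr0
    omega

/-- Offsets are additive in size and row. Hence adding one offset from each list to the address of a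
state function directly yields the target cell of the product of the two cells, and the convolution
is a threefold loop over lists whose only address arithmetic is addition. -/
theorem does_convolve (hl : Limits B n N s L J m lb ls) (he : Ready S)
    {c ca cb : ℕ} {D DA DB C : Finset ℕ} (hc : S.reg R.lc = c) (hD : Enumerates S K.list c D)
    (hca : S.reg R.lca = ca) (hDA : Enumerates S K.listA ca DA)
    (hcb : S.reg R.lcb = cb) (hDB : Enumerates S K.listB cb DB) {zA zB : ℕ → ZMod m}
    (hA : ∀ i ∈ D, ∀ a ∈ DA, Cell m S K.wA (i + a) (zA (i + a)))
    (hBt : ∀ i ∈ D, ∀ b ∈ DB, Cell m S K.wB (i + b) (zB (i + b)))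
    (hC : ∀ i ∈ D, ∀ a ∈ DA, ∀ b ∈ DB, i + a + b ∈ C) (h0 : ∀ t ∈ C, S.mem K.wC t = 0) :
    Does M B convolve S (c * (ca * (cb * (lb * 20 + 18) + 4) + 4) + 2) fun S' =>
      ∀ t ∈ C, Cell m S' K.wC t
        (∑ i ∈ D, ∑ a ∈ DA, ∑ b ∈ DB, if i + a + b = t then zA (i + a) * zB (i + b) else 0) := by
  have hB := hl.le_B
  have hm1 := hl.one_lt_m
  refine Does.mono (τ := c * ((ca * ((cb * ((1 + (1 + (1 + (1 + (1 + ((lb * 20 + 10) + 1)))))) + 2) + 2) + 2)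
    + 2) + 2) + 2) ?_ (by ring_nf; omega)
  refine Does.forEach hB (fun X S' => ∀ t ∈ C, Cell m S' K.wC t
      (∑ i ∈ X, ∑ a ∈ DA, ∑ b ∈ DB, if i + a + b = t then zA (i + a) * zB (i + b) else 0))
    hc hD rfl rfl (by decide) rfl (fun D S' v h => h) ?_ ?_ (fun S' _ h => h)
  · intro t ht
    simp only [sum_empty, Cell, h0 t ht, Nat.cast_zero, and_true]
    omega
  · rintro i hi X hX hiX S₁ hf₁ hxi h1
    refine Does.forEach hB (fun XA S' => ∀ t ∈ C, Cell m S' K.wC t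
        ((∑ a ∈ XA, ∑ b ∈ DB, if i + a + b = t then zA (i + a) * zB (i + b) else 0) +
        ∑ i ∈ X, ∑ a ∈ DA, ∑ b ∈ DB, if i + a + b = t then zA (i + a) * zB (i + b) else 0))
      (by rw [hf₁.reg _ rfl]; exact hca) (hDA.congr (hf₁.mem _ rfl)) rfl rfl (by decide) rfl
      (fun D S' v h => h) ?_ ?_ ?_
    · intro t ht
      simpa using h1 t ht
    · rintro a ha XA hXA haX S₂ hf₂ hxa h2
      have p1 : S₂.mem K.list (S₂.reg R.i) = i := by
        rw [hf₂.mem _ rfl, hf₂.reg R.i rfl]; exact hxi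
      have p2 : Enumerates S₂ K.listB cb DB :=
        hDB.congr (by rw [hf₂.mem _ rfl, hf₁.mem _ rfl])
      refine Does.forEach hB (fun XB S' => ∀ t ∈ C, Cell m S' K.wC t
        ((∑ b ∈ XB, if i + a + b = t then zA (i + a) * zB (i + b) else 0) +
          ((∑ a ∈ XA, ∑ b ∈ DB, if i + a + b = t then zA (i + a) * zB (i + b) else 0) +
          ∑ i ∈ X, ∑ a ∈ DA, ∑ b ∈ DB, if i + a + b = t then zA (i + a) * zB (i + b) else 0)))
        (by rw [hf₂.reg _ rfl, hf₁.reg _ rfl]; exact hcb) p2 rfl rfl (by decide) rfl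
        (fun D S' v h => h) ?_ ?_ ?_
      · intro t ht
        simpa using h2 t ht
      · rintro b hb XB hXB hbX S₃ hf₃ hxb h3
        have q0 : Ready S₃ :=
          ((he.frame hf₁ rfl).frame hf₂ rfl).frame hf₃ rfl
        have q1 : S₃.mem K.list (S₃.reg R.i) = i := by
          rw [hf₃.mem _ rfl, hf₃.reg R.i rfl]; exact p1
        have q2 : S₃.mem K.listA (S₃.reg R.j) = a := by
          rw [hf₃.mem _ rfl, hf₃.reg R.j rfl]; exact hxa
        have hA' : Cell m S₃ K.wA (i + a) (zA (i + a)) :=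
          (hA i hi a ha).congr (by rw [hf₃.mem _ rfl, hf₂.mem _ rfl, hf₁.mem _ rfl])
        have hB' : Cell m S₃ K.wB (i + b) (zB (i + b)) :=
          (hBt i hi b hb).congr (by rw [hf₃.mem _ rfl, hf₂.mem _ rfl, hf₁.mem _ rfl])
        have hC' := h3 _ (hC i hi a ha b hb)
        refine .seq (.assign hB rfl (fun hS => hS.mem _ _) (.seq (.assign hB rfl
          (fun hS => hS.mem _ _) (.seq (.assign hB rfl (fun hS => hS.mem _ _) (.seq
          (.assign hB rfl (by simp [eval]) (.seq (.assign hB rfl (fun hS => hS.reg _) (.seq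
          (Does.conseq (does_mulAcc (l := lb) hl
            (((((q0.setReg (by decide) _).setReg (by decide) _).setReg (by decide) _).setReg
              (by decide) _).setReg (by decide) _) ?_ le_rfl ?_ ?_ ?_) ?_)))))))))))
        · simp only [setReg_reg, OfNat.ofNat_eq_ofNat, Nat.reduceEqDiff, reduceIte, eval]
          exact q0.bits_eq
        · simp only [setReg_reg, setReg_mem, OfNat.ofNat_eq_ofNat, Nat.reduceEqDiff,
            reduceIte, eval, q1, q2]
          exact hA'.1
        · simp only [setReg_reg, setReg_mem, OfNat.ofNat_eq_ofNat, Nat.reduceEqDiff,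
            reduceIte, eval, q1, hxb]
          exact hB'.1.trans hl.m_lt
        · simp only [setReg_reg, setReg_mem, OfNat.ofNat_eq_ofNat, Nat.reduceEqDiff,
            reduceIte, eval, q1, q2, hxb]
          exact hC'.1
        · rintro S₄ hf₄ - ⟨b1, b2⟩
          simp only [setReg_reg, setReg_mem, OfNat.ofNat_eq_ofNat, Nat.reduceEqDiff,
            reduceIte, eval, q1, q2, hxb, ne_eq, not_true_eq_false, if_false, one_mul,
            hA'.2, hB'.2, hC'.2] at b2
          have r1 : S₄.mem K.list (S₄.reg R.i) = i := by
            rw [hf₄.mem _ rfl, hf₄.reg R.i rfl]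
            simpa using q1
          have r2 : S₄.mem K.listA (S₄.reg R.j) = a := by
            rw [hf₄.mem _ rfl, hf₄.reg R.j rfl]
            simpa using q2
          have r3 : S₄.mem K.listB (S₄.reg R.k) = b := by
            rw [hf₄.mem _ rfl, hf₄.reg R.k rfl]
            simpa using hxb
          have r4 : S₄.mem K.wC = S₃.mem K.wC := by rw [hf₄.mem _ rfl]; rfl
          refine .store hB rfl rfl (fun hS => hS.reg _) ?_
          intro t ht
          have haddr : eval S₄ (.add (.add (.load K.list (.reg R.i)) (.load K.listA (.reg R.j)))
              (.load K.listB (.reg R.k))) = i + a + b := by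
            simp only [eval, r1, r2, r3]
          rw [haddr, sum_insert hbX]
          refine Cell.setMem (fun hne => ?_) b1 b2 (fun heq => ?_)
          · rw [if_neg (Ne.symm hne), zero_add]
            exact (h3 t ht).congr r4
          · rw [if_pos heq.symm, heq]
            ring
      · intro S₃ _ h3 t ht
        rw [sum_insert haX, add_assoc]
        exact h3 t ht
    · intro S₂ _ h2 t ht
      rw [sum_insert hiX]
      exact h2 t ht

/-- Compute the number of rows that are needed for the bag of the node in the register `R.ly`. -/
def countRows : Prog :=
  assign R.rr (const 1) ;;
  forLoop R.h R.n
    (branch (load K.inc (add (load K.mulN (reg R.ly)) (reg R.h)))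
      (assign R.rr (add (reg R.rr) (reg R.top))) skip)

/-- Compute the power of the number in the register `R.u` whose exponent is the size of the bag of
the node in the register `R.ly`. -/
def unitPower : Prog :=
  assign R.pw (const 1) ;;
  forLoop R.h R.n
    (branch (load K.inc (add (load K.mulN (reg R.ly)) (reg R.h)))
      (assign R.mx (reg R.pw) ;;
      assign R.my (reg R.u) ;;
      assign R.ml (reg R.bits) ;;
      mulMod ;;
      assign R.pw (reg R.macc)) skip)

/-- Write the rows of `K.wC` that belong to the ranks into the table of the node in the register
`R.ly`, after a multiplication with the number in the register `R.pw`. -/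
def extract : Prog :=
  assign R.lz (reg R.ly) ;;
  assign R.bz (reg R.ly) ;;
  assign R.bskip (reg R.n) ;;
  assign R.bq (const 1) ;;
  assign R.br (const 1) ;;
  build ;;
  forLoop R.i R.lc
    (assign R.df (load K.list (reg R.i)) ;;
    decode ;;
    project ;;
    forLoop R.k R.L
      (assign R.mx (load K.wC (add (add (reg R.df) (load K.mulW (reg R.k)))
        (load K.mulLW (reg R.rk)))) ;;
      assign R.my (reg R.pw) ;;
      assign R.ml (reg R.bits) ;;
      mulMod ;;
      store K.tab (add (add (reg R.df) (load K.mulW (reg R.k))) (load K.mulLW (reg R.ly)))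
        (reg R.macc)))

theorem filter_lt_succ {Y : Finset (Fin n)} {i : ℕ} (hi : i < n) :
    Y.filter (fun v : Fin n => (v : ℕ) < i + 1) =
      if (⟨i, hi⟩ : Fin n) ∈ Y then insert ⟨i, hi⟩ (Y.filter (fun v : Fin n => (v : ℕ) < i))
      else Y.filter (fun v : Fin n => (v : ℕ) < i) := by
  split_ifs with h
  · ext u
    simp only [mem_insert, mem_filter, Fin.ext_iff]
    constructor
    · rintro ⟨h, h'⟩
      by_cases hvi : (u : ℕ) = i
      · exact Or.inl hvi
      · exact Or.inr ⟨h, by omega⟩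
    · rintro (h' | h')
      · have : u = ⟨i, hi⟩ := Fin.ext h'
        rw [this]
        exact ⟨h, by simp⟩
      · exact ⟨h'.1, by omega⟩
  · refine filter_congr fun v hv' => ?_
    have : v ≠ ⟨i, hi⟩ := fun h' => h (h' ▸ hv')
    have : (v : ℕ) ≠ i := fun h => this (Fin.ext h)
    omega

theorem card_filter_lt_succ {Y : Finset (Fin n)} {i : ℕ} (hi : i < n) :
    #(Y.filter (fun v : Fin n => (v : ℕ) < i + 1)) =
      if (⟨i, hi⟩ : Fin n) ∈ Y then #(Y.filter (fun v : Fin n => (v : ℕ) < i)) + 1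
      else #(Y.filter (fun v : Fin n => (v : ℕ) < i)) := by
  rw [filter_lt_succ hi]
  split_ifs
  · rw [card_insert_of_notMem (by simp)]
  · rfl

/-- By `StateSystem.rank_le` the ranks over a bag are at most its size times `s - 2`, so one more
row than that suffices. -/
theorem does_countRows (hl : Limits B n N s L J m lb ls) (he : Ready S)
    {bag : Fin N → Finset (Fin n)} (hbag : Bags S bag) {y : Fin N} (hy : S.reg R.ly = y) :
    Does M B countRows S (n * 5 + 3) fun S' => S'.reg R.rr = #(bag y) * (s - 2) + 1 := by
  have hB := hl.le_B
  have hJ := hl.le_J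
  have hJ4 := hl.J_lt
  refine Does.mono (τ := 1 + (n * ((1 + 1 + 1) + 2) + 2)) (.seq (.assign hB rfl
    (fun _ => Nat.one_lt_two_pow (by omega)) (.forLoop hB (fun i S' =>
      S'.reg R.rr = #((bag y).filter (fun v : Fin n => (v : ℕ) < i)) * (s - 2) + 1)
      (by simpa using he.n_eq) rfl rfl (by decide) ?_ ?_ ?_))) (by omega)
  · simp [eval]
  · rintro i S₁ hi hf hxi h1
    have e0 : Ready S₁ := (he.setReg (by decide) _).frame hf rfl
    have e1 : S₁.reg R.ly = y := by rw [hf.reg _ rfl]; simpa using hy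
    have e2 := (hbag.congr (S' := S₁) (hf.mem _ rfl)) y ⟨i, hi⟩
    have e3 : S₁.mem K.mulN y = y * n := e0.mulN _ (by omega)
    have hcard : #((bag y).filter (fun v : Fin n => (v : ℕ) < i)) + 1 ≤ n := by
      have h1 : (bag y).filter (fun v : Fin n => (v : ℕ) < i) ⊆ univ.erase ⟨i, hi⟩ := by
        intro v hv
        simp only [mem_filter] at hv
        simp only [mem_erase, mem_univ, and_true, ne_eq, Fin.ext_iff]
        omega
      have h2 := card_le_card h1
      rw [card_erase_of_mem (mem_univ _), card_univ, Fintype.card_fin] at h2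
      omega
    have hmul := Nat.mul_le_mul_right (s - 2) hcard
    rw [add_mul, one_mul] at hmul
    rw [card_filter_lt_succ hi]
    refine .branch hB rfl (fun hg => .assign hB rfl (fun _ => ?_) ?_) (fun hg => .skip ?_)
    · simp only [eval, h1, e0.top_eq]
      omega
    · simp only [eval, e1, hxi, e3] at hg
      rw [if_pos (e2.1 hg)]
      simp only [setReg_reg, OfNat.ofNat_eq_ofNat, Nat.reduceEqDiff, reduceIte, eval,
        h1, e0.top_eq]
      ring
    · simp only [eval, e1, hxi, e3] at hg
      rw [if_neg (fun h => e2.2 h hg)]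
      simpa using h1
  · rintro S₁ - - h
    rwa [filter_true_of_mem fun v _ => v.2] at h

/-- Interpolation multiplies by `scale` once for each vertex of the bag. The power computed here, of
the inverse of `scale`, cancels these factors. -/
theorem does_unitPower (hl : Limits B n N s L J m lb ls) (he : Ready S)
    {bag : Fin N → Finset (Fin n)} (hbag : Bags S bag) {y : Fin N} (hy : S.reg R.ly = y) :
    Does M B unitPower S (n * (lb * 20 + 11) + 3) fun S' => S'.reg R.pw < m ∧
      (S'.reg R.pw : ZMod m) = (S.reg R.u : ZMod m) ^ #(bag y) := by
  have hB := hl.le_B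
  have hm1 := hl.one_lt_m
  refine Does.mono (τ := 1 + (n * ((1 + (1 + (1 + (1 + ((lb * 20 + 3) + 1)))) + 1) + 2) + 2))
    (.seq (.assign hB rfl (fun _ => Nat.one_lt_two_pow (by omega)) (.forLoop hB (fun i S' =>
      S'.reg R.pw < m ∧ (S'.reg R.pw : ZMod m) = (S.reg R.u : ZMod m) ^
        #((bag y).filter (fun v : Fin n => (v : ℕ) < i)))
      (by simpa using he.n_eq) rfl rfl (by decide) ?_ ?_ ?_))) (by ring_nf; omega)
  · simp [eval, hm1]
  · rintro i S₁ hi hf hxi ⟨h1, h2⟩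
    have e0 : Ready S₁ := (he.setReg (by decide) _).frame hf rfl
    have e1 : S₁.reg R.ly = y := by rw [hf.reg _ rfl]; simpa using hy
    have e2 := (hbag.congr (S' := S₁) (hf.mem _ rfl)) y ⟨i, hi⟩
    have e3 : S₁.mem K.mulN y = y * n := e0.mulN _ (by omega)
    have e4 : S₁.reg R.u = S.reg R.u := by rw [hf.reg _ rfl]; simp
    rw [card_filter_lt_succ hi]
    refine .branch hB rfl (fun hg => .seq (.assign hB rfl (fun hS => hS.reg _) (.seq
      (.assign hB rfl (fun hS => hS.reg _) (.seq (.assign hB rfl (fun hS => hS.reg _) (.seq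
      (Does.conseq (does_mulMod hB (m := m) (l := lb) ?_ hl.two_m ?_ ?_ ?_ (by omega)
        (fun j hj => e0.pow2 j hj)) ?_)))))))) (fun hg => .skip ?_)
    · simpa using e0.m_eq
    · simpa [eval] using e0.bits_eq
    · simpa [eval] using h1.le
    · simp only [setReg_reg, OfNat.ofNat_eq_ofNat, Nat.reduceEqDiff, reduceIte, eval]
      exact e0.u_lt.trans hl.m_lt
    · rintro S₂ - - ⟨g1, g2⟩
      simp only [eval, e1, hxi, e3] at hg
      rw [if_pos (e2.1 hg)]
      refine .assign hB rfl (fun hS => hS.reg _) ?_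
      simp only [setReg_reg, OfNat.ofNat_eq_ofNat, Nat.reduceEqDiff, reduceIte, eval,
        h2, e4] at g2 ⊢
      exact ⟨g1, by rw [g2, pow_succ]⟩
    · simp only [eval, e1, hxi, e3] at hg
      rw [if_neg (fun h => e2.2 h hg)]
      simpa using ⟨h1, h2⟩
  · rintro S₁ - - h
    rwa [filter_true_of_mem fun v _ => v.2] at h

/-- After interpolation, only the row whose index is the rank of `f` carries the correct value for
`f`; the other rows are contaminated by folded terms and are ignored. The routine `project` is
called, for the bag itself, only to obtain the rank. -/
theorem does_extract (hl : Limits B n N s L J m lb ls) (he : Ready S)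
    {X : Set (Fin N)} {bag : Fin N → Finset (Fin n)} (hbag : Bags S bag)
    {Z : Fin N → (Fin n → Fin s) → ℕ → ZMod m} (hT : Tables m L S X bag Z) {y : Fin N}
    (hy : S.reg R.ly = y) {r : ℕ} (hrJ : r ≤ J) (hrank : ∀ f, Off (bag y) f → A.rank f < r)
    {C : (Fin n → Fin s) → ℕ → ℕ → ZMod m}
    (hC : ∀ f, Off (bag y) f → ∀ κ < L, ∀ j < r, Cell m S K.wC (addr L f κ j) (C f κ j))
    (hpw : S.reg R.pw < m) {w : ℕ} (hw : s ^ (bag y).card ≤ w) :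
    Does M B extract S (w * (L * (lb * 20 + 9) + 30 * (n * s) + 120)) fun S' =>
      Tables m L S' X bag fun z f κ => if z = y then C f κ (A.rank f) * S.reg R.pw else Z z f κ := by
  have hB := hl.le_B
  have hL := hl.L_pos
  have hJ := hl.J_pos
  have hs2 := hl.two_le
  have hm1 := hl.one_lt_m
  have hn := hl.n_pos
  have hNJ : N ≤ J := by have := hl.le_J; omega
  set c := s ^ (bag y).card with hc
  have hc0 : 0 < c := Nat.pow_pos (by omega)
  refine Does.mono (τ := 1 + (1 + (1 + (1 + (1 + ((n * 7 + 70 * (c * 1 * 1)) + (c * ((1 +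
    ((n * (s * 6 + 6) + 3) + ((n * (s * 3 + 14) + 5) + (L * ((1 + (1 + (1 + ((lb * 20 + 3) + 1)))) + 2) + 2))))
    + 2) + 2)))))))
    (.seq (.assign hB rfl (fun hS => hS.reg _) (.seq (.assign hB rfl (fun hS => hS.reg _) (.seq
    (.assign hB rfl (fun hS => hS.reg _) (.seq (.assign hB rfl
    (fun _ => Nat.one_lt_two_pow (by omega)) (.seq (.assign hB rfl
    (fun _ => Nat.one_lt_two_pow (by omega)) (.seq (Does.mono (Does.conseq (does_build hl
      (z := y) (bag := bag) (k := n) (q := 1) (r := 1)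
      (((((he.setReg (by decide) _).setReg (by decide) _).setReg (by decide) _).setReg
        (by decide) _).setReg (by decide) _) (by exact hbag) ?_ ?_ ?_ ?_ (by omega) (by omega)
        (by omega) (by omega)) ?_) ?_))))))))))))
    ?_
  · simp [eval, hy]
  · simp [eval, he.n_eq]
  · simp [eval]
  · simp [eval]
  · rintro S₁ hf₁ - ⟨a1, a2⟩
    rw [bagWithout_of_le le_rfl] at a1 a2
    simp only [mul_one] at a1 a2
    have q0 : Ready S₁ :=
      (((((he.setReg (by decide) _).setReg (by decide) _).setReg (by decide) _).setReg
        (by decide) _).setReg (by decide) _).frame hf₁ rfl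
    have q1 : S₁.reg R.lz = y := by rw [hf₁.reg _ rfl]; simpa [eval] using hy
    have q2 : S₁.reg R.ly = y := by rw [hf₁.reg _ rfl]; simpa using hy
    have q3 : S₁.reg R.pw = S.reg R.pw := by rw [hf₁.reg _ rfl]; simp
    have q4 : Bags S₁ bag := hbag.congr (by rw [hf₁.mem _ rfl]; rfl)
    have q5 : S₁.mem K.wC = S.mem K.wC := by rw [hf₁.mem _ rfl]; rfl
    have q6 : S₁.mem K.tab = S.mem K.tab := by rw [hf₁.mem _ rfl]; rfl
    refine Does.forEach hB
      (fun D S' => ∀ x ∈ X, ∀ f, Off (bag x) f → ∀ κ < L, Cell m S' K.tab (addr L f κ x)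
        (if x = y ∧ addr L f 0 0 ∈ D then C f κ (A.rank f) * S.reg R.pw else Z x f κ))
      a1 a2 rfl rfl (by decide) rfl (fun D S' v h => h) ?_ ?_ ?_
    · intro x hx f hf κ hκ
      simpa using (hT x hx f hf κ hκ).congr q6
    · rintro a ha D hD haD S₂ hf₂ hxa h2
      obtain ⟨f, hf, κ₀, hκ₀, j₀, hj₀, rfl⟩ := mem_addrBox.1 ha
      obtain rfl : κ₀ = 0 := by omega
      obtain rfl : j₀ = 0 := by omega
      have r0 : Ready S₂ := q0.frame hf₂ rfl
      refine .seq (.assign hB rfl (fun hS => hS.mem _ _) (.seq ((does_decode (f := f) hl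
        (r0.setReg (by decide) _) ?_).conseq fun S₃ hf₃ _ hdig => ?_)))
      · simp only [setReg_reg, reduceIte, eval, hxa]
        simp [addr]
      · have t0 : Ready S₃ := (r0.setReg (by decide) _).frame hf₃ rfl
        have t1 : S₃.reg R.lz = y := by rw [hf₃.reg _ rfl]; simpa [hf₂.reg R.lz rfl] using q1
        have t2 : S₃.reg R.df = addr L f 0 0 := by
          rw [hf₃.reg _ rfl]; simpa [eval] using hxa
        have t3 : Bags S₃ bag := q4.congr (by
          rw [hf₃.mem _ rfl, setReg_mem, hf₂.mem _ rfl])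
        refine .seq ((does_project (f := f) hl t0 t3 hdig (by rw [t2]; simp [addr]) t1
          (by have := hrank f hf; omega)).conseq ?_)
        rintro S₄ hf₄ - ⟨b1, -, -⟩
        have u0 : Ready S₄ := t0.frame hf₄ rfl
        have u1 : S₄.reg R.df = addr L f 0 0 := by rw [hf₄.reg _ rfl, t2]
        have u2 : S₄.reg R.ly = y := by
          rw [hf₄.reg _ rfl, hf₃.reg _ rfl]
          simpa [hf₂.reg R.ly rfl] using q2
        have u3 : S₄.reg R.pw = S.reg R.pw := by
          rw [hf₄.reg _ rfl, hf₃.reg _ rfl]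
          simpa [hf₂.reg R.pw rfl] using q3
        have u5 : S₄.mem K.wC = S.mem K.wC := by
          rw [hf₄.mem _ rfl, hf₃.mem _ rfl, setReg_mem, hf₂.mem _ rfl, q5]
        have u6 : S₄.mem K.tab = S₂.mem K.tab := by
          rw [hf₄.mem _ rfl, hf₃.mem _ rfl, setReg_mem]
        refine Does.forLoop (n := L) hB (fun k S' =>
          ∀ x ∈ X, ∀ g, Off (bag x) g → ∀ κ < L, Cell m S' K.tab (addr L g κ x)
          (if x = y ∧ (addr L g 0 0 ∈ D ∨ g = f ∧ κ < k) then C g κ (A.rank g) * S.reg R.pw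
            else Z x g κ)) u0.L_eq rfl rfl (by decide) ?_ ?_ ?_
        · intro x hx g hg κ hκ
          have := (h2 x hx g hg κ hκ).congr (S' := S₄.setReg R.k 0) u6
          simpa only [Nat.not_lt_zero, and_false, or_false] using this
        · rintro k S₅ hk hf₅ hxk h5
          have v0 : Ready S₅ := u0.frame hf₅ rfl
          have v1 : S₅.reg R.df = addr L f 0 0 := by rw [hf₅.reg _ rfl, u1]
          have v2 : S₅.reg R.ly = y := by rw [hf₅.reg _ rfl, u2]
          have v3 : S₅.reg R.pw = S.reg R.pw := by rw [hf₅.reg _ rfl, u3]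
          have v4 : S₅.reg R.rk = A.rank f := by rw [hf₅.reg _ rfl, b1]
          have v7 := v0.mulW k hk
          have v8 : S₅.mem K.mulLW y = y * (L * s ^ n) := v0.mulLW _ (by omega)
          have v9 : S₅.mem K.mulLW (A.rank f) = A.rank f * (L * s ^ n) :=
            v0.mulLW _ (by have := hrank f hf; omega)
          have hval : eval S₅ (.load K.wC (.add (.add (.reg R.df) (.load K.mulW (.reg R.k)))
              (.load K.mulLW (.reg R.rk)))) = S₅.mem K.wC (addr L f k (A.rank f)) := by
            simp only [eval, v1, v4, hxk, v7, v9]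
            simp [addr]
          have hcell : Cell m S₅ K.wC (addr L f k (A.rank f)) (C f k (A.rank f)) :=
            (hC f hf k hk _ (hrank f hf)).congr (by rw [hf₅.mem _ rfl, u5])
          refine .seq (.assign hB rfl (fun hS => hS.mem _ _) (.seq
            (.assign hB rfl (fun hS => hS.reg _) (.seq (.assign hB rfl (fun hS => hS.reg _) (.seq
            (Does.conseq (does_mulMod hB (m := m) (l := lb) ?_ hl.two_m ?_ ?_ ?_ (by omega)
              (fun j hj => v0.pow2 j hj)) ?_)))))))
          · simpa using v0.m_eq
          · simpa [eval] using v0.bits_eq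
          · rw [hval]
            simpa using hcell.1.le
          · simp only [setReg_reg, OfNat.ofNat_eq_ofNat, Nat.reduceEqDiff, reduceIte,
              eval, v3]
            exact hpw.trans hl.m_lt
          · rintro S₆ hf₆ - ⟨g1, g2⟩
            rw [hval] at g2
            simp only [setReg_reg, OfNat.ofNat_eq_ofNat, Nat.reduceEqDiff, reduceIte,
              eval, v3, hcell.2] at g2
            have w1 : S₆.reg R.df = addr L f 0 0 := by rw [hf₆.reg _ rfl]; simpa using v1
            have w2 : S₆.reg R.ly = y := by rw [hf₆.reg _ rfl]; simpa using v2
            have w3 : S₆.reg R.k = k := by rw [hf₆.reg _ rfl]; simpa using hxk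
            have w4 : S₆.mem K.mulW k = k * s ^ n := by rw [hf₆.mem _ rfl]; exact v7
            have w5 : S₆.mem K.mulLW y = y * (L * s ^ n) := by rw [hf₆.mem _ rfl]; exact v8
            have w6 : S₆.mem K.tab = S₅.mem K.tab := by rw [hf₆.mem _ rfl]; rfl
            refine .store hB rfl rfl (fun hS => hS.reg _) ?_
            have haddr : eval S₆ (.add (.add (.reg R.df) (.load K.mulW (.reg R.k)))
                (.load K.mulLW (.reg R.ly))) = addr L f k y := by
              simp only [eval, w1, w2, w3, w4, w5]
              simp [addr]
            rw [haddr]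
            intro x hx g hg κ hκ
            change Cell m (S₆.setMem K.tab _ (S₆.reg R.macc)) K.tab _ _
            refine Cell.setMem (fun hne => ?_) g1 g2 (fun heq => ?_)
            · have := (h5 x hx g hg κ hκ).congr w6
              rw [Ne, addr_inj hκ hk] at hne
              convert this using 2
              refine and_congr_right fun h => or_congr_right (and_congr_right fun h' => ?_)
              have : κ ≠ k := fun h'' => hne ⟨h', h'', by rw [h]⟩
              omega
            · rw [addr_inj hκ hk] at heq
              obtain ⟨rfl, rfl, hxy⟩ := heq
              rw [if_pos ⟨Fin.ext hxy, Or.inr ⟨rfl, by omega⟩⟩]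
        · rintro S₅ - - h5 x hx g hg κ hκ
          have := h5 x hx g hg κ hκ
          convert this using 2
          rw [mem_insert, addr_inj hL hL]
          simp only [and_true, hκ]
          rw [or_comm]
    · intro S₂ _ h2 x hx f hf κ hκ
      have := h2 x hx f hf κ hκ
      by_cases hxy : x = y
      · subst hxy
        simpa only [mem_addrBox.2 ⟨f, hf, 0, Nat.one_pos, 0, Nat.one_pos, rfl⟩, and_true] using this
      · simpa only [hxy, false_and] using this
  · rw [bagWithout_of_le le_rfl]
  · have h1 : n * 2 ≤ n * s := Nat.mul_le_mul_left _ hs2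
    have h2 : c * (L * (lb * 20 + 9) + 30 * (n * s) + 120) ≤
        w * (L * (lb * 20 + 9) + 30 * (n * s) + 120) := Nat.mul_le_mul_right _ hw
    have h3 : c * (n * 2) ≤ c * (n * s) := Nat.mul_le_mul_left _ h1
    have h4 : n ≤ c * n := Nat.le_mul_of_pos_left _ hc0
    refine le_trans ?_ h2
    ring_nf at h1 h3 h4 ⊢
    omega

/-! ### Correctness of the product of tables -/

/-- The convolution of two tables with respect to sizes and rows. -/
def tableConvolution {R : Type*} [CommRing R] (qa qb r : ℕ) (ZA ZB : (Fin n → Fin s) → ℕ → ℕ → R)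
    (f : Fin n → Fin s) (κ j : ℕ) : R :=
  ∑ κ₁ ∈ range qa, ∑ j₁ ∈ range r, ∑ κ₂ ∈ range qb, ∑ j₂ ∈ range r,
    if κ₁ + κ₂ = κ ∧ j₁ + j₂ = j then ZA f κ₁ j₁ * ZB f κ₂ j₂ else 0

/-- As `qa + qb ≤ L`, the sum of two sizes does not carry over into the row, and `addr_inj` turns
the equation of addresses into equations for the states, the size and the row. -/
theorem sum_eq_convolution {R : Type*} [CommRing R] (hs : 0 < s) (Y : Finset (Fin n))
    {qa qb r : ℕ} (hL : qa + qb ≤ L) (ha : 0 < qa) (hb : 0 < qb) (zA zB : ℕ → R) {f : Fin n → Fin s}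
    (hf : Off Y f) {κ j : ℕ} (hκ : κ < L) :
    (∑ i ∈ addrBox s L Y 1 1, ∑ a ∈ addrBox s L (∅ : Finset (Fin n)) qa r,
      ∑ b ∈ addrBox s L (∅ : Finset (Fin n)) qb r,
      if i + a + b = addr L f κ j then zA (i + a) * zB (i + b) else 0) =
    tableConvolution qa qb r (fun f κ j => zA (addr L f κ j)) (fun f κ j => zB (addr L f κ j)) f κ j := by
  rw [sum_addrBox Y (by omega : 1 ≤ L)]
  simp only [range_one, sum_singleton]
  simp only [sum_addrBox (∅ : Finset (Fin n)) (by omega : qa ≤ L),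
    sum_addrBox (∅ : Finset (Fin n)) (by omega : qb ≤ L), off_empty hs, sum_singleton, addr_zero]
  have hadd : ∀ (g : Fin n → Fin s) κ₁ j₁, addr L g 0 0 + (κ₁ * s ^ n + j₁ * (L * s ^ n)) =
      addr L g κ₁ j₁ := by
    intro g κ₁ j₁
    simp only [addr]
    ring
  have hadd' : ∀ (g : Fin n → Fin s) κ₁ j₁ κ₂ j₂, addr L g κ₁ j₁ + (κ₂ * s ^ n + j₂ * (L * s ^ n)) =
      addr L g (κ₁ + κ₂) (j₁ + j₂) := by
    intro g κ₁ j₁ κ₂ j₂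
    simp only [addr]
    ring
  simp only [hadd, hadd']
  rw [sum_eq_single f]
  · unfold tableConvolution
    refine sum_congr rfl fun κ₁ h₁ => sum_congr rfl fun j₁ _ => sum_congr rfl fun κ₂ h₂ =>
      sum_congr rfl fun j₂ _ => ?_
    rw [mem_range] at h₁ h₂
    refine if_congr ?_ rfl rfl
    rw [addr_inj (by omega) hκ]
    simp
  · intro g _ hgf
    refine sum_eq_zero fun κ₁ h₁ => sum_eq_zero fun j₁ _ => sum_eq_zero fun κ₂ h₂ =>
      sum_eq_zero fun j₂ _ => if_neg fun h => hgf ?_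
    rw [mem_range] at h₁ h₂
    exact ((addr_inj (by omega) hκ).1 h).1
  · intro h
    simp [hf] at h

-- For each pair of sizes within the two lengths, `mix_extract` computes the sum over all pairs of
-- state functions with sum `f`, and summing over the pairs of sizes gives `sem_union`.
open scoped Classical in
theorem mix_convolution {u : ZMod m} (hu : u * A.scale = 1) {Y F₁ F₂ : Finset (Fin n)}
    {E₁ E₂ : Fin n → Fin n → Prop} (hF : Disjoint F₁ F₂)
    (hE₁ : ∀ u v, E₁ u v → u ∉ F₂ ∧ v ∉ F₂) (hE₂ : ∀ u v, E₂ u v → u ∉ F₁ ∧ v ∉ F₁)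
    (hE : ∀ u v, E₁ u v → ¬ E₂ u v) (hY : ∀ v ∈ F₁ ∪ F₂, v ∉ Y) {qa qb r : ℕ} (ha : #F₁ < qa)
    (hb : #F₂ < qb) {f : Fin n → Fin s} (hf : Off Y f) (hr : A.rank f < r) (κ : ℕ) :
    mix Y (A.invMatrix.map (Int.castRingHom (ZMod m))) (fun g => tableConvolution qa qb r
      (fun f κ j => mix Y (A.evalMatrix.map (Int.castRingHom (ZMod m)))
        (fun a => if A.rank a = j then ((A.sem F₁ E₁ a κ : ℤ) : ZMod m) else 0) f)
      (fun f κ j => mix Y (A.evalMatrix.map (Int.castRingHom (ZMod m)))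
        (fun a => if A.rank a = j then ((A.sem F₂ E₂ a κ : ℤ) : ZMod m) else 0) f)
      g κ (A.rank f)) f * u ^ #Y =
      (A.sem (F₁ ∪ F₂) (fun u v => E₁ u v ∨ E₂ u v) f κ : ℤ) := by
  have hf0 : ∀ v, v ∉ Y → f v = A.zero := fun v hv => Fin.ext (by rw [A.zero_val]; exact hf v hv)
  set I := (range qa ×ˢ range qb).filter fun p => p.1 + p.2 = κ with hI
  have hconv : ∀ (ZA ZB : (Fin n → Fin s) → ℕ → ℕ → ZMod m) g,
      tableConvolution qa qb r ZA ZB g κ (A.rank f) =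
        ∑ p ∈ I, ∑ q ∈ antidiagonal (A.rank f), ZA g p.1 q.1 * ZB g p.2 q.2 := by
    intro ZA ZB g
    rw [hI, sum_filter, sum_product]
    unfold tableConvolution
    refine sum_congr rfl fun κ₁ _ => ?_
    rw [sum_comm]
    refine sum_congr rfl fun κ₂ _ => ?_
    by_cases hκ : κ₁ + κ₂ = κ
    · simp only [hκ, true_and, if_true]
      -- Ranks that add up to the rank of `f` are below `r` automatically, so the `r` rows contain
      -- all of them.
      have : antidiagonal (A.rank f) =
          (range r ×ˢ range r).filter fun q => q.1 + q.2 = A.rank f := by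
        ext q
        simp only [HasAntidiagonal.mem_antidiagonal, mem_filter, mem_product, mem_range]
        omega
      rw [this, sum_filter, sum_product]
    · simp [hκ]
  simp only [hconv]
  rw [mix_sum, sum_mul]
  have hstep : ∀ p : ℕ × ℕ, _ := fun p => A.mix_extract hu Y
    (fun a => ((A.sem F₁ E₁ a p.1 : ℤ) : ZMod m)) (fun a => ((A.sem F₂ E₂ a p.2 : ℤ) : ZMod m)) hf0
  rw [StateSystem.sem_union hF hE₁ hE₂ hE (fun v hv => hf0 v (hY v hv)), Int.cast_sum]
  have hsub : I ⊆ antidiagonal κ := by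
    intro p hp
    rw [hI, mem_filter] at hp
    exact HasAntidiagonal.mem_antidiagonal.2 hp.2
  rw [← sum_subset hsub]
  · refine sum_congr rfl fun p _ => ?_
    rw [mul_comm, hstep p]
    push_cast
    rfl
  -- A size beyond the length of its table exceeds the number of completed vertices of that part.
  · intro p hp hpI
    have : qa ≤ p.1 ∨ qb ≤ p.2 := by
      by_contra hc
      push Not at hc
      refine hpI ?_
      rw [hI, mem_filter, mem_product, mem_range, mem_range]
      exact ⟨hc, HasAntidiagonal.mem_antidiagonal.1 hp⟩
    refine (congrArg (Int.cast : ℤ → ZMod m) ?_).trans Int.cast_zero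
    refine sum_eq_zero fun a _ => sum_eq_zero fun b _ => ?_
    rcases this with h | h
    · rw [StateSystem.sem_eq_zero (by omega) E₁ a]
      simp
    · rw [StateSystem.sem_eq_zero (by omega) E₂ b]
      simp

/-- Multiply the tables in the banks `K.wA` and `K.wB`, which belong to the nodes in the registers
`R.px` and `R.py`. -/
def multiplyTables : Prog :=
  assign R.bz (reg R.ly) ;;
  assign R.bskip (reg R.n) ;;
  assign R.bq (reg R.L) ;;
  assign R.br (add (reg R.rr) (reg R.rr)) ;;
  build ;;
  forLoop R.i R.lc (store K.wC (load K.list (reg R.i)) (const 0)) ;;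
  assign R.br (reg R.rr) ;;
  assign R.bq (load K.len (reg R.px)) ;;
  offsets K.listA R.lca ;;
  assign R.bq (load K.len (reg R.py)) ;;
  offsets K.listB R.lcb ;;
  assign R.bq (const 1) ;;
  assign R.br (const 1) ;;
  build ;;
  convolve

/-- The target bank gets `r + r` rows and all sizes below `L`, which is enough for all sums. The
time is split into linear work, proportional to `w * (L * r)`, and the convolution proper, which
keeps the product of the two lengths for the later amortization. -/
theorem does_multiplyTables (hl : Limits B n N s L J m lb ls) (he : Ready S)
    {bag : Fin N → Finset (Fin n)} (hbag : Bags S bag) {y : Fin N} (hy : S.reg R.ly = y)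
    {qa qb r : ℕ} (hqa : S.mem K.len (S.reg R.px) = qa) (hqb : S.mem K.len (S.reg R.py) = qb)
    (hr : S.reg R.rr = r) (ha0 : 0 < qa) (hb0 : 0 < qb) (hab : qa + qb ≤ L) (hr0 : 0 < r)
    (hrJ : r + r ≤ J) {w : ℕ} (hw : s ^ (bag y).card ≤ w)
    {ZA ZB : (Fin n → Fin s) → ℕ → ℕ → ZMod m}
    (hA : ∀ f, Off (bag y) f → ∀ κ < qa, ∀ j < r, Cell m S K.wA (addr L f κ j) (ZA f κ j))
    (hBt : ∀ f, Off (bag y) f → ∀ κ < qb, ∀ j < r, Cell m S K.wB (addr L f κ j) (ZB f κ j)) :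
    Does M B multiplyTables S (14 * n + 600 * (w * (L * r)) +
      w * (qa * r * (qb * r * (lb * 20 + 18)))) fun S' =>
      ∀ f, Off (bag y) f → ∀ κ < L, ∀ j < r + r,
        Cell m S' K.wC (addr L f κ j) (tableConvolution qa qb r ZA ZB f κ j) := by
  have hB := hl.le_B
  have hL := hl.L_pos
  have hJ := hl.J_pos
  have hJ4 := hl.J_lt
  have hs2 := hl.two_le
  have hs0 : 0 < s := by omega
  set c := s ^ (bag y).card with hc
  have hc0 : 0 < c := Nat.pow_pos hs0
  refine Does.mono (τ := 1 + (1 + (1 + (1 + ((n * 7 + 70 * (c * L * (r + r))) +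
    ((c * L * (r + r) * (1 + 2) + 2) + (1 + (1 + (100 * (qa * r) + (1 + (100 * (qb * r) + (1 + (1 +
    ((n * 7 + 70 * (c * 1 * 1)) +
    (c * (qa * r * (qb * r * (lb * 20 + 18) + 4) + 4) + 2)))))))))))))))
    (.seq (.assign hB rfl (fun hS => hS.reg _) (.seq (.assign hB rfl (fun hS => hS.reg _) (.seq
    (.assign hB rfl (fun hS => hS.reg _) (.seq (.assign hB rfl (fun _ => ?_) (.seq
    (Does.mono (Does.conseq (does_build hl
      (z := y) (bag := bag) (k := n) (q := L) (r := r + r)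
      ((((he.setReg (by decide) _).setReg (by decide) _).setReg (by decide) _).setReg
        (by decide) _) (by exact hbag) ?_ ?_ ?_ ?_ hL le_rfl (by omega) hrJ) ?_) ?_))))))))))
    ?_
  · simp only [eval, setReg_reg, OfNat.ofNat_eq_ofNat, Nat.reduceEqDiff, reduceIte, hr]
    omega
  · simp [eval, hy]
  · simp [eval, he.n_eq]
  · simp [eval, he.L_eq]
  · simp [eval, hr]
  · rintro S₁ hf₁ - ⟨g1, g2⟩
    rw [bagWithout_of_le le_rfl] at g1 g2
    have k0 : Ready S₁ :=
      ((((he.setReg (by decide) _).setReg (by decide) _).setReg (by decide) _).setReg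
        (by decide) _).frame hf₁ rfl
    have k1 : S₁.reg R.bz = y := by rw [hf₁.reg _ rfl]; simpa [eval] using hy
    have k2 : S₁.reg R.bskip = n := by rw [hf₁.reg _ rfl]; simpa [eval] using he.n_eq
    have k3 : S₁.reg R.rr = r := by rw [hf₁.reg _ rfl]; simpa using hr
    have k4 : S₁.mem K.len (S₁.reg R.px) = qa := by
      rw [hf₁.mem _ rfl, hf₁.reg _ rfl]; simpa using hqa
    have k5 : S₁.mem K.len (S₁.reg R.py) = qb := by
      rw [hf₁.mem _ rfl, hf₁.reg _ rfl]; simpa using hqb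
    have k6 : Bags S₁ bag := hbag.congr (by rw [hf₁.mem _ rfl]; rfl)
    have k7 : S₁.mem K.wA = S.mem K.wA := by rw [hf₁.mem _ rfl]; rfl
    have k8 : S₁.mem K.wB = S.mem K.wB := by rw [hf₁.mem _ rfl]; rfl
    refine .seq ((Does.forEach hB (fun D S' => ∀ a ∈ D, S'.mem K.wC a = 0) g1 g2 rfl rfl (by decide)
      rfl (fun D S' v h => h) (by simp) ?_ (fun S' _ h => h)).conseq ?_)
    · rintro a ha D hD haD S₂ hf₂ hxa h2
      refine .store hB rfl rfl (by simp [eval]) ?_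
      intro b hb
      rw [setMem_mem_self]
      split_ifs with hab
      · rfl
      · refine h2 b ?_
        rcases mem_insert.1 hb with h | h
        · exact absurd (h.trans hxa.symm) hab
        · exact h
    · intro S₂ hf₂ _ hzero
      have p0 : Ready S₂ := k0.frame hf₂ rfl
      have p1 : S₂.reg R.bz = y := by rw [hf₂.reg _ rfl, k1]
      have p2 : S₂.reg R.bskip = n := by rw [hf₂.reg _ rfl, k2]
      have p3 : S₂.reg R.rr = r := by rw [hf₂.reg _ rfl, k3]
      have p4 : S₂.mem K.len (S₂.reg R.px) = qa := by
        rw [hf₂.mem _ rfl, hf₂.reg R.px rfl, k4]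
      have p5 : S₂.mem K.len (S₂.reg R.py) = qb := by
        rw [hf₂.mem _ rfl, hf₂.reg R.py rfl, k5]
      have p6 : Bags S₂ bag := k6.congr (by rw [hf₂.mem _ rfl])
      have p7 : S₂.mem K.wA = S.mem K.wA := by rw [hf₂.mem _ rfl, k7]
      have p8 : S₂.mem K.wB = S.mem K.wB := by rw [hf₂.mem _ rfl, k8]
      refine .seq (.assign hB rfl (fun hS => hS.reg _) (.seq (.assign hB rfl (fun hS => hS.mem _ _)
        (.seq (Does.conseq (does_offsets hl ((p0.setReg (by decide) _).setReg (by decide) _)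
          (Or.inl ⟨rfl, rfl⟩) (q := qa) (r := r) ?_ ?_ ha0 (by omega) hr0 (by omega)) ?_)))))
      · simpa [eval] using p4
      · simpa [eval] using p3
      · rintro S₃ hf₃ - ⟨a1, a2⟩
        have q0 : Ready S₃ :=
          ((p0.setReg (by decide) _).setReg (by decide) _).frame hf₃ rfl
        have q1 : S₃.reg R.bz = y := by rw [hf₃.reg _ rfl]; simpa using p1
        have q2 : S₃.reg R.bskip = n := by rw [hf₃.reg _ rfl]; simpa using p2
        have q3 : S₃.reg R.br = r := by rw [hf₃.reg _ rfl]; simpa [eval] using p3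
        have q5 : S₃.mem K.len (S₃.reg R.py) = qb := by
          rw [hf₃.mem _ rfl, hf₃.reg R.py rfl]; simpa using p5
        have q6 : Bags S₃ bag := p6.congr (by rw [hf₃.mem _ rfl]; rfl)
        have q7 : S₃.mem K.wA = S.mem K.wA := by rw [hf₃.mem _ rfl]; exact p7
        have q8 : S₃.mem K.wB = S.mem K.wB := by rw [hf₃.mem _ rfl]; exact p8
        have q9 : S₃.mem K.wC = S₂.mem K.wC := by rw [hf₃.mem _ rfl]; rfl
        refine .seq (.assign hB rfl (fun hS => hS.mem _ _) (.seq (Does.conseq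
          (does_offsets hl (q0.setReg (by decide) _) (Or.inr ⟨rfl, rfl⟩) (q := qb) (r := r) ?_ ?_
            hb0 (by omega) hr0 (by omega)) ?_)))
        · simpa [eval] using q5
        · simpa [eval] using q3
        · rintro S₄ hf₄ - ⟨b1, b2⟩
          have r0 : Ready S₄ := (q0.setReg (by decide) _).frame hf₄ rfl
          have r1 : S₄.reg R.bz = y := by rw [hf₄.reg _ rfl]; simpa using q1
          have r2 : S₄.reg R.bskip = n := by rw [hf₄.reg _ rfl]; simpa using q2
          have r6 : Bags S₄ bag := q6.congr (by rw [hf₄.mem _ rfl]; rfl)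
          have r7 : S₄.mem K.wA = S.mem K.wA := by rw [hf₄.mem _ rfl]; exact q7
          have r8 : S₄.mem K.wB = S.mem K.wB := by rw [hf₄.mem _ rfl]; exact q8
          have r9 : S₄.mem K.wC = S₂.mem K.wC := by rw [hf₄.mem _ rfl]; exact q9
          have r10 : S₄.reg R.lca = qa * r := by rw [hf₄.reg _ rfl]; simpa using a1
          have r11 : Enumerates S₄ K.listA (qa * r) (addrBox s L (∅ : Finset (Fin n)) qa r) :=
            a2.congr (by rw [hf₄.mem _ rfl]; rfl)
          refine .seq (.assign hB rfl (fun hS => Nat.one_lt_two_pow (by omega)) (.seq (.assign hB rfl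
            (fun hS => Nat.one_lt_two_pow (by omega)) (.seq (Does.mono (Does.conseq (does_build hl
              (z := y) (bag := bag) (k := n) (q := 1) (r := 1)
              ((r0.setReg (by decide) _).setReg (by decide) _) (by exact r6) ?_ ?_ ?_ ?_
              (by omega) (by omega) (by omega) (by omega)) ?_) ?_)))))
          · simpa using r1
          · simpa using r2
          · simp [eval]
          · simp [eval]
          · rintro S₅ hf₅ - ⟨c1, c2⟩
            rw [bagWithout_of_le le_rfl] at c1 c2
            simp only [mul_one] at c1 c2
            have t0 : Ready S₅ :=
              ((r0.setReg (by decide) _).setReg (by decide) _).frame hf₅ rfl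
            have t7 : S₅.mem K.wA = S.mem K.wA := by rw [hf₅.mem _ rfl]; exact r7
            have t8 : S₅.mem K.wB = S.mem K.wB := by rw [hf₅.mem _ rfl]; exact r8
            have t9 : S₅.mem K.wC = S₂.mem K.wC := by rw [hf₅.mem _ rfl]; exact r9
            have hadd : ∀ {i a : ℕ} {q : ℕ}, q ≤ L → i ∈ addrBox s L (bag y) 1 1 →
                a ∈ addrBox s L (∅ : Finset (Fin n)) q r → ∃ f : Fin n → Fin s, Off (bag y) f ∧ ∃ κ < q, ∃ j < r,
                  a = κ * s ^ n + j * (L * s ^ n) ∧ i = addr L f 0 0 ∧ i + a = addr L f κ j := by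
              intro i a q hq hi ha
              obtain ⟨f, hf, κ₀, hκ₀, j₀, hj₀, rfl⟩ := mem_addrBox.1 hi
              obtain rfl : κ₀ = 0 := by omega
              obtain rfl : j₀ = 0 := by omega
              obtain ⟨g, hg, κ, hκ, j, hj, rfl⟩ := mem_addrBox.1 ha
              have : code g = 0 := by simp [code, hg _ (notMem_empty _)]
              refine ⟨f, hf, κ, hκ, j, hj, ?_, rfl, ?_⟩
              · simp [addr, this]
              · simp only [addr, this]
                ring
            refine Does.conseq (does_convolve hl t0 c1 c2
              (by rw [hf₅.reg _ rfl]; simpa using r10) (r11.congr (by rw [hf₅.mem _ rfl]; rfl))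
              (by rw [hf₅.reg _ rfl]; simpa using b1) (b2.congr (by rw [hf₅.mem _ rfl]; rfl))
              (zA := fun t => (S.mem K.wA t : ZMod m)) (zB := fun t => (S.mem K.wB t : ZMod m))
              (C := addrBox s L (bag y) L (r + r)) ?_ ?_ ?_ ?_) ?_
            · intro i hi a ha
              obtain ⟨f, hf, κ, hκ, j, hj, -, -, he⟩ := hadd (by omega) hi ha
              rw [he]
              exact ⟨by rw [t7]; exact (hA f hf κ hκ j hj).1, by rw [t7]⟩
            · intro i hi a ha
              obtain ⟨f, hf, κ, hκ, j, hj, -, -, he⟩ := hadd (by omega) hi ha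
              rw [he]
              exact ⟨by rw [t8]; exact (hBt f hf κ hκ j hj).1, by rw [t8]⟩
            · intro i hi a ha b hb
              obtain ⟨f, hf, κ, hκ, j, hj, -, hi', he⟩ := hadd (by omega) hi ha
              obtain ⟨f', hf', κ', hκ', j', hj', hb', -, -⟩ := hadd (by omega) hi hb
              refine mem_addrBox.2 ⟨f, hf, κ + κ', by omega, j + j', by omega, ?_⟩
              rw [he, hb']
              simp only [addr]
              ring
            · intro t ht
              rw [t9]
              exact hzero t ht
            · intro S₆ _ _ h6 f hf κ hκ j hj
              have := h6 _ (mem_addrBox.2 ⟨f, hf, κ, hκ, j, hj, rfl⟩)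
              have hsum := sum_eq_convolution hs0 (bag y) hab ha0 hb0 (r := r) (j := j)
                (fun t => (S.mem K.wA t : ZMod m)) (fun t => (S.mem K.wB t : ZMod m)) hf hκ
              replace this : Cell m S₆ K.wC (addr L f κ j) _ := ⟨this.1, this.2.trans hsum⟩
              convert this using 1
              unfold tableConvolution
              refine sum_congr rfl fun κ₁ h₁ => sum_congr rfl fun j₁ h₂ => sum_congr rfl fun κ₂ h₃ =>
                sum_congr rfl fun j₂ h₄ => ?_
              rw [mem_range] at h₁ h₂ h₃ h₄
              simp only [(hA f hf κ₁ h₁ j₁ h₂).2, (hBt f hf κ₂ h₃ j₂ h₄).2]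
          · rw [bagWithout_of_le le_rfl]
  · rw [bagWithout_of_le le_rfl]
  · have h1 : c * (L * r) ≤ w * (L * r) := Nat.mul_le_mul_right _ hw
    have h2 : qa * r ≤ L * r := Nat.mul_le_mul_right _ (by omega)
    have h3 : qb * r ≤ L * r := Nat.mul_le_mul_right _ (by omega)
    have h4 : L * r ≤ c * (L * r) := Nat.le_mul_of_pos_left _ hc0
    have h5 : c * 1 ≤ c * (L * r) := Nat.mul_le_mul_left _ (Nat.mul_pos hL hr0)
    have h6 : c * (qa * r) ≤ c * (L * r) := Nat.mul_le_mul_left _ h2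
    have h7 : c * (qa * r * (qb * r * (lb * 20 + 18))) ≤ w * (qa * r * (qb * r * (lb * 20 + 18))) :=
      Nat.mul_le_mul_right _ hw
    have h8 : c * (qa * r * (qb * r * (lb * 20 + 18) + 4) + 4) =
      c * (qa * r * (qb * r * (lb * 20 + 18))) + 4 * (c * (qa * r)) + 4 * c := by ring
    have h9 : c * L * (r + r) = 2 * (c * (L * r)) := by ring
    have h10 : 1 ≤ c * (L * r) := Nat.mul_pos hc0 (Nat.mul_pos hL hr0)
    rw [h8, h9]
    -- The remaining inequality is linear in the monomials that are named here.
    generalize qa * r * (qb * r * (lb * 20 + 18)) = e at h7 ⊢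
    generalize c * (L * r) = X at *
    generalize w * (L * r) = W at *
    generalize qa * r = a at *
    generalize qb * r = b at *
    generalize c * a = d at *
    generalize c * e = f at *
    generalize w * e = g at *
    clear_value c
    clear hA hBt hbag he hl hL hJ hJ4 hs2 hs0 hc hc0 hw ha0 hb0 hab hr0 hrJ hqa hqb hr hy hB h8 h9
    omega

/-- Merge the table of the node in the register `R.px` into the table of the node in the register
`R.py`. -/
def mergeTables : Prog :=
  assign R.ly (reg R.py) ;;
  countRows ;;
  assign R.lz (reg R.px) ;;
  assign R.lenz (load K.len (reg R.px)) ;;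
  loadRanked K.wA ;;
  assign R.lz (reg R.py) ;;
  assign R.lenz (load K.len (reg R.py)) ;;
  loadRanked K.wB ;;
  assign R.xr (reg R.rr) ;;
  assign R.xq (load K.len (reg R.px)) ;;
  mixAll K.wA K.fwdAbs K.fwdSgn ;;
  assign R.xq (load K.len (reg R.py)) ;;
  mixAll K.wB K.fwdAbs K.fwdSgn ;;
  multiplyTables ;;
  assign R.xq (reg R.L) ;;
  assign R.xr (add (reg R.rr) (reg R.rr)) ;;
  mixAll K.wC K.invAbs K.invSgn ;;
  unitPower ;;
  extract ;;
  store K.len (reg R.py) (add (load K.len (reg R.py)) (load K.len (reg R.px))) ;;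
  store K.alive (reg R.px) (const 0)

/-! ### Invariants of the decomposition and the merging of tables -/

/-- The parts of the graph that belong to the nodes in `X` meet in the bags only. -/
structure Arranged (G : SimpleGraph (Fin n)) (X : Finset (Fin N)) (bag F : Fin N → Finset (Fin n))
    (E : Fin N → Fin n → Fin n → Prop) (len : Fin N → ℕ) : Prop where
  touch : ∀ z ∈ X, ∀ u v, E z u v → (u ∈ F z ∨ u ∈ bag z) ∧ (v ∈ F z ∨ v ∈ bag z)
  disjoint : ∀ z ∈ X, ∀ z' ∈ X, z ≠ z' → Disjoint (F z) (F z')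
  disjoint_bag : ∀ z ∈ X, ∀ z' ∈ X, Disjoint (F z) (bag z')
  edges : ∀ z ∈ X, ∀ z' ∈ X, z ≠ z' → ∀ u v, E z u v → ¬ E z' u v
  card_lt : ∀ z ∈ X, #(F z) < len z
  cover : ∀ v, ∃ z ∈ X, v ∈ F z ∨ v ∈ bag z
  adj : ∀ u v, G.Adj u v ↔ ∃ z ∈ X, E z u v
  sum_len : ∑ z ∈ X, len z = N + ∑ z ∈ X, #(F z)

/-- By `hY` a forgotten vertex lies in no other remaining bag, so the completed vertices stay
disjoint from all bags. The length of the table grows by as much as the number of completed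
vertices, which preserves `card_lt` and `sum_len`. -/
theorem Arranged.forget (h : Arranged G X bag F E len) {x : Fin N}
    (hx : x ∈ X) {Y : Finset (Fin n)} (hY : ∀ z ∈ X, z ≠ x → bag x ∩ bag z ⊆ Y) :
    Arranged G X (update bag x (bag x ∩ Y)) (update F x (F x ∪ (bag x \ Y))) E
      (update len x (len x + #(bag x \ Y))) := by
  have hd : ∀ z ∈ X, z ≠ x → Disjoint (bag x \ Y) (bag z) := by
    intro z hz hzx
    rw [disjoint_left]
    intro v hv hvz
    rw [mem_sdiff] at hv
    exact hv.2 (hY z hz hzx (mem_inter.2 ⟨hv.1, hvz⟩))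
  refine ⟨fun z hz u v huv => ?_, fun z hz z' hz' hne => ?_, fun z hz z' hz' => ?_, h.edges,
    fun z hz => ?_, fun v => ?_, h.adj, ?_⟩
  · have := h.touch z hz u v huv
    by_cases hzx : z = x
    · subst hzx
      simp only [update_self, mem_union, mem_inter, mem_sdiff]
      by_cases hu : u ∈ Y <;> by_cases hv : v ∈ Y <;> simpa [hu, hv] using this
    · simpa only [update_of_ne hzx] using this
  · by_cases hzx : z = x
    · subst hzx
      rw [update_self, update_of_ne hne.symm, disjoint_union_left]
      exact ⟨h.disjoint z hz z' hz' hne,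
        ((h.disjoint_bag z' hz' z hz).symm.mono_left sdiff_subset)⟩
    · rw [update_of_ne hzx]
      by_cases hzx' : z' = x
      · subst hzx'
        rw [update_self, disjoint_union_right]
        exact ⟨h.disjoint z hz z' hz' hne, ((h.disjoint_bag z hz z' hz').mono_right sdiff_subset)⟩
      · rw [update_of_ne hzx']
        exact h.disjoint z hz z' hz' hne
  · by_cases hzx : z = x
    · subst hzx
      rw [update_self, disjoint_union_left]
      by_cases hzx' : z' = z
      · subst hzx'
        rw [update_self]
        exact ⟨(h.disjoint_bag z' hz z' hz).mono_right inter_subset_left,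
          disjoint_sdiff_inter _ _⟩
      · rw [update_of_ne hzx']
        exact ⟨h.disjoint_bag z hz z' hz', hd z' hz' hzx'⟩
    · rw [update_of_ne hzx]
      by_cases hzx' : z' = x
      · subst hzx'
        rw [update_self]
        exact (h.disjoint_bag z hz z' hz').mono_right inter_subset_left
      · rw [update_of_ne hzx']
        exact h.disjoint_bag z hz z' hz'
  · by_cases hzx : z = x
    · subst hzx
      rw [update_self, update_self]
      have := h.card_lt z hz
      have := card_union_le (F z) (bag z \ Y)
      omega
    · rw [update_of_ne hzx, update_of_ne hzx]
      exact h.card_lt z hz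
  · obtain ⟨z, hz, hv⟩ := h.cover v
    refine ⟨z, hz, ?_⟩
    by_cases hzx : z = x
    · subst hzx
      simp only [update_self, mem_union, mem_inter, mem_sdiff]
      by_cases hvY : v ∈ Y <;> simpa [hvY] using hv
    · rwa [update_of_ne hzx, update_of_ne hzx]
  · have h1 := h.sum_len
    rw [← add_sum_erase X _ hx, ← add_sum_erase X (fun z => #(F z)) hx] at h1
    have e₁ : ∑ z ∈ X.erase x, update len x (len x + #(bag x \ Y)) z = ∑ z ∈ X.erase x, len z :=
      sum_congr rfl fun z hz => by rw [update_of_ne (ne_of_mem_erase hz)]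
    have e₂ : ∑ z ∈ X.erase x, #(update F x (F x ∪ (bag x \ Y)) z) = ∑ z ∈ X.erase x, #(F z) :=
      sum_congr rfl fun z hz => by rw [update_of_ne (ne_of_mem_erase hz)]
    rw [← add_sum_erase X _ hx, ← add_sum_erase X (fun z => #(update F x (F x ∪ (bag x \ Y)) z)) hx,
      e₁, e₂]
    simp only [update_self]
    rw [card_union_of_disjoint ((h.disjoint_bag x hx x hx).mono_right sdiff_subset)]
    omega

/-- Since the bag of `x` is contained in the bag of `y`, the latter still separates the united part
from the rest. Lengths are added, so their sum over the remaining nodes does not change. -/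
theorem Arranged.merge (h : Arranged G X bag F E len) {x y : Fin N}
    (hx : x ∈ X) (hy : y ∈ X) (hxy : x ≠ y) (hbag : bag x ⊆ bag y) :
    Arranged G (X.erase x) bag (update F y (F x ∪ F y))
      (update E y fun u v => E x u v ∨ E y u v) (update len y (len y + len x)) := by
  refine ⟨fun z hz u v huv => ?_, fun z hz z' hz' hne => ?_, fun z hz z' hz' => ?_,
    fun z hz z' hz' hne u v huv => ?_, fun z hz => ?_, fun v => ?_, fun u v => ?_, ?_⟩
  · by_cases hzy : z = y
    · subst hzy
      rw [update_self] at huv ⊢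
      simp only [mem_union]
      rcases huv with huv | huv
      · have := h.touch x hx u v huv
        exact ⟨this.1.elim (fun h => Or.inl (Or.inl h)) fun h => Or.inr (hbag h),
          this.2.elim (fun h => Or.inl (Or.inl h)) fun h => Or.inr (hbag h)⟩
      · have := h.touch z hy u v huv
        exact ⟨this.1.imp_left Or.inr, this.2.imp_left Or.inr⟩
    · rw [update_of_ne hzy] at huv ⊢
      exact h.touch z (mem_of_mem_erase hz) u v huv
  · rw [mem_erase] at hz hz'
    by_cases hzy : z = y
    · subst hzy
      rw [update_self, update_of_ne hne.symm, disjoint_union_left]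
      exact ⟨h.disjoint x hx z' hz'.2 hz'.1.symm, h.disjoint z hy z' hz'.2 hne⟩
    · rw [update_of_ne hzy]
      by_cases hzy' : z' = y
      · subst hzy'
        rw [update_self, disjoint_union_right]
        exact ⟨h.disjoint z hz.2 x hx hz.1, h.disjoint z hz.2 z' hy hne⟩
      · rw [update_of_ne hzy']
        exact h.disjoint z hz.2 z' hz'.2 hne
  · have hz'' := mem_of_mem_erase hz'
    by_cases hzy : z = y
    · subst hzy
      rw [update_self, disjoint_union_left]
      exact ⟨h.disjoint_bag x hx z' hz'', h.disjoint_bag z hy z' hz''⟩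
    · rw [update_of_ne hzy]
      exact h.disjoint_bag z (mem_of_mem_erase hz) z' hz''
  · rw [mem_erase] at hz hz'
    by_cases hzy : z = y
    · subst hzy
      rw [update_self] at huv
      rw [update_of_ne hne.symm]
      rcases huv with huv | huv
      · exact h.edges x hx z' hz'.2 hz'.1.symm u v huv
      · exact h.edges z hy z' hz'.2 hne u v huv
    · rw [update_of_ne hzy] at huv
      by_cases hzy' : z' = y
      · subst hzy'
        rw [update_self]
        rintro (huv' | huv')
        · exact h.edges z hz.2 x hx hz.1 u v huv huv'
        · exact h.edges z hz.2 z' hy hne u v huv huv'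
      · rw [update_of_ne hzy']
        exact h.edges z hz.2 z' hz'.2 hne u v huv
  · have hz' := mem_of_mem_erase hz
    by_cases hzy : z = y
    · subst hzy
      rw [update_self, update_self]
      have := h.card_lt z hy
      have := h.card_lt x hx
      have := card_union_le (F x) (F z)
      omega
    · rw [update_of_ne hzy, update_of_ne hzy]
      exact h.card_lt z hz'
  · obtain ⟨z, hz, hv⟩ := h.cover v
    by_cases hzx : z = x
    · subst hzx
      refine ⟨y, mem_erase.2 ⟨hxy.symm, hy⟩, ?_⟩
      rw [update_self]
      exact hv.imp (fun h => mem_union_left _ h) fun h => hbag h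
    · refine ⟨z, mem_erase.2 ⟨hzx, hz⟩, ?_⟩
      by_cases hzy : z = y
      · subst hzy
        rw [update_self]
        exact hv.imp_left fun h => mem_union_right _ h
      · rwa [update_of_ne hzy]
  · rw [h.adj]
    constructor
    · rintro ⟨z, hz, hv⟩
      by_cases hzx : z = x
      · subst hzx
        exact ⟨y, mem_erase.2 ⟨hxy.symm, hy⟩, by rw [update_self]; exact Or.inl hv⟩
      · refine ⟨z, mem_erase.2 ⟨hzx, hz⟩, ?_⟩
        by_cases hzy : z = y
        · subst hzy
          rw [update_self]
          exact Or.inr hv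
        · rwa [update_of_ne hzy]
    · rintro ⟨z, hz, hv⟩
      by_cases hzy : z = y
      · subst hzy
        rw [update_self] at hv
        exact hv.elim (fun h => ⟨x, hx, h⟩) fun h => ⟨z, hy, h⟩
      · rw [update_of_ne hzy] at hv
        exact ⟨z, mem_of_mem_erase hz, hv⟩
  · have h1 := h.sum_len
    have hy' : y ∈ X.erase x := mem_erase.2 ⟨hxy.symm, hy⟩
    rw [← add_sum_erase X _ hx, ← add_sum_erase X (fun z => #(F z)) hx, ← add_sum_erase _ _ hy',
      ← add_sum_erase _ (fun z => #(F z)) hy'] at h1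
    have e₁ : ∑ z ∈ (X.erase x).erase y, update len y (len y + len x) z = ∑ z ∈ (X.erase x).erase y, len z :=
      sum_congr rfl fun z hz => by rw [update_of_ne (ne_of_mem_erase hz)]
    have e₂ : ∑ z ∈ (X.erase x).erase y, #(update F y (F x ∪ F y) z) = ∑ z ∈ (X.erase x).erase y, #(F z) :=
      sum_congr rfl fun z hz => by rw [update_of_ne (ne_of_mem_erase hz)]
    rw [← add_sum_erase _ _ hy', ← add_sum_erase _ (fun z => #(update F y (F x ∪ F y) z)) hy',
      e₁, e₂]
    simp only [update_self]
    rw [card_union_of_disjoint (h.disjoint x hx y hy hxy)]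
    omega

theorem Arranged.sum_card_le (h : Arranged G X bag F E len) :
    ∑ z ∈ X, #(F z) ≤ n := by
  rw [← card_biUnion h.disjoint]
  exact (card_le_univ _).trans_eq (Fintype.card_fin n)

theorem StateSystem.rank_le {Y : Finset (Fin n)} {f : Fin n → Fin s} (hf : Off Y f) :
    A.rank f ≤ #Y * (s - 2) := by
  have h0 : ∀ v, v ∉ Y → A.cv (f v) = 0 := fun v hv => by
    have : f v = A.zero := Fin.ext (by rw [A.zero_val]; exact hf v hv)
    rw [this, A.cv_zero]
  rw [StateSystem.rank, ← sum_subset (subset_univ Y) fun v _ hv => h0 v hv]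
  exact sum_le_card_nsmul Y _ _ fun v _ => A.cv_le _

/-- Apart from the convolution, every contribution is at most a constant times `w * (L * r) * (s *
(n * ls + lb))` or `n * n`. The former covers `n` rounds of matrix entries with `ls` bits and
multiplications by factors with `lb` bits. -/
theorem mergeTables_cost {w lx ly r₀ r : ℕ} (hn : 0 < n) (hw0 : 0 < w) (hL : n < L) (hr0 : 0 < r)
    (hs0 : 0 < s) (hls0 : 0 < ls) (hls : ls ≤ lb) (hr₀r : r₀ ≤ r) (hlxL : lx ≤ L) (hlyL : ly ≤ L) :
    1 + ((n * 5 + 3) + (1 + (1 + (w * (200 * (lx * r₀) + 30 * (n * s)) +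
    (1 + (1 + (w * (200 * (ly * r₀) + 30 * (n * s)) + (1 + (1 +
    ((n * (200 * (w * (lx * r₀) * (s * ls)) + 7 * n) + 2) + (1 +
    ((n * (200 * (w * (ly * r₀) * (s * ls)) + 7 * n) + 2) +
    ((14 * n + 600 * (w * (L * r₀)) + w * (lx * r₀ * (ly * r₀ * (lb * 20 + 18)))) + (1 + (1 +
    ((n * (200 * (w * (L * (r₀ + r₀)) * (s * ls)) + 7 * n) + 2) + ((n * (lb * 20 + 11) + 3) +
    (w * (L * (lb * 20 + 9) + 30 * (n * s) + 120) + (1 + 1))))))))))))))))))) ≤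
    2500 * (w * (L * r) * (s * (n * ls + lb))) + 60 * (n * n) +
      w * (lx * r * (ly * r * (lb * 20 + 18))) := by
  have key : ∀ n P Q x₁ x₂ x₃ x₄ x₅ x₆ x₇ x₈ z₁ z₂ : ℕ, x₁ ≤ 230 * P → x₂ ≤ 230 * P →
      x₃ ≤ 179 * P → x₄ ≤ 31 * P → x₅ ≤ 400 * P + 7 * Q → x₆ ≤ 200 * P + 7 * Q →
      x₇ ≤ 200 * P + 7 * Q → 1 ≤ n → n ≤ P → x₈ ≤ P → z₁ ≤ z₂ →
      1 + ((n * 5 + 3) + (1 + (1 + (x₁ + (1 + (1 + (x₂ + (1 + (1 + ((x₆ + 2) + (1 + ((x₇ + 2) +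
      ((14 * n + 600 * x₈ + z₁) + (1 + (1 + ((x₅ + 2) + ((x₄ + 3) + (x₃ + (1 + 1))))))))))))))))))) ≤
      2500 * P + 60 * Q + z₂ := by
    intros
    linarith
  have hlb0 : 0 < lb := by omega
  have hL0 : 0 < L := by omega
  have a0 : ∀ x q, x ≤ L → q ≤ r → n * (w * (x * q) * (s * ls)) ≤ w * (L * r) * (s * (n * ls + lb)) := by
    intro x q hx hq
    calc n * (w * (x * q) * (s * ls)) = w * (x * q) * (s * (n * ls)) := by ring
      _ ≤ _ := by gcongr; exact Nat.le_add_right _ _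
  have a1 := a0 lx r₀ hlxL hr₀r
  have a2 := a0 ly r₀ hlyL hr₀r
  have a3 := a0 L r₀ le_rfl hr₀r
  have a4 : w * (L * r) ≤ w * (L * r) * (s * (n * ls + lb)) := Nat.le_mul_of_pos_right _ (by positivity)
  have a5 : w * (lx * r₀) ≤ w * (L * r) := by gcongr
  have a6 : w * (ly * r₀) ≤ w * (L * r) := by gcongr
  have a7 : w * (L * r₀) ≤ w * (L * r) := by gcongr
  have a8 : w * (n * s) ≤ w * (L * r) * (s * (n * ls + lb)) := by
    calc w * (n * s) ≤ (w * (n * s)) * (L * r * ls) := Nat.le_mul_of_pos_right _ (by positivity)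
      _ = w * (L * r) * (s * (n * ls)) := by ring
      _ ≤ _ := by gcongr; exact Nat.le_add_right _ _
  have a10 : w * (L * lb) ≤ w * (L * r) * (s * (n * ls + lb)) := by
    calc w * (L * lb) ≤ (w * (L * lb)) * (r * s) := Nat.le_mul_of_pos_right _ (by positivity)
      _ = w * (L * r) * (s * lb) := by ring
      _ ≤ _ := by gcongr; exact Nat.le_add_left _ _
  have a9 : n * lb ≤ w * (L * r) * (s * (n * ls + lb)) := by
    refine le_trans ?_ a10
    calc n * lb ≤ L * lb := Nat.mul_le_mul_right _ hL.le
      _ ≤ w * (L * lb) := Nat.le_mul_of_pos_left _ hw0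
  have a11 : n ≤ n * lb := Nat.le_mul_of_pos_right _ hlb0
  have a12 : w * L ≤ w * (L * lb) := Nat.mul_le_mul_left _ (Nat.le_mul_of_pos_right _ hlb0)
  have a13 : w ≤ w * L := Nat.le_mul_of_pos_right _ hL0
  have a14 : w * (lx * r₀ * (ly * r₀ * (lb * 20 + 18))) ≤
      w * (lx * r * (ly * r * (lb * 20 + 18))) := by gcongr
  have b1 : w * (200 * (lx * r₀) + 30 * (n * s)) ≤ 230 * (w * (L * r) * (s * (n * ls + lb))) := by
    rw [mul_add, mul_left_comm w 200, mul_left_comm w 30]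
    linarith
  have b2 : w * (200 * (ly * r₀) + 30 * (n * s)) ≤ 230 * (w * (L * r) * (s * (n * ls + lb))) := by
    rw [mul_add, mul_left_comm w 200, mul_left_comm w 30]
    linarith
  have b3 : w * (L * (lb * 20 + 9) + 30 * (n * s) + 120) ≤
      179 * (w * (L * r) * (s * (n * ls + lb))) := by
    have : w * (L * (lb * 20 + 9) + 30 * (n * s) + 120) =
      20 * (w * (L * lb)) + 9 * (w * L) + 30 * (w * (n * s)) + 120 * w := by ring
    linarith
  have b4 : n * (lb * 20 + 11) ≤ 31 * (w * (L * r) * (s * (n * ls + lb))) := by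
    have : n * (lb * 20 + 11) = 20 * (n * lb) + 11 * n := by ring
    linarith
  have b5 : n * (200 * (w * (L * (r₀ + r₀)) * (s * ls)) + 7 * n) ≤
      400 * (w * (L * r) * (s * (n * ls + lb))) + 7 * (n * n) := by
    have : n * (200 * (w * (L * (r₀ + r₀)) * (s * ls)) + 7 * n) =
      400 * (n * (w * (L * r₀) * (s * ls))) + 7 * (n * n) := by ring
    linarith
  have b6 : n * (200 * (w * (lx * r₀) * (s * ls)) + 7 * n) ≤
      200 * (w * (L * r) * (s * (n * ls + lb))) + 7 * (n * n) := by
    rw [mul_add, mul_left_comm n 200, mul_left_comm n 7]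
    linarith
  have b7 : n * (200 * (w * (ly * r₀) * (s * ls)) + 7 * n) ≤
      200 * (w * (L * r) * (s * (n * ls + lb))) + 7 * (n * n) := by
    rw [mul_add, mul_left_comm n 200, mul_left_comm n 7]
    linarith
  have b8 : n ≤ w * (L * r) * (s * (n * ls + lb)) := a11.trans a9
  have b9 : w * (L * r₀) ≤ w * (L * r) * (s * (n * ls + lb)) := a7.trans a4
  exact key _ _ _ _ _ _ _ _ _ _ _ _ _ b1 b2 b3 b4 b5 b6 b7 hn b8 b9 a14

/-- Rows are allotted for the actual bag, `r₀` of them, and estimated by `r` only in the time bound.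
The term with `len x` and `len y` stays separate, because it is amortized over all merges. -/
theorem does_mergeTables (hl : Limits B n N s L J m lb ls) (he : Ready S)
    (hS : Holds A m L S X bag F E len) (ha : Arranged G X bag F E len)
    {x y : Fin N} (hxX : x ∈ X) (hyX : y ∈ X) (hxy : x ≠ y) (hx : S.reg R.px = x)
    (hy : S.reg R.py = y) (hlen : len x + len y ≤ L) {w r : ℕ} (hw : s ^ #(bag y) ≤ w)
    (hr : #(bag y) * (s - 2) + 1 ≤ r) :
    Does M B mergeTables S (2500 * (w * (L * r) * (s * (n * ls + lb))) + 60 * (n * n) +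
      w * (len x * r * (len y * r * (lb * 20 + 18)))) fun S' =>
        Holds A m L S' (X.erase x) bag (update F y (F x ∪ F y))
          (update E y fun u v => E x u v ∨ E y u v) (update len y (len y + len x)) := by
  have hB := hl.le_B
  have hL := hl.L_pos
  have hLn := hl.lt_L
  have hJ := hl.le_J
  have hn := hl.n_pos
  have hs2 := hl.two_le
  have hm1 := hl.one_lt_m
  have hlx : 0 < len x := by have := ha.card_lt x hxX; omega
  have hly : 0 < len y := by have := ha.card_lt y hyX; omega
  have hcard : #(bag y) ≤ n := by simpa using card_le_univ (bag y)
  set r₀ := #(bag y) * (s - 2) + 1 with hr₀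
  have hr₀0 : 0 < r₀ := by omega
  have hr₀J : r₀ + r₀ ≤ J := by
    have := Nat.mul_le_mul_right (s - 2) hcard
    omega
  have hrank : ∀ f, Off (bag y) f → A.rank f < r₀ := fun f hf => by
    have := StateSystem.rank_le (A := A) hf
    omega
  have hlen' : len x + len y < 2 ^ B := by
    have := hl.L_lt
    omega
  refine Does.mono (τ := 1 + ((n * 5 + 3) + (1 + (1 + (w * (200 * (len x * r₀) + 30 * (n * s)) +
    (1 + (1 + (w * (200 * (len y * r₀) + 30 * (n * s)) + (1 + (1 +
    ((n * (200 * (w * (len x * r₀) * (s * ls)) + 7 * n) + 2) + (1 +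
    ((n * (200 * (w * (len y * r₀) * (s * ls)) + 7 * n) + 2) +
    ((14 * n + 600 * (w * (L * r₀)) + w * (len x * r₀ * (len y * r₀ * (lb * 20 + 18)))) + (1 + (1 +
    ((n * (200 * (w * (L * (r₀ + r₀)) * (s * ls)) + 7 * n) + 2) + ((n * (lb * 20 + 11) + 3) +
    (w * (L * (lb * 20 + 9) + 30 * (n * s) + 120) + (1 + 1))))))))))))))))))))
    (.seq (.assign hB rfl (fun hS => hS.reg _) (.seq (Does.conseq (does_countRows hl
      (he.setReg (by decide) _) (by exact hS.bags) (y := y) (by simpa [eval] using hy)) ?_)))) ?_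
  · intro S₁ hf₁ _ hrr
    have b0 : Ready S₁ := (he.setReg (by decide) _).frame hf₁ rfl
    have b1 : Holds A m L S₁ X bag F E len := hS.congr (by rw [hf₁.mem _ rfl]; rfl)
      (by rw [hf₁.mem _ rfl]; rfl) (by rw [hf₁.mem _ rfl]; rfl) (by rw [hf₁.mem _ rfl]; rfl)
    have b2 : S₁.reg R.px = x := by rw [hf₁.reg _ rfl]; simpa using hx
    have b3 : S₁.reg R.py = y := by rw [hf₁.reg _ rfl]; simpa using hy
    have b4 : S₁.reg R.ly = y := by rw [hf₁.reg _ rfl]; simpa [eval] using hy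
    have b5 : S₁.mem K.len x = len x := b1.lens x
    refine .seq (.assign hB rfl (fun hS => hS.reg _) (.seq (.assign hB rfl (fun hS => hS.mem _ _)
      (.seq (Does.conseq (does_loadRanked hl ((b0.setReg (by decide) _).setReg (by decide) _)
        (hS := b1.congr rfl rfl rfl rfl) (Or.inl rfl) (z := x) (y := y) (q := len x) (r := r₀) hxX
        ?_ ?_ ?_ ?_ hlx (by omega) hr₀0 (by omega) hrank (ha.touch x hxX)
        (ha.disjoint_bag x hxX y hyX) hw) ?_)))))
    · simpa [eval] using b2
    · simpa using b4
    · simp [eval, b2, b5]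
    · simpa using hrr
    intro S₂ hf₂ _ tA
    have c0 : Ready S₂ :=
      ((b0.setReg (by decide) _).setReg (by decide) _).frame hf₂ rfl
    have c1 : Holds A m L S₂ X bag F E len := b1.congr (by rw [hf₂.mem _ rfl]; rfl)
      (by rw [hf₂.mem _ rfl]; rfl) (by rw [hf₂.mem _ rfl]; rfl) (by rw [hf₂.mem _ rfl]; rfl)
    have c2 : S₂.reg R.px = x := by rw [hf₂.reg _ rfl]; simpa using b2
    have c3 : S₂.reg R.py = y := by rw [hf₂.reg _ rfl]; simpa using b3
    have c4 : S₂.reg R.ly = y := by rw [hf₂.reg _ rfl]; simpa using b4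
    have c5 : S₂.mem K.len y = len y := c1.lens y
    have c6 : S₂.reg R.rr = r₀ := by rw [hf₂.reg _ rfl]; simpa using hrr
    refine .seq (.assign hB rfl (fun hS => hS.reg _) (.seq (.assign hB rfl (fun hS => hS.mem _ _)
      (.seq (Does.conseq (does_loadRanked hl ((c0.setReg (by decide) _).setReg (by decide) _)
        (hS := c1.congr rfl rfl rfl rfl) (Or.inr rfl) (z := y) (y := y) (q := len y) (r := r₀) hyX
        ?_ ?_ ?_ ?_ hly (by omega) hr₀0 (by omega) hrank (ha.touch y hyX)
        (ha.disjoint_bag y hyX y hyX) hw) ?_)))))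
    · simpa [eval] using c3
    · simpa using c4
    · simp [eval, c3, c5]
    · simpa using c6
    intro S₃ hf₃ _ tB
    have d0 : Ready S₃ :=
      ((c0.setReg (by decide) _).setReg (by decide) _).frame hf₃ rfl
    have d1 : Holds A m L S₃ X bag F E len := c1.congr (by rw [hf₃.mem _ rfl]; rfl)
      (by rw [hf₃.mem _ rfl]; rfl) (by rw [hf₃.mem _ rfl]; rfl) (by rw [hf₃.mem _ rfl]; rfl)
    have d2 : S₃.reg R.px = x := by rw [hf₃.reg _ rfl]; simpa using c2
    have d3 : S₃.reg R.py = y := by rw [hf₃.reg _ rfl]; simpa using c3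
    have d4 : S₃.reg R.ly = y := by rw [hf₃.reg _ rfl]; simpa using c4
    have d5 : S₃.mem K.len x = len x := d1.lens x
    have d6 : S₃.reg R.rr = r₀ := by rw [hf₃.reg _ rfl]; simpa using c6
    have d7 : S₃.mem K.wA = S₂.mem K.wA := by rw [hf₃.mem _ rfl]; rfl
    refine .seq (.assign hB rfl (fun hS => hS.reg _) (.seq (.assign hB rfl (fun hS => hS.mem _ _)
      (.seq (Does.conseq (does_mixAll hl ((d0.setReg (by decide) _).setReg (by decide) _)
        (Or.inl ⟨rfl, rfl, rfl, rfl⟩) (by exact d1.bags) (y := y) ?_ (q := len x) (r := r₀)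
        ?_ ?_ hlx (by omega) hr₀0 (by omega) hw
        (fun f hf κ hκ j hj => (tA f hf κ hκ j hj).congr d7)) ?_)))))
    · simpa using d4
    · simp [eval, d2, d5]
    · simpa [eval] using d6
    intro S₄ hf₄ _ mA
    have e0 : Ready S₄ :=
      ((d0.setReg (by decide) _).setReg (by decide) _).frame hf₄ rfl
    have e1 : Holds A m L S₄ X bag F E len := d1.congr (by rw [hf₄.mem _ rfl]; rfl)
      (by rw [hf₄.mem _ rfl]; rfl) (by rw [hf₄.mem _ rfl]; rfl) (by rw [hf₄.mem _ rfl]; rfl)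
    have e2 : S₄.reg R.px = x := by rw [hf₄.reg _ rfl]; simpa using d2
    have e3 : S₄.reg R.py = y := by rw [hf₄.reg _ rfl]; simpa using d3
    have e4 : S₄.reg R.ly = y := by rw [hf₄.reg _ rfl]; simpa using d4
    have e5 : S₄.mem K.len y = len y := e1.lens y
    have e6 : S₄.reg R.rr = r₀ := by rw [hf₄.reg _ rfl]; simpa using d6
    have e7 : S₄.reg R.xr = r₀ := by rw [hf₄.reg _ rfl]; simpa [eval] using d6
    have e8 : S₄.mem K.wB = S₃.mem K.wB := by rw [hf₄.mem _ rfl]; rfl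
    refine .seq (.assign hB rfl (fun hS => hS.mem _ _)
      (.seq (Does.conseq (does_mixAll hl (e0.setReg (by decide) _)
        (Or.inr (Or.inl ⟨rfl, rfl, rfl, rfl⟩)) (by exact e1.bags) (y := y) ?_ (q := len y) (r := r₀)
        ?_ ?_ hly (by omega) hr₀0 (by omega) hw
        (fun f hf κ hκ j hj => (tB f hf κ hκ j hj).congr e8)) ?_)))
    · simpa using e4
    · simp [eval, e3, e5]
    · simpa using e7
    intro S₅ hf₅ _ mB
    have g0 : Ready S₅ := (e0.setReg (by decide) _).frame hf₅ rfl
    have g1 : Holds A m L S₅ X bag F E len := e1.congr (by rw [hf₅.mem _ rfl]; rfl)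
      (by rw [hf₅.mem _ rfl]; rfl) (by rw [hf₅.mem _ rfl]; rfl) (by rw [hf₅.mem _ rfl]; rfl)
    have g2 : S₅.reg R.px = x := by rw [hf₅.reg _ rfl]; simpa using e2
    have g3 : S₅.reg R.py = y := by rw [hf₅.reg _ rfl]; simpa using e3
    have g4 : S₅.reg R.ly = y := by rw [hf₅.reg _ rfl]; simpa using e4
    have g6 : S₅.reg R.rr = r₀ := by rw [hf₅.reg _ rfl]; simpa using e6
    have g7 : S₅.mem K.wA = S₄.mem K.wA := by rw [hf₅.mem _ rfl]; rfl
    refine .seq (Does.conseq (does_multiplyTables hl g0 g1.bags g4 (by rw [g2]; exact g1.lens x)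
      (by rw [g3]; exact g1.lens y) g6 hlx hly hlen hr₀0 hr₀J hw
      (fun f hf κ hκ j hj => (mA f hf κ hκ j hj).congr g7) mB) ?_)
    intro S₆ hf₆ _ mC
    have i0 : Ready S₆ := g0.frame hf₆ rfl
    have i1 : Holds A m L S₆ X bag F E len := g1.congr (hf₆.mem _ rfl) (hf₆.mem _ rfl)
      (hf₆.mem _ rfl) (hf₆.mem _ rfl)
    have i2 : S₆.reg R.px = x := by rw [hf₆.reg _ rfl, g2]
    have i3 : S₆.reg R.py = y := by rw [hf₆.reg _ rfl, g3]
    have i4 : S₆.reg R.ly = y := by rw [hf₆.reg _ rfl, g4]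
    have i6 : S₆.reg R.rr = r₀ := by rw [hf₆.reg _ rfl, g6]
    refine .seq (.assign hB rfl (fun hS => hS.reg _) (.seq (.assign hB rfl (fun _ => ?_)
      (.seq (Does.conseq (does_mixAll hl ((i0.setReg (by decide) _).setReg (by decide) _)
        (Or.inr (Or.inr ⟨rfl, rfl, rfl, rfl⟩)) (by exact i1.bags) (y := y) ?_ (q := L)
        (r := r₀ + r₀) ?_ ?_ hL le_rfl (by omega) hr₀J hw
        (fun f hf κ hκ j hj => (mC f hf κ hκ j hj).congr rfl)) ?_)))))
    · have := hl.J_lt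
      simp only [eval, setReg_reg, OfNat.ofNat_eq_ofNat, Nat.reduceEqDiff, reduceIte, i6]
      omega
    · simpa using i4
    · simpa [eval] using i0.L_eq
    · simp [eval, i6]
    intro S₇ hf₇ _ mD
    have k0 : Ready S₇ :=
      ((i0.setReg (by decide) _).setReg (by decide) _).frame hf₇ rfl
    have k1 : Holds A m L S₇ X bag F E len := i1.congr (by rw [hf₇.mem _ rfl]; rfl)
      (by rw [hf₇.mem _ rfl]; rfl) (by rw [hf₇.mem _ rfl]; rfl) (by rw [hf₇.mem _ rfl]; rfl)
    have k2 : S₇.reg R.px = x := by rw [hf₇.reg _ rfl]; simpa using i2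
    have k3 : S₇.reg R.py = y := by rw [hf₇.reg _ rfl]; simpa using i3
    have k4 : S₇.reg R.ly = y := by rw [hf₇.reg _ rfl]; simpa using i4
    refine .seq (Does.conseq (does_unitPower hl k0 k1.bags k4) ?_)
    rintro S₈ hf₈ - ⟨hpw, hpw'⟩
    have l0 : Ready S₈ := k0.frame hf₈ rfl
    have l1 : Holds A m L S₈ X bag F E len := k1.congr (hf₈.mem _ rfl) (hf₈.mem _ rfl)
      (hf₈.mem _ rfl) (hf₈.mem _ rfl)
    have l2 : S₈.reg R.px = x := by rw [hf₈.reg _ rfl, k2]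
    have l3 : S₈.reg R.py = y := by rw [hf₈.reg _ rfl, k3]
    have l4 : S₈.reg R.ly = y := by rw [hf₈.reg _ rfl, k4]
    refine .seq (Does.conseq (does_extract hl l0 l1.bags l1.tabs l4 (by omega : r₀ ≤ J) hrank
      (fun f hf κ hκ j hj => (mD f hf κ hκ j (by omega)).congr (hf₈.mem _ rfl)) hpw hw) ?_)
    intro S₉ hf₉ _ hT
    have m2 : S₉.reg R.px = x := by rw [hf₉.reg _ rfl, l2]
    have m3 : S₉.reg R.py = y := by rw [hf₉.reg _ rfl, l3]
    have m5 : ∀ z : Fin N, S₉.mem K.len z = len z := fun z => by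
      rw [hf₉.mem _ rfl]; exact l1.lens z
    have m6 : ∀ z : Fin N, S₉.mem K.alive z ≠ 0 ↔ z ∈ X := fun z => by
      rw [hf₉.mem _ rfl]; exact l1.alive z
    refine .seq (.store hB rfl rfl (fun _ => ?_) (.store hB rfl rfl (by simp [eval]) ?_))
    · simp only [eval, m2, m3, m5]
      omega
    · refine ⟨l1.bags.congr (by simp [Config.setMem, hf₉.mem K.inc rfl]), fun z => ?_, fun z => ?_, ?_⟩
      · by_cases hz : z = y
        · subst hz
          simp [Config.setMem, eval, m2, m3, m5]
        · have : (z : ℕ) ≠ y := fun h => hz (Fin.ext h)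
          simp [Config.setMem, eval, m3, m5, hz, this]
      · by_cases hz : z = x
        · subst hz
          simp [Config.setMem, eval, m2]
        · have : (z : ℕ) ≠ x := fun h => hz (Fin.ext h)
          simpa [Config.setMem, eval, m2, hz, this] using m6 z
      · intro z hz f hf κ hκ
        have h1 := hT z (mem_of_mem_erase hz) f hf κ hκ
        refine Cell.congr (S := S₉) ?_ (by simp [Config.setMem])
        refine ⟨h1.1, h1.2.trans ?_⟩
        by_cases hzy : z = y
        · subst hzy
          simp only [if_true, update_self]
          rw [hpw']
          -- What `mix_convolution` asks of the two parts is supplied by `Arranged`: edges of one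
          -- part touch only its own completed vertices and its bag, and both avoid the completed
          -- vertices of the other part.
          refine mix_convolution (A := A) k0.u_mul (ha.disjoint x hxX z hyX hxy) (fun u v huv => ?_)
            (fun u v huv => ?_) (ha.edges x hxX z hyX hxy) (fun v hv => ?_) (ha.card_lt x hxX)
            (ha.card_lt z hyX) hf (hrank f hf) κ
          · have h1 := ha.touch x hxX u v huv
            have h2 := disjoint_right.1 (ha.disjoint x hxX z hyX hxy)
            have h3 := disjoint_left.1 (ha.disjoint_bag z hyX x hxX)
            exact ⟨fun h => h1.1.elim (h2 h) (h3 h), fun h => h1.2.elim (h2 h) (h3 h)⟩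
          · have h1 := ha.touch z hyX u v huv
            have h2 := disjoint_left.1 (ha.disjoint x hxX z hyX hxy)
            have h3 := disjoint_left.1 (ha.disjoint_bag x hxX z hyX)
            exact ⟨fun h => h1.1.elim (h2 h) (h3 h), fun h => h1.2.elim (h2 h) (h3 h)⟩
          · rcases mem_union.1 hv with h | h
            · exact disjoint_left.1 (ha.disjoint_bag x hxX z hyX) h
            · exact disjoint_left.1 (ha.disjoint_bag z hyX z hyX) h
        · simp only [hzy, if_false, update_of_ne hzy]
  · have hw0 : 0 < w := (Nat.pow_pos (by omega)).trans_le hw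
    have hls := hl.ls_le
    have hls0 := hl.ls_pos
    exact mergeTables_cost hn hw0 (by have := hl.lt_L; omega) (by omega) (by omega) hl.ls_pos hls hr (by omega)
      (by omega)

/-! ### Ends of the remaining tree -/

/-- The node `x` has at most one neighbour among the nodes in `X`. -/
def IsEnd (T : TreeDecomposition G (Fin N)) (X : Finset (Fin N)) (x : Fin N) : Prop :=
  ∀ y ∈ X, ∀ z ∈ X, T.tree.Adj x y → T.tree.Adj x z → y = z

/-- A connected induced subgraph of a tree is a tree. If it has at least two nodes it has a leaf,
and a single node is an end trivially. -/
theorem exists_isEnd {X : Finset (Fin N)} (hX : (T.tree.induce (X : Set (Fin N))).Connected) :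
    ∃ x ∈ X, IsEnd T X x := by
  classical
  have ht : (T.tree.induce (X : Set (Fin N))).IsTree := ⟨hX, T.isTree.isAcyclic.induce _⟩
  rcases subsingleton_or_nontrivial (X : Set (Fin N)) with h | h
  · obtain ⟨x⟩ := hX.nonempty
    exact ⟨x, x.2, fun y hy z hz _ _ =>
      congrArg Subtype.val (Subsingleton.elim (⟨y, hy⟩ : (X : Set (Fin N))) ⟨z, hz⟩)⟩
  · obtain ⟨x, hx⟩ := ht.exists_vert_degree_one_of_nontrivial
    obtain ⟨u, -, hu⟩ := SimpleGraph.degree_eq_one_iff_existsUnique_adj.1 hx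
    refine ⟨x, x.2, fun y hy z hz hxy hxz => ?_⟩
    have h1 := hu ⟨y, hy⟩ hxy
    have h2 := hu ⟨z, hz⟩ hxz
    exact congrArg Subtype.val (h1.trans h2.symm)

theorem exists_adj {X : Finset (Fin N)} (hX : (T.tree.induce (X : Set (Fin N))).Connected)
    {x z : Fin N} (hx : x ∈ X) (hz : z ∈ X) (hxz : x ≠ z) : ∃ y ∈ X, T.tree.Adj x y := by
  obtain ⟨P⟩ := hX.preconnected ⟨x, hx⟩ ⟨z, hz⟩
  cases P with
  | nil => exact absurd rfl hxz
  | @cons _ y _ h _ => exact ⟨y, y.2, h⟩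

/-- Deleting a node of degree at most one keeps the other nodes connected, and `y` shows that there
are some left. The homomorphism `f` only identifies the two descriptions of the remaining induced
subgraph. -/
theorem IsEnd.connected_erase {X : Finset (Fin N)} {x y : Fin N} (h : IsEnd T X x)
    (hX : (T.tree.induce (X : Set (Fin N))).Connected) (hx : x ∈ X) (hy : y ∈ X) (hxy : x ≠ y) :
    (T.tree.induce (X.erase x : Set (Fin N))).Connected := by
  have hp := hX.preconnected.induce_of_degree_eq_one (s := {⟨x, hx⟩}ᶜ) (by
    rintro v hv
    obtain rfl : v = ⟨x, hx⟩ := by simpa using hv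
    intro a ha b hb
    exact Subtype.ext (h a a.2 b b.2 ha hb))
  have hmem : ∀ a : ({⟨x, hx⟩}ᶜ : Set (X : Set (Fin N))), (a : Fin N) ∈
      ((X.erase x : Finset (Fin N)) : Set (Fin N)) := fun a =>
    mem_coe.2 (mem_erase.2 ⟨fun he => a.2 (Subtype.ext he), a.1.2⟩)
  let f : (T.tree.induce (X : Set (Fin N))).induce {⟨x, hx⟩}ᶜ →g
      T.tree.induce ((X.erase x : Finset (Fin N)) : Set (Fin N)) :=
    ⟨fun a => ⟨a, hmem a⟩, fun h => h⟩
  have : Nonempty ((X.erase x : Finset (Fin N)) : Set (Fin N)) :=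
    ⟨⟨y, mem_coe.2 (mem_erase.2 ⟨hxy.symm, hy⟩)⟩⟩
  refine (SimpleGraph.connected_iff _).2 ⟨fun a b => ?_, this⟩
  have ha := mem_erase.1 (mem_coe.1 a.2)
  have hb := mem_erase.1 (mem_coe.1 b.2)
  exact (hp ⟨⟨a, ha.2⟩, fun he => ha.1 (congrArg Subtype.val he)⟩
    ⟨⟨b, hb.2⟩, fun he => hb.1 (congrArg Subtype.val he)⟩).map f

/-- The remaining nodes are connected, so a path inside them leads from `x` to `z`, and its second
node can only be `y`. A vertex in the bags of both ends of the path lies in all bags on it. -/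
theorem IsEnd.inter_subset {X : Finset (Fin N)} {x y z : Fin N} (h : IsEnd T X x)
    (hX : (T.tree.induce (X : Set (Fin N))).Connected) (hx : x ∈ X) (hy : y ∈ X)
    (hxy : T.tree.Adj x y) (hz : z ∈ X) (hxz : z ≠ x) : T.bag x ∩ T.bag z ⊆ T.bag y := by
  intro v hv
  rw [mem_inter] at hv
  obtain ⟨P, hP⟩ := hX.preconnected.exists_isPath ⟨x, hx⟩ ⟨z, hz⟩
  have hP' := SimpleGraph.Walk.IsPath.map
    (f := (SimpleGraph.Embedding.induce (G := T.tree) (X : Set (Fin N))).toHom)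
    (Subtype.val_injective) hP
  refine T.mem_bag_of_mem_path v x z _ hP' hv.1 hv.2 y ?_
  cases P with
  | nil => exact absurd rfl hxz
  | @cons _ y' _ hadj P =>
    have : y = y' := h y hy y' y'.2 hxy hadj
    have key : ∀ {a b : (X : Set (Fin N))} (w : (T.tree.induce (X : Set (Fin N))).Walk a b),
        y' ∈ w.support → (y' : Fin N) ∈ (w.map
          (SimpleGraph.Embedding.induce (G := T.tree) (X : Set (Fin N))).toHom).support := by
      intro a b w hw
      rw [SimpleGraph.Walk.support_map]
      exact List.mem_map.2 ⟨y', hw, rfl⟩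
    rw [this]
    exact key _ (List.mem_cons_of_mem _ P.start_mem_support)

/-- Find a remaining node with at most one remaining neighbour, and this neighbour. -/
def findEnd : Prog :=
  forLoop R.x R.N
    (branch (load K.alive (reg R.x))
      (assign R.cnt (const 0) ;;
      forLoop R.y R.N
        (branch (load K.alive (reg R.y))
          (branch (load K.adjT (add (load K.mulNN (reg R.x)) (reg R.y)))
            (assign R.cnt (add (reg R.cnt) (const 1)) ;; assign R.last (reg R.y)) skip) skip) ;;
      branch (lt (reg R.cnt) (const 2))
        (assign R.px (reg R.x) ;; assign R.py (reg R.last)) skip) skip)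

/-- Write the values of `e` at the vertices into the bank `K.keep`. -/
def fillKeep (e : Expr) : Prog :=
  forLoop R.h R.n (store K.keep (reg R.h) e)

theorem does_fillKeep (hl : Limits B n N s L J m lb ls) (hn : S.reg R.n = n) {e : Expr}
    (he : e.small = true) {Y : Finset (Fin n)}
    (hY : ∀ S', (fillKeep e).Frame S S' → S'.Bounded B → ∀ v : Fin n, S'.reg R.h = v →
      e.eval S' < 2 ^ B ∧ (e.eval S' ≠ 0 ↔ v ∈ Y)) :
    Does M B (fillKeep e) S (n * 3 + 2) fun S' => ∀ v : Fin n, S'.mem K.keep v ≠ 0 ↔ v ∈ Y := by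
  have hB := hl.le_B
  refine Does.mono (τ := n * (1 + 2) + 2) (.forLoop hB (fun i S' => ∀ v : Fin n, (v : ℕ) < i →
    (S'.mem K.keep v ≠ 0 ↔ v ∈ Y)) hn rfl rfl (by decide) (fun v hv => absurd hv (by omega)) ?_
    fun S' _ _ h v => h v v.2) (by omega)
  intro i S₁ hi hf hxi h1
  refine .of_bounded fun hb => ?_
  have h2 := hY S₁ hf hb ⟨i, hi⟩ hxi
  refine .store hB rfl he (fun _ => h2.1) fun v hv => ?_
  by_cases hvi : (v : ℕ) = i
  · obtain rfl : v = ⟨i, hi⟩ := Fin.ext hvi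
    simpa [Config.setMem, eval, hxi] using h2.2
  · simpa [Config.setMem, eval, hxi, hvi] using h1 v (by omega)

/-- The search does not stop early, so the last end overwrites the earlier ones; the invariant
therefore claims a result only once an end has been passed. The register `R.py` is meaningful only
if the end has a remaining neighbour, which fails exactly for the last node. -/
theorem does_findEnd (hl : Limits B n N s L J m lb ls) (he : Ready S)
    {X : Finset (Fin N)} (hX : ∀ x : Fin N, S.mem K.alive x ≠ 0 ↔ x ∈ X)
    (hex : ∃ x ∈ X, IsEnd T X x) :
    Does M B findEnd S (N * (N * 8 + 11) + 2) fun S' => ∃ x ∈ X, IsEnd T X x ∧ S'.reg R.px = x ∧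
      ((∃ y ∈ X, T.tree.Adj x y) → ∃ y ∈ X, T.tree.Adj x y ∧ S'.reg R.py = y) := by
  classical
  have hB := hl.le_B
  have hNB : N < 2 ^ B := by have := hl.n_lt; omega
  refine Does.mono (τ := N * ((N * 8 + 9) + 2) + 2) (.forLoop hB (fun i S' => (∃ x ∈ X, IsEnd T X x ∧ (x : ℕ) < i) →
    ∃ x ∈ X, IsEnd T X x ∧ S'.reg R.px = x ∧
      ((∃ y ∈ X, T.tree.Adj x y) → ∃ y ∈ X, T.tree.Adj x y ∧ S'.reg R.py = y))
    he.N_eq rfl rfl (by decide) ?_ ?_ ?_) ?_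
  · rintro ⟨x, -, -, h⟩
    omega
  · intro i S₁ hi hf hxi h1
    have e0 : Ready S₁ := he.frame hf rfl
    have e1 : ∀ x : Fin N, S₁.mem K.alive x ≠ 0 ↔ x ∈ X := fun x => by rw [hf.mem _ rfl, hX]
    set x : Fin N := ⟨i, hi⟩ with hx
    by_cases hxX : x ∈ X
    · refine Does.mono (τ := 1 + (1 + ((N * ((1 + (1 + (1 + 1) + 1) + 1) + 2) + 2) +
        (1 + (1 + 1) + 1))) + 1) (.branch hB rfl (fun _ => .seq (.assign hB rfl
        (fun _ => by simp [eval]) (.seq (Does.conseq (.forLoop (n := N) hB (fun j S' =>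
        S'.reg R.cnt = #((X.filter (T.tree.Adj x)).filter fun y : Fin N => (y : ℕ) < j) ∧
          (0 < S'.reg R.cnt → ∃ y ∈ X, T.tree.Adj x y ∧ S'.reg R.last = y))
        (by simpa using e0.N_eq) rfl rfl (by decide) (by simp [eval]) ?_
        fun S' _ _ h => h) ?_)))) fun hg => ?_) (by omega)
      · rintro j S₂ hj hf₂ hyj ⟨h2, h3⟩
        have e3 : S₂.reg R.x = x := by rw [hf₂.reg _ rfl]; simpa using hxi
        have e4 : S₂.mem K.alive = S₁.mem K.alive := by rw [hf₂.mem _ rfl]; rfl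
        have e5 : Ready S₂ := (e0.setReg (by decide) _).frame hf₂ rfl
        have e6 : eval S₂ (.load K.adjT (.add (.load K.mulNN (.reg R.x)) (.reg R.y))) ≠ 0 ↔
            T.tree.Adj x ⟨j, hj⟩ := by
          simp only [eval, e3, hyj, e5.mulNN x x.2]
          exact e5.adjT x ⟨j, hj⟩
        have hskip : ⟨j, hj⟩ ∉ X.filter (T.tree.Adj x) → (S₂.setReg R.y (j + 1)).reg R.cnt =
            #((X.filter (T.tree.Adj x)).filter fun y : Fin N => (y : ℕ) < j + 1) ∧
            (0 < (S₂.setReg R.y (j + 1)).reg R.cnt → ∃ y ∈ X, T.tree.Adj x y ∧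
              (S₂.setReg R.y (j + 1)).reg R.last = y) := by
          intro hn
          rw [card_filter_lt_succ hj, if_neg hn]
          simpa using And.intro h2 h3
        refine .branch hB rfl (fun hg => .branch hB rfl (fun hg' => .seq (.assign hB rfl (fun _ => ?_)
          (.assign hB rfl (fun hS => hS.reg _) ?_))) fun hg' => .skip (hskip ?_))
          fun hg => .skip (hskip ?_)
        · have : S₂.reg R.cnt ≤ N := by
            rw [h2]
            exact (card_le_univ _).trans_eq (Fintype.card_fin N)
          have := hl.n_lt
          have := hl.n_pos
          simp only [eval]
          omega
        · have hmem : ⟨j, hj⟩ ∈ X.filter (T.tree.Adj x) := by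
            refine mem_filter.2 ⟨?_, e6.1 hg'⟩
            rw [← e1, ← e4]
            simpa [eval, hyj] using hg
          rw [card_filter_lt_succ hj, if_pos hmem]
          refine ⟨by simp [eval, h2], fun _ => ⟨⟨j, hj⟩, (mem_filter.1 hmem).1,
            (mem_filter.1 hmem).2, by simp [eval, hyj]⟩⟩
        · intro hmem
          exact e6.2 (mem_filter.1 hmem).2 hg'
        · intro hmem
          have := (e1 ⟨j, hj⟩).2 (mem_filter.1 hmem).1
          rw [← e4] at this
          simp [eval, hyj, this] at hg
      · rintro S₂ hf₂ - ⟨h2, h3⟩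
        have e3 : S₂.reg R.x = x := by rw [hf₂.reg _ rfl]; simpa using hxi
        have hall : (X.filter (T.tree.Adj x)).filter (fun y : Fin N => (y : ℕ) < N) =
            X.filter (T.tree.Adj x) := filter_true_of_mem fun y _ => y.2
        rw [hall] at h2
        have hend : IsEnd T X x ↔ S₂.reg R.cnt < 2 := by
          rw [h2, Nat.lt_succ_iff, card_le_one]
          simp only [mem_filter, and_imp]
          exact ⟨fun h y hy hxy z hz hxz => h y hy z hz hxy hxz,
            fun h y hy z hz hxy hxz => h y hy hxy z hz hxz⟩
        refine .branch hB rfl (fun hg => .seq (.assign hB rfl (fun hS => hS.reg _)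
          (.assign hB rfl (fun hS => hS.reg _) ?_))) fun hg => .skip ?_
        · intro _
          refine ⟨x, hxX, hend.2 (by simpa [eval] using hg), by simp [eval, e3], ?_⟩
          rintro ⟨y, hy, hxy⟩
          obtain ⟨y', hy', hxy', hlast⟩ := h3 (by
            rw [h2]
            exact card_pos.2 ⟨y, mem_filter.2 ⟨hy, hxy⟩⟩)
          exact ⟨y', hy', hxy', by simpa [eval] using hlast⟩
        · rintro ⟨z, hz, hz', hzi⟩
          have hne : (z : ℕ) ≠ i := fun h => by
            obtain rfl : z = x := Fin.ext h
            simp [eval, hend.1 hz'] at hg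
          have := h1 ⟨z, hz, hz', by omega⟩
          have p1 : S₂.reg R.px = S₁.reg R.px := by rw [hf₂.reg _ rfl]; rfl
          have p2 : S₂.reg R.py = S₁.reg R.py := by rw [hf₂.reg _ rfl]; rfl
          simpa [p1, p2] using this
      · have := (e1 x).2 hxX
        simp only [eval, hxi] at hg
        exact absurd hg this
    · refine Does.mono (τ := 1 + 0 + 1) (.branch hB rfl (fun hg => ?_) fun _ => .skip ?_) (by omega)
      · refine absurd ((e1 x).1 ?_) hxX
        simpa [eval, hxi] using hg
      · rintro ⟨z, hz, hz', hzi⟩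
        have hne : (z : ℕ) ≠ i := fun h => by
          obtain rfl : z = x := Fin.ext h
          exact hxX hz
        simpa using h1 ⟨z, hz, hz', by omega⟩
  · intro S₁ _ _ h
    obtain ⟨x, hx, hx'⟩ := hex
    exact h ⟨x, hx, hx', x.2⟩
  · exact le_rfl

/-! ### Contraction of the tree and its amortized time -/

/-- Process the nodes of the tree until one is left. -/
def contractTree : Prog :=
  assign R.its (sub (reg R.N) (const 1)) ;;
  forLoop R.it R.its
    (findEnd ;;
    fillKeep (load K.inc (add (load K.mulN (reg R.py)) (reg R.h))) ;;
    forgetAll ;;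
    mergeTables)

/-- Complete the table of the last node and copy it to the output. -/
def finish : Prog :=
  findEnd ;;
  fillKeep (const 0) ;;
  forgetAll ;;
  assign R.xq (add (reg R.n) (const 1)) ;;
  forLoop R.k R.xq
    (store K.out (reg R.k) (load K.tab (add (load K.mulW (reg R.k)) (load K.mulLW (reg R.px)))))

/-- The change of `∑ g (len z)` by a merge, written without subtraction; it will be used for the
lengths and for their squares. -/
theorem sum_erase_merge {ι : Type*} [DecidableEq ι] {X : Finset ι} {x y : ι} (hx : x ∈ X)
    (hy : y ∈ X) (hxy : x ≠ y) (len : ι → ℕ) (g : ℕ → ℕ) (a b : ℕ) :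
    ∑ z ∈ X.erase x, g (update (update len x a) y b z) + g (len x) + g (len y) =
      ∑ z ∈ X, g (len z) + g b := by
  have hy' : y ∈ X.erase x := mem_erase.2 ⟨hxy.symm, hy⟩
  have h : ∑ z ∈ (X.erase x).erase y, g (update (update len x a) y b z) =
      ∑ z ∈ (X.erase x).erase y, g (len z) := by
    refine sum_congr rfl fun z hz => ?_
    rw [update_of_ne (ne_of_mem_erase hz),
      update_of_ne (ne_of_mem_erase (mem_of_mem_erase hz))]
  rw [← add_sum_erase X _ hx, ← add_sum_erase _ _ hy', ← add_sum_erase _ (fun z => g (len z)) hy', h,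
    update_self]
  omega

/-- A version of the rule for composition in which the time of the second program may depend on the
outcome of the first: the time of a step depends on the end that was found. -/
theorem Does.exists_seq {P Q : Prog} {τ : ℕ} {mid : Config → Prop} {post : ℕ → Config → Prop}
    (h : Does M B P S τ mid) (hQ : ∀ S', P.Frame S S' → S'.Bounded B → mid S' →
      ∃ τ', Does M B Q S' τ' (post τ')) : ∃ τ', Does M B (P ;; Q) S (τ + τ') (post τ') := by
  by_cases hS : S.Bounded B
  · obtain ⟨S', t, hr, ht, hb, hm⟩ := h hS
    obtain ⟨τ', hτ⟩ := hQ S' hr.frame hb hm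
    obtain ⟨S'', t', hr', ht', hb', hp⟩ := hτ hb
    exact ⟨τ', fun _ => ⟨S'', t + t', .seq hr hr', by rw [Nat.add_mul]; exact Nat.add_le_add ht ht',
      hb', hp⟩⟩
  · exact ⟨0, fun h => absurd h hS⟩

/-- The state of the computation after a number of nodes have been processed. -/
structure Contracted (A : StateSystem ρ σ s) (T : TreeDecomposition G (Fin N)) (m L : ℕ)
    (S : Config) (X : Finset (Fin N)) (bag F : Fin N → Finset (Fin n))
    (E : Fin N → Fin n → Fin n → Prop) (len : Fin N → ℕ) : Prop where
  holds : Holds A m L S X bag F E len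
  arranged : Arranged G X bag F E len
  connected : (T.tree.induce (X : Set (Fin N))).Connected
  bag_eq : ∀ z ∈ X, bag z = T.bag z

/-- A bound for the time of processing a node, apart from the time for the convolutions. -/
def contractCost (n N L s lb ls w r : ℕ) : ℕ :=
  N * (N * 8 + 11) + 2 + (n * 3 + 2) + (n * 7 + 3) +
    (2500 * (w * (L * r) * (s * (n * ls + lb))) + 60 * (n * n))

/-- Here `a` and `b` stand for the sums of the lengths and of their squares before the step, `a'`
and `b'` for those after it. Their growth pays for the `δ` completed vertices and for the
convolution. -/
theorem contractStep_cost {w r δ lx ly a a' b b' : ℕ} (ha : a + δ ≤ a') (hb : b + lx * ly ≤ b') :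
    N * (N * 8 + 11) + 2 + ((n * 3 + 2) + ((n * 7 + 3 + δ * (200 * (w * L))) +
      (2500 * (w * (L * r) * (s * (n * ls + lb))) + 60 * (n * n) +
      w * (lx * r * (ly * r * (lb * 20 + 18)))))) + a * (200 * (w * L)) +
      b * (w * (r * (r * (lb * 20 + 18)))) ≤
    contractCost n N L s lb ls w r + a' * (200 * (w * L)) + b' * (w * (r * (r * (lb * 20 + 18)))) := by
  have h1 := Nat.mul_le_mul_right (200 * (w * L)) ha
  have h2 := Nat.mul_le_mul_right (w * (r * (r * (lb * 20 + 18)))) hb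
  have h3 : lx * ly * (w * (r * (r * (lb * 20 + 18)))) =
    w * (lx * r * (ly * r * (lb * 20 + 18))) := by ring
  rw [add_mul] at h1 h2
  rw [h3] at h2
  unfold contractCost
  linarith

/-- A potential argument. Completing `δ` vertices increases the sum of the lengths by `δ`. Merging
tables of lengths `a` and `b` replaces `a ^ 2 + b ^ 2` by `(a + b) ^ 2`, so the sum of the squares
grows by at least `a * b`, the number of pairs of sizes that are convolved. -/
theorem does_contractStep (hl : Limits B n N s L J m lb ls) (he : Ready S)
    (h : Contracted A T m L S X bag F E len) (hX : 1 < #X) {w r : ℕ}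
    (hw : ∀ x, s ^ #(T.bag x) ≤ w) (hr : ∀ x, #(T.bag x) * (s - 2) + 1 ≤ r) :
    ∃ τ, Does M B (findEnd ;; fillKeep (.load K.inc (.add (.load K.mulN (.reg R.py)) (.reg R.h))) ;;
      forgetAll ;; mergeTables) S τ fun S' => ∃ X' bag' F' E' len',
        Contracted A T m L S' X' bag' F' E' len' ∧ #X' + 1 = #X ∧
        τ + (∑ z ∈ X, len z) * (200 * (w * L)) +
            (∑ z ∈ X, len z ^ 2) * (w * (r * (r * (lb * 20 + 18)))) ≤
          contractCost n N L s lb ls w r + (∑ z ∈ X', len' z) * (200 * (w * L)) +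
            (∑ z ∈ X', len' z ^ 2) * (w * (r * (r * (lb * 20 + 18)))) := by
  have hB := hl.le_B
  have hLn := hl.lt_L
  refine (Does.exists_seq (Q := fillKeep (.load K.inc (.add (.load K.mulN (.reg R.py))
    (.reg R.h))) ;; forgetAll ;; mergeTables) (post := fun τ' S' => ∃ X' bag' F' E' len',
        Contracted A T m L S' X' bag' F' E' len' ∧ #X' + 1 = #X ∧
        N * (N * 8 + 11) + 2 + τ' + (∑ z ∈ X, len z) * (200 * (w * L)) +
            (∑ z ∈ X, len z ^ 2) * (w * (r * (r * (lb * 20 + 18)))) ≤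
          contractCost n N L s lb ls w r + (∑ z ∈ X', len' z) * (200 * (w * L)) +
            (∑ z ∈ X', len' z ^ 2) * (w * (r * (r * (lb * 20 + 18)))))
    (does_findEnd hl he h.holds.alive (exists_isEnd h.connected)) ?_).elim fun τ hτ => ⟨_, hτ⟩
  rintro S₁ hf₁ - ⟨x, hxX, hend, hpx, hpy⟩
  obtain ⟨z, hzX, hzx⟩ := exists_mem_ne hX x
  obtain ⟨y, hyX, hxy, hpy⟩ := hpy (exists_adj h.connected hxX hzX hzx.symm)
  have hne : x ≠ y := hxy.ne
  have b0 : Ready S₁ := he.frame hf₁ rfl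
  have b1 : Holds A m L S₁ X bag F E len := h.holds.congr (hf₁.mem _ rfl) (hf₁.mem _ rfl)
    (hf₁.mem _ rfl) (hf₁.mem _ rfl)
  have hY : ∀ z ∈ X, z ≠ x → bag x ∩ bag z ⊆ bag y := by
    intro z hz hzx
    rw [h.bag_eq x hxX, h.bag_eq z hz, h.bag_eq y hyX]
    exact hend.inter_subset h.connected hxX hyX hxy hz hzx
  have ha := h.arranged.forget hxX hY
  set δ := #(bag x \ bag y) with hδ
  set len' := update len x (len x + δ) with hlen'
  have hsum : ∀ z ∈ X, len' z ≤ ∑ z ∈ X, len' z := fun z hz =>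
    single_le_sum (fun _ _ => Nat.zero_le _) hz
  have hle : ∑ z ∈ X, len' z ≤ N + n := by
    rw [ha.sum_len]
    exact Nat.add_le_add_left ha.sum_card_le _
  have hlx : len' x = len x + δ := update_self ..
  have hly : len' y = len y := update_of_ne hne.symm ..
  have hlxy : len' x + len' y ≤ N + n := by
    refine le_trans ?_ hle
    rw [← sum_pair hne]
    exact sum_le_sum_of_subset (by
      intro z hz
      rcases mem_insert.1 hz with rfl | hz
      · exact hxX
      · rwa [mem_singleton.1 hz])
  have hlen : len x + #(bag x \ bag y) < L := by omega
  have hlenL : len' x + len' y ≤ L := by omega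
  have hwx : ∀ z ∈ X, s ^ #(bag z) ≤ w := fun z hz => by
    rw [h.bag_eq z hz]
    exact hw z
  have hby : update bag x (bag x ∩ bag y) y = bag y := update_of_ne hne.symm ..
  refine ⟨(n * 3 + 2) + ((n * 7 + 3 + δ * (200 * (w * L))) +
    (2500 * (w * (L * r) * (s * (n * ls + lb))) + 60 * (n * n) +
      w * (len' x * r * (len' y * r * (lb * 20 + 18))))),
    .seq (Does.conseq (does_fillKeep hl b0.n_eq rfl (Y := bag y) ?_) ?_)⟩
  · intro S₂ hf₂ hb₂ v hv
    refine ⟨hb₂.mem _ _, ?_⟩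
    have e0 : Ready S₂ := b0.frame hf₂ rfl
    simp only [eval, hv, hf₂.reg R.py rfl, hpy, e0.mulN y (by omega), hf₂.mem K.inc rfl]
    exact b1.bags y v
  intro S₂ hf₂ _ hkeep
  have c0 : Ready S₂ := b0.frame hf₂ rfl
  have c1 : Holds A m L S₂ X bag F E len := b1.congr (hf₂.mem _ rfl) (hf₂.mem _ rfl)
    (hf₂.mem _ rfl) (hf₂.mem _ rfl)
  have c2 : S₂.reg R.px = x := by rw [hf₂.reg _ rfl, hpx]
  have c3 : S₂.reg R.py = y := by rw [hf₂.reg _ rfl, hpy]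
  refine .seq (Does.conseq (does_forgetAll hl c0 c1 hxX c2 hkeep
    (h.arranged.disjoint_bag x hxX x hxX) hlen (hwx x hxX)) ?_)
  intro S₃ hf₃ _ c4
  refine Does.conseq (does_mergeTables hl (c0.frame hf₃ rfl) c4 ha hxX hyX hne
    (by rw [hf₃.reg _ rfl, c2]) (by rw [hf₃.reg _ rfl, c3]) hlenL
    (by rw [hby]; exact hwx y hyX) (by rw [hby, h.bag_eq y hyX]; exact hr y)) ?_
  intro S₄ _ _ c5
  have hsub : update bag x (bag x ∩ bag y) x ⊆ update bag x (bag x ∩ bag y) y := by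
    rw [update_self, hby]
    exact inter_subset_right
  refine ⟨_, _, _, _, _, ⟨c5, ha.merge hxX hyX hne hsub,
    hend.connected_erase h.connected hxX hyX hne, fun z hz => ?_⟩, ?_, ?_⟩
  · rw [update_of_ne (ne_of_mem_erase hz), h.bag_eq z (mem_of_mem_erase hz)]
  · rw [card_erase_of_mem hxX]
    omega
  · have h1 : ∑ z ∈ X.erase x, update len' y (len' y + len' x) z + len x + len y =
        ∑ z ∈ X, len z + (len' y + len' x) :=
      sum_erase_merge hxX hyX hne len (fun t => t) (len x + δ) (len' y + len' x)
    have h2 : ∑ z ∈ X.erase x, update len' y (len' y + len' x) z ^ 2 + len x ^ 2 + len y ^ 2 =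
        ∑ z ∈ X, len z ^ 2 + (len' y + len' x) ^ 2 := sum_erase_merge hxX hyX hne len (fun t => t ^ 2) (len x + δ) (len' y + len' x)
    refine contractStep_cost ?_ ?_
    · change _ ≤ ∑ z ∈ X.erase x, update len' y (len' y + len' x) z
      omega
    · have h3 : (len' y + len' x) ^ 2 = len' y ^ 2 + len' x ^ 2 + 2 * (len' x * len' y) := by ring
      have h4 : len x ^ 2 ≤ len' x ^ 2 := Nat.pow_le_pow_left (by omega) 2
      rw [h3, hly] at h2
      change _ + len' x * len' y ≤ ∑ z ∈ X.erase x, update len' y (len' y + len' x) z ^ 2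
      rw [hly]
      omega

theorem sum_sq_le {ι : Type*} (X : Finset ι) (len : ι → ℕ) :
    ∑ z ∈ X, len z ^ 2 ≤ (∑ z ∈ X, len z) ^ 2 := by
  rw [sq, sum_mul]
  refine sum_le_sum fun z hz => ?_
  rw [sq]
  exact Nat.mul_le_mul_left _ (single_le_sum (fun _ _ => Nat.zero_le _) hz)

/-- The lengths add up to `N` plus the number of completed vertices, so the two potentials never
exceed `N + n` and `(N + n) ^ 2`. Hence all convolutions together handle quadratically many pairs of
sizes, although there may be linearly many merges. -/
theorem does_contractTree (hl : Limits B n N s L J m lb ls) (he : Ready S)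
    (h : Contracted A T m L S X bag F E len) (hX : #X = N) {w r : ℕ}
    (hw : ∀ x, s ^ #(T.bag x) ≤ w) (hr : ∀ x, #(T.bag x) * (s - 2) + 1 ≤ r) :
    Does M B contractTree S (N * 2 + 3 + (N * contractCost n N L s lb ls w r +
      (N + n) * (200 * (w * L)) + (N + n) ^ 2 * (w * (r * (r * (lb * 20 + 18)))))) fun S' =>
        ∃ X' bag' F' E' len', Contracted A T m L S' X' bag' F' E' len' ∧ #X' = 1 := by
  have hB := hl.le_B
  have hN := hl.N_pos
  have hNB : N < 2 ^ B := by have := hl.n_lt; omega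
  refine Does.mono (τ := 1 + ((N - 1) * 2 + 2 + (N * contractCost n N L s lb ls w r +
      (N + n) * (200 * (w * L)) + (N + n) ^ 2 * (w * (r * (r * (lb * 20 + 18)))))))
    (.seq (.assign hB rfl (fun _ => ?_) (.forLoop_amortized (n := N - 1) hB (fun i t S' =>
      ∃ X' bag' F' E' len', Contracted A T m L S' X' bag' F' E' len' ∧ #X' + i = N ∧
        t ≤ i * contractCost n N L s lb ls w r + (∑ z ∈ X', len' z) * (200 * (w * L)) +
          (∑ z ∈ X', len' z ^ 2) * (w * (r * (r * (lb * 20 + 18)))))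
      (by simp [eval, he.N_eq]) rfl rfl (by decide) ?_ ?_ ?_))) (by omega)
  · simp only [eval, he.N_eq]
    omega
  · exact ⟨X, bag, F, E, len, ⟨h.holds.congr rfl rfl rfl rfl, h.arranged, h.connected, h.bag_eq⟩,
      hX, Nat.zero_le _⟩
  · rintro i t S₁ hi hf - ⟨X', bag', F', E', len', h1, h2, h3⟩
    have e0 : Ready S₁ := (he.setReg (by decide) _).frame hf rfl
    obtain ⟨τ, hτ⟩ := does_contractStep (M := M) hl e0 h1 (by omega) hw hr
    refine ⟨τ, hτ.conseq ?_⟩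
    rintro S₂ - - ⟨X'', bag'', F'', E'', len'', g1, g2, g3⟩
    refine ⟨X'', bag'', F'', E'', len'', ⟨g1.holds.congr rfl rfl rfl rfl, g1.arranged, g1.connected,
      g1.bag_eq⟩, by omega, ?_⟩
    rw [add_mul i 1]
    linarith
  · rintro t S₁ - - ⟨X', bag', F', E', len', h1, h2, h3⟩
    refine ⟨⟨X', bag', F', E', len', h1, by omega⟩, h3.trans ?_⟩
    have h4 : ∑ z ∈ X', len' z ≤ N + n := by
      rw [h1.arranged.sum_len]
      exact Nat.add_le_add_left h1.arranged.sum_card_le _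
    have h5 := (sum_sq_le X' len').trans (Nat.pow_le_pow_left h4 2)
    gcongr
    omega

/-- When one node is left, its part of the graph has all edges, and its bag together with its
completed vertices covers everything. Completing the bag leaves a table that is described by
`sem_univ`. -/
theorem does_finish (hl : Limits B n N s L J m lb ls) (he : Ready S)
    (h : Contracted A T m L S X bag F E len) (hX : #X = 1) {w : ℕ}
    (hw : ∀ x, s ^ #(T.bag x) ≤ w) (hm : ∀ κ, rhoSigmaCount ρ σ G κ < m) :
    Does M B finish S (N * (N * 8 + 11) + 13 * n + n * (200 * (w * L)) + 13) fun S' =>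
      ∀ κ ≤ n, S'.mem K.out κ = rhoSigmaCount ρ σ G κ := by
  have hB := hl.le_B
  have hLn := hl.lt_L
  have hnB := hl.n_lt
  refine Does.mono (τ := (N * (N * 8 + 11) + 2) + ((n * 3 + 2) + ((n * 7 + 3 + n * (200 * (w * L))) +
    (1 + ((n + 1) * (1 + 2) + 2))))) (.seq (Does.conseq (does_findEnd hl he h.holds.alive
    (exists_isEnd h.connected)) ?_)) (by omega)
  rintro S₁ hf₁ - ⟨x, hxX, -, hpx, -⟩
  obtain ⟨x', rfl⟩ := card_eq_one.1 hX
  obtain rfl : x = x' := mem_singleton.1 hxX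
  have b0 : Ready S₁ := he.frame hf₁ rfl
  have b1 : Holds A m L S₁ {x} bag F E len := h.holds.congr (hf₁.mem _ rfl) (hf₁.mem _ rfl)
    (hf₁.mem _ rfl) (hf₁.mem _ rfl)
  refine .seq (Does.conseq (does_fillKeep hl b0.n_eq rfl (Y := ∅) fun S' _ _ _ _ =>
    ⟨by simp [eval], by simp [eval]⟩) ?_)
  intro S₂ hf₂ _ hkeep
  have c0 : Ready S₂ := b0.frame hf₂ rfl
  have c1 : Holds A m L S₂ {x} bag F E len := b1.congr (hf₂.mem _ rfl) (hf₂.mem _ rfl)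
    (hf₂.mem _ rfl) (hf₂.mem _ rfl)
  have c2 : S₂.reg R.px = x := by rw [hf₂.reg _ rfl, hpx]
  have hcard : #(bag x \ ∅) ≤ n := (card_le_univ _).trans_eq (Fintype.card_fin n)
  have ha := h.arranged.forget hxX (Y := ∅) fun z hz hzx => absurd (mem_singleton.1 hz) hzx
  have hlen : len x + #(bag x \ ∅) < L := by
    have h1 := ha.sum_len
    have h2 := ha.sum_card_le
    rw [sum_singleton, update_self] at h1
    omega
  have hwx : s ^ #(bag x) ≤ w := by rw [h.bag_eq x hxX]; exact hw x
  refine .seq (Does.conseq (Does.mono (does_forgetAll hl c0 c1 hxX c2 hkeep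
    (h.arranged.disjoint_bag x hxX x hxX) hlen hwx) ?_) ?_)
  · gcongr
  intro S₃ hf₃ _ c3
  have d0 : Ready S₃ := c0.frame hf₃ rfl
  have d1 : S₃.reg R.px = x := by rw [hf₃.reg _ rfl, c2]
  have hF : F x ∪ (bag x \ ∅) = univ := by
    refine eq_univ_of_forall fun v => ?_
    obtain ⟨z, hz, hv⟩ := h.arranged.cover v
    obtain rfl := mem_singleton.1 hz
    simpa using hv
  have hE : E x = G.Adj := by
    ext u v
    rw [h.arranged.adj]
    simp
  have hs0 : 0 < s := by have := hl.two_le; omega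
  -- Both the stored residue and the number of dominating sets are below `m`, so their congruence is
  -- an equality.
  have hcell : ∀ κ ≤ n, S₃.mem K.tab (κ * s ^ n + x * (L * s ^ n)) = rhoSigmaCount ρ σ G κ := by
    intro κ hκ
    have h1 := c3.tabs x (mem_coe.2 hxX) (fun _ => A.zero) (fun v _ => A.zero_val) κ (by omega)
    have h2 : addr L (fun _ : Fin n => A.zero) κ x = κ * s ^ n + x * (L * s ^ n) := by
      simp [addr, code, A.zero_val]
    rw [h2] at h1
    simp only [update_self, hF, hE, StateSystem.sem_univ] at h1
    have h3 := h1.2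
    rw [Int.cast_natCast, ZMod.natCast_eq_natCast_iff'] at h3
    rwa [Nat.mod_eq_of_lt h1.1, Nat.mod_eq_of_lt (hm κ)] at h3
  refine .seq (.assign hB rfl (fun _ => ?_) (.forLoop (n := n + 1) hB (fun i S' => ∀ κ < i,
    S'.mem K.out κ = rhoSigmaCount ρ σ G κ) (by simp [eval, d0.n_eq]) rfl rfl (by decide)
    (fun κ hκ => absurd hκ (by omega)) ?_ fun S' _ _ h κ hκ => h κ (by omega)))
  · have := hl.N_pos
    simp only [eval, d0.n_eq]
    omega
  · intro i S₄ hi hf₄ hki h4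
    have e0 : Ready S₄ := (d0.setReg (by decide) _).frame hf₄ rfl
    have e1 : S₄.reg R.px = x := by rw [hf₄.reg _ rfl]; simpa using d1
    have e2 : S₄.mem K.tab = S₃.mem K.tab := by rw [hf₄.mem _ rfl]; rfl
    have hNJ : N ≤ J := by have := hl.le_J; omega
    refine .store hB rfl rfl (fun hb => hb.mem _ _) fun κ hκ => ?_
    have hval : eval S₄ (.load K.tab (.add (.load K.mulW (.reg R.k))
        (.load K.mulLW (.reg R.px)))) = rhoSigmaCount ρ σ G i := by
      simp only [eval, hki, e1, e0.mulW i (by omega), e0.mulLW x (by omega), e2]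
      exact hcell i (by omega)
    rw [hval]
    by_cases hκi : κ = i
    · subst hκi
      simp [Config.setMem, eval, hki]
    · simpa [Config.setMem, eval, hki, hκi] using h4 κ (by omega)

/-! ### Initialization of the constants, tables of multiples and homes of the edges -/

/-- Write the values of a sequence into the bank `b`. The first value is `e`, and `Q` computes the
next one. -/
def table (b y : ℕ) (e : Expr) (Q : Prog) : Prog :=
  assign R.acc e ;; forLoop R.i y (store b (reg R.i) (reg R.acc) ;; Q)

/-- Add the register `r` to the accumulator. -/
def addReg (r : ℕ) : Prog := assign R.acc (add (reg R.acc) (reg r))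

/-- Multiply the accumulator by the register `r`. -/
def mulReg (r : ℕ) : Prog :=
  assign R.tacc (const 0) ;;
  forLoop R.j r (assign R.tacc (add (reg R.tacc) (reg R.acc))) ;;
  assign R.acc (reg R.tacc)

/-- For all pairs of vertices, find a node whose bag contains them. -/
def findHomes : Prog :=
  forLoop R.a R.n (forLoop R.b R.n (forLoop R.x R.N
    (branch (load K.inc (add (load K.mulN (reg R.x)) (reg R.a)))
      (branch (load K.inc (add (load K.mulN (reg R.x)) (reg R.b)))
        (store K.own (add (load K.mulN (reg R.a)) (reg R.b)) (reg R.x)) skip) skip)))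

/-- Store constants. -/
def storeAll {ι : Type*} (key val : ℕ → ι → ℕ) : List (ℕ × ι) → Prog
  | [] => skip
  | t :: l => storeAll key val l ;; store t.1 (const (key t.1 t.2)) (const (val t.1 t.2))

theorem Prog.Frame.seq {P Q : Prog} {S S' S'' : Config} (h : P.Frame S S') (h' : Q.Frame S' S'') :
    (P ;; Q).Frame S S'' :=
  .trans (h.mono (fun _ h => (Bool.or_eq_false_iff.1 h).1) fun _ h => (Bool.or_eq_false_iff.1 h).1)
    (h'.mono (fun _ h => (Bool.or_eq_false_iff.1 h).2) fun _ h => (Bool.or_eq_false_iff.1 h).2)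

/-- Several items of the list may have the same address, since the vectors are listed with an
irrelevant first index. By `hkv` they then have the same value, and the order of writing does not
matter. -/
theorem does_storeAll {ι : Type*} {key val : ℕ → ι → ℕ} (hk : ∀ b i, key b i < 2 ^ B)
    (hv : ∀ b i, val b i < 2 ^ B) (hkv : ∀ b i j, key b i = key b j → val b i = val b j)
    (l : List (ℕ × ι)) : Does M B (storeAll key val l) S (l.length + 1) fun S' => S'.reg = S.reg ∧
      (∀ t ∈ l, S'.mem t.1 (key t.1 t.2) = val t.1 t.2) ∧
      ∀ b, (∀ t ∈ l, t.1 ≠ b) → S'.mem b = S.mem b := by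
  induction l with
  | nil => exact .skip ⟨rfl, by simp, fun _ _ => rfl⟩
  | cons t l ih =>
    refine .seq (ih.conseq ?_)
    rintro S₁ - - ⟨h1, h2, h3⟩
    refine .store_const (hk _ _) (hv _ _) ⟨h1, fun t' ht => ?_, fun b hb => ?_⟩
    · by_cases hb : t'.1 = t.1
      · rw [hb, setMem_mem_self]
        split_ifs with hi
        · exact hkv _ _ _ hi.symm
        · rcases List.mem_cons.1 ht with rfl | ht
          · exact absurd rfl hi
          · rw [← hb]
            exact h2 t' ht
      · rw [setMem_mem_ne _ _ _ _ _ hb]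
        rcases List.mem_cons.1 ht with rfl | ht
        · exact absurd rfl hb
        · exact h2 t' ht
    · rw [setMem_mem_ne _ _ _ _ _ (hb t List.mem_cons_self).symm]
      exact h3 b fun t' ht => hb t' (List.mem_cons_of_mem _ ht)

/-- The final value of the accumulator is part of the conclusion, because the next value of the
sequence is often a parameter itself, such as `s ^ n` after the table of the powers `s ^ j` with `j
< n`. -/
theorem does_table (hB : 64 ≤ B) {b y cnt τ : ℕ} {e : Expr} {Q : Prog} {f : ℕ → ℕ}
    (h0 : Does M B (.assign R.acc e) S 1 fun S' => S'.reg R.acc = f 0) (hy : S.reg y = cnt)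
    (hya : y ≠ R.acc) (hyi : R.i ≠ y) (hQi : Q.writesReg R.i = false) (hQy : Q.writesReg y = false)
    (hQb : Q.writesMem b = false)
    (hQ : ∀ S' j, j < cnt → (table b y e Q).Frame S S' → S'.reg R.acc = f j →
      Does M B Q S' τ fun S'' => S''.reg R.acc = f (j + 1)) :
    Does M B (table b y e Q) S (1 + (cnt * (1 + τ + 2) + 2)) fun S' =>
      (∀ j < cnt, S'.mem b j = f j) ∧ S'.reg R.acc = f cnt := by
  refine .seq (h0.conseq fun S₁ hf₁ _ h1 => .forLoop hB (fun i S' => (∀ j < i, S'.mem b j = f j) ∧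
    S'.reg R.acc = f i) (by rw [hf₁.reg _ (by simpa [Prog.writesReg] using hya.symm), hy])
    (by simpa [Prog.writesReg] using hQi) (by simpa [Prog.writesReg] using hQy) hyi
    ⟨fun j hj => absurd hj (by omega), by simpa using h1⟩ ?_ fun S' _ _ h => h)
  rintro i S₂ hi hf₂ hxi ⟨h2, h3⟩
  refine .seq (.store hB rfl rfl (fun hS => hS.reg _) ((hQ _ i hi ((hf₁.seq hf₂).trans ?_) ?_).conseq
    fun S₃ hf₃ _ h4 => ⟨fun j hj => ?_, by simpa using h4⟩))
  · refine ⟨fun _ _ => rfl, fun z hz => setMem_mem_ne _ _ _ _ _ ?_⟩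
    simp only [Prog.writesMem, Prog.forLoop, Bool.or_eq_false_iff, beq_eq_false_iff_ne] at hz
    exact hz.2.2.1.1.symm
  · simpa using h3
  · rw [setReg_mem, hf₃.mem b hQb, setMem_mem_self]
    simp only [eval, hxi, h3]
    split_ifs with hji
    · rw [hji]
    · exact h2 j (by omega)

theorem does_assign_eq (hB : 64 ≤ B) {x v : ℕ} {e : Expr} (he : e.small = true)
    (hv : e.eval S = v) (hlt : v < 2 ^ B) : Does M B (.assign x e) S 1 fun S' => S'.reg x = v :=
  .assign hB he (fun _ => hv ▸ hlt) (by simpa using hv)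

theorem does_assign_value {x c : ℕ} (hc : c < 2 ^ B) :
    Does M B (.assign x (.const c)) S 1 fun S' => S'.reg x = c :=
  .assign_const hc (by simp)

theorem does_multiplesTable (hB : 64 ≤ B) {b y r cnt a : ℕ} (hy : S.reg y = cnt) (hr : S.reg r = a)
    (hy' : y ≠ R.acc ∧ R.i ≠ y) (hr' : r ≠ R.acc ∧ R.i ≠ r) (hlt : cnt * a < 2 ^ B)
    (hrs : (addReg r).writesReg y = false ∧ (Expr.add (.reg R.acc) (.reg r)).small = true := by
      exact ⟨rfl, rfl⟩) :
    Does M B (table b y (.const 0) (addReg r)) S (cnt * 4 + 3) fun S' =>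
      (∀ j < cnt, S'.mem b j = j * a) ∧ S'.reg R.acc = cnt * a := by
  refine (does_table (τ := 1) (f := fun j => j * a) hB
    ((does_assign_value (by positivity)).conseq fun _ _ _ h => by simpa using h)
    hy hy'.1 hy'.2 rfl hrs.1 rfl ?_).mono (by omega)
  intro S₁ j hj hf h1
  have h2 : S₁.reg r = a := by
    rw [hf.reg, hr]
    have := hr'.1
    simp only [table, addReg, Prog.forLoop, Prog.writesReg, Bool.or_eq_false_iff, beq_eq_false_iff_ne]
    grind
  have h3 : (j + 1) * a ≤ cnt * a := Nat.mul_le_mul_right _ hj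
  rw [add_mul, one_mul] at h3
  refine .assign hB hrs.2 (fun _ => ?_) ?_
  · simp only [eval, h1, h2]
    omega
  · simp [eval, h1, h2, add_mul]

theorem does_doublingTable (hB : 64 ≤ B) {b y cnt a : ℕ} (hy : S.reg y = cnt)
    (hy' : y ≠ R.acc ∧ R.i ≠ y) (hlt : a * 2 ^ cnt < 2 ^ B)
    (hys : (addReg R.acc).writesReg y = false := by rfl) :
    Does M B (table b y (.const a) (addReg R.acc)) S (cnt * 4 + 3) fun S' =>
      (∀ j < cnt, S'.mem b j = a * 2 ^ j) ∧ S'.reg R.acc = a * 2 ^ cnt := by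
  refine (does_table (τ := 1) (f := fun j => a * 2 ^ j) hB ((does_assign_value
    ((Nat.le_mul_of_pos_right _ (by positivity)).trans_lt hlt)).conseq fun _ _ _ h => by simpa using h)
    hy hy'.1 hy'.2 rfl hys rfl ?_).mono (by omega)
  intro S₁ j hj _ h1
  have h3 : a * 2 ^ (j + 1) ≤ a * 2 ^ cnt :=
    Nat.mul_le_mul_left _ (Nat.pow_le_pow_right (by norm_num) hj)
  have h4 : a * 2 ^ (j + 1) = a * 2 ^ j + a * 2 ^ j := by ring
  refine .assign hB rfl (fun _ => ?_) ?_
  · simp only [eval, h1]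
    omega
  · simp [eval, h1, h4]

theorem does_powersTable (hB : 64 ≤ B) (hn : S.reg R.n = n) (hs : S.reg R.s = s) (hs0 : 0 < s)
    (hlt : s ^ n < 2 ^ B) : Does M B (table K.powS R.n (.const 1) (mulReg R.s)) S
      (n * (s * 3 + 7) + 3) fun S' => (∀ j < n, S'.mem K.powS j = s ^ j) ∧ S'.reg R.acc = s ^ n := by
  refine (does_table (τ := 1 + ((s * (1 + 2) + 2) + 1)) (f := fun j => s ^ j) hB
    ((does_assign_value (Nat.one_lt_two_pow (by omega))).conseq fun _ _ _ h => by simpa using h)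
    hn (by decide) (by decide) rfl rfl rfl ?_).mono (by ring_nf; omega)
  intro S₁ j hj hf h1
  have h3 : s ^ j * s < 2 ^ B := by
    rw [← pow_succ]
    exact (Nat.pow_le_pow_right hs0 hj).trans_lt hlt
  refine .seq (.assign hB rfl (fun _ => by simp [eval]) (.seq (Does.conseq (.forLoop (n := s) hB
    (fun i S' => S'.reg R.tacc = i * s ^ j) (by rw [setReg_reg]; simpa using (hf.reg R.s rfl).trans hs)
    rfl rfl (by decide) (by simp [eval]) ?_ fun S' _ _ h => h) ?_)))
  · intro i S₂ hi hf₂ hji h2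
    have h4 : S₂.reg R.acc = s ^ j := by rw [hf₂.reg _ rfl]; simpa using h1
    have h5 : (i + 1) * s ^ j ≤ s * s ^ j := Nat.mul_le_mul_right _ hi
    rw [add_mul, one_mul, mul_comm s] at h5
    refine .assign hB rfl (fun _ => ?_) ?_
    · simp only [eval, h2, h4]
      omega
    · simp [eval, h2, h4, add_mul]
  · intro S₂ _ _ h2
    exact .assign hB rfl (fun hS => hS.reg _) (by simp [eval, h2, pow_succ, mul_comm])

/-- The cell of `K.own` that belongs to `u` and `v` contains a node, whose bag contains `u` and `v`
if this holds for one of the first `k u v` nodes. -/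
def Homes (T : TreeDecomposition G (Fin N)) (S : Config) (k : ℕ → ℕ → ℕ) : Prop :=
  ∀ u v : Fin n, ∃ y : Fin N, S.mem K.own (u * n + v) = y ∧
    ∀ x : Fin N, (x : ℕ) < k u v → u ∈ T.bag x → v ∈ T.bag x → u ∈ T.bag y ∧ v ∈ T.bag y

theorem Homes.congr {S' : Config} {k k' : ℕ → ℕ → ℕ} (h : Homes T S k)
    (hS : S'.mem K.own = S.mem K.own) (hk : ∀ u v : Fin n, k' u v ≤ k u v) : Homes T S' k' := fun u v => by
  obtain ⟨y, h1, h2⟩ := h u v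
  exact ⟨y, by rw [hS, h1], fun x hx => h2 x (hx.trans_le (hk u v))⟩

/-- Later nodes overwrite earlier ones, so the cell holds the last node whose bag contains both
vertices. If there is none, it keeps an arbitrary node, initially 0; this happens only for pairs
that are not adjacent. -/
theorem does_findHomes (hB : 64 ≤ B) (hn : S.reg R.n = n) (hN : S.reg R.N = N)
    (hm : ∀ v < n + N, S.mem K.mulN v = v * n) (hbag : Bags S T.bag)
    (h0 : Homes T S fun _ _ => 0) :
    Does M B findHomes S (n * (n * (N * 7 + 4) + 4) + 2) fun S' => Homes T S' fun _ _ => N := by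
  refine Does.mono (τ := n * ((n * ((N * (5 + 2) + 2) + 2) + 2) + 2) + 2)
    (.forLoop hB (fun i S' => Homes T S' fun u _ => if u < i then N else 0) hn rfl rfl (by decide)
    (h0.congr rfl (by simp)) ?_ ?_) le_rfl
  · intro i S₁ hi hf₁ ha h1
    refine .forLoop hB (fun j S' => Homes T S' fun u v => if u < i ∨ (u = i ∧ v < j) then N else 0)
      (by rw [hf₁.reg _ rfl, hn]) rfl rfl (by decide)
      (h1.congr rfl fun u v => by split_ifs <;> omega) ?_ ?_
    · intro j S₂ hj hf₂ hb h2
      refine .forLoop hB (fun k S' => Homes T S' fun u v => if u < i ∨ (u = i ∧ v < j) then N else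
        if u = i ∧ v = j then k else 0) (by rw [hf₂.reg _ rfl, hf₁.reg _ rfl, hN]) rfl rfl (by decide)
        (h2.congr rfl fun u v => by split_ifs <;> omega) ?_ ?_
      · intro k S₃ hk hf₃ hx h3
        have e1 : S₃.mem K.mulN = S.mem K.mulN := by
          rw [hf₃.mem _ rfl, hf₂.mem _ rfl, hf₁.mem _ rfl]
        have e2 : Bags S₃ T.bag := hbag.congr (by
          rw [hf₃.mem _ rfl, hf₂.mem _ rfl, hf₁.mem _ rfl])
        have e3 : S₃.reg R.a = i := by rw [hf₃.reg _ rfl, hf₂.reg _ rfl, ha]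
        have e4 : S₃.reg R.b = j := by rw [hf₃.reg _ rfl, hb]
        have e5 : ∀ r v, S₃.reg r = v → v < n → (eval S₃ (.load K.inc
            (.add (.load K.mulN (.reg R.x)) (.reg r))) = S₃.mem K.inc (k * n + v)) := by
          intro r v hr _
          simp only [eval, hx, hr, e1, hm k (by omega)]
        have e6 : (∀ u v : Fin n, (u : ℕ) = i → (v : ℕ) = j → ¬ (u ∈ T.bag ⟨k, hk⟩ ∧
            v ∈ T.bag ⟨k, hk⟩)) → Homes T (S₃.setReg R.x (k + 1)) fun u v =>
              if u < i ∨ (u = i ∧ v < j) then N else if u = i ∧ v = j then k + 1 else 0 := by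
          intro hno u v
          obtain ⟨y, h4, h5⟩ := h3 u v
          refine ⟨y, h4, fun x hx' hu hv => ?_⟩
          by_cases hxk : u = i ∧ v = j ∧ x = k
          · obtain rfl : x = ⟨k, hk⟩ := Fin.ext hxk.2.2
            exact absurd ⟨hu, hv⟩ (hno u v hxk.1 hxk.2.1)
          · refine h5 x ?_ hu hv
            beta_reduce at hx' ⊢
            split_ifs at hx' ⊢ <;> omega
        have e7 := hm i (by omega)
        refine Does.mono (τ := 1 + (1 + 1 + 1) + 1) (.branch hB rfl (fun hg => .branch hB rfl (fun hg' =>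
          .store hB rfl rfl (fun hS => hS.reg _) ?_) fun hg' => .skip (e6 ?_)) fun hg => .skip (e6 ?_))
          le_rfl
        · rw [e5 R.a i e3 hi, e2 ⟨k, hk⟩ ⟨i, hi⟩] at hg
          rw [e5 R.b j e4 hj, e2 ⟨k, hk⟩ ⟨j, hj⟩] at hg'
          intro u v
          by_cases huv : (u : ℕ) = i ∧ (v : ℕ) = j
          · obtain rfl : u = ⟨i, hi⟩ := Fin.ext huv.1
            obtain rfl : v = ⟨j, hj⟩ := Fin.ext huv.2
            exact ⟨⟨k, hk⟩, by simp [Config.setMem, eval, e3, e4, e1, e7, hx],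
              fun _ _ _ _ => ⟨hg, hg'⟩⟩
          · obtain ⟨y, h4, h5⟩ := h3 u v
            have hne : (u : ℕ) * n + v ≠ i * n + j := fun h => by
              have := (mul_add_inj (x := u) (y := ⟨i, hi⟩) (u := v) (v := ⟨j, hj⟩)).1 h
              exact huv ⟨congrArg Fin.val this.1, congrArg Fin.val this.2⟩
            refine ⟨y, by simpa [Config.setMem, eval, e3, e4, e1, e7, hne] using h4,
              fun x hx' hu hv => h5 x ?_ hu hv⟩
            beta_reduce at hx' ⊢
            rwa [if_neg huv] at hx' ⊢
        · intro u v hu hv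
          obtain rfl : u = ⟨i, hi⟩ := Fin.ext hu
          obtain rfl : v = ⟨j, hj⟩ := Fin.ext hv
          rw [e5 R.b j e4 hj] at hg'
          exact fun h => (e2 ⟨k, hk⟩ ⟨j, hj⟩).2 h.2 hg'
        · intro u v hu hv
          obtain rfl : u = ⟨i, hi⟩ := Fin.ext hu
          rw [e5 R.a i e3 hi] at hg
          exact fun h => (e2 ⟨k, hk⟩ ⟨i, hi⟩).2 h.1 hg
      · intro S₃ _ _ h3
        exact h3.congr rfl fun u v => by split_ifs <;> omega
    · intro S₂ _ _ h2
      exact h2.congr rfl fun u v => by split_ifs <;> omega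
  · intro S₁ _ _ h1
    exact h1.congr rfl fun u v => by simp

/-- The addresses of the constants. -/
def constKey (s b : ℕ) (p : Fin s × Fin s) : ℕ := if b < 15 then p.1 * s + p.2 else p.2

/-- The constants in the banks 11, …, 19. -/
def constVal (A : StateSystem ρ σ s) (b : ℕ) (p : Fin s × Fin s) : ℕ :=
  match b with
  | 11 => (A.evalMatrix p.1 p.2).natAbs
  | 12 => if A.evalMatrix p.1 p.2 < 0 then 1 else 0
  | 13 => (A.invMatrix p.1 p.2).natAbs
  | 14 => if A.invMatrix p.1 p.2 < 0 then 1 else 0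
  | 15 => if A.inn p.2 = true then 1 else 0
  | 16 => A.cv p.2
  | 17 => if A.star p.2 = true then 1 else 0
  | 18 => (A.w p.2).natAbs
  | 19 => if A.w p.2 < 0 then 1 else 0
  | _ => 0

/-- The places of the constants. -/
noncomputable def constList (s : ℕ) : List (ℕ × (Fin s × Fin s)) :=
  [11, 12, 13, 14, 15, 16, 17, 18, 19].product univ.toList

/-- Compute the parameters of the algorithm and their multiples and powers. -/
noncomputable def setup (A : StateSystem ρ σ s) (ls : ℕ) : Prog :=
  storeAll (constKey s) (constVal A) (constList s) ;;
  assign R.s (const s) ;;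
  assign R.top (const (s - 2)) ;;
  assign R.sbits (const ls) ;;
  assign R.bits (add (reg R.n) (reg R.sbits)) ;;
  assign R.L (add (add (reg R.n) (reg R.N)) (const 1)) ;;
  assign R.d (add (reg R.n) (reg R.N)) ;;
  table K.mulN R.d (const 0) (addReg R.n) ;;
  table K.mulNN R.N (const 0) (addReg R.N) ;;
  table K.mulS R.s (const 0) (addReg R.s) ;;
  table K.tmp R.n (const 0) (addReg R.top) ;;
  assign R.row (add (reg R.N) (add (add (reg R.acc) (const 1)) (add (reg R.acc) (const 1)))) ;;
  table K.powS R.n (const 1) (mulReg R.s) ;;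
  assign R.W (reg R.acc) ;;
  table K.mulW R.L (const 0) (addReg R.W) ;;
  assign R.LW (reg R.acc) ;;
  table K.mulLW R.row (const 0) (addReg R.LW) ;;
  table K.pow2 R.bits (const 1) (addReg R.acc) ;;
  table K.tmp R.n (const A.scale) (addReg R.acc) ;;
  assign R.m (add (reg R.acc) (const 1)) ;;
  assign R.u (sub (reg R.m) (load K.pow2 (reg R.n))) ;;
  table K.alive R.N (const 1) skip ;;
  table K.len R.N (const 1) skip ;;
  findHomes

theorem ite_ne_zero {p : Prop} [Decidable p] : (if p then 1 else 0) ≠ 0 ↔ p := by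
  by_cases h : p <;> simp [h]

theorem matrixCells_ne_zero {a b : ℕ} (P : Fin a → Fin b → Prop) (u : Fin a) (v : Fin b) :
    matrixCells P (u * b + v) ≠ 0 ↔ P u v := by
  unfold matrixCells
  constructor
  · intro h
    by_contra hP
    refine h (if_neg ?_)
    rintro ⟨u', v', he, h'⟩
    obtain ⟨rfl, rfl⟩ := mul_add_inj.1 he
    exact hP h'
  · intro h
    rw [if_pos ⟨u, v, rfl, h⟩]
    exact one_ne_zero

/-- There are nine banks with `s * s` items each; the vectors in the banks from 15 on are written
`s` times, which keeps the list uniform. -/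
theorem does_constants (hs2 : s * s < 2 ^ B) (hs : 2 ≤ s) (hls : 2 ^ entryBits s ≤ 2 ^ B) :
    Does M B (storeAll (constKey s) (constVal A) (constList s)) S (9 * (s * s) + 1) fun S' =>
      S'.reg = S.reg ∧ (∀ b, 11 ≤ b → b ≤ 19 → ∀ p, S'.mem b (constKey s b p) = constVal A b p) ∧
      ∀ b, b < 11 ∨ 19 < b → S'.mem b = S.mem b := by
  have hB1 : 1 < 2 ^ B := by nlinarith
  have hss : s ≤ s * s := Nat.le_mul_of_pos_left _ (by omega)
  have hlen : (constList s).length = 9 * (s * s) :=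
    (List.length_product _ _).trans (by simp)
  rw [← hlen]
  refine (does_storeAll (fun b p => ?_) (fun b p => ?_) (fun b p q h => ?_) _).conseq ?_
  · unfold constKey
    have h1 := Nat.mul_le_mul_right s (show (p.1 : ℕ) + 1 ≤ s from p.1.2)
    have h2 := p.2.2
    rw [add_mul, one_mul] at h1
    split_ifs <;> omega
  · have h1 := A.entries_lt hs p.1 p.2
    have h2 := A.cv_le p.2
    have h3 := A.natAbs_w_le p.2
    unfold constVal
    split <;> first | omega | (split_ifs <;> omega)
  · by_cases hb : b < 15
    · simp only [constKey, hb, if_true] at h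
      rw [Prod.ext_iff.2 (mul_add_inj.1 h)]
    · simp only [constKey, hb, if_false] at h
      have := Fin.ext h
      unfold constVal
      rw [this]
      split <;> first | rfl | omega
  · rintro S₁ - - ⟨h1, h2, h3⟩
    refine ⟨h1, fun b hb hb' p => h2 (b, p) ?_, fun b hb => h3 b fun t ht => ?_⟩
    · refine List.pair_mem_product.2 ⟨?_, by simp⟩
      interval_cases b <;> simp
    · have := (List.pair_mem_product.1 (show (t.1, t.2) ∈ _ from ht)).1
      simp only [List.mem_cons, List.not_mem_nil, or_false] at this
      omega

theorem Does.andThen {P Q : Prog} {τ τ' : ℕ} {mid post : Config → Prop} (h : Does M B P S τ mid)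
    (hQ : ∀ S', (∀ y, P.writesReg y = false → S'.reg y = S.reg y) →
      (∀ b, P.writesMem b = false → S'.mem b = S.mem b) → mid S' → Does M B Q S' τ' post) :
    Does M B (P ;; Q) S (τ + τ') post :=
  .seq (h.conseq fun S' hf _ hm => hQ S' hf.reg hf.mem hm)

-- The choice `m = scale * 2 ^ n + 1` makes an inverse of `scale` available without any division,
-- namely `-2 ^ n`, stored as `m - 2 ^ n`. All products needed later, for addresses and for
-- parameters, are obtained here by repeated addition.
set_option maxHeartbeats 4000000 in
theorem does_setup (hl : Limits B n N s L J m lb ls) (hm : m = A.scale * 2 ^ n + 1)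
    (hls : ls = entryBits s) (hlb : lb = n + ls) (hL : L = n + N + 1)
    (hJ : J = N + 2 * (n * (s - 2) + 1)) (hlbB : lb < B) (hsB : 2 * s ≤ B)
    (hS : S = inputConfig G T) :
    Does M B (setup A ls) S (100 * (s * s + L + J + lb + n * s) +
      n * (n * (N * 7 + 4) + 4)) fun S' => ∃ home : Fin n → Fin n → Fin N,
        Env A G T home L J m lb ls S' ∧ Bags S' T.bag ∧
        (∀ u v, ∀ x, u ∈ T.bag x → v ∈ T.bag x → u ∈ T.bag (home u v) ∧ v ∈ T.bag (home u v)) ∧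
        (∀ x : Fin N, S'.mem K.alive x = 1) ∧ (∀ x : Fin N, S'.mem K.len x = 1) ∧
        ∀ a, S'.mem K.tab a = 0 := by
  have hB := hl.le_B
  have hs := hl.two_le
  have hn := hl.n_pos
  have hN := hl.N_pos
  have hc := hl.cells
  have hpow := hl.pow_lt
  have hnB := hl.n_lt
  have hLB := hl.L_lt
  have hJB := hl.J_lt
  have hmB := hl.two_m
  have hm' : m < 2 ^ B := by omega
  have hW : 0 < s ^ n := Nat.pow_pos (by omega)
  have hnW : n < s ^ n := Nat.lt_pow_self (by omega)
  have hJ0 : 0 < J := by omega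
  have hss : s * s < 2 ^ B := by
    calc s * s < 2 ^ s * 2 ^ s := Nat.mul_lt_mul'' Nat.lt_two_pow_self Nat.lt_two_pow_self
      _ = 2 ^ (2 * s) := by rw [← pow_add]; ring_nf
      _ ≤ 2 ^ B := Nat.pow_le_pow_right (by norm_num) hsB
  have h2n : 2 ^ n < m := by
    rw [hm]
    exact Nat.lt_succ_of_le (Nat.le_mul_of_pos_left _ A.scale_pos)
  have hlsB : 2 ^ ls ≤ 2 ^ B := Nat.pow_le_pow_right (by norm_num) (by omega)
  have hlsv : ls < 2 ^ ls := Nat.lt_two_pow_self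
  have hlbv : lb < 2 ^ lb := Nat.lt_two_pow_self
  have hlbp : 2 ^ lb < 2 ^ B := Nat.pow_lt_pow_right (by norm_num) hlbB
  have b1 : (n + N) * n < 2 ^ B := by
    have h1 : (n + N) * n ≤ L * s ^ n := Nat.mul_le_mul (by omega) hnW.le
    have h2 : L * s ^ n ≤ s ^ n * (L * J) := by
      rw [mul_comm, ← mul_assoc]
      exact Nat.le_mul_of_pos_right _ hJ0
    omega
  have b2 : N * N < 2 ^ B := by
    have h1 : N * N ≤ L * J := Nat.mul_le_mul (by omega) (by omega)
    have h2 : L * J ≤ s ^ n * (L * J) := Nat.le_mul_of_pos_left _ hW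
    omega
  have b3 : L * s ^ n < 2 ^ B := by
    have h2 : L * s ^ n ≤ s ^ n * (L * J) := by
      rw [mul_comm, ← mul_assoc]
      exact Nat.le_mul_of_pos_right _ hJ0
    omega
  have b4 : J * (L * s ^ n) < 2 ^ B := by
    have h2 : J * (L * s ^ n) = s ^ n * (L * J) := by ring
    omega
  have b5 : A.scale * 2 ^ n < 2 ^ B := by omega
  have hsv : s ≤ s * s := Nat.le_mul_of_pos_left _ (by omega)
  refine Does.mono (τ := (9 * (s * s) + 1) + (1 + (1 + (1 + (1 + (1 + (1 + (((n + N) * 4 + 3) +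
    ((N * 4 + 3) + ((s * 4 + 3) + ((n * 4 + 3) + (1 + ((n * (s * 3 + 7) + 3) + (1 + ((L * 4 + 3) +
    (1 + ((J * 4 + 3) + ((lb * 4 + 3) + ((n * 4 + 3) + (1 + (1 + ((1 + (N * (1 + 1 + 2) + 2)) +
    ((1 + (N * (1 + 1 + 2) + 2)) + (n * (n * (N * 7 + 4) + 4) + 2))))))))))))))))))))))))
    (.seq ((does_constants hss hs (hls ▸ hlsB)).conseq ?_)) ?_
  · rintro S₀ - - ⟨g1, g2, g3⟩
    have n0 : S₀.reg R.n = n := by rw [g1, hS]; rfl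
    have N0 : S₀.reg R.N = N := by rw [g1, hS]; rfl
    have z0 : S₀.mem K.own = fun _ => 0 := by rw [g3 _ (by decide), hS]; rfl
    have t0 : S₀.mem K.tab = fun _ => 0 := by rw [g3 _ (by decide), hS]; rfl
    have a0 : S₀.mem K.adjG = matrixCells G.Adj := by rw [g3 _ (by decide), hS]; rfl
    have a1 : S₀.mem K.adjT = matrixCells T.tree.Adj := by rw [g3 _ (by decide), hS]; rfl
    have a2 : S₀.mem K.inc = matrixCells fun x v => v ∈ T.bag x := by rw [g3 _ (by decide), hS]; rfl
    refine Does.andThen (does_assign_value (by omega)) fun S₁ r₁ m₁ h₁ =>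
      Does.andThen (does_assign_value (by omega)) fun S₂ r₂ m₂ h₂ =>
      Does.andThen (does_assign_value (by omega)) fun S₃ r₃ m₃ h₃ =>
      Does.andThen (does_assign_eq hB (v := lb) rfl ?_ (by omega)) fun S₄ r₄ m₄ h₄ =>
      Does.andThen (does_assign_eq hB (v := L) rfl ?_ (by omega)) fun S₅ r₅ m₅ h₅ =>
      Does.andThen (does_assign_eq hB (v := n + N) rfl ?_ (by omega)) fun S₆ r₆ m₆ h₆ =>
      Does.andThen (does_multiplesTable hB (cnt := n + N) (a := n) ?_ ?_ (by decide) (by decide) b1)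
        fun S₇ r₇ m₇ h₇ =>
      Does.andThen (does_multiplesTable hB (cnt := N) (a := N) ?_ ?_ (by decide) (by decide) b2)
        fun S₈ r₈ m₈ h₈ =>
      Does.andThen (does_multiplesTable hB (cnt := s) (a := s) ?_ ?_ (by decide) (by decide) hss)
        fun S₉ r₉ m₉ h₉ =>
      Does.andThen (does_multiplesTable hB (cnt := n) (a := s - 2) ?_ ?_ (by decide) (by decide)
        (by omega)) fun S₁₀ r₁₀ m₁₀ h₁₀ =>
      Does.andThen (does_assign_eq hB (v := J) rfl ?_ (by omega)) fun S₁₁ r₁₁ m₁₁ h₁₁ =>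
      Does.andThen (does_powersTable hB (n := n) (s := s) ?_ ?_ (by omega) (by omega))
        fun S₁₂ r₁₂ m₁₂ h₁₂ =>
      Does.andThen (does_assign_eq hB (v := s ^ n) rfl ?_ (by omega)) fun S₁₃ r₁₃ m₁₃ h₁₃ =>
      Does.andThen (does_multiplesTable hB (cnt := L) (a := s ^ n) ?_ ?_ (by decide) (by decide) b3)
        fun S₁₄ r₁₄ m₁₄ h₁₄ =>
      Does.andThen (does_assign_eq hB (v := L * s ^ n) rfl ?_ (by omega)) fun S₁₅ r₁₅ m₁₅ h₁₅ =>
      Does.andThen (does_multiplesTable hB (cnt := J) (a := L * s ^ n) ?_ ?_ (by decide) (by decide)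
        b4) fun S₁₆ r₁₆ m₁₆ h₁₆ =>
      Does.andThen (does_doublingTable hB (cnt := lb) (a := 1) ?_ (by decide) (by omega))
        fun S₁₇ r₁₇ m₁₇ h₁₇ =>
      Does.andThen (does_doublingTable hB (cnt := n) (a := A.scale) ?_ (by decide) b5)
        fun S₁₈ r₁₈ m₁₈ h₁₈ =>
      Does.andThen (does_assign_eq hB (v := m) rfl ?_ (by omega)) fun S₁₉ r₁₉ m₁₉ h₁₉ =>
      Does.andThen (does_assign_eq hB (v := m - 2 ^ n) rfl ?sub ((Nat.sub_le _ _).trans_lt hm'))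
        fun S₂₀ r₂₀ m₂₀ h₂₀ =>
      Does.andThen (does_table hB (f := fun _ => 1) (cnt := N) (does_assign_value (by omega)) ?_ (by decide)
        (by decide) rfl rfl rfl fun _ _ _ _ h => .skip h) fun S₂₁ r₂₁ m₂₁ h₂₁ =>
      Does.andThen (does_table hB (f := fun _ => 1) (cnt := N) (does_assign_value (by omega)) ?_ (by decide)
        (by decide) rfl rfl rfl fun _ _ _ _ h => .skip h) fun S₂₂ r₂₂ m₂₂ h₂₂ =>
      (does_findHomes hB (T := T) ?_ ?_ ?maps ?bags ?homes).conseq fun S₂₃ f₂₃ _ h₂₃ => ?_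
    rotate_right
    choose home hh using h₂₃
    refine ⟨home, ?_, ?bags', fun u v x => (hh u v).2 x x.2, ?alive, ?len, ?tab⟩
    constructor
    case own => exact fun u v => (hh u v).1
    all_goals try unfold Bags
    all_goals try unfold Homes
    all_goals try simp only [eval]
    -- Each goal concerns the content of a register or bank after some step. It is traced back,
    -- through the steps that do not write it, to the step that did.
    all_goals repeat first
      | rw [n0] | rw [N0] | rw [h₁] | rw [h₂] | rw [h₃] | rw [h₄] | rw [h₅] | rw [h₆] | rw [h₁₁]
      | rw [h₁₃] | rw [h₁₅] | rw [h₁₉] | rw [h₂₀] | rw [h₁₀.2] | rw [h₁₂.2] | rw [h₁₄.2]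
      | rw [h₁₆.2] | rw [h₁₈.2] | rw [f₂₃.reg _ rfl] | rw [f₂₃.mem _ rfl] | rw [r₂₂ _ rfl]
      | rw [r₂₁ _ rfl] | rw [r₂₀ _ rfl] | rw [r₁₉ _ rfl] | rw [r₁₈ _ rfl] | rw [r₁₇ _ rfl]
      | rw [r₁₆ _ rfl] | rw [r₁₅ _ rfl] | rw [r₁₄ _ rfl] | rw [r₁₃ _ rfl] | rw [r₁₂ _ rfl]
      | rw [r₁₁ _ rfl] | rw [r₁₀ _ rfl] | rw [r₉ _ rfl] | rw [r₈ _ rfl] | rw [r₇ _ rfl]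
      | rw [r₆ _ rfl] | rw [r₅ _ rfl] | rw [r₄ _ rfl] | rw [r₃ _ rfl] | rw [r₂ _ rfl]
      | rw [r₁ _ rfl] | rw [m₂₂ _ rfl] | rw [m₂₁ _ rfl] | rw [m₂₀ _ rfl] | rw [m₁₉ _ rfl]
      | rw [m₁₈ _ rfl] | rw [m₁₇ _ rfl] | rw [m₁₆ _ rfl] | rw [m₁₅ _ rfl] | rw [m₁₄ _ rfl]
      | rw [m₁₃ _ rfl] | rw [m₁₂ _ rfl] | rw [m₁₁ _ rfl] | rw [m₁₀ _ rfl] | rw [m₉ _ rfl]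
      | rw [m₈ _ rfl] | rw [m₇ _ rfl] | rw [m₆ _ rfl] | rw [m₅ _ rfl] | rw [m₄ _ rfl]
      | rw [m₃ _ rfl] | rw [m₂ _ rfl] | rw [m₁ _ rfl]
    all_goals try first | assumption | omega
    case u_lt => exact Nat.sub_lt (by omega) (by positivity)
    -- Modulo `m` the claim is `-2 ^ n * scale = 1`, that is, `scale * 2 ^ n + 1 = m = 0`.
    case u_mul =>
      rw [Nat.cast_sub h2n.le, ZMod.natCast_self, zero_sub, neg_mul, neg_eq_iff_add_eq_zero,
        ← Nat.cast_one, ← Nat.cast_mul, ← Nat.cast_add, mul_comm, ← hm, ZMod.natCast_self]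
    case adjG => exact a0 ▸ matrixCells_ne_zero _
    case adjT => exact a1 ▸ matrixCells_ne_zero _
    case pow2 => simpa using h₁₇.1
    case powS => exact h₁₂.1
    case mulNN => exact h₈.1
    case mulW => exact h₁₄.1
    case mulLW => exact h₁₆.1
    case mulS => exact h₉.1
    case fwd_lt => exact fun l d => hls ▸ (A.entries_lt hs l d).1
    case inv_lt => exact fun l d => hls ▸ (A.entries_lt hs l d).2.1
    case fwdAbs => exact fun l d => g2 11 (by decide) (by decide) (l, d)
    case invAbs => exact fun l d => g2 13 (by decide) (by decide) (l, d)
    case cv => exact fun d => g2 16 (by decide) (by decide) (d, d)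
    case inn => exact fun d => g2 15 (by decide) (by decide) (d, d)
    case wAbs => exact fun d => g2 18 (by decide) (by decide) (d, d)
    case fwdSgn => exact fun l d => (g2 12 (by decide) (by decide) (l, d)).symm ▸ ite_ne_zero
    case invSgn => exact fun l d => (g2 14 (by decide) (by decide) (l, d)).symm ▸ ite_ne_zero
    case star => exact fun d => (g2 17 (by decide) (by decide) (d, d)).symm ▸ ite_ne_zero
    case wSgn => exact fun d => (g2 19 (by decide) (by decide) (d, d)).symm ▸ ite_ne_zero
    case maps => exact h₇.1
    case mulN => exact h₇.1
    case bags | bags' => exact a2 ▸ matrixCells_ne_zero _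
    -- The power `2 ^ n` is in the table of the powers below `2 ^ lb`, as `lb` exceeds `n` by the
    -- positive number `ls`.
    case sub => rw [h₁₇.1 n (by rw [hlb]; exact Nat.lt_add_of_pos_right hl.ls_pos), one_mul]
    case homes =>
      exact fun u v => ⟨⟨0, hN⟩, congrFun z0 _, fun x hx => absurd hx (Nat.not_lt_zero _)⟩
    case tab => exact fun a => congrFun t0 a
    case alive => exact fun x => h₂₁.1 x x.2
    case len => exact fun x => h₂₂.1 x x.2
  · have h1 : n ≤ n * s := Nat.le_mul_of_pos_right _ (by omega)
    linarith [hl.lt_L]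

/-! ### The algorithm -/

/-- The algorithm that counts `[ρ, σ]`-dominating sets. -/
noncomputable def algorithm (A : StateSystem ρ σ s) : Prog :=
  setup A (entryBits s) ;; (initTables ;; (contractTree ;; finish))

/-- Nothing is completed at the beginning, so all disjointness conditions are void. Each edge
belongs to its home alone, whose bag contains both ends because some bag does. Tables have length 1,
for the size 0. -/
theorem arranged_initial {home : Fin n → Fin n → Fin N}
    (hh : ∀ u v, ∀ x, u ∈ T.bag x → v ∈ T.bag x → u ∈ T.bag (home u v) ∧ v ∈ T.bag (home u v)) :
    Arranged G univ T.bag (fun _ => ∅) (fun x u v => G.Adj u v ∧ home u v = x) fun _ => 1 where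
  touch z _ u v h := by
    obtain ⟨x, hu, hv⟩ := T.exists_edge_subset_bag u v h.1
    obtain ⟨h1, h2⟩ := h.2 ▸ hh u v x hu hv
    exact ⟨.inr h1, .inr h2⟩
  disjoint _ _ _ _ _ := disjoint_empty_left _
  disjoint_bag _ _ _ _ := disjoint_empty_left _
  edges _ _ _ _ hne _ _ h h' := hne (h.2.symm.trans h'.2)
  card_lt _ _ := Nat.one_pos
  cover v := (T.exists_mem_bag v).imp fun x hx => ⟨mem_univ x, .inr hx⟩
  adj u v := ⟨fun h => ⟨_, mem_univ _, h, rfl⟩, fun ⟨_, _, h⟩ => h.1⟩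
  sum_len := by simp

theorem does_algorithm (hl : Limits B n N s L J m lb ls) (hm : m = A.scale * 2 ^ n + 1)
    (hls : ls = entryBits s) (hlb : lb = n + ls) (hL : L = n + N + 1)
    (hJ : J = N + 2 * (n * (s - 2) + 1)) (hlbB : lb < B) (hsB : 2 * s ≤ B) {w r : ℕ}
    (hw : ∀ x, s ^ #(T.bag x) ≤ w) (hr : ∀ x, #(T.bag x) * (s - 2) + 1 ≤ r) :
    Does M B (algorithm A) (inputConfig G T)
      ((100 * (s * s + L + J + lb + n * s) + n * (n * (N * 7 + 4) + 4)) +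
      ((N * (w * (40 * (n * (n + s)) + 100)) + 2) +
      ((N * 2 + 3 + (N * contractCost n N L s lb ls w r +
      (N + n) * (200 * (w * L)) + (N + n) ^ 2 * (w * (r * (r * (lb * 20 + 18)))))) +
      (N * (N * 8 + 11) + 13 * n + n * (200 * (w * L)) + 13))))
      fun S' => ∀ κ ≤ n, S'.mem K.out κ = rhoSigmaCount ρ σ G κ := by
  unfold algorithm
  rw [← hls]
  refine .seq ((does_setup hl hm hls hlb hL hJ hlbB hsB rfl).conseq ?_)
  rintro S₁ - - ⟨home, he, hbag, hh, ha, hlen, ht⟩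
  refine .seq ((does_initTables hl he hbag hw ht).conseq fun S₂ hf₂ _ htab => ?_)
  have he₂ := he.frame hf₂ rfl
  have hc : Contracted A T m L S₂ univ T.bag (fun _ => ∅) (fun x u v => G.Adj u v ∧ home u v = x)
      fun _ => 1 :=
    { holds := ⟨hbag.congr (hf₂.mem _ rfl), fun x => by rw [hf₂.mem _ rfl]; exact hlen x,
        fun x => by simp [hf₂.mem K.alive rfl, ha x], by rwa [coe_univ]⟩
      arranged := arranged_initial hh
      connected := by
        rw [coe_univ]
        exact (SimpleGraph.induceUnivIso T.tree).connected_iff.2 T.isTree.connected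
      bag_eq := fun _ _ => rfl }
  refine .seq ((does_contractTree hl he₂ hc (by simp) hw hr).conseq ?_)
  rintro S₃ hf₃ - ⟨X, bag, F, E, len, hc₃, hX⟩
  refine does_finish hl (he₂.frame hf₃ rfl) hc₃ hX hw fun κ => ?_
  -- There are only `2 ^ n` sets of vertices, and `m` is larger.
  have h1 : rhoSigmaCount ρ σ G κ ≤ 2 ^ n := by
    refine (Set.ncard_le_card _).trans ?_
    simp
  rw [hm]
  exact Nat.lt_succ_of_le (h1.trans (Nat.le_mul_of_pos_left _ A.scale_pos))

/-- The bit bound `B` generously adds up the lengths of all factors: `s ^ n` has at most `s * n`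
bits, and `L` and `J` are simply estimated by `2 ^ L` and `2 ^ J`. It remains linear in `n` and `N`,
which is all that the time bound needs. -/
theorem limits_algorithm (A : StateSystem ρ σ s) (hs : 2 ≤ s) (hn : 0 < n) (hN : 0 < N)
    (hlb : lb = n + ls) (hls : ls = entryBits s) (hL : L = n + N + 1)
    (hJ : J = N + 2 * (n * (s - 2) + 1)) (hB : B = 64 + s * n + L + J + lb + 2 * s) :
    Limits B n N s L J (A.scale * 2 ^ n + 1) lb ls := by
  have hm : A.scale * 2 ^ n + 1 < 2 ^ lb := by
    have h1 := Nat.mul_le_mul_right (2 ^ n) (A.entries_lt hs ⟨0, by omega⟩ ⟨0, by omega⟩).2.2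
    have h2 := Nat.one_lt_two_pow hn.ne'
    rw [Nat.succ_mul, ← hls] at h1
    rw [hlb, add_comm n, pow_add]
    omega
  have hlbB : 2 * 2 ^ lb ≤ 2 ^ B := by
    rw [← pow_succ']
    exact Nat.pow_le_pow_right (by norm_num) (by omega)
  refine ⟨by omega, hn, hN, hs, by omega, hJ.ge, by omega, ?_, ?_, hm, ?_, by omega⟩
  · exact Nat.lt_succ_of_le (Nat.succ_le_of_lt (Nat.mul_pos A.scale_pos (by positivity)))
  · calc 4 * (s ^ n * (L * J)) < 2 ^ 2 * ((2 ^ s) ^ n * (2 ^ L * 2 ^ J)) := by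
          have h1 : s ^ n ≤ (2 ^ s) ^ n := Nat.pow_le_pow_left Nat.lt_two_pow_self.le n
          have h2 : L * J < 2 ^ L * 2 ^ J := Nat.mul_lt_mul'' Nat.lt_two_pow_self Nat.lt_two_pow_self
          exact Nat.mul_lt_mul_of_pos_left (Nat.mul_lt_mul_of_le_of_lt h1 h2 (by positivity))
            (by norm_num)
      _ = 2 ^ (2 + s * n + L + J) := by ring
      _ ≤ 2 ^ B := Nat.pow_le_pow_right (by norm_num) (by omega)
  · rw [hls]
    exact Nat.succ_pos _

/-- All parameters are replaced by monomials in `c`, `s` and `n`. The decisive terms are the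
convolutions, quadratically many pairs of sizes with `w * r ^ 2` products of about `n + 2 * s ^ 3`
doubling steps, and the matrix transformations, which give the factor `s ^ 4`. -/
theorem algorithm_cost {c w r : ℕ} (hn : 0 < n) (hc : 0 < c) (hs : 2 ≤ s) (hw : 0 < w) (hr : 0 < r)
    (hN : N ≤ c * n) (hls : ls = entryBits s) (hlb : lb = n + ls) (hL : L = n + N + 1)
    (hJ : J = N + 2 * (n * (s - 2) + 1)) :
    (100 * (s * s + L + J + lb + n * s) + n * (n * (N * 7 + 4) + 4)) +
      ((N * (w * (40 * (n * (n + s)) + 100)) + 2) +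
      ((N * 2 + 3 + (N * contractCost n N L s lb ls w r +
      (N + n) * (200 * (w * L)) + (N + n) ^ 2 * (w * (r * (r * (lb * 20 + 18)))))) +
      (N * (N * 8 + 11) + 13 * n + n * (200 * (w * L)) + 13))) ≤
        50000 * (c ^ 3 * s ^ 4 * n ^ 3 * w * r ^ 2) ∧
    64 + s * n + L + J + lb + 2 * s ≤ 100 * (c * s ^ 3) * n := by
  have hs0 : 0 < s := by omega
  have hcn : n ≤ c * n := Nat.le_mul_of_pos_left _ hc
  have h1 : ls ≤ 2 * s ^ 3 := by
    rw [hls]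
    unfold entryBits
    nlinarith [Nat.mul_le_mul hs hs, Nat.mul_le_mul_right (s * s) hs]
  have h2 : lb ≤ n + 2 * s ^ 3 := by omega
  have h3 : L ≤ 3 * (c * n) := by omega
  have h4 : J ≤ c * n + 2 * (n * s) := by
    have : n * (s - 2) + n * 2 = n * s := by rw [← mul_add, Nat.sub_add_cancel hs]
    omega
  constructor
  · have h6 : ∀ a b d e f, a ≤ 3 ∧ b ≤ 4 ∧ d ≤ 3 ∧ e ≤ 1 ∧ f ≤ 2 →
        c ^ a * s ^ b * n ^ d * w ^ e * r ^ f ≤ c ^ 3 * s ^ 4 * n ^ 3 * w * r ^ 2 := by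
      intro a b d e f h
      calc _ ≤ c ^ 3 * s ^ 4 * n ^ 3 * w ^ 1 * r ^ 2 := by gcongr <;> omega
        _ = _ := by rw [pow_one]
    unfold contractCost
    calc _ ≤ (100 * (s * s + 3 * (c * n) + (c * n + 2 * (n * s)) + (n + 2 * s ^ 3) + n * s) +
        n * (n * (c * n * 7 + 4) + 4)) +
      ((c * n * (w * (40 * (n * (n + s)) + 100)) + 2) +
      ((c * n * 2 + 3 + (c * n * (c * n * (c * n * 8 + 11) + 2 + (n * 3 + 2) + (n * 7 + 3) +
      (2500 * (w * (3 * (c * n) * r) * (s * (n * (2 * s ^ 3) + (n + 2 * s ^ 3)))) + 60 * (n * n))) +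
      (c * n + c * n) * (200 * (w * (3 * (c * n)))) +
      (c * n + c * n) ^ 2 * (w * (r * (r * ((n + 2 * s ^ 3) * 20 + 18)))))) +
      (c * n * (c * n * 8 + 11) + 13 * n + n * (200 * (w * (3 * (c * n)))) + 13))) := by
          gcongr
      _ ≤ _ := by
          -- After expansion every term is a monomial that is bounded by the leading one, an
          -- instance of `h6`; the rest is a linear combination of these instances.
          generalize c ^ 3 * s ^ 4 * n ^ 3 * w * r ^ 2 = X at h6 ⊢
          linarith [h6 0 0 0 0 0 (by simp), h6 1 1 2 1 0 (by simp), h6 2 1 3 1 1 (by simp),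
            h6 0 1 1 0 0 (by simp), h6 0 2 0 0 0 (by simp), h6 0 3 0 0 0 (by simp),
            h6 2 3 2 1 2 (by simp), h6 2 4 2 1 1 (by simp), h6 2 4 3 1 1 (by simp),
            h6 1 0 1 0 0 (by simp), h6 1 0 1 1 0 (by simp), h6 1 0 2 0 0 (by simp),
            h6 1 0 2 1 0 (by simp), h6 1 0 3 0 0 (by simp), h6 1 0 3 1 0 (by simp),
            h6 2 0 2 0 0 (by simp), h6 2 0 2 1 0 (by simp), h6 2 0 2 1 2 (by simp),
            h6 2 0 3 1 2 (by simp), h6 3 0 3 0 0 (by simp), h6 0 0 1 0 0 (by simp),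
            h6 0 0 2 0 0 (by simp)]
  · have h5 : ∀ a b d, a ≤ 1 → b ≤ 3 → d ≤ 1 → c ^ a * s ^ b * n ^ d ≤ c * s ^ 3 * n := by
      intro a b d ha hb hd
      calc _ ≤ c ^ 1 * s ^ 3 * n ^ 1 := by gcongr
        _ = _ := by rw [pow_one, pow_one]
    linarith [h5 0 0 0 (by omega) (by omega) (by omega), h5 0 1 1 (by omega) (by omega) (by omega),
      h5 1 0 1 (by omega) (by omega) (by omega), h5 0 0 1 (by omega) (by omega) (by omega),
      h5 0 3 0 (by omega) (by omega) (by omega), h5 0 1 0 (by omega) (by omega) (by omega)]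

/-- For `s = 2` the exponent on the right is 0 and the left side is 2 ^ 7. For `s = a + 3` the
exponent is `2 * a + 2`: two of the factors `s * k` bound the square on the left up to a factor 4,
and the other `2 * a` absorb `s ^ 7` if `a ≥ 4`. If `a < 4`, then `s ≤ 6`, and the constant 10 ^ 7
suffices. -/
theorem pow_seven_mul_le {k : ℕ} (hs : 2 ≤ s) (hk : 0 < k) :
    s ^ 7 * ((k + 1) * (s - 2) + 1) ^ 2 ≤ 4 * 10 ^ 7 * (s * k) ^ (2 * (s - 2)) := by
  obtain ⟨a, rfl⟩ := Nat.exists_eq_add_of_le' hs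
  rcases a with _ | a
  · norm_num
  have h1 : (a + 1 + 2) ^ 7 ≤ 10 ^ 7 * (a + 1 + 2) ^ (2 * a) := by
    by_cases h : a < 4
    · calc (a + 1 + 2) ^ 7 ≤ 10 ^ 7 := Nat.pow_le_pow_left (by omega) _
        _ ≤ _ := Nat.le_mul_of_pos_right _ (by positivity)
    · calc (a + 1 + 2) ^ 7 ≤ (a + 1 + 2) ^ (2 * a) := Nat.pow_le_pow_right (by omega) (by omega)
        _ ≤ _ := Nat.le_mul_of_pos_left _ (by norm_num)
  have h2 : (k + 1) * (a + 1 + 2 - 2) + 1 ≤ 2 * ((a + 1 + 2) * k) := by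
    rw [Nat.add_sub_cancel]
    nlinarith
  calc (a + 1 + 2) ^ 7 * ((k + 1) * (a + 1 + 2 - 2) + 1) ^ 2
      ≤ (10 ^ 7 * (a + 1 + 2) ^ (2 * a)) * (2 * ((a + 1 + 2) * k)) ^ 2 := by gcongr
    _ ≤ (10 ^ 7 * ((a + 1 + 2) * k) ^ (2 * a)) * (2 * ((a + 1 + 2) * k)) ^ 2 := by
        gcongr
        exact Nat.le_mul_of_pos_right _ hk
    _ = 4 * 10 ^ 7 * ((a + 1 + 2) * k) ^ (2 * (a + 1 + 2 - 2)) := by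
        rw [Nat.add_sub_cancel, mul_add 2 a 1, pow_add]
        ring

theorem bounded_inputConfig (h : n + N < 2 ^ B) (hB : B ≠ 0) : (inputConfig G T).Bounded B := by
  have h1 := Nat.one_lt_two_pow hB
  constructor
  · intro x
    unfold inputConfig
    dsimp only
    split_ifs <;> omega
  · intro a i
    unfold inputConfig matrixCells
    dsimp only
    split_ifs <;> first | omega | (dsimp only; first | positivity | (split_ifs <;> omega))

/-- Multiplication of numbers with `n` bits includes the time for reading them, so `n / w + 1` is a
lower bound for `i_×(n)`, and numbers with at most `x * n` bits occupy about `x` times as many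
words. This is how `i_×(n)` enters the bound although nothing is ever multiplied by an instruction.
-/
theorem Machine.unit_le (M : Machine) {x : ℕ} (h : B ≤ x * n) (hx : 0 < x) :
    M.unit B ≤ 500 * (2 * x * M.iMul n) := by
  have h1 : n / M.wordLength + 1 ≤ M.iMul n :=
    (Nat.le_add_right _ _).trans (le_sup (f := M.mulTime) (self_mem_range_succ n))
  have h2 : B / M.wordLength ≤ x * (n / M.wordLength + 1) := by
    refine Nat.div_le_of_le_mul (h.trans ?_)
    rw [mul_left_comm]
    exact Nat.mul_le_mul_left _ (Nat.lt_mul_div_succ n M.wordLength_pos).le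
  have h3 : x * (n / M.wordLength + 1) ≤ x * M.iMul n := Nat.mul_le_mul_left _ h1
  have h4 : 0 < x * M.iMul n := Nat.mul_pos hx ((Nat.succ_pos _).trans_le h1)
  unfold Machine.unit
  linarith

end Algorithm

theorem mainTheorem4 :
    ∃ C : ℕ → ℕ, ∀ ρ σ : Set ℕ, (ρ.Finite ∨ ρᶜ.Finite) → (σ.Finite ∨ σᶜ.Finite) →
      ∃ P : Prog, ∀ (M : Machine) (c n N k : ℕ) (G : SimpleGraph (Fin n))
        (T : TreeDecomposition G (Fin N)),
        0 < n → N ≤ c * n → 0 < k → T.width ≤ k →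
        ∃ (S : Config) (t : ℕ), Runs M P (inputConfig G T) S t ∧
          (∀ κ ≤ n, S.mem 3 κ = rhoSigmaCount ρ σ G κ) ∧
          t ≤ C c * (n ^ 3 * (numStates ρ σ * k) ^ (2 * (numStates ρ σ - 2)) *
            numStates ρ σ ^ (k + 1) * M.iMul n) := by
  -- The constant is the product of 50000 from the number of units, 500 · 2 · 100 from the time of a
  -- unit, and 4 · 10 ^ 7 from `pow_seven_mul_le`. Of the power of `c`, three factors come from the
  -- number of units and one from the number of bits.
  refine ⟨fun c => 2 * 10 ^ 17 * c ^ 4, fun ρ σ hρ hσ => ⟨algorithm (.of hρ hσ), ?_⟩⟩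
  intro M c n N k G T hn hN hk hT
  set s := numStates ρ σ with hs'
  have hs : 2 ≤ s := Nat.le_add_left 2 _
  have hN0 : 0 < N := Fin.pos_iff_nonempty.2 T.isTree.connected.nonempty
  have hc : 0 < c := Nat.pos_of_ne_zero fun h => by simp [h] at hN; omega
  have hbag : ∀ x, (T.bag x).card ≤ k + 1 := fun x => by
    have := Finset.le_sup (f := fun x => (T.bag x).card) (Finset.mem_univ x)
    unfold TreeDecomposition.width at hT
    omega
  set A : StateSystem ρ σ s := .of hρ hσ
  obtain ⟨ls, hls⟩ : ∃ x, x = entryBits s := ⟨_, rfl⟩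
  obtain ⟨lb, hlb⟩ : ∃ x, x = n + ls := ⟨_, rfl⟩
  obtain ⟨L, hL⟩ : ∃ x, x = n + N + 1 := ⟨_, rfl⟩
  obtain ⟨J, hJ⟩ : ∃ x, x = N + 2 * (n * (s - 2) + 1) := ⟨_, rfl⟩
  obtain ⟨B, hB⟩ : ∃ x, x = 64 + s * n + L + J + lb + 2 * s := ⟨_, rfl⟩
  have hl := limits_algorithm A hs hn hN0 hlb hls hL hJ hB
  have hS : (inputConfig G T).Bounded B := bounded_inputConfig hl.n_lt (by have := hl.le_B; omega)
  obtain ⟨S, t, hrun, ht, -, hout⟩ := does_algorithm (M := M) (G := G) (T := T) (A := A) hl rfl hls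
    hlb hL hJ (by omega) (by omega) (w := s ^ (k + 1)) (r := (k + 1) * (s - 2) + 1)
    (fun x => Nat.pow_le_pow_right (by omega) (hbag x))
    (fun x => Nat.succ_le_succ (Nat.mul_le_mul_right _ (hbag x))) hS
  refine ⟨S, t, hrun, hout, ht.trans ?_⟩
  obtain ⟨h1, h2⟩ := algorithm_cost hn hc hs (w := s ^ (k + 1)) (r := (k + 1) * (s - 2) + 1)
    (by positivity) (Nat.succ_pos _) hN hls hlb hL hJ
  refine (Nat.mul_le_mul h1 (M.unit_le (hB.trans_le h2) (by positivity))).trans ?_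
  have h3 := pow_seven_mul_le hs hk
  -- The number of units contributes `s ^ 4` and the length of the numbers contributes `s ^ 3`;
  -- together with the square of the number of rows they form the left side of `pow_seven_mul_le`.
  calc 50000 * (c ^ 3 * s ^ 4 * n ^ 3 * s ^ (k + 1) * ((k + 1) * (s - 2) + 1) ^ 2) *
        (500 * (2 * (100 * (c * s ^ 3)) * M.iMul n))
      = 5 * 10 ^ 9 * c ^ 4 * n ^ 3 * s ^ (k + 1) * M.iMul n *
          (s ^ 7 * ((k + 1) * (s - 2) + 1) ^ 2) := by ring
    _ ≤ 5 * 10 ^ 9 * c ^ 4 * n ^ 3 * s ^ (k + 1) * M.iMul n *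
          (4 * 10 ^ 7 * (s * k) ^ (2 * (s - 2))) := Nat.mul_le_mul_left _ h3
    _ = 2 * 10 ^ 17 * c ^ 4 * (n ^ 3 * (s * k) ^ (2 * (s - 2)) * s ^ (k + 1) * M.iMul n) := by ring
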